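/- **Conventions.** A geometric lattice is a finite atomistic semimodular lattice; $\mathrm{rk}$ is its rank function, $\hat 0,\hat 1$ its bounds, $\mathrm{At}$ its set of atoms. A flat $F$ of a geometric lattice $\mathcal E$ is *modular* if $\mathrm{rk}(F\wedge G)+\mathrm{rk}(F\vee G)=\mathrm{rk}(F)+\mathrm{rk}(G)$ for all $G\in\mathcal E$. A geometric lattice is *supersolvable* if it has a maximal chain all of whose elements are modular. An *embedding* of geometric lattices is an injective increasing join-preserving map sending atoms to atoms. Let $\mathcal L$ be a geometric lattice with at least two elements. A *modular extension* of $\mathcal L$ is a pair $(\mathcal E,\imath)$ with $\mathcal E$ a geometric lattice and $\imath:\mathcal L\to\mathcal E$ an embedding whose image is an interval $[\hat 0,F_\imath]$ with $F_\imath$ modular in $\mathcal E$. A *modular diagram* of $\mathcal L$ is a triple $\Gamma=(\mathcal E,\imath,J)$ with $(\mathcal E,\imath)$ a modular extension of $\mathcal L$ and $J$ a finite word in the alphabet $\mathrm{At}(\mathcal E)$; its degree is $|J|-2\big(\mathrm{rk}(\bigvee J)-\mathrm{rk}((\bigvee J)\wedge F_\imath)\big)$. The graded vector space $\mathcal{MD}(\mathcal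 L)$ is the $\mathbb Q$-vector space spanned by the modular diagrams of $\mathcal L$ modulo the relations: 1. $(\mathcal E,\imath,J)\sim-(\mathcal E,\imath,J')$ if $J'$ is obtained from $J$ by exchanging two letters; 2. $(\mathcal E,\imath,J)\sim(\mathcal E',\varphi\circ\imath,\varphi(J))$ for every embedding $\varphi:\mathcal E\to\mathcal E'$ with $\mathrm{rk}\,\mathcal E=\mathrm{rk}\,\mathcal E'$; 3. $(\mathcal E,\imath,J)\sim0$ if $F_\imath\vee\bigvee J<\hat 1$; 4. $(\mathcal E,\imath,J)\sim0$ if $\mathcal E\simeq\mathcal E_1\times\mathcal E_2$ with $\mathcal E_1,\mathcal E_2$ geometric lattices having at least two elements and $F_\imath\in\mathcal E_1\times\{\hat 0\}$; 5. $(\mathcal E,\imath,J)\sim0$ if exactly two letters of $J$ are not below some modular flat $F\ge F_\imath$ of $\mathcal E$. A letter $H$ of a word $J=H_1\cdots H_n$ with distinct letters is a *bridge* if it is the only letter not below some flat $F\geq F_\imath$, and is *contractible* if it is neither a bridge nor below $F_\imath$; in that case $\Gamma/H:=([H,\hat 1],\,H\vee\imath,\,H\vee(J\setminus H))$. Let $\mathrm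 d$ be the differential with $\mathrm d(\Gamma)=\sum_{H_i\text{ contractible}}(-1)^{i+1}\,\Gamma/H_i$ for every diagram $\Gamma$ with distinct letters (by relation 1, the other diagrams vanish). Let $\bullet$ be the product with $(\mathcal E_1,\imath_1,J_1)\bullet(\mathcal E_2,\imath_2,J_2)=(\mathcal E_1\cup_{\mathcal L}\mathcal E_2,\,\imath_{12},\,J_1J_2)$, where $\mathcal E_1\cup_{\mathcal L}\mathcal E_2\subset\mathcal E_1\times\mathcal E_2$ is the poset of pairs with $\imath_1^{-1}(F_1\wedge F_{\imath_1})=\imath_2^{-1}(F_2\wedge F_{\imath_2})$, $\imath_{12}=(\imath_1,\imath_2)$, a letter $H$ of $J_1$ is identified with $(H,\imath_2\imath_1^{-1}(H\wedge F_{\imath_1}))$, and similarly for the letters of $J_2$. The unit is $(\mathcal L,\mathrm{id},\emptyset)$. Let $\mathrm{OS}(\mathcal L)$ be the Orlik–Solomon algebra: the quotient of the exterior algebra over $\mathbb Q$ on generators $e_H$ of degree $1$, $H\in\mathrm{At}(\mathcal L)$, by the ideal generated by the $\delta(e_C)$, where $C$ runs over the circuits of $\mathcal L$ (sets of atoms with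 $\mathrm{rk}(C)=\#C-1=\mathrm{rk}(C\setminus c)$ for all $c\in C$), $e_C=\prod_{H\in C}e_H$ and $\delta$ is the antiderivation with $\delta(e_H)=1$ for all $H$. **Theorem.** Let $\mathcal L$ be a supersolvable geometric lattice with at least two elements. Then $\mathcal{MD}(\mathcal L)$, with the above grading, unit, product and differential, is a well-defined commutative differential graded algebra, and there is a well-defined morphism of commutative differential graded algebras $$\mathbb I_{\mathcal L}:\mathcal{MD}(\mathcal L)\longrightarrow(\mathrm{OS}(\mathcal L),\mathrm d=0)$$ with $\mathbb I_{\mathcal L}(\mathcal E,\imath,J)=e_{\imath^{-1}(J)}$ (the product of the $e_{\imath^{-1}(H)}$ over the letters $H$ of $J$, in order) if $F_\imath=\hat 1$, and $\mathbb I_{\mathcal L}(\mathcal E,\imath,J)=0$ otherwise. (Equivalently: it is $0$ on the diagrams with a contractible letter, and $e_{\imath^{-1}(J)}$ on the diagrams without contractible letters which do not vanish in $\mathcal{MD}(\mathcal L)$.) Moreover $\mathbb I_{\mathcal L}$ is a quasi-isomorphism, that is, it induces an isomorphism $H^k(\mathcal{MD}(\mathcal L))\to\mathrm{OS}^k(\mathcal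 L)$ for every $k\in\mathbb Z$. -/

import Mathlib

open scoped DirectSum

universe u v w

set_option linter.unusedSectionVars false

namespace ModDiag

/-! ### Geometric lattices -/

/-- A geometric lattice: a finite lattice which is atomistic and (upper) semimodular.
By `rk_of_covBy` and `rk_inf_add_rk_sup_le` below, such a lattice is graded by `rk`
and `rk` satisfies the semimodular inequality. -/
class IsGeometricLattice (L : Type u) [Lattice L] [BoundedOrder L] : Prop extends
    IsAtomistic L, IsUpperModularLattice L where
  finite : Finite L

attribute [instance] IsGeometricLattice.finite

/-- The rank of an element: the length of the longest chains from `⊥` to it. -/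
noncomputable def rk {L : Type u} [Preorder L] (a : L) : ℕ := (Order.height a).toNat

/-- The set of atoms of `L`. -/
abbrev Atoms (L : Type u) [Lattice L] [BoundedOrder L] : Type u := {a : L // IsAtom a}

/-- Modular flats: `rk (F ∧ G) + rk (F ∨ G) = rk F + rk G` for all flats `G`. -/
def IsModularFlat {L : Type u} [Lattice L] (F : L) : Prop :=
  ∀ G : L, rk (F ⊓ G) + rk (F ⊔ G) = rk F + rk G

/-- A geometric lattice is supersolvable if it has a maximal chain consisting of modular flats. -/
def IsSupersolvable (L : Type u) [Lattice L] : Prop :=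
  ∃ c : Set L, IsMaxChain (· ≤ ·) c ∧ ∀ F ∈ c, IsModularFlat F

/-- Embeddings of geometric lattices: injective, join-preserving (hence increasing) maps
sending atoms to atoms. -/
structure IsEmbedding {L₁ : Type u} {L₂ : Type v} [Lattice L₁] [BoundedOrder L₁] [Lattice L₂]
    [BoundedOrder L₂] (φ : L₁ → L₂) : Prop where
  injective : Function.Injective φ
  map_sup : ∀ a b, φ (a ⊔ b) = φ a ⊔ φ b
  map_atom : ∀ a, IsAtom a → IsAtom (φ a)

/-! ### Basic facts on ranks and modular flats -/

section Basic

variable {L : Type u} [Lattice L] [BoundedOrder L]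

/-- There is a saturated chain of length `n` from `a` to `b`. -/
inductive Sat : ℕ → L → L → Prop
  | refl (a : L) : Sat 0 a a
  | cons {n : ℕ} {a b c : L} (h : a ⋖ b) (t : Sat n b c) : Sat (n + 1) a c

theorem Sat.le {n : ℕ} {a b : L} (h : Sat n a b) : a ≤ b := by
  induction h with
  | refl a => exact le_rfl
  | cons h _ ih => exact h.le.trans ih

theorem Sat.snoc {n : ℕ} {a b c : L} (h : Sat n a b) (hb : b ⋖ c) : Sat (n + 1) a c := by
  induction h with
  | refl a => exact .cons hb (.refl _)
  | cons h _ ih => exact .cons h (ih hb)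

theorem exists_covBy_le [Finite L] {a b : L} (h : a < b) : ∃ c, a ⋖ c ∧ c ≤ b :=
  exists_covBy_le_of_lt h

theorem exists_sat [Finite L] (b : L) : ∀ a : L, a ≤ b → ∃ n, Sat n a b := by
  intro a
  induction a using WellFoundedGT.induction with
  | ind a ih =>
    intro hab
    rcases hab.eq_or_lt with rfl | hlt
    · exact ⟨0, .refl _⟩
    · obtain ⟨c, hc, hcb⟩ := exists_covBy_le hlt
      obtain ⟨n, hn⟩ := ih c hc.lt hcb
      exact ⟨n + 1, .cons hc hn⟩

theorem sat_unique [Finite L] [IsUpperModularLattice L] (b : L) :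
    ∀ (a : L) (n m : ℕ), Sat n a b → Sat m a b → n = m := by
  intro a
  induction a using WellFoundedGT.induction with
  | ind a ih =>
    intro n m hn hm
    cases hn with
    | refl =>
      cases hm with
      | refl => rfl
      | cons h t => exact absurd (h.lt.trans_le t.le) (lt_irrefl _)
    | @cons n _ x _ hx tx =>
      cases hm with
      | refl => exact absurd (hx.lt.trans_le tx.le) (lt_irrefl _)
      | @cons m _ y _ hy ty =>
        by_cases hxy : x = y
        · subst hxy
          rw [ih x hx.lt n m tx ty]
        · have hinf : x ⊓ y = a := by
            have h1 : a ≤ x ⊓ y := le_inf hx.le hy.le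
            rcases hx.eq_or_eq h1 inf_le_left with h | h
            · exact h
            · exact absurd (hy.eq_or_eq hx.le (inf_eq_left.1 h)) (by
                rintro (h' | h')
                · exact hx.ne' h'
                · exact hxy h')
          have hx' : x ⋖ x ⊔ y := covBy_sup_of_inf_covBy_right (by rw [hinf]; exact hy)
          have hy' : y ⋖ x ⊔ y := covBy_sup_of_inf_covBy_left (by rw [hinf]; exact hx)
          obtain ⟨k, hk⟩ := exists_sat b (x ⊔ y) (sup_le tx.le ty.le)
          rw [ih x hx.lt n _ tx (.cons hx' hk), ih y hy.lt m _ ty (.cons hy' hk)]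

/-- A function vanishing at `⊥` and increasing by one along covers is the rank. -/
theorem rk_eq_of_covBy [Finite L] (r : L → ℕ) (h0 : r ⊥ = 0)
    (hr : ∀ a b, a ⋖ b → r b = r a + 1) (a : L) : rk a = r a := by
  have key : ∀ (n : ℕ) (a b : L), Sat n a b → r b = r a + n := by
    intro n a b h
    induction h with
    | refl a => rfl
    | cons h _ ih => rw [ih, hr _ _ h]; omega
  have hmono : StrictMono r := by
    intro a b hab
    obtain ⟨c, hc, hcb⟩ := exists_covBy_le hab
    obtain ⟨n, hn⟩ := exists_sat b c hcb
    have h1 := key _ _ _ hn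
    have h2 := hr _ _ hc
    omega
  have hle : Order.height a ≤ (r a : ℕ∞) := by
    have := Order.height_le_height_apply_of_strictMono r hmono a
    rwa [Order.height_nat] at this
  have hge : ∀ (n : ℕ) (a b : L), Sat n a b → Order.height a + (n : ℕ∞) ≤ Order.height b := by
    intro n a b h
    induction h with
    | refl a => simp
    | @cons n a b c h _ ih =>
      refine le_trans ?_ ih
      have := Order.height_add_one_le h.lt
      calc Order.height a + ((n + 1 : ℕ) : ℕ∞) = (Order.height a + 1) + n := by
            push_cast; ring
        _ ≤ _ := by gcongr
  obtain ⟨n, hn⟩ := exists_sat a ⊥ bot_le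
  have h1 := key _ _ _ hn
  have h2 := hge _ _ _ hn
  have h3 : Order.height a = (r a : ℕ∞) := by
    refine le_antisymm hle ?_
    rw [h1, h0, zero_add]
    refine le_trans ?_ h2
    exact le_add_self
  rw [rk, h3, ENat.toNat_natCast]

/-- The rank increases by one along covers. -/
theorem rk_of_covBy [Finite L] [IsUpperModularLattice L] {a b : L} (h : a ⋖ b) :
    rk b = rk a + 1 := by
  choose r hr using fun a : L => exists_sat a ⊥ bot_le
  have hcov : ∀ a b, a ⋖ b → r b = r a + 1 := fun a b hab =>
    sat_unique b ⊥ _ _ (hr b) ((hr a).snoc hab)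
  have h0 : r ⊥ = 0 := sat_unique ⊥ ⊥ _ _ (hr ⊥) (.refl _)
  rw [rk_eq_of_covBy r h0 hcov, rk_eq_of_covBy r h0 hcov, hcov _ _ h]

theorem rk_of_sat [Finite L] [IsUpperModularLattice L] {n : ℕ} {a b : L}
    (h : Sat n a b) : rk b = rk a + n := by
  induction h with
  | refl a => rfl
  | cons h _ ih => rw [ih, rk_of_covBy h]; omega

theorem rk_bot : rk (⊥ : L) = 0 := by simp [rk]

theorem rk_strictMono [Finite L] [IsUpperModularLattice L] : StrictMono (rk : L → ℕ) := by
  intro a b hab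
  obtain ⟨c, hc, hcb⟩ := exists_covBy_le hab
  obtain ⟨n, hn⟩ := exists_sat b c hcb
  have h1 := rk_of_sat hn
  have h2 := rk_of_covBy hc
  omega

theorem eq_of_le_of_rk_le [Finite L] [IsUpperModularLattice L] {a b : L} (h : a ≤ b)
    (hr : rk b ≤ rk a) : a = b := by
  rcases h.eq_or_lt with h | h
  · exact h
  · exact absurd (rk_strictMono h) (by omega)

/-- The semimodular inequality. -/
theorem rk_inf_add_rk_sup_le [Finite L] [IsUpperModularLattice L] (a b : L) :
    rk (a ⊓ b) + rk (a ⊔ b) ≤ rk a + rk b := by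
  have key : ∀ (n : ℕ) (c a : L), Sat n c a → rk (a ⊔ b) ≤ rk (c ⊔ b) + n := by
    intro n c a h
    induction h with
    | refl a => simp
    | @cons n a x c h _ ih =>
      have hx : rk (x ⊔ b) ≤ rk (a ⊔ b) + 1 := by
        have h1 : a ≤ x ⊓ (a ⊔ b) := le_inf h.le le_sup_left
        rcases h.eq_or_eq h1 inf_le_left with h2 | h2
        · have h3 : a ⊔ b ⋖ x ⊔ (a ⊔ b) := covBy_sup_of_inf_covBy_left (by rw [h2]; exact h)
          have h4 : x ⊔ (a ⊔ b) = x ⊔ b := by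
            rw [← sup_assoc, sup_eq_left.2 h.le]
          rw [h4] at h3
          exact (rk_of_covBy h3).le
        · have h3 : x ⊔ b ≤ a ⊔ b := sup_le (inf_eq_left.1 h2) le_sup_right
          have := rk_strictMono.monotone h3
          omega
      omega
  obtain ⟨n, hn⟩ := exists_sat a (a ⊓ b) inf_le_left
  have h1 := key _ _ _ hn
  have h2 := rk_of_sat hn
  rw [sup_eq_right.2 (inf_le_right : a ⊓ b ≤ b)] at h1
  omega

theorem IsModularFlat.inf_sup [Finite L] [IsUpperModularLattice L] {F : L}
    (hF : IsModularFlat F) {a : L} (b : L) (ha : a ≤ F) : F ⊓ (a ⊔ b) = a ⊔ (F ⊓ b) := by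
  symm
  have hle : a ⊔ (F ⊓ b) ≤ F ⊓ (a ⊔ b) :=
    sup_le (le_inf ha le_sup_left) (inf_le_inf_left _ le_sup_right)
  refine eq_of_le_of_rk_le hle ?_
  have h1 := hF (a ⊔ b)
  have h2 := hF b
  have h3 := rk_inf_add_rk_sup_le (a ⊔ F ⊓ b) b
  have h4 : (a ⊔ F ⊓ b) ⊔ b = a ⊔ b := by
    rw [sup_assoc, sup_eq_right.2 (inf_le_right : F ⊓ b ≤ b)]
  have h5 : (a ⊔ F ⊓ b) ⊓ b = F ⊓ b := by
    apply le_antisymm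
    · exact inf_le_inf_right _ (sup_le ha inf_le_left)
    · exact le_inf le_sup_right inf_le_right
  have h6 : F ⊔ (a ⊔ b) = F ⊔ b := by
    rw [← sup_assoc, sup_eq_left.2 ha]
  rw [h4, h5] at h3
  rw [h6] at h1
  omega

theorem IsModularFlat.inf_sup' [Finite L] [IsUpperModularLattice L] {F : L}
    (hF : IsModularFlat F) {a b : L} (hab : a ≤ b) : b ⊓ (a ⊔ F) = a ⊔ (b ⊓ F) := by
  symm
  have hle : a ⊔ (b ⊓ F) ≤ b ⊓ (a ⊔ F) :=
    sup_le (le_inf hab le_sup_left) (inf_le_inf_left _ le_sup_right)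
  refine eq_of_le_of_rk_le hle ?_
  have h1 := hF (b ⊓ (a ⊔ F))
  have h2 := hF (a ⊔ (b ⊓ F))
  have h3 : F ⊔ (b ⊓ (a ⊔ F)) = F ⊔ a := by
    apply le_antisymm
    · exact sup_le le_sup_left (inf_le_right.trans (by rw [sup_comm]))
    · exact sup_le le_sup_left ((le_inf hab le_sup_left).trans le_sup_right)
  have h4 : F ⊔ (a ⊔ (b ⊓ F)) = F ⊔ a := by
    rw [← sup_assoc]
    exact sup_eq_left.2 (inf_le_right.trans le_sup_left)
  have h5 : F ⊓ (b ⊓ (a ⊔ F)) = F ⊓ b := by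
    apply le_antisymm
    · exact inf_le_inf_left _ inf_le_left
    · exact le_inf inf_le_left (le_inf inf_le_right (inf_le_left.trans le_sup_right))
  have h6 : F ⊓ b ≤ F ⊓ (a ⊔ (b ⊓ F)) :=
    le_inf inf_le_left (by rw [inf_comm]; exact le_sup_right)
  have h7 := rk_strictMono.monotone h6
  rw [h3, h5] at h1
  rw [h4] at h2
  omega

theorem isModularFlat_top : IsModularFlat (⊤ : L) := by
  intro G; simp [add_comm]

theorem exists_atom_not_le [IsAtomistic L] {a b : L} (h : ¬ b ≤ a) :
    ∃ c, IsAtom c ∧ c ≤ b ∧ ¬ c ≤ a := by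
  obtain ⟨s, hs, hat⟩ := isLUB_atoms b
  by_contra! hc
  exact h (hs.2 fun x hx => hc x (hat x hx) (hs.1 hx))

/-- In a semimodular lattice, joining with an atom gives a cover. -/
theorem covBy_sup_atom [IsUpperModularLattice L] {a b : L} (hb : IsAtom b) (h : ¬ b ≤ a) :
    a ⋖ a ⊔ b := by
  have : b ⊓ a = ⊥ := by
    rcases hb.le_iff.1 (inf_le_left : b ⊓ a ≤ b) with h' | h'
    · exact h'
    · exact absurd (inf_eq_left.1 h') h
  rw [sup_comm]
  exact covBy_sup_of_inf_covBy_left (by rw [this]; exact hb.bot_covBy)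

/-- Criterion of semimodularity for atomistic lattices. -/
theorem isUpperModularLattice_of_atoms [IsAtomistic L]
    (h : ∀ a b : L, IsAtom b → ¬ b ≤ a → a ⋖ a ⊔ b) : IsUpperModularLattice L := by
  refine ⟨fun {a b} hab => ?_⟩
  have hn : ¬ a ≤ a ⊓ b := hab.lt.not_ge
  obtain ⟨c, hc, hca, hcn⟩ := exists_atom_not_le hn
  have h1 : (a ⊓ b) ⊔ c = a := by
    rcases hab.eq_or_eq (le_sup_left : a ⊓ b ≤ (a ⊓ b) ⊔ c) (sup_le inf_le_left hca) with h' | h'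
    · exact absurd (sup_eq_left.1 h') hcn
    · exact h'
  have h2 : ¬ c ≤ b := fun hcb => hcn (le_inf hca hcb)
  have h3 : a ⊔ b = b ⊔ c := by
    apply le_antisymm
    · conv_lhs => rw [← h1]
      exact sup_le (sup_le (inf_le_right.trans le_sup_left) le_sup_right) le_sup_left
    · exact sup_le le_sup_right (hca.trans le_sup_left)
  rw [h3]
  exact h b c hc h2

/-! ### Upper intervals -/

theorem covBy_coe {H : L} {a b : Set.Ici H} (h : a ⋖ b) : (a : L) ⋖ (b : L) := by
  refine ⟨h.lt, fun c hac hcb => ?_⟩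
  exact h.2 (c := ⟨c, le_trans a.2 hac.le⟩) hac hcb

theorem coe_covBy {H : L} {a b : Set.Ici H} (h : (a : L) ⋖ (b : L)) : a ⋖ b :=
  ⟨h.lt, fun _ hac hcb => h.2 hac hcb⟩

/-- The join with `a`, as an atom of `[H, ⊤]`. -/
theorem isAtom_Ici_sup [IsUpperModularLattice L] (H : L) {a : L} (ha : IsAtom a)
    (h : ¬ a ≤ H) : IsAtom (⟨H ⊔ a, le_sup_left⟩ : Set.Ici H) := by
  rw [← bot_covBy_iff]
  exact coe_covBy (covBy_sup_atom ha h)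

instance instGeometricIci [IsGeometricLattice L] (H : L) : IsGeometricLattice (Set.Ici H) where
  finite := inferInstance
  isLUB_atoms := by
    rintro ⟨b, hb⟩
    refine ⟨{x | IsAtom x ∧ x ≤ ⟨b, hb⟩}, ⟨fun x hx => hx.2, ?_⟩, fun x hx => hx.1⟩
    rintro ⟨c, hc⟩ hub
    by_contra hbc
    obtain ⟨a, ha, hab, hac⟩ := exists_atom_not_le (a := c) (b := b) hbc
    have haH : ¬ a ≤ H := fun h => hac (h.trans hc)
    have := hub ⟨isAtom_Ici_sup H ha haH, (sup_le hb hab : H ⊔ a ≤ b)⟩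
    exact hac ((le_sup_right : a ≤ H ⊔ a).trans this)
  covBy_sup_of_inf_covBy := by
    intro a b hab
    exact coe_covBy (IsUpperModularLattice.covBy_sup_of_inf_covBy (covBy_coe hab))

theorem rk_Ici [IsGeometricLattice L] {H : L} (x : Set.Ici H) : rk x + rk H = rk (x : L) := by
  have h := rk_eq_of_covBy (L := Set.Ici H) (fun x => rk (x : L) - rk H) (by simp)
    (fun a b hab => by
      have h1 := rk_of_covBy (covBy_coe hab)
      have h2 : rk H ≤ rk (a : L) := rk_strictMono.monotone a.2
      omega) x
  have h2 : rk H ≤ rk (x : L) := rk_strictMono.monotone x.2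
  rw [h]
  omega

end Basic

/-! ### Modular extensions -/

/-- A modular extension of `L`: a geometric lattice `E` with an embedding `ι : L → E` whose image
is an interval `[⊥, F]` with `F` a modular flat of `E`. Necessarily `F = ι ⊤`. -/
structure ModularExtension (L : Type u) [Lattice L] [BoundedOrder L] : Type (u + 1) where
  E : Type u
  [lattice : Lattice E]
  [boundedOrder : BoundedOrder E]
  [geometric : IsGeometricLattice E]
  ι : L → E
  embedding : IsEmbedding ι
  range_eq : Set.range ι = Set.Iic (ι ⊤)
  modular : IsModularFlat (ι ⊤)

attribute [instance] ModularExtension.lattice ModularExtension.boundedOrder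
  ModularExtension.geometric

namespace ModularExtension

variable {L : Type u} [Lattice L] [BoundedOrder L]

/-- The modular flat `F_ι` of a modular extension. -/
def F (X : ModularExtension L) : X.E := X.ι ⊤

/-- The identity extension `L → L`. -/
def refl (L : Type u) [Lattice L] [BoundedOrder L] [IsGeometricLattice L] :
    ModularExtension L where
  E := L
  ι := id
  embedding := ⟨Function.injective_id, fun _ _ => rfl, fun _ h => h⟩
  range_eq := by simp
  modular := isModularFlat_top

theorem exists_trace (X : ModularExtension L) (x : X.E) : ∃ l, X.ι l = x ⊓ X.F := by
  have : x ⊓ X.F ∈ Set.range X.ι := by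
    rw [X.range_eq]; exact inf_le_right
  exact this

/-- The trace on `L` of a flat `x` of `E`, that is, `ι⁻¹ (x ∧ F_ι)`. -/
noncomputable def trace (X : ModularExtension L) (x : X.E) : L := (X.exists_trace x).choose

theorem ι_trace (X : ModularExtension L) (x : X.E) : X.ι (X.trace x) = x ⊓ X.F :=
  (X.exists_trace x).choose_spec

theorem ι_le_iff (X : ModularExtension L) {a b : L} : X.ι a ≤ X.ι b ↔ a ≤ b := by
  rw [← sup_eq_right, ← X.embedding.map_sup, X.embedding.injective.eq_iff, sup_eq_right]

theorem ι_le_F (X : ModularExtension L) (a : L) : X.ι a ≤ X.F := X.ι_le_iff.2 le_top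

theorem ι_le_iff_le_trace (X : ModularExtension L) {a : L} {x : X.E} :
    X.ι a ≤ x ↔ a ≤ X.trace x := by
  rw [← X.ι_le_iff, ι_trace, le_inf_iff, and_iff_left (X.ι_le_F a)]

theorem trace_ι (X : ModularExtension L) (a : L) : X.trace (X.ι a) = a := by
  apply X.embedding.injective
  rw [ι_trace, inf_eq_left.2 (X.ι_le_F a)]

theorem trace_mono (X : ModularExtension L) : Monotone X.trace := fun x y h => by
  rw [← X.ι_le_iff_le_trace, ι_trace]
  exact inf_le_left.trans h

theorem trace_inf (X : ModularExtension L) (x y : X.E) :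
    X.trace (x ⊓ y) = X.trace x ⊓ X.trace y := by
  apply le_antisymm
  · exact le_inf (X.trace_mono inf_le_left) (X.trace_mono inf_le_right)
  · rw [← X.ι_le_iff_le_trace]
    exact le_inf (X.ι_le_iff_le_trace.2 inf_le_left) (X.ι_le_iff_le_trace.2 inf_le_right)

theorem trace_top (X : ModularExtension L) : X.trace ⊤ = ⊤ :=
  top_le_iff.1 (X.ι_le_iff_le_trace.1 le_top)

theorem ι_bot (X : ModularExtension L) : X.ι ⊥ = ⊥ := by
  have h : X.ι ⊥ ≤ X.ι (X.trace ⊥) := X.ι_le_iff.2 bot_le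
  rw [ι_trace, bot_inf_eq] at h
  exact le_bot_iff.1 h

theorem trace_bot (X : ModularExtension L) : X.trace ⊥ = ⊥ := by
  rw [← X.ι_bot, trace_ι]

theorem trace_sup_ι (X : ModularExtension L) (x : X.E) (a : L) :
    X.trace (x ⊔ X.ι a) = X.trace x ⊔ a := by
  apply X.embedding.injective
  have := X.modular.inf_sup x (X.ι_le_F a)
  rw [ι_trace, X.embedding.map_sup, ι_trace, sup_comm x, inf_comm, F, this, sup_comm, inf_comm x]

theorem ι_inf (X : ModularExtension L) (x : X.E) (a : L) :
    X.ι (X.trace x ⊓ a) = x ⊓ X.ι a := by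
  apply le_antisymm
  · exact le_inf (X.ι_le_iff_le_trace.2 inf_le_left) (X.ι_le_iff.2 inf_le_right)
  · have h : x ⊓ X.ι a = X.ι (X.trace (x ⊓ X.ι a)) := by
      rw [ι_trace, inf_eq_left.2 (inf_le_right.trans (X.ι_le_F a))]
    rw [h, X.ι_le_iff, trace_inf, trace_ι]

theorem ι_covBy (X : ModularExtension L) {a b : L} (h : a ⋖ b) : X.ι a ⋖ X.ι b := by
  have hlt : ∀ {a b : L}, X.ι a < X.ι b ↔ a < b := fun {a b} => by
    rw [lt_iff_le_not_ge, lt_iff_le_not_ge, X.ι_le_iff, X.ι_le_iff]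
  refine ⟨hlt.2 h.lt, fun c hac hcb => ?_⟩
  have hc : c = X.ι (X.trace c) := by
    rw [ι_trace, inf_eq_left.2 (hcb.le.trans (X.ι_le_F b))]
  rw [hc, hlt] at hac hcb
  exact h.2 hac hcb

/-! ### Contractions -/

theorem inf_F_eq_bot (X : ModularExtension L) {H : X.E} (hH : IsAtom H) (h : ¬ H ≤ X.F) :
    X.F ⊓ H = ⊥ := by
  rcases hH.le_iff.1 (inf_le_right : X.F ⊓ H ≤ H) with h' | h'
  · exact h'
  · exact absurd (inf_eq_right.1 h') h

/-- The contraction `([H, ⊤], H ∨ ι)` of a modular extension at an atom `H` not below `F_ι`. -/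
def contract (X : ModularExtension L) (H : Atoms X.E) (h : ¬ (H : X.E) ≤ X.F) :
    ModularExtension L where
  E := Set.Ici (H : X.E)
  ι := fun a => ⟨H ⊔ X.ι a, le_sup_left⟩
  embedding := by
    have hinv : ∀ a, X.F ⊓ ((H : X.E) ⊔ X.ι a) = X.ι a := fun a => by
      have := X.modular.inf_sup (H : X.E) (X.ι_le_F a)
      rw [sup_comm, F, this]
      have h' := X.inf_F_eq_bot H.2 h
      rw [F] at h'
      rw [h', sup_bot_eq]
    refine ⟨fun a b hab => ?_, fun a b => ?_, fun a ha => ?_⟩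
    · have h1 : (H : X.E) ⊔ X.ι a = (H : X.E) ⊔ X.ι b := congrArg Subtype.val hab
      apply X.embedding.injective
      rw [← hinv a, h1, hinv b]
    · apply Subtype.ext
      change (H : X.E) ⊔ X.ι (a ⊔ b) = ((H : X.E) ⊔ X.ι a) ⊔ ((H : X.E) ⊔ X.ι b)
      rw [X.embedding.map_sup, sup_sup_sup_comm, sup_idem]
    · refine isAtom_Ici_sup _ (X.embedding.map_atom a ha) fun hle => ?_
      rcases H.2.le_iff.1 hle with h1 | h1
      · exact (X.embedding.map_atom a ha).1 h1
      · exact h (h1 ▸ X.ι_le_F a)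
  range_eq := by
    ext ⟨y, hy⟩
    constructor
    · rintro ⟨a, ha⟩
      rw [← ha]
      exact (sup_le_sup_left (X.ι_le_F a) _ : (H : X.E) ⊔ X.ι a ≤ (H : X.E) ⊔ X.ι ⊤)
    · intro hle
      have hle' : y ≤ (H : X.E) ⊔ X.ι ⊤ := hle
      refine ⟨X.trace y, Subtype.ext ?_⟩
      change (H : X.E) ⊔ X.ι (X.trace y) = y
      have := X.modular.inf_sup' (a := (H : X.E)) (b := y) hy
      rw [X.ι_trace, F, ← this, inf_eq_left.2 hle']
  modular := by
    rintro ⟨G, hG⟩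
    have hHG : (H : X.E) ≤ G := hG
    have h1 := rk_Ici ((⟨H ⊔ X.ι ⊤, le_sup_left⟩ : Set.Ici (H : X.E)) ⊓ ⟨G, hG⟩)
    have h2 := rk_Ici ((⟨H ⊔ X.ι ⊤, le_sup_left⟩ : Set.Ici (H : X.E)) ⊔ ⟨G, hG⟩)
    have h3 := rk_Ici (⟨H ⊔ X.ι ⊤, le_sup_left⟩ : Set.Ici (H : X.E))
    have h4 := rk_Ici (⟨G, hG⟩ : Set.Ici (H : X.E))
    rw [Set.Ici.coe_inf] at h1
    rw [Set.Ici.coe_sup] at h2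
    simp only at h1 h2 h3 h4
    have h5 := X.modular.inf_sup' (a := (H : X.E)) (b := G) hG
    have h6 : ((H : X.E) ⊔ X.ι ⊤) ⊔ G = X.ι ⊤ ⊔ G := by
      rw [sup_comm (H : X.E), sup_assoc, sup_eq_right.2 hHG]
    have h7 := X.modular G
    have h8 := X.modular H
    have h9 : X.ι ⊤ ⊓ (H : X.E) = ⊥ := X.inf_F_eq_bot H.2 h
    have h10 := X.modular ((H : X.E) ⊔ (G ⊓ X.ι ⊤))
    have h11 : X.ι ⊤ ⊓ ((H : X.E) ⊔ (G ⊓ X.ι ⊤)) = X.ι ⊤ ⊓ G := by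
      have := X.modular.inf_sup (a := X.ι ⊤ ⊓ G) (H : X.E) inf_le_left
      rw [sup_comm, inf_comm G, this, h9, sup_bot_eq]
    have h12 : X.ι ⊤ ⊔ ((H : X.E) ⊔ (G ⊓ X.ι ⊤)) = X.ι ⊤ ⊔ H := by
      rw [sup_comm (H : X.E), ← sup_assoc, sup_eq_left.2 (inf_le_right : G ⊓ X.ι ⊤ ≤ X.ι ⊤)]
    have h13 : ((H : X.E) ⊔ X.ι ⊤) ⊓ G = (H : X.E) ⊔ (G ⊓ X.ι ⊤) := by rw [inf_comm, h5]
    rw [h13] at h1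
    rw [h6] at h2
    have h14 : X.ι ⊤ ⊔ (H : X.E) = (H : X.E) ⊔ X.ι ⊤ := sup_comm _ _
    rw [h9, rk_bot, h14] at h8
    rw [h11, h12, h14] at h10
    omega

/-! ### Pushouts -/

/-- The pushout (generalized parallel connection) of two modular extensions of `L`: the poset of
pairs of flats having the same trace on `L`, ordered componentwise. -/
def Pushout (X Y : ModularExtension L) : Type u :=
  {p : X.E × Y.E // X.trace p.1 = Y.trace p.2}

namespace Pushout

variable {X Y : ModularExtension L}

instance : PartialOrder (Pushout X Y) :=
  inferInstanceAs (PartialOrder {p : X.E × Y.E // X.trace p.1 = Y.trace p.2})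

instance : Finite (Pushout X Y) :=
  inferInstanceAs (Finite {p : X.E × Y.E // X.trace p.1 = Y.trace p.2})

theorem le_iff {p q : Pushout X Y} : p ≤ q ↔ p.1.1 ≤ q.1.1 ∧ p.1.2 ≤ q.1.2 := Iff.rfl

/-- The smallest element of the pushout above a pair of flats. -/
noncomputable def cl (x : X.E) (y : Y.E) : Pushout X Y :=
  ⟨(x ⊔ X.ι (X.trace x ⊔ Y.trace y), y ⊔ Y.ι (X.trace x ⊔ Y.trace y)), by
    simp only [trace_sup_ι]
    rw [← sup_assoc, sup_idem, sup_comm (X.trace x), ← sup_assoc, sup_idem]⟩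

theorem cl_le_iff {x : X.E} {y : Y.E} {p : Pushout X Y} :
    cl x y ≤ p ↔ x ≤ p.1.1 ∧ y ≤ p.1.2 := by
  constructor
  · intro h
    exact ⟨le_sup_left.trans h.1, le_sup_left.trans h.2⟩
  · rintro ⟨hx, hy⟩
    have h : X.trace x ⊔ Y.trace y ≤ X.trace p.1.1 :=
      sup_le (X.trace_mono hx) ((Y.trace_mono hy).trans p.2.ge)
    exact ⟨sup_le hx (X.ι_le_iff_le_trace.2 h), sup_le hy (Y.ι_le_iff_le_trace.2 (h.trans p.2.le))⟩

noncomputable instance : Lattice (Pushout X Y) where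
  inf p q := ⟨(p.1.1 ⊓ q.1.1, p.1.2 ⊓ q.1.2), by simp only [trace_inf, p.2, q.2]⟩
  inf_le_left p q := ⟨inf_le_left, inf_le_left⟩
  inf_le_right p q := ⟨inf_le_right, inf_le_right⟩
  le_inf p q r h h' := ⟨le_inf h.1 h'.1, le_inf h.2 h'.2⟩
  sup p q := cl (p.1.1 ⊔ q.1.1) (p.1.2 ⊔ q.1.2)
  le_sup_left p q := ⟨le_sup_left.trans le_sup_left, le_sup_left.trans le_sup_left⟩
  le_sup_right p q := ⟨le_sup_right.trans le_sup_left, le_sup_right.trans le_sup_left⟩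
  sup_le p q r h h' := cl_le_iff.2 ⟨sup_le h.1 h'.1, sup_le h.2 h'.2⟩

instance : BoundedOrder (Pushout X Y) where
  top := ⟨(⊤, ⊤), by simp only [trace_top]⟩
  le_top p := ⟨le_top, le_top⟩
  bot := ⟨(⊥, ⊥), by simp only [trace_bot]⟩
  bot_le p := ⟨bot_le, bot_le⟩

theorem sup_def (p q : Pushout X Y) : p ⊔ q = cl (p.1.1 ⊔ q.1.1) (p.1.2 ⊔ q.1.2) := rfl

/-- The embedding of `X.E` in the pushout. -/
noncomputable def inl (x : X.E) : Pushout X Y :=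
  ⟨(x, Y.ι (X.trace x)), by simp only [trace_ι]⟩

/-- The embedding of `Y.E` in the pushout. -/
noncomputable def inr (y : Y.E) : Pushout X Y :=
  ⟨(X.ι (Y.trace y), y), by simp only [trace_ι]⟩

/-- The embedding of `L` in the pushout. -/
def incl (l : L) : Pushout X Y :=
  ⟨(X.ι l, Y.ι l), by simp only [trace_ι]⟩

theorem inl_le_iff {x : X.E} {p : Pushout X Y} : inl x ≤ p ↔ x ≤ p.1.1 := by
  refine ⟨fun h => h.1, fun h => ⟨h, ?_⟩⟩
  exact Y.ι_le_iff_le_trace.2 ((X.trace_mono h).trans p.2.le)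

theorem inr_le_iff {y : Y.E} {p : Pushout X Y} : inr y ≤ p ↔ y ≤ p.1.2 := by
  refine ⟨fun h => h.2, fun h => ⟨?_, h⟩⟩
  exact X.ι_le_iff_le_trace.2 ((Y.trace_mono h).trans p.2.ge)

/-- The symmetry of the pushout. -/
def swap (X Y : ModularExtension L) : Pushout X Y ≃o Pushout Y X where
  toFun p := ⟨(p.1.2, p.1.1), p.2.symm⟩
  invFun p := ⟨(p.1.2, p.1.1), p.2.symm⟩
  left_inv _ := rfl
  right_inv _ := rfl
  map_rel_iff' := and_comm

theorem swap_inr (y : Y.E) : swap X Y (inr y) = inl y := rfl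

theorem isAtom_inl {x : X.E} (hx : IsAtom x) : IsAtom (inl x : Pushout X Y) := by
  refine ⟨fun h => hx.1 (congrArg (fun p : Pushout X Y => p.1.1) h), fun p hp => ?_⟩
  rcases hx.le_iff.1 hp.le.1 with h | h
  · apply le_bot_iff.1
    refine ⟨h.le, ?_⟩
    have h1 : p.1.2 = Y.ι (Y.trace p.1.2) := by
      rw [ι_trace, inf_eq_left.2 (hp.le.2.trans (Y.ι_le_F _))]
    rw [h1, ← p.2, h, trace_bot, ι_bot]
    exact le_rfl
  · exact absurd (inl_le_iff.2 h.ge) hp.not_ge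

theorem isAtom_inr {y : Y.E} (hy : IsAtom y) : IsAtom (inr y : Pushout X Y) := by
  rw [← (swap X Y).isAtom_iff, swap_inr]
  exact isAtom_inl hy

theorem exists_atom {p q : Pushout X Y} (h : ¬ p ≤ q) :
    (∃ x : X.E, IsAtom x ∧ inl x ≤ p ∧ ¬ inl x ≤ q) ∨
      ∃ y : Y.E, IsAtom y ∧ inr y ≤ p ∧ ¬ inr y ≤ q := by
  rw [le_iff, not_and_or] at h
  rcases h with h | h
  · obtain ⟨c, hc, h1, h2⟩ := exists_atom_not_le h
    exact .inl ⟨c, hc, inl_le_iff.2 h1, fun h => h2 (inl_le_iff.1 h)⟩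
  · obtain ⟨c, hc, h1, h2⟩ := exists_atom_not_le h
    exact .inr ⟨c, hc, inr_le_iff.2 h1, fun h => h2 (inr_le_iff.1 h)⟩

instance : IsAtomistic (Pushout X Y) where
  isLUB_atoms p := by
    refine ⟨{a | IsAtom a ∧ a ≤ p}, ⟨fun x hx => hx.2, fun q hq => ?_⟩, fun x hx => hx.1⟩
    by_contra hpq
    rcases exists_atom hpq with ⟨x, hx, h1, h2⟩ | ⟨y, hy, h1, h2⟩
    · exact h2 (hq ⟨isAtom_inl hx, h1⟩)
    · exact h2 (hq ⟨isAtom_inr hy, h1⟩)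

theorem sup_inl (p : Pushout X Y) (x : X.E) :
    (p ⊔ inl x).1 = (p.1.1 ⊔ x, p.1.2 ⊔ Y.ι (X.trace (p.1.1 ⊔ x))) := by
  have h1 : Y.trace (p.1.2 ⊔ Y.ι (X.trace x)) ≤ X.trace (p.1.1 ⊔ x) := by
    rw [trace_sup_ι, ← p.2]
    exact sup_le (X.trace_mono le_sup_left) (X.trace_mono le_sup_right)
  have h2 : X.trace (p.1.1 ⊔ x) ⊔ Y.trace (p.1.2 ⊔ Y.ι (X.trace x)) = X.trace (p.1.1 ⊔ x) :=
    sup_eq_left.2 h1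
  rw [sup_def]
  change (_, _) = (_, _)
  refine Prod.ext ?_ ?_
  · change (p.1.1 ⊔ x) ⊔ X.ι (X.trace (p.1.1 ⊔ x) ⊔ Y.trace (p.1.2 ⊔ Y.ι (X.trace x))) = _
    rw [h2]
    exact sup_eq_left.2 (X.ι_le_iff_le_trace.2 le_rfl)
  · change (p.1.2 ⊔ Y.ι (X.trace x)) ⊔
      Y.ι (X.trace (p.1.1 ⊔ x) ⊔ Y.trace (p.1.2 ⊔ Y.ι (X.trace x))) = _
    rw [h2, sup_assoc]
    congr 1
    exact sup_eq_right.2 (Y.ι_le_iff.2 (X.trace_mono le_sup_right))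

theorem trace_covBy {x H : X.E} (hx : x ⋖ x ⊔ H)
    (hne : X.trace x ≠ X.trace (x ⊔ H)) : X.trace x ⋖ X.trace (x ⊔ H) := by
  refine ⟨(X.trace_mono le_sup_left).lt_of_ne hne, fun z hz hz' => ?_⟩
  rcases hx.eq_or_eq (le_sup_left : x ≤ x ⊔ X.ι z)
    (sup_le le_sup_left (X.ι_le_iff_le_trace.2 hz'.le)) with h | h
  · exact hz.not_ge (X.ι_le_iff_le_trace.1 (sup_eq_left.1 h))
  · have h1 := X.trace_sup_ι x z
    rw [h, sup_eq_right.2 hz.le] at h1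
    exact hz'.ne h1.symm

theorem snd_covBy {p : Pushout X Y} {m : L} (h : X.trace p.1.1 ⋖ m) :
    p.1.2 ⋖ p.1.2 ⊔ Y.ι m := by
  rw [sup_comm]
  apply covBy_sup_of_inf_covBy_left
  rw [inf_comm, ← ι_inf, ← p.2, inf_eq_left.2 h.le]
  exact Y.ι_covBy h

theorem covBy_sup_inl (p : Pushout X Y) {x : X.E} (hx : IsAtom x)
    (h : ¬ (inl x : Pushout X Y) ≤ p) : p ⋖ p ⊔ inl x := by
  have hx' : p.1.1 ⋖ p.1.1 ⊔ x := covBy_sup_atom hx fun h' => h (inl_le_iff.2 h')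
  have hs := sup_inl p x
  refine ⟨left_lt_sup.2 h, fun q hpq hq => ?_⟩
  have hq1 : q.1.1 ≤ p.1.1 ⊔ x := by
    have := hq.le.1
    rwa [hs] at this
  have hq2 : q.1.2 ≤ p.1.2 ⊔ Y.ι (X.trace (p.1.1 ⊔ x)) := by
    have := hq.le.2
    rwa [hs] at this
  rcases hx'.eq_or_eq hpq.le.1 hq1 with h1 | h1
  · by_cases hm : X.trace p.1.1 = X.trace (p.1.1 ⊔ x)
    · rw [← hm, p.2, sup_eq_left.2 (Y.ι_le_iff_le_trace.2 le_rfl)] at hq2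
      exact hpq.not_ge ⟨h1.le, hq2⟩
    · have hcov := trace_covBy hx' hm
      rcases (snd_covBy hcov).eq_or_eq hpq.le.2 hq2 with h2 | h2
      · exact hpq.not_ge ⟨h1.le, h2.le⟩
      · have h3 : X.trace (p.1.1 ⊔ x) ≤ Y.trace q.1.2 := by
          rw [h2]
          exact Y.ι_le_iff_le_trace.1 le_sup_right
        rw [← q.2, h1] at h3
        exact hcov.lt.not_ge h3
  · refine hq.not_ge (sup_le hpq.le (inl_le_iff.2 ?_))
    rw [h1]
    exact le_sup_right

theorem covBy_sup_inr (p : Pushout X Y) {y : Y.E} (hy : IsAtom y)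
    (h : ¬ (inr y : Pushout X Y) ≤ p) : p ⋖ p ⊔ inr y := by
  rw [← apply_covBy_apply_iff (swap X Y), map_sup, swap_inr]
  refine covBy_sup_inl _ hy fun h' => h ?_
  rwa [← swap_inr (X := X), (swap X Y).le_iff_le] at h'

instance : IsGeometricLattice (Pushout X Y) where
  finite := inferInstance
  toIsUpperModularLattice := isUpperModularLattice_of_atoms fun p a ha hap => by
    rcases exists_atom hap with ⟨x, hx, h1, h2⟩ | ⟨y, hy, h1, h2⟩
    · rcases ha.le_iff.1 h1 with h3 | h3
      · exact absurd h3 (isAtom_inl hx).1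
      · rw [← h3]; exact covBy_sup_inl p hx h2
    · rcases ha.le_iff.1 h1 with h3 | h3
      · exact absurd h3 (isAtom_inr hy).1
      · rw [← h3]; exact covBy_sup_inr p hy h2

theorem rk_step (p : Pushout X Y) {x : X.E} (hx : IsAtom x)
    (h : ¬ (inl x : Pushout X Y) ≤ p) [IsGeometricLattice L] :
    (rk (p ⊔ inl x).1.1 + rk (p ⊔ inl x).1.2) + rk (X.trace p.1.1) =
      rk p.1.1 + rk p.1.2 + rk (X.trace (p ⊔ inl x).1.1) + 1 := by
  have hx' : p.1.1 ⋖ p.1.1 ⊔ x := covBy_sup_atom hx fun h' => h (inl_le_iff.2 h')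
  rw [sup_inl]
  simp only
  have h1 := rk_of_covBy hx'
  by_cases hm : X.trace p.1.1 = X.trace (p.1.1 ⊔ x)
  · rw [← hm, p.2, sup_eq_left.2 (Y.ι_le_iff_le_trace.2 le_rfl)]
    omega
  · have hcov := trace_covBy hx' hm
    have h2 := rk_of_covBy hcov
    have h3 := rk_of_covBy (snd_covBy hcov)
    omega

theorem sat_ι (X : ModularExtension L) {n : ℕ} {a b : L} (h : Sat n a b) :
    Sat n (X.ι a) (X.ι b) := by
  induction h with
  | refl a => exact .refl _
  | cons h _ ih => exact .cons (X.ι_covBy h) ih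

theorem rk_ι [IsGeometricLattice L] (X : ModularExtension L) (a : L) : rk (X.ι a) = rk a := by
  obtain ⟨n, hn⟩ := exists_sat a ⊥ bot_le
  have h1 := rk_of_sat hn
  have h2 := rk_of_sat (sat_ι X hn)
  rw [X.ι_bot, rk_bot] at h2
  rw [rk_bot] at h1
  omega

theorem rk_trace_le [IsGeometricLattice L] (X : ModularExtension L) (x : X.E) :
    rk (X.trace x) ≤ rk x := by
  rw [← rk_ι X]
  exact rk_strictMono.monotone (X.ι_le_iff_le_trace.2 le_rfl)

/-- The rank in the pushout. -/
theorem rk_add_rk_trace [IsGeometricLattice L] (p : Pushout X Y) :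
    rk p + rk (X.trace p.1.1) = rk p.1.1 + rk p.1.2 := by
  have hle : ∀ p : Pushout X Y, rk (X.trace p.1.1) ≤ rk p.1.1 + rk p.1.2 := fun p =>
    (rk_trace_le X _).trans (Nat.le_add_right _ _)
  have h := rk_eq_of_covBy (L := Pushout X Y)
    (fun p => rk p.1.1 + rk p.1.2 - rk (X.trace p.1.1))
    (by
      change rk (⊥ : X.E) + rk (⊥ : Y.E) - rk (X.trace ⊥) = 0
      simp [rk_bot])
    (fun p q hpq => by
      have hle' := hle p
      have hle'' := hle q
      rcases exists_atom hpq.lt.not_ge with ⟨x, hx, h1, h2⟩ | ⟨y, hy, h1, h2⟩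
      · rcases hpq.eq_or_eq (le_sup_left : p ≤ p ⊔ inl x) (sup_le hpq.le h1) with h3 | h3
        · exact absurd (sup_eq_left.1 h3) h2
        · have := rk_step p hx h2
          rw [h3] at this
          omega
      · rcases hpq.eq_or_eq (le_sup_left : p ≤ p ⊔ inr y) (sup_le hpq.le h1) with h3 | h3
        · exact absurd (sup_eq_left.1 h3) h2
        · have h4 : ¬ (inl y : Pushout Y X) ≤ swap X Y p := fun h' => h2 (by
            rwa [← swap_inr (X := X), (swap X Y).le_iff_le] at h')
          have := rk_step (swap X Y p) hy h4
          rw [← swap_inr (X := X), ← map_sup, h3] at this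
          have e1 : (swap X Y p).1 = (p.1.2, p.1.1) := rfl
          have e2 : (swap X Y q).1 = (q.1.2, q.1.1) := rfl
          rw [e1, e2] at this
          simp only at this
          rw [← p.2, ← q.2] at this
          omega) p
  have := hle p
  rw [h]
  omega

end Pushout

/-- The pushout of two modular extensions of `L`, as a modular extension of `L`. -/
noncomputable def pushout [IsGeometricLattice L] (X Y : ModularExtension L) :
    ModularExtension L where
  E := Pushout X Y
  ι := Pushout.incl
  embedding := by
    refine ⟨fun a b h => ?_, fun a b => ?_, fun a ha => ?_⟩
    · exact X.embedding.injective (congrArg (fun p : Pushout X Y => p.1.1) h)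
    · apply le_antisymm
      · refine ⟨?_, ?_⟩
        · change X.ι (a ⊔ b) ≤ _
          rw [X.embedding.map_sup]
          exact le_sup_left
        · change Y.ι (a ⊔ b) ≤ _
          rw [Y.embedding.map_sup]
          exact le_sup_left
      · exact sup_le ⟨X.ι_le_iff.2 le_sup_left, Y.ι_le_iff.2 le_sup_left⟩
          ⟨X.ι_le_iff.2 le_sup_right, Y.ι_le_iff.2 le_sup_right⟩
    · have h : (Pushout.incl a : Pushout X Y) = Pushout.inl (X.ι a) := by
        apply Subtype.ext
        change (X.ι a, Y.ι a) = (X.ι a, Y.ι (X.trace (X.ι a)))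
        rw [trace_ι]
      rw [h]
      exact Pushout.isAtom_inl (X.embedding.map_atom a ha)
  range_eq := by
    ext p
    constructor
    · rintro ⟨a, rfl⟩
      exact ⟨X.ι_le_F a, Y.ι_le_F a⟩
    · intro h
      refine ⟨X.trace p.1.1, Subtype.ext (Prod.ext ?_ ?_)⟩
      · change X.ι (X.trace p.1.1) = p.1.1
        rw [ι_trace]
        exact inf_eq_left.2 h.1
      · change Y.ι (X.trace p.1.1) = p.1.2
        rw [p.2, ι_trace]
        exact inf_eq_left.2 h.2
  modular := by
    intro p
    have htop : ∀ Z : ModularExtension L, Z.trace (Z.ι ⊤) = ⊤ := fun Z => Z.trace_ι ⊤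
    have hsup : (Pushout.incl ⊤ ⊔ p : Pushout X Y).1 = (X.ι ⊤ ⊔ p.1.1, Y.ι ⊤ ⊔ p.1.2) := by
      have key : ∀ (Z : ModularExtension L) (z : Z.E) (l : L),
          (Z.ι ⊤ ⊔ z) ⊔ Z.ι l = Z.ι ⊤ ⊔ z := fun Z z l =>
        sup_eq_left.2 ((Z.ι_le_F l).trans le_sup_left)
      exact Prod.ext (key X _ _) (key Y _ _)
    have hinf : (Pushout.incl ⊤ ⊓ p : Pushout X Y).1 = (X.ι ⊤ ⊓ p.1.1, Y.ι ⊤ ⊓ p.1.2) := rfl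
    have h1 := Pushout.rk_add_rk_trace (Pushout.incl ⊤ ⊓ p : Pushout X Y)
    have h2 := Pushout.rk_add_rk_trace (Pushout.incl ⊤ ⊔ p : Pushout X Y)
    have h3 := Pushout.rk_add_rk_trace (Pushout.incl ⊤ : Pushout X Y)
    have h4 := Pushout.rk_add_rk_trace p
    rw [hinf] at h1
    rw [hsup] at h2
    have e3 : (Pushout.incl ⊤ : Pushout X Y).1 = (X.ι ⊤, Y.ι ⊤) := rfl
    rw [e3] at h3
    simp only at h1 h2 h3
    have h5 : X.trace (X.ι ⊤ ⊓ p.1.1) = X.trace p.1.1 := by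
      rw [trace_inf, trace_ι, top_inf_eq]
    have h6 : X.trace (X.ι ⊤ ⊔ p.1.1) = ⊤ :=
      top_le_iff.1 ((htop X).ge.trans (X.trace_mono le_sup_left))
    have h7 := X.modular p.1.1
    have h8 := Y.modular p.1.2
    rw [h5] at h1
    rw [h6] at h2
    rw [htop] at h3
    omega

end ModularExtension

/-! ### Modular diagrams -/

/-- A modular diagram `(E, ι, J)` of `L`: a modular extension `(E, ι)` of `L` and a finite word `J`
(a linearly ordered multiset) in the atoms of `E`. -/
structure ModularDiagram (L : Type u) [Lattice L] [BoundedOrder L] : Type (u + 1) where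
  ext : ModularExtension L
  word : List (Atoms ext.E)

namespace ModularDiagram

variable {L : Type u} [Lattice L] [BoundedOrder L]

/-- The join of the letters of `J`. -/
def join (Γ : ModularDiagram L) : Γ.ext.E := Γ.word.foldr (fun a s => (a : Γ.ext.E) ⊔ s) ⊥

/-- The degree `|J| - 2 (rk (⋁ J) - rk ((⋁ J) ∧ F_ι))`. -/
noncomputable def degree (Γ : ModularDiagram L) : ℤ :=
  (Γ.word.length : ℤ) - 2 * ((rk Γ.join : ℤ) - (rk (Γ.join ⊓ Γ.ext.F) : ℤ))

/-- The `i`-th letter of `J` is a bridge if it is the only one which is not below some flat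
`G ≥ F_ι`. -/
def IsBridge (Γ : ModularDiagram L) (i : Fin Γ.word.length) : Prop :=
  ∃ G : Γ.ext.E, Γ.ext.F ≤ G ∧ ∀ j : Fin Γ.word.length, ¬ (Γ.word.get j : Γ.ext.E) ≤ G ↔ j = i

/-- The `i`-th letter of `J` is contractible if it is neither a bridge nor below `F_ι`. -/
def IsContractible (Γ : ModularDiagram L) (i : Fin Γ.word.length) : Prop :=
  ¬ Γ.IsBridge i ∧ ¬ (Γ.word.get i : Γ.ext.E) ≤ Γ.ext.F

theorem not_le_of_mem_eraseIdx (Γ : ModularDiagram L) (hΓ : Γ.word.Nodup)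
    (i : Fin Γ.word.length) (a : Atoms Γ.ext.E) (ha : a ∈ Γ.word.eraseIdx i) :
    ¬ (a : Γ.ext.E) ≤ Γ.word.get i := by
  intro hle
  have h1 : a = Γ.word.get i := Subtype.ext
    (((Γ.word.get i).2.le_iff.1 hle).resolve_left a.2.1)
  obtain ⟨j, hj, hji, hja⟩ := List.mem_eraseIdx_iff_getElem.1 ha
  rw [h1] at hja
  exact hji ((hΓ.getElem_inj_iff).1 hja)

/-- The contraction `Γ / H = ([H, ⊤], H ∨ ι, H ∨ (J ∖ H))` of a diagram (whose letters are pairwise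
distinct) at its `i`-th letter `H`, when `H` is contractible. -/
def contract (Γ : ModularDiagram L) (hΓ : Γ.word.Nodup) (i : Fin Γ.word.length)
    (hi : Γ.IsContractible i) : ModularDiagram L where
  ext := Γ.ext.contract (Γ.word.get i) hi.2
  word := (Γ.word.eraseIdx i).pmap
    (fun (a : Atoms Γ.ext.E) ha =>
      ⟨⟨(Γ.word.get i : Γ.ext.E) ⊔ a, le_sup_left⟩, isAtom_Ici_sup _ a.2 ha⟩)
    (Γ.not_le_of_mem_eraseIdx hΓ i)

/-- The product of two diagrams: the pushout of the extensions, with concatenated words. -/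
noncomputable def prod [IsGeometricLattice L] (Γ₁ Γ₂ : ModularDiagram L) : ModularDiagram L where
  ext := Γ₁.ext.pushout Γ₂.ext
  word :=
    Γ₁.word.map (fun a => ⟨ModularExtension.Pushout.inl a.1,
      ModularExtension.Pushout.isAtom_inl a.2⟩) ++
    Γ₂.word.map (fun a => ⟨ModularExtension.Pushout.inr a.1,
      ModularExtension.Pushout.isAtom_inr a.2⟩)

/-- The empty diagram `(L, id, ∅)`. -/
def empty (L : Type u) [Lattice L] [BoundedOrder L] [IsGeometricLattice L] : ModularDiagram L where
  ext := ModularExtension.refl L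
  word := []

end ModularDiagram

/-! ### The space of modular diagrams -/

section MD

variable {L : Type u} [Lattice L] [BoundedOrder L]

/-- The relators defining the space of modular diagrams. -/
inductive Relator : (ModularDiagram L →₀ ℚ) → Prop
  /-- Exchanging two letters of the word changes the sign. -/
  | transposition (X : ModularExtension L) (l₁ l₂ l₃ : List (Atoms X.E)) (a b : Atoms X.E) :
      Relator (Finsupp.single ⟨X, l₁ ++ a :: (l₂ ++ b :: l₃)⟩ 1 +
        Finsupp.single ⟨X, l₁ ++ b :: (l₂ ++ a :: l₃)⟩ 1)
  /-- Diagrams related by an embedding between extensions of the same rank are identified. -/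
  | embedding (Γ Γ' : ModularDiagram L) (φ : Γ.ext.E → Γ'.ext.E) (hφ : IsEmbedding φ)
      (hrk : rk (⊤ : Γ.ext.E) = rk (⊤ : Γ'.ext.E)) (hι : ∀ l, Γ'.ext.ι l = φ (Γ.ext.ι l))
      (hword : Γ'.word = Γ.word.map fun a => ⟨φ a, hφ.map_atom a a.2⟩) :
      Relator (Finsupp.single Γ 1 - Finsupp.single Γ' 1)
  /-- A diagram with `F_ι ∨ ⋁ J < ⊤` vanishes. -/
  | not_spanning (Γ : ModularDiagram L) (h : Γ.ext.F ⊔ Γ.join < ⊤) :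
      Relator (Finsupp.single Γ 1)
  /-- A diagram whose lattice is a product `E₁ × E₂` of non-trivial geometric lattices with
  `F_ι ∈ E₁ × {⊥}` vanishes. -/
  | product (Γ : ModularDiagram L) (E₁ E₂ : Type u) [Lattice E₁] [BoundedOrder E₁]
      [IsGeometricLattice E₁] [Nontrivial E₁] [Lattice E₂] [BoundedOrder E₂]
      [IsGeometricLattice E₂] [Nontrivial E₂] (e : Γ.ext.E ≃o E₁ × E₂)
      (h : (e Γ.ext.F).2 = ⊥) : Relator (Finsupp.single Γ 1)
  /-- A diagram vanishes if exactly two letters are not below some modular flat `G ≥ F_ι`. -/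
  | bivalent (Γ : ModularDiagram L) (G : Γ.ext.E) (hG : IsModularFlat G) (hF : Γ.ext.F ≤ G)
      (h : {i : Fin Γ.word.length | ¬ (Γ.word.get i : Γ.ext.E) ≤ G}.ncard = 2) :
      Relator (Finsupp.single Γ 1)

variable (L) in
/-- The `ℚ`-vector space of modular diagrams of `L`. -/
abbrev MD : Type (u + 1) :=
  (ModularDiagram L →₀ ℚ) ⧸ Submodule.span ℚ {x : ModularDiagram L →₀ ℚ | Relator x}

/-- The class of a modular diagram. -/
noncomputable def MD.mk (Γ : ModularDiagram L) : MD L :=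
  Submodule.Quotient.mk (Finsupp.single Γ 1)

end MD

/-! ### Commutative differential graded algebras -/

/-- Graded pieces, unit, product and differential on a `ℚ`-vector space. -/
structure CDGAData (V : Type v) [AddCommGroup V] [Module ℚ V] where
  gr : ℤ → Submodule ℚ V
  one : V
  mul : V →ₗ[ℚ] V →ₗ[ℚ] V
  d : V →ₗ[ℚ] V

namespace CDGAData

variable {V : Type v} [AddCommGroup V] [Module ℚ V] {W : Type w} [AddCommGroup W] [Module ℚ W]

/-- The axioms of a (unital, `ℤ`-graded, cohomological) commutative differential graded algebra. -/
structure IsCDGA (A : CDGAData V) : Prop where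
  isInternal : DirectSum.IsInternal A.gr
  one_mem : A.one ∈ A.gr 0
  mul_mem : ∀ k l : ℤ, ∀ x ∈ A.gr k, ∀ y ∈ A.gr l, A.mul x y ∈ A.gr (k + l)
  one_mul : ∀ x, A.mul A.one x = x
  mul_one : ∀ x, A.mul x A.one = x
  mul_assoc : ∀ x y z, A.mul (A.mul x y) z = A.mul x (A.mul y z)
  mul_comm : ∀ k l : ℤ, ∀ x ∈ A.gr k, ∀ y ∈ A.gr l, A.mul x y = (-1 : ℚ) ^ (k * l) • A.mul y x
  d_mem : ∀ k : ℤ, ∀ x ∈ A.gr k, A.d x ∈ A.gr (k + 1)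
  d_d : ∀ x, A.d (A.d x) = 0
  leibniz : ∀ k : ℤ, ∀ x ∈ A.gr k, ∀ y,
    A.d (A.mul x y) = A.mul (A.d x) y + (-1 : ℚ) ^ k • A.mul x (A.d y)

/-- Cocycles of degree `k`. -/
def cocycles (A : CDGAData V) (k : ℤ) : Submodule ℚ V := A.gr k ⊓ LinearMap.ker A.d

/-- Coboundaries of degree `k`. -/
def coboundaries (A : CDGAData V) (k : ℤ) : Submodule ℚ V := (A.gr (k - 1)).map A.d

/-- The cohomology in degree `k`. -/
abbrev Cohomology (A : CDGAData V) (k : ℤ) : Type v :=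
  A.cocycles k ⧸ (A.coboundaries k).submoduleOf (A.cocycles k)

/-- Morphisms of commutative differential graded algebras. -/
structure IsHom (A : CDGAData V) (B : CDGAData W) (f : V →ₗ[ℚ] W) : Prop where
  map_gr : ∀ k : ℤ, ∀ x ∈ A.gr k, f x ∈ B.gr k
  map_one : f A.one = B.one
  map_mul : ∀ x y, f (A.mul x y) = B.mul (f x) (f y)
  map_d : ∀ x, f (A.d x) = B.d (f x)

variable {A : CDGAData V} {B : CDGAData W} {f : V →ₗ[ℚ] W}

/-- The restriction of a morphism to cocycles. -/
def IsHom.cocyclesMap (hf : IsHom A B f) (k : ℤ) : A.cocycles k →ₗ[ℚ] B.cocycles k :=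
  f.restrict fun x hx => ⟨hf.map_gr k x hx.1, by
    have h : A.d x = 0 := hx.2
    exact LinearMap.mem_ker.2 (by rw [← hf.map_d, h, map_zero])⟩

/-- The map induced by a morphism in cohomology. -/
def IsHom.cohomologyMap (hf : IsHom A B f) (k : ℤ) : A.Cohomology k →ₗ[ℚ] B.Cohomology k :=
  Submodule.mapQ _ _ (hf.cocyclesMap k) (by
    rintro ⟨x, hx⟩ ⟨y, hy, hxy⟩
    exact ⟨f y, hf.map_gr _ y hy, by
      rw [← hf.map_d, hxy]
      rfl⟩)

/-- Quasi-isomorphisms: morphisms inducing isomorphisms in cohomology in all degrees. -/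
def IsHom.IsQuasiIso (hf : IsHom A B f) : Prop :=
  ∀ k : ℤ, Function.Bijective (hf.cohomologyMap k)

end CDGAData

/-! ### Orlik–Solomon algebras -/

section OS

variable {L : Type u} [Lattice L] [BoundedOrder L]

open Classical in
/-- Circuits: sets `C` of atoms with `rk C = #C - 1 = rk (C ∖ c)` for all `c ∈ C`. -/
def IsCircuit (C : Finset (Atoms L)) : Prop :=
  rk (C.sup Subtype.val : L) + 1 = C.card ∧
    ∀ c ∈ C, rk ((C.erase c).sup Subtype.val : L) + 1 = C.card

/-- The generator `e_H` of the exterior algebra on the atoms of `L`. -/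
noncomputable def extGen (H : Atoms L) : ExteriorAlgebra ℚ (Atoms L →₀ ℚ) :=
  ExteriorAlgebra.ι ℚ (Finsupp.single H 1)

/-- The (anti)derivation `δ` of the exterior algebra with `δ e_H = 1` for all atoms `H`:
the contraction by the linear form taking the value `1` on all the `e_H`. -/
noncomputable def extδ :
    ExteriorAlgebra ℚ (Atoms L →₀ ℚ) →ₗ[ℚ] ExteriorAlgebra ℚ (Atoms L →₀ ℚ) :=
  CliffordAlgebra.contractLeft (Finsupp.linearCombination ℚ fun _ : Atoms L => (1 : ℚ))

/-- The relations `δ e_C = 0` for the circuits `C` of `L`, where `e_C` is the product of the `e_H`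
for `H ∈ C`, in any order. -/
inductive OSRel : ExteriorAlgebra ℚ (Atoms L →₀ ℚ) → ExteriorAlgebra ℚ (Atoms L →₀ ℚ) → Prop
  | circuit (C : Finset (Atoms L)) (hC : IsCircuit C) (l : List (Atoms L))
      (hl : (l : Multiset (Atoms L)) = C.val) : OSRel (extδ (l.map extGen).prod) 0

variable (L) in
/-- The Orlik–Solomon algebra of `L`. -/
abbrev OS : Type u := RingQuot (OSRel (L := L))

/-- The generator `e_H` of the Orlik–Solomon algebra. -/
noncomputable def OS.gen (H : Atoms L) : OS L := RingQuot.mkAlgHom ℚ OSRel (extGen H)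

variable (L) in
/-- The Orlik–Solomon algebra, graded by `deg e_H = 1`, with zero differential. -/
noncomputable def OS.cdga : CDGAData (OS L) where
  gr k := Submodule.span ℚ {x | ∃ l : List (Atoms L), (l.length : ℤ) = k ∧ (l.map OS.gen).prod = x}
  one := 1
  mul := LinearMap.mul ℚ (OS L)
  d := 0

theorem ModularExtension.isAtom_trace (X : ModularExtension L) {a : X.E} (ha : IsAtom a)
    (h : a ≤ X.F) : IsAtom (X.trace a) := by
  have h1 : X.ι (X.trace a) = a := by rw [X.ι_trace, inf_eq_left.2 h]
  refine ⟨fun h0 => ha.1 (by rw [← h1, h0, X.ι_bot]), fun b hb => ?_⟩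
  have h2 : X.ι b ≤ a := X.ι_le_iff_le_trace.2 hb.le
  rcases ha.le_iff.1 h2 with h3 | h3
  · exact X.embedding.injective (h3.trans X.ι_bot.symm)
  · rw [← h3, X.trace_ι] at hb
    exact absurd hb (lt_irrefl _)

open Classical in
/-- The value of the morphism `MD(L) → OS(L)` on a diagram `(E, ι, J)`: it is `e_{ι⁻¹(J)}` if
`F_ι = ⊤`, that is, if `ι` is an isomorphism, and `0` otherwise.
If `F_ι = ⊤`, then no letter of `J` is contractible. Conversely, if no letter is contractible then
either `J` has a bridge or all letters are below `F_ι`, and then, unless `F_ι = ⊤`, the diagram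
vanishes in `MD(L)`. So this is `e_{ι⁻¹(J)}` on the nonvanishing diagrams without contractible
letter and `0` on the diagrams with a contractible letter. -/
noncomputable def ModularDiagram.osValue (Γ : ModularDiagram L) : OS L :=
  if h : Γ.ext.F = ⊤ then
    (Γ.word.map fun a : Atoms Γ.ext.E =>
      OS.gen ⟨Γ.ext.trace a, Γ.ext.isAtom_trace a.2 (h ▸ le_top)⟩).prod
  else 0

end OS

/-! ### The cdga of modular diagrams -/

section

variable {L : Type u} [Lattice L] [BoundedOrder L] [IsGeometricLattice L]

open Classical in
/-- The data of the cdga of modular diagrams: the grading by the degree of diagrams, the unit, the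
product and the differential given by their values on diagrams. Since the classes of diagrams span
`MD L`, and since diagrams with a repeated letter vanish in `MD L`, there is at most one such
data. -/
structure IsMDData (A : CDGAData (MD L)) : Prop where
  gr_eq : ∀ k : ℤ, A.gr k = Submodule.span ℚ {x | ∃ Γ, Γ.degree = k ∧ MD.mk Γ = x}
  one_eq : A.one = MD.mk (ModularDiagram.empty L)
  mul_mk : ∀ Γ₁ Γ₂, A.mul (MD.mk Γ₁) (MD.mk Γ₂) = MD.mk (Γ₁.prod Γ₂)
  /-- `d Γ` is the alternating sum of the contractions of `Γ` at its contractible letters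
  (the letters being numbered from `0`). -/
  d_mk : ∀ (Γ : ModularDiagram L) (hΓ : Γ.word.Nodup), A.d (MD.mk Γ) =
    ∑ i : Fin Γ.word.length, if hi : Γ.IsContractible i then
      (-1 : ℚ) ^ (i : ℕ) • MD.mk (Γ.contract hΓ i hi) else 0

end

end ModDiag

open ModDiag

/-!
The algebraic structure comes first. A linear map out of the space of modular diagrams is the same
as a family of vectors indexed by diagrams which satisfies the five relations (`DiagramFun`,
`DiagramFun.lift`). The differential (`dMap`), the product (`mulMap`), the projections onto the
homogeneous parts (`projFun`) and the morphism to the Orlik–Solomon algebra (`osMap`) are families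
of this kind. The product is a special case of gluing a fixed diagram to a variable one along `L`
(`glueMap`), so that its relations are those of gluing. The morphism kills coboundaries
(`osMap_dMap`) because only the diagrams for which `F` is a hyperplane matter: there, the products of
traces of lines through a point outside of `F` can be expanded along the other points outside of `F`
(`traceProd_eq`), and the expansions cancel. It is convenient to work with a variant `D L` of the
space of diagrams which agrees with it when `L` is nontrivial (`dEquiv`) and which is one-dimensional
when `L` is trivial.

Surjectivity in cohomology is immediate, as the products of generators of the Orlik–Solomon algebra
are the images of the diagrams on the trivial extension `(L, id)`, which are cocycles
(`exists_osMap_eq`).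

Injectivity is proved by induction on the rank. A supersolvable lattice has a modular coatom `M` such
that the interval `[⊥, M]` is supersolvable. There are restriction and residue maps from the diagrams
of `L` to those of `[⊥, M]`: the map `epsMap`, and for every atom `a` of `L` not below `M` the map
`resAtMap`, which removes a letter `a` and contracts it. In the other direction, `indMap` glues the
lattice `L` along `[⊥, M]` and adds a word in the atoms of `L`. All these maps commute with the
differentials up to sign, and the first two are compatible with maps between the Orlik–Solomon
algebras (`exists_osProj`, `exists_osRes`).

The heart of the proof is a homotopy. Let `Hat M` be the lattice generated by two copies of `L` glued
along `[⊥, M]` and by one more atom `p`, which is collinear with the two copies of every atom not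
below `M`. Gluing `Hat M` to a diagram of `L` along the first copy, adding the letter `p` and seeing
the result as a diagram of the second copy defines a map `h` (`hatMap`). In the differential of such a
diagram, the contraction of `p` identifies the two copies and returns the original diagram, unless
`p` is a bridge, in which case the original diagram is induced from `[⊥, M]`. The contraction of an
atom `a` of the first copy which is not below `M` gives the diagram induced from the residue at `a`,
with the letter `a` in the place of `p`. The other contractions give `h ∘ d`. Hence
`d h + h d = 1 - ind ∘ ε - ∑_a ind_a ∘ res_a` (`dMap_hatMap`). If `x` is a cocycle with vanishing image
in the Orlik–Solomon algebra, then so are `ε x` and the residues of `x`; they are coboundaries by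
induction, and therefore so is `x` (`exists_dMap_eq_step`). For the trivial lattice, the space of
diagrams is spanned by the unit, which is not killed by the morphism.
-/

namespace ModDiag

/-! ### Alternating functions of words and alternating sums over letters -/

section Words

variable {α β : Type*} {V W : Type*} [AddCommGroup V] [Module ℚ V] [AddCommGroup W] [Module ℚ W]

/-- The alternating sum `∑ (-1)^i f (l_i) (l ∖ l_i)` over the letters of a word `l`. -/
def dsum : List α → (α → List α → V) → V
  | [], _ => 0
  | a :: l, f => f a l - dsum l fun b l' => f b (a :: l')

/-- A function of words is alternating if exchanging two consecutive letters changes its sign. -/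
def IsAlt (g : List α → V) : Prop :=
  ∀ l₁ a b l₂, g (l₁ ++ a :: b :: l₂) = -g (l₁ ++ b :: a :: l₂)

@[simp] theorem dsum_nil (f : α → List α → V) : dsum [] f = 0 := rfl

theorem dsum_cons (a : α) (l : List α) (f : α → List α → V) :
    dsum (a :: l) f = f a l - dsum l fun b l' => f b (a :: l') := rfl

theorem dsum_congr {l : List α} {f f' : α → List α → V}
    (h : ∀ b l', (b :: l').Perm l → f b l' = f' b l') : dsum l f = dsum l f' := by
  induction l generalizing f f' with
  | nil => rfl
  | cons a l ih =>
    rw [dsum_cons, dsum_cons, h a l (List.Perm.refl _)]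
    congr 1
    exact ih fun b l' hb => h b (a :: l') ((List.Perm.swap a b l').trans (hb.cons a))

theorem dsum_add (l : List α) (f f' : α → List α → V) :
    (dsum l fun b l' => f b l' + f' b l') = dsum l f + dsum l f' := by
  induction l generalizing f f' with
  | nil => simp
  | cons a l ih => rw [dsum_cons, dsum_cons, dsum_cons, ih]; abel

theorem dsum_zero (l : List α) : (dsum l fun _ _ => (0 : V)) = 0 := by
  induction l with
  | nil => rfl
  | cons a l ih => rw [dsum_cons, ih, sub_zero]

theorem dsum_eq_zero {l : List α} {f : α → List α → V}
    (h : ∀ b l', (b :: l').Perm l → f b l' = 0) : dsum l f = 0 := by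
  rw [dsum_congr h, dsum_zero]

theorem map_dsum (φ : V →ₗ[ℚ] W) (l : List α) (f : α → List α → V) :
    φ (dsum l f) = dsum l fun b l' => φ (f b l') := by
  induction l generalizing f with
  | nil => simp
  | cons a l ih => rw [dsum_cons, dsum_cons, map_sub, ih]

theorem dsum_smul (r : ℚ) (l : List α) (f : α → List α → V) :
    (dsum l fun b l' => r • f b l') = r • dsum l f :=
  (map_dsum (r • LinearMap.id : V →ₗ[ℚ] V) l f).symm

theorem dsum_neg (l : List α) (f : α → List α → V) :
    (dsum l fun b l' => -f b l') = -dsum l f :=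
  (map_dsum (-LinearMap.id : V →ₗ[ℚ] V) l f).symm

theorem dsum_sub (l : List α) (f f' : α → List α → V) :
    (dsum l fun b l' => f b l' - f' b l') = dsum l f - dsum l f' := by
  simp only [sub_eq_add_neg, dsum_add, dsum_neg]

theorem dsum_sum {ι : Type*} (s : Finset ι) (l : List α) (f : ι → α → List α → V) :
    (dsum l fun b l' => ∑ i ∈ s, f i b l') = ∑ i ∈ s, dsum l (f i) := by
  classical
  induction s using Finset.induction_on with
  | empty => simp [dsum_zero]
  | insert a s ha ih =>
    rw [Finset.sum_insert ha, ← ih, ← dsum_add]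
    exact dsum_congr fun b l' _ => Finset.sum_insert ha

theorem dsum_map (φ : β → α) (l : List β) (f : α → List α → V) :
    dsum (l.map φ) f = dsum l fun b l' => f (φ b) (l'.map φ) := by
  induction l generalizing f with
  | nil => rfl
  | cons a l ih => rw [List.map_cons, dsum_cons, dsum_cons, ih]; rfl

theorem dsum_append (l m : List α) (f : α → List α → V) :
    dsum (l ++ m) f = (dsum l fun b l' => f b (l' ++ m)) +
      (-1 : ℚ) ^ l.length • dsum m fun b m' => f b (l ++ m') := by
  induction l generalizing f with
  | nil => simp
  | cons a l ih =>
    rw [List.cons_append, dsum_cons, dsum_cons, ih, List.length_cons, pow_succ, mul_neg_one,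
      neg_smul]
    simp only [List.cons_append]
    abel

/-- The recursive definition of `dsum` agrees with the sum over the positions of the word. -/
theorem dsum_eq_sum (l : List α) (f : α → List α → V) :
    dsum l f = ∑ i : Fin l.length, (-1 : ℚ) ^ (i : ℕ) • f (l.get i) (l.eraseIdx i) := by
  induction l generalizing f with
  | nil => simp
  | cons a l ih =>
    rw [dsum_cons, ih]
    have := Fin.sum_univ_succ (n := l.length) fun i : Fin (l.length + 1) =>
      (-1 : ℚ) ^ (i : ℕ) • f ((a :: l).get i) ((a :: l).eraseIdx i)
    refine Eq.trans ?_ this.symm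
    simp [pow_succ, sub_eq_add_neg]

/-- Removing two letters in both orders gives opposite signs. -/
theorem dsum_comm (l : List α) (Φ : α → α → List α → V) :
    (dsum l fun b l' => dsum l' (Φ b)) + (dsum l fun b l' => dsum l' fun c l'' => Φ c b l'') = 0 := by
  induction l generalizing Φ with
  | nil => simp
  | cons a l ih =>
    have h := ih fun b c l'' => Φ b c (a :: l'')
    simp only [dsum_cons, dsum_sub]
    rw [← h]
    abel

/-- The mechanism behind `d ∘ d = 0`: a double alternating sum of a function which is symmetric in
the two removed letters vanishes. -/
theorem dsum_dsum_eq_zero_of_symm (l : List α) (Φ : α → α → List α → V)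
    (h : ∀ b c l'', (b :: c :: l'').Perm l → Φ b c l'' = Φ c b l'') :
    (dsum l fun b l' => dsum l' (Φ b)) = 0 := by
  have h1 := dsum_comm l Φ
  have h2 : (dsum l fun b l' => dsum l' fun c l'' => Φ c b l'') =
      dsum l fun b l' => dsum l' (Φ b) := dsum_congr fun b l' hb => dsum_congr fun c l'' hc =>
    (h b c l'' ((hc.cons b).trans hb)).symm
  rw [h2, ← two_smul ℚ] at h1
  exact (smul_eq_zero.1 h1).resolve_left two_ne_zero

/-! #### Alternating functions -/

theorem IsAlt.cons {g : List α → V} (hg : IsAlt g) (c : α) : IsAlt fun l => g (c :: l) :=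
  fun l₁ a b l₂ => hg (c :: l₁) a b l₂

theorem IsAlt.append_left {g : List α → V} (hg : IsAlt g) (m : List α) :
    IsAlt fun l => g (m ++ l) := fun l₁ a b l₂ => by
  simpa [List.append_assoc] using hg (m ++ l₁) a b l₂

theorem IsAlt.append_right {g : List α → V} (hg : IsAlt g) (m : List α) :
    IsAlt fun l => g (l ++ m) := fun l₁ a b l₂ => by
  simpa [List.append_assoc] using hg l₁ a b (l₂ ++ m)

theorem IsAlt.map {g : List α → V} (hg : IsAlt g) (φ : β → α) :
    IsAlt fun l => g (l.map φ) := fun l₁ a b l₂ => by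
  simpa using hg (l₁.map φ) (φ a) (φ b) (l₂.map φ)

theorem IsAlt.ite {g : List α → V} (hg : IsAlt g) (p : List α → Prop) [DecidablePred p]
    (hp : ∀ l l', l.Perm l' → (p l ↔ p l')) : IsAlt fun l => if p l then g l else 0 :=
  fun l₁ a b l₂ => by
    have h := hp (l₁ ++ a :: b :: l₂) (l₁ ++ b :: a :: l₂)
      (List.Perm.append_left _ (List.Perm.swap _ _ _))
    by_cases h1 : p (l₁ ++ b :: a :: l₂)
    · simp only [if_pos h1, if_pos (h.2 h1)]; exact hg _ _ _ _
    · simp only [if_neg h1, if_neg (mt h.1 h1), neg_zero]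

theorem IsAlt.cons_swap {g : List α → V} (hg : IsAlt g) (a b : α) (l : List α) :
    g (a :: b :: l) = -g (b :: a :: l) := hg [] a b l

theorem IsAlt.move {g : List α → V} (hg : IsAlt g) (l₁ : List α) (a : α) (l₂ : List α) :
    g (l₁ ++ a :: l₂) = (-1 : ℚ) ^ l₁.length • g (a :: (l₁ ++ l₂)) := by
  induction l₁ generalizing g with
  | nil => simp
  | cons b l ih =>
    have h1 := ih (hg.cons b)
    have h2 := hg.cons_swap b a (l ++ l₂)
    simp only [List.cons_append, List.length_cons] at h1 ⊢
    rw [h1, h2, pow_succ, mul_neg_one, smul_neg, neg_smul]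

theorem IsAlt.append_comm {g : List α → V} (hg : IsAlt g) (l m : List α) :
    g (l ++ m) = (-1 : ℚ) ^ (l.length * m.length) • g (m ++ l) := by
  induction l generalizing g with
  | nil => simp
  | cons a l ih =>
    have h1 := ih (hg.cons a)
    simp only [List.cons_append, List.length_cons] at h1 ⊢
    rw [h1, hg.move m a l, smul_smul, Nat.succ_mul, pow_add, mul_assoc, ← pow_add, ← two_mul,
      pow_mul (-1 : ℚ) 2]
    simp

theorem IsAlt.transposition {g : List α → V} (hg : IsAlt g) (l₁ l₂ l₃ : List α) (a b : α) :
    g (l₁ ++ a :: (l₂ ++ b :: l₃)) = -g (l₁ ++ b :: (l₂ ++ a :: l₃)) := by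
  have h1 := ((hg.append_left l₁).cons a).move l₂ b l₃
  have h2 := ((hg.append_left l₁).cons b).move l₂ a l₃
  rw [h1, h2, hg l₁ a b, smul_neg]

theorem IsAlt.exists_perm {g : List α → V} (hg : IsAlt g) {l l' : List α} (h : l.Perm l') :
    g l = g l' ∨ g l = -g l' := by
  induction h generalizing g with
  | nil => exact .inl rfl
  | cons a _ ih => exact ih (hg.cons a)
  | swap a b l => exact .inr (hg.cons_swap _ _ _)
  | trans _ _ ih₁ ih₂ =>
    rcases ih₁ hg with h1 | h1 <;> rcases ih₂ hg with h2 | h2 <;> rw [h1, h2] <;> simp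

theorem IsAlt.eq_zero_of_perm {g : List α → V} (hg : IsAlt g) {l l' : List α} (h : l.Perm l')
    (h0 : g l' = 0) : g l = 0 := by
  rcases hg.exists_perm h with h1 | h1 <;> simp [h1, h0]

theorem IsAlt.eq_zero_of_not_nodup {g : List α → V} (hg : IsAlt g) {l : List α}
    (h : ¬ l.Nodup) : g l = 0 := by
  obtain ⟨a, ha⟩ : ∃ a, List.Duplicate a l := by
    by_contra hc
    push Not at hc
    exact h (List.nodup_iff_forall_not_duplicate.2 hc)
  obtain ⟨l', hl'⟩ : ∃ l', l.Perm (a :: a :: l') := by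
    rw [List.duplicate_iff_sublist] at ha
    exact ha.exists_perm_append
  refine hg.eq_zero_of_perm hl' ?_
  have h1 := hg.cons_swap a a l'
  rw [eq_neg_iff_add_eq_zero, ← two_smul ℚ] at h1
  exact (smul_eq_zero.1 h1).resolve_left two_ne_zero

theorem IsAlt.dsum {f : α → List α → V} (hf : ∀ b, IsAlt (f b)) : IsAlt fun l => dsum l f := by
  intro l₁ a b l₂
  induction l₁ generalizing f with
  | nil =>
    simp only [List.nil_append, dsum_cons]
    have : (ModDiag.dsum l₂ fun c l' => f c (a :: b :: l')) =
        -ModDiag.dsum l₂ fun c l' => f c (b :: a :: l') := by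
      rw [← dsum_neg]
      exact dsum_congr fun c l' _ => (hf c).cons_swap _ _ _
    rw [this]
    abel
  | cons c l ih =>
    have h1 := ih fun b => (hf b).cons c
    simp only [List.cons_append, dsum_cons] at h1 ⊢
    rw [h1, hf c l a b l₂]
    abel

end Words

end ModDiag

namespace ModDiag

/-! ### Ranks, intervals and products of geometric lattices -/

section Geometry

variable {L : Type u} [Lattice L] [BoundedOrder L]

/-- The join of the letters of a word. -/
def jn (l : List L) : L := l.foldr (fun a s => a ⊔ s) ⊥

@[simp] theorem jn_nil : jn ([] : List L) = ⊥ := rfl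

@[simp] theorem jn_cons (a : L) (l : List L) : jn (a :: l) = a ⊔ jn l := rfl

theorem jn_le_iff {l : List L} {x : L} : jn l ≤ x ↔ ∀ a ∈ l, a ≤ x := by
  induction l with
  | nil => simp
  | cons a l ih => simp [ih]

theorem le_jn {l : List L} {a : L} (h : a ∈ l) : a ≤ jn l := jn_le_iff.1 le_rfl a h

theorem jn_append (l m : List L) : jn (l ++ m) = jn l ⊔ jn m := by
  induction l with
  | nil => simp
  | cons a l ih => simp [ih, sup_assoc]

theorem jn_perm {l m : List L} (h : l.Perm m) : jn l = jn m :=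
  le_antisymm (jn_le_iff.2 fun _ ha => le_jn (h.mem_iff.1 ha))
    (jn_le_iff.2 fun _ ha => le_jn (h.mem_iff.2 ha))

theorem jn_map {K : Type v} [Lattice K] [BoundedOrder K] (φ : L → K) (h0 : φ ⊥ = ⊥)
    (h : ∀ a b, φ (a ⊔ b) = φ a ⊔ φ b) (l : List L) : jn (l.map φ) = φ (jn l) := by
  induction l with
  | nil => simp [h0]
  | cons a l ih => simp [ih, h]

variable [IsGeometricLattice L]

theorem rk_mono {a b : L} (h : a ≤ b) : rk a ≤ rk b := rk_strictMono.monotone h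

theorem rk_eq_zero {a : L} : rk a = 0 ↔ a = ⊥ := by
  refine ⟨fun h => ?_, fun h => by rw [h, rk_bot]⟩
  exact (eq_of_le_of_rk_le bot_le (by rw [h]; exact Nat.zero_le _)).symm

theorem isAtom_iff_rk {a : L} : IsAtom a ↔ rk a = 1 := by
  constructor
  · intro h
    have := rk_of_covBy h.bot_covBy
    rwa [rk_bot] at this
  · intro h
    refine ⟨fun h0 => by rw [h0, rk_bot] at h; omega, fun b hb => ?_⟩
    have := rk_strictMono hb
    exact rk_eq_zero.1 (by omega)

theorem rk_atom {a : L} (h : IsAtom a) : rk a = 1 := isAtom_iff_rk.1 h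

theorem rk_sup_le (a b : L) : rk (a ⊔ b) ≤ rk a + rk b :=
  (Nat.le_add_left _ _).trans (rk_inf_add_rk_sup_le a b)

theorem rk_sup_atom {a b : L} (hb : IsAtom b) (h : ¬ b ≤ a) : rk (a ⊔ b) = rk a + 1 :=
  rk_of_covBy (covBy_sup_atom hb h)

theorem isAtom_or_bot {a : L} (h : rk a ≤ 1) : IsAtom a ∨ a = ⊥ := by
  rw [isAtom_iff_rk, ← rk_eq_zero]; omega

theorem eq_top_of_rk {a : L} (h : rk (⊤ : L) ≤ rk a) : a = ⊤ := eq_of_le_of_rk_le le_top h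

theorem atom_eq_of_le {a b : L} (ha : IsAtom a) (hb : IsAtom b) (h : a ≤ b) : a = b :=
  (hb.le_iff.1 h).resolve_left ha.1

theorem exists_sup_atom_of_covBy {a b : L} (h : a ⋖ b) : ∃ c, IsAtom c ∧ ¬ c ≤ a ∧ a ⊔ c = b := by
  obtain ⟨c, hc, hcb, hca⟩ := exists_atom_not_le h.lt.not_ge
  refine ⟨c, hc, hca, ?_⟩
  exact (h.eq_or_eq le_sup_left (sup_le h.le hcb)).resolve_left fun h' => hca (sup_eq_left.1 h')

/-- The map `a ↦ b ∨ a` to the upper interval `[b, ⊤]`. -/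
def up (b a : L) : Set.Ici b := ⟨b ⊔ a, le_sup_left⟩

theorem rk_up (b a : L) : rk (up b a) + rk b = rk (b ⊔ a) := rk_Ici (up b a)

theorem rk_up_le (b a : L) : rk (up b a) ≤ rk a := by
  have h1 := rk_up b a
  have h2 := rk_sup_le b a
  omega

theorem up_sup (b x y : L) : up b (x ⊔ y) = up b x ⊔ up b y :=
  Subtype.ext (show b ⊔ (x ⊔ y) = (b ⊔ x) ⊔ (b ⊔ y) by rw [sup_sup_sup_comm, sup_idem])

theorem isAtom_up {b a : L} (ha : IsAtom a) (h : ¬ a ≤ b) : IsAtom (up b a) :=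
  isAtom_Ici_sup b ha h

theorem IsModularFlat.up {G b : L} (hG : IsModularFlat G) (h : b ≤ G) :
    IsModularFlat (⟨G, h⟩ : Set.Ici b) := by
  rintro ⟨x, hx⟩
  have h1 := rk_Ici ((⟨G, h⟩ : Set.Ici b) ⊓ ⟨x, hx⟩)
  have h2 := rk_Ici ((⟨G, h⟩ : Set.Ici b) ⊔ ⟨x, hx⟩)
  have h3 := rk_Ici (⟨G, h⟩ : Set.Ici b)
  have h4 := rk_Ici (⟨x, hx⟩ : Set.Ici b)
  have h5 := hG x
  rw [Set.Ici.coe_inf] at h1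
  rw [Set.Ici.coe_sup] at h2
  simp only at h1 h2 h3 h4
  omega

/-! #### Lower intervals -/

theorem covBy_coe_Iic {M : L} {a b : Set.Iic M} : (a : L) ⋖ (b : L) ↔ a ⋖ b := by
  constructor
  · exact fun h => ⟨h.lt, fun _ hac hcb => h.2 hac hcb⟩
  · exact fun h => ⟨h.lt, fun c hac hcb => h.2 (c := ⟨c, hcb.le.trans b.2⟩) hac hcb⟩

theorem isAtom_coe_Iic {M : L} {a : Set.Iic M} : IsAtom (a : L) ↔ IsAtom a := by
  rw [← bot_covBy_iff, ← bot_covBy_iff, ← covBy_coe_Iic]; rfl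

instance instGeometricIic (M : L) : IsGeometricLattice (Set.Iic M) where
  finite := inferInstance
  isLUB_atoms := by
    rintro ⟨b, hb⟩
    refine ⟨{x | IsAtom x ∧ x ≤ ⟨b, hb⟩}, ⟨fun x hx => hx.2, ?_⟩, fun x hx => hx.1⟩
    rintro ⟨c, hc⟩ hub
    by_contra hbc
    obtain ⟨a, ha, hab, hac⟩ := exists_atom_not_le (a := c) (b := b) hbc
    exact hac (hub (a := ⟨a, hab.trans hb⟩) ⟨isAtom_coe_Iic.1 ha, hab⟩)
  covBy_sup_of_inf_covBy := by
    intro a b hab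
    exact covBy_coe_Iic.1 (IsUpperModularLattice.covBy_sup_of_inf_covBy (covBy_coe_Iic.2 hab))

theorem rk_Iic {M : L} (x : Set.Iic M) : rk x = rk (x : L) :=
  rk_eq_of_covBy (L := Set.Iic M) (fun x => rk (x : L)) rk_bot
    (fun _ _ hab => rk_of_covBy (covBy_coe_Iic.2 hab)) x

/-! #### Products -/

variable {K : Type v} [Lattice K] [BoundedOrder K] [IsGeometricLattice K]

theorem isAtom_mk_bot {a : L} (ha : IsAtom a) : IsAtom ((a, ⊥) : L × K) := by
  rw [← bot_covBy_iff] at ha ⊢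
  exact Prod.mk_covBy_mk_iff.2 (.inl ⟨ha, rfl⟩)

theorem isAtom_bot_mk {a : K} (ha : IsAtom a) : IsAtom ((⊥, a) : L × K) := by
  rw [← bot_covBy_iff] at ha ⊢
  exact Prod.mk_covBy_mk_iff.2 (.inr ⟨ha, rfl⟩)

instance instGeometricProd : IsGeometricLattice (L × K) where
  finite := inferInstance
  isLUB_atoms := by
    rintro ⟨b, c⟩
    refine ⟨{x | IsAtom x ∧ x ≤ (b, c)}, ⟨fun x hx => hx.2, ?_⟩, fun x hx => hx.1⟩
    rintro ⟨b', c'⟩ hub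
    constructor
    · by_contra hbc
      obtain ⟨a, ha, hab, hac⟩ := exists_atom_not_le (a := b') (b := b) hbc
      exact hac (hub (a := (a, ⊥)) ⟨isAtom_mk_bot ha, ⟨hab, bot_le⟩⟩).1
    · by_contra hbc
      obtain ⟨a, ha, hab, hac⟩ := exists_atom_not_le (a := c') (b := c) hbc
      exact hac (hub (a := (⊥, a)) ⟨isAtom_bot_mk ha, ⟨bot_le, hab⟩⟩).2
  covBy_sup_of_inf_covBy := by
    rintro ⟨a, b⟩ ⟨a', b'⟩ h
    rcases Prod.mk_covBy_mk_iff.1 h with ⟨h1, h2⟩ | ⟨h1, h2⟩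
    · exact Prod.mk_covBy_mk_iff.2 (.inl ⟨IsUpperModularLattice.covBy_sup_of_inf_covBy h1,
        (sup_eq_right.2 (inf_eq_left.1 h2)).symm⟩)
    · exact Prod.mk_covBy_mk_iff.2 (.inr ⟨IsUpperModularLattice.covBy_sup_of_inf_covBy h1,
        (sup_eq_right.2 (inf_eq_left.1 h2)).symm⟩)

theorem rk_prod (x : L × K) : rk x = rk x.1 + rk x.2 :=
  rk_eq_of_covBy (L := L × K) (fun x => rk x.1 + rk x.2)
    (by change rk (⊥ : L) + rk (⊥ : K) = 0; rw [rk_bot, rk_bot])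
    (by
      rintro ⟨a, b⟩ ⟨a', b'⟩ h
      rcases Prod.mk_covBy_mk_iff.1 h with ⟨h1, rfl⟩ | ⟨h1, rfl⟩
      · have := rk_of_covBy h1; simp only; omega
      · have := rk_of_covBy h1; simp only; omega) x

/-! #### Embeddings -/

theorem IsEmbedding.le_iff {φ : L → K} (hφ : IsEmbedding φ) {a b : L} : φ a ≤ φ b ↔ a ≤ b := by
  rw [← sup_eq_right, ← hφ.map_sup, hφ.injective.eq_iff, sup_eq_right]

theorem IsEmbedding.rk {φ : L → K} (hφ : IsEmbedding φ) (h0 : φ ⊥ = ⊥) (a : L) :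
    rk (φ a) = rk a := by
  refine (rk_eq_of_covBy (fun x => ModDiag.rk (φ x)) (by simp only [h0, rk_bot]) ?_ a).symm
  intro a b h
  obtain ⟨c, hc, hca, rfl⟩ := exists_sup_atom_of_covBy h
  simp only [hφ.map_sup]
  exact rk_sup_atom (hφ.map_atom c hc) (mt hφ.le_iff.1 hca)

theorem IsEmbedding.of_orderIso (e : L ≃o K) : IsEmbedding e :=
  ⟨e.injective, e.map_sup, fun _ h => (e.isAtom_iff _).2 h⟩

theorem rk_orderIso (e : L ≃o K) (a : L) : rk (e a) = rk a :=
  (IsEmbedding.of_orderIso e).rk e.map_bot a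

end Geometry

/-! ### Modular embeddings and extensions -/

/-- A map `β : L → K` is a modular embedding if `(K, β)` is a modular extension of `L`. -/
structure IsModularEmbedding {L K : Type u} [Lattice L] [BoundedOrder L] [Lattice K]
    [BoundedOrder K] (β : L → K) : Prop where
  embedding : IsEmbedding β
  range_eq : Set.range β = Set.Iic (β ⊤)
  modular : IsModularFlat (β ⊤)

namespace ModularExtension

open Pushout

variable {L K : Type u} [Lattice L] [BoundedOrder L] [IsGeometricLattice L]
  [Lattice K] [BoundedOrder K] [IsGeometricLattice K]

theorem isModularEmbedding (X : ModularExtension L) : IsModularEmbedding X.ι :=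
  ⟨X.embedding, X.range_eq, X.modular⟩

theorem modular_F (X : ModularExtension L) : IsModularFlat X.F := X.modular

/-- The extension given by a modular embedding. -/
@[reducible] def of {β : L → K} (hβ : IsModularEmbedding β) : ModularExtension L where
  E := K
  ι := β
  embedding := hβ.embedding
  range_eq := hβ.range_eq
  modular := hβ.modular

theorem rk_ι_eq (X : ModularExtension L) (a : L) : rk (X.ι a) = rk a := rk_ι X a

theorem rk_F (X : ModularExtension L) : rk X.F = rk (⊤ : L) := rk_ι X ⊤

theorem ι_le_ι (X : ModularExtension L) {a b : L} (h : a ≤ b) : X.ι a ≤ X.ι b := X.ι_le_iff.2 h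

/-- A modular flat of `L` is modular in every modular extension of `L`. -/
theorem modular_ι (X : ModularExtension L) {m : L} (hm : IsModularFlat m) :
    IsModularFlat (X.ι m) := by
  intro G
  have h1 := hm (X.trace G)
  have h2 := X.modular (G ⊔ X.ι m)
  have h3 := X.modular G
  have e1 : X.ι m ⊓ G = X.ι (m ⊓ X.trace G) := by rw [inf_comm, ← X.ι_inf, inf_comm]
  have e2 : X.ι ⊤ ⊓ (G ⊔ X.ι m) = X.ι (m ⊔ X.trace G) := by
    rw [sup_comm m, ← X.trace_sup_ι, X.ι_trace, inf_comm]; rfl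
  have e3 : X.ι ⊤ ⊔ (G ⊔ X.ι m) = X.ι ⊤ ⊔ G := by
    rw [← sup_assoc, sup_eq_left]
    exact (X.ι_le_F m).trans le_sup_left
  have e4 : X.ι ⊤ ⊓ G = X.ι (X.trace G) := by rw [X.ι_trace, inf_comm]; rfl
  rw [e2, e3, X.rk_ι_eq] at h2
  rw [e4, X.rk_ι_eq] at h3
  rw [e1, sup_comm (X.ι m), X.rk_ι_eq, X.rk_ι_eq]
  rw [X.rk_ι_eq] at h2 h3
  omega

/-- The restriction of a modular extension of `K` along a modular embedding `L → K`. -/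
@[reducible] def comp (X : ModularExtension K) {β : L → K} (hβ : IsModularEmbedding β) :
    ModularExtension L where
  E := X.E
  ι a := X.ι (β a)
  embedding := by
    refine ⟨X.embedding.injective.comp hβ.embedding.injective, fun a b => ?_,
      fun a ha => X.embedding.map_atom _ (hβ.embedding.map_atom a ha)⟩
    rw [hβ.embedding.map_sup, X.embedding.map_sup]
  range_eq := by
    ext x
    constructor
    · rintro ⟨a, rfl⟩
      exact X.ι_le_ι ((ModularExtension.of hβ).ι_le_F a)
    · intro hx
      have hx' : x ≤ X.ι (β ⊤) := hx
      obtain ⟨k, hk⟩ := X.exists_trace x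
      rw [inf_eq_left.2 (hx'.trans (X.ι_le_F _))] at hk
      rw [← hk, X.ι_le_iff] at hx'
      have : k ∈ Set.range β := by rw [hβ.range_eq]; exact hx'
      obtain ⟨a, ha⟩ := this
      exact ⟨a, by simp only [ha, hk]⟩
  modular := X.modular_ι hβ.modular

theorem _root_.ModDiag.isModularEmbedding_coe {M : L} (hM : IsModularFlat M) :
    IsModularEmbedding (Subtype.val : Set.Iic M → L) where
  embedding := ⟨Subtype.val_injective, fun _ _ => rfl, fun _ h => isAtom_coe_Iic.2 h⟩
  range_eq := by ext x; simp
  modular := hM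

theorem _root_.ModDiag.isModularEmbedding_id : IsModularEmbedding (id : L → L) :=
  (ModularExtension.refl L).isModularEmbedding

theorem ι_eq_bot (X : ModularExtension L) {a : L} : X.ι a = ⊥ ↔ a = ⊥ := by
  rw [← X.ι_bot, X.embedding.injective.eq_iff]

theorem isAtom_ι (X : ModularExtension L) {a : L} : IsAtom (X.ι a) ↔ IsAtom a := by
  rw [isAtom_iff_rk, isAtom_iff_rk, X.rk_ι_eq]

theorem ι_trace_of_le (X : ModularExtension L) {x : X.E} (h : x ≤ X.F) : X.ι (X.trace x) = x := by
  rw [X.ι_trace, inf_eq_left.2 h]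

theorem trace_eq_iff (X : ModularExtension L) {x : X.E} {a : L} :
    X.trace x = a ↔ x ⊓ X.F = X.ι a := by
  rw [← X.ι_trace, X.embedding.injective.eq_iff]

/-- The rank formula for the modular flat `F`, in terms of traces. -/
theorem rk_trace (X : ModularExtension L) (x : X.E) :
    rk (X.trace x) + rk (X.F ⊔ x) = rk (⊤ : L) + rk x := by
  have := X.modular_F x
  rw [← X.rk_F, ← this, ← X.rk_ι_eq, X.ι_trace, inf_comm]

/-- Morphisms of modular extensions of `L` of the same rank. -/
structure IsMap (X Y : ModularExtension L) (φ : X.E → Y.E) : Prop where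
  embedding : IsEmbedding φ
  rk_top : rk (⊤ : X.E) = rk (⊤ : Y.E)
  map_ι : ∀ l, Y.ι l = φ (X.ι l)

namespace IsMap

variable {X Y : ModularExtension L} {φ : X.E → Y.E} (h : IsMap X Y φ)
include h

theorem map_bot : φ ⊥ = ⊥ := by rw [← X.ι_bot, ← h.map_ι, Y.ι_bot]

theorem map_F : φ X.F = Y.F := (h.map_ι ⊤).symm

theorem rk (x : X.E) : rk (φ x) = rk x := h.embedding.rk h.map_bot x

theorem map_top : φ ⊤ = ⊤ := eq_top_of_rk (by rw [h.rk, h.rk_top])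

theorem map_sup (x y : X.E) : φ (x ⊔ y) = φ x ⊔ φ y := h.embedding.map_sup x y

theorem le_iff {x y : X.E} : φ x ≤ φ y ↔ x ≤ y := h.embedding.le_iff

theorem trace (x : X.E) : Y.trace (φ x) = X.trace x := by
  symm
  refine eq_of_le_of_rk_le (Y.ι_le_iff_le_trace.1 ?_) ?_
  · rw [h.map_ι, h.le_iff]
    exact X.ι_le_iff_le_trace.2 le_rfl
  · have h1 := X.rk_trace x
    have h2 := Y.rk_trace (φ x)
    rw [← h.map_F, ← h.map_sup, h.rk, h.rk] at h2
    omega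

theorem jn (l : List X.E) : jn (l.map φ) = φ (jn l) := jn_map φ h.map_bot h.map_sup l

theorem eq_top {x : X.E} : φ x = ⊤ ↔ x = ⊤ := by
  rw [← h.map_top, h.embedding.injective.eq_iff]

end IsMap

theorem IsMap.of_orderIso {X Y : ModularExtension L} (e : X.E ≃o Y.E)
    (he : ∀ l, Y.ι l = e (X.ι l)) : IsMap X Y e :=
  ⟨IsEmbedding.of_orderIso e, by rw [← e.map_top, rk_orderIso], he⟩

end ModularExtension

end ModDiag

namespace ModDiag

/-! ### Families of vectors indexed by diagrams -/

section DiagramSpace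

variable (L : Type u) [Lattice L] [BoundedOrder L]

/-- The relators of the space of modular diagrams, together with all the diagrams with a nontrivial
lattice when `L` is trivial. The additional relators do not exist when `L` is nontrivial; they make
the space of diagrams of the trivial lattice one-dimensional, so that it can serve as the start of
an induction on the rank. -/
def DRelator (x : ModularDiagram L →₀ ℚ) : Prop :=
  Relator x ∨ ∃ Γ : ModularDiagram L, Subsingleton L ∧ Nontrivial Γ.ext.E ∧ x = Finsupp.single Γ 1

/-- The space of modular diagrams of `L`, with the convention that the diagrams `(E, ι, J)` with
`E` nontrivial vanish if `L` is trivial. -/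
abbrev D : Type (u + 1) :=
  (ModularDiagram L →₀ ℚ) ⧸ Submodule.span ℚ {x : ModularDiagram L →₀ ℚ | DRelator L x}

variable {L}

open Classical in
/-- The class of the diagram `(E, ι, l)`, where `l` is a word in arbitrary elements of `E`; it is
defined to be zero if some letter is not an atom. -/
noncomputable def cls (X : ModularExtension L) (l : List X.E) : D L :=
  if h : ∀ a ∈ l, IsAtom a then
    Submodule.Quotient.mk (Finsupp.single ⟨X, l.pmap Subtype.mk h⟩ 1)
  else 0

variable (L) in
/-- A family of vectors indexed by extensions `(E, ι)` of `L` and words in the elements of `E`,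
subject to the relations of modular diagrams. The fields `split` and `biv` are reformulations of the
relations on products and on bivalent flats which do not mention any auxiliary lattice and in which
the word starts with the two distinguished letters. -/
structure DiagramFun (V : Type v) [AddCommGroup V] [Module ℚ V] where
  toFun : (X : ModularExtension L) → List X.E → V
  alt : ∀ X, IsAlt (toFun X)
  bot : ∀ X l, ⊥ ∈ l → toFun X l = 0
  emb : ∀ (X Y : ModularExtension L) (φ : X.E → Y.E), X.IsMap Y φ → ∀ l : List X.E,
    (∀ a ∈ l, IsAtom a) → toFun Y (l.map φ) = toFun X l
  span : ∀ (X : ModularExtension L) (l : List X.E), (∀ a ∈ l, IsAtom a) →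
    X.F ⊔ jn l ≠ ⊤ → toFun X l = 0
  split : ∀ (X : ModularExtension L) (l : List X.E) (w z : X.E), (∀ a ∈ l, IsAtom a) →
    X.F ≤ w → w ⊔ z = ⊤ → rk w + rk z = rk (⊤ : X.E) → z ≠ ⊥ → (∀ a ∈ l, a ≤ w ∨ a ≤ z) →
    toFun X l = 0
  biv : ∀ (X : ModularExtension L) (G e f : X.E) (l : List X.E), IsModularFlat G → X.F ≤ G →
    IsAtom e → IsAtom f → (∀ a ∈ l, IsAtom a) → ¬ e ≤ G → ¬ f ≤ G → (∀ a ∈ l, a ≤ G) →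
    toFun X (e :: f :: l) = 0

theorem cls_of_atoms {X : ModularExtension L} {l : List X.E} (h : ∀ a ∈ l, IsAtom a) :
    cls X l = Submodule.Quotient.mk (Finsupp.single ⟨X, l.pmap Subtype.mk h⟩ 1) := dif_pos h

theorem cls_map_val (X : ModularExtension L) (w : List (Atoms X.E)) :
    cls X (w.map Subtype.val) = Submodule.Quotient.mk (Finsupp.single ⟨X, w⟩ 1) := by
  rw [cls_of_atoms (by simp only [List.mem_map]; rintro a ⟨b, _, rfl⟩; exact b.2)]
  congr
  induction w with
  | nil => rfl
  | cons a w ih => exact congrArg (List.cons a) ih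

theorem cls_of_not_atom {X : ModularExtension L} {l : List X.E} {a : X.E} (ha : a ∈ l)
    (h : ¬ IsAtom a) : cls X l = 0 := dif_neg fun h' => h (h' a ha)

theorem cls_bot {X : ModularExtension L} {l : List X.E} (h : ⊥ ∈ l) : cls X l = 0 :=
  cls_of_not_atom h fun h' => h'.1 rfl

/-- A word with a letter which is not an atom contributes zero, so the sign rule for atoms extends
to all words. -/
theorem cls_alt (X : ModularExtension L) : IsAlt (cls X) := by
  intro l₁ a b l₂
  have hp : (l₁ ++ a :: b :: l₂).Perm (l₁ ++ b :: a :: l₂) :=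
    List.Perm.append_left _ (List.Perm.swap _ _ _)
  by_cases h : ∀ x ∈ l₁ ++ a :: b :: l₂, IsAtom x
  · have h1 : ∀ x ∈ l₁, IsAtom x := fun x hx => h x (by simp [hx])
    have h2 : ∀ x ∈ l₂, IsAtom x := fun x hx => h x (by simp [hx])
    have ha : IsAtom a := h a (by simp)
    have hb : IsAtom b := h b (by simp)
    lift l₁ to List (Atoms X.E) using h1
    lift l₂ to List (Atoms X.E) using h2
    lift a to Atoms X.E using ha
    lift b to Atoms X.E using hb
    have e1 := cls_map_val X (l₁ ++ a :: b :: l₂)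
    have e2 := cls_map_val X (l₁ ++ b :: a :: l₂)
    simp only [List.map_append, List.map_cons] at e1 e2
    rw [e1, e2, eq_neg_iff_add_eq_zero, ← Submodule.Quotient.mk_add,
      Submodule.Quotient.mk_eq_zero]
    exact Submodule.subset_span (.inl (Relator.transposition X l₁ [] l₂ a b))
  · push Not at h
    obtain ⟨x, hx, hx'⟩ := h
    rw [cls_of_not_atom hx hx', cls_of_not_atom (hp.mem_iff.1 hx) hx', neg_zero]

/-- The vector space of diagrams is spanned by the classes of diagrams. -/
theorem D.induction {p : D L → Prop} (x : D L) (hz : p 0) (ha : ∀ x y, p x → p y → p (x + y))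
    (hs : ∀ (r : ℚ) x, p x → p (r • x))
    (hc : ∀ (X : ModularExtension L) (l : List X.E), (∀ a ∈ l, IsAtom a) → p (cls X l)) : p x := by
  obtain ⟨y, rfl⟩ := Submodule.Quotient.mk_surjective _ x
  induction y using Finsupp.induction_linear with
  | zero => exact hz
  | add f g hf hg => rw [Submodule.Quotient.mk_add]; exact ha _ _ hf hg
  | single Γ r =>
    have : Finsupp.single Γ r = r • Finsupp.single Γ (1 : ℚ) := by simp
    rw [this, Submodule.Quotient.mk_smul]
    refine hs _ _ ?_
    obtain ⟨X, w⟩ := Γ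
    rw [← cls_map_val]
    exact hc X _ (by simp only [List.mem_map]; rintro a ⟨b, _, rfl⟩; exact b.2)

theorem D.hom_ext {V : Type v} [AddCommGroup V] [Module ℚ V] {f g : D L →ₗ[ℚ] V}
    (h : ∀ (X : ModularExtension L) (l : List X.E), (∀ a ∈ l, IsAtom a) →
      f (cls X l) = g (cls X l)) : f = g := by
  refine LinearMap.ext fun x => ?_
  refine D.induction (p := fun x => f x = g x) x (by simp) (fun x y hx hy => by simp [hx, hy])
    (fun r x hx => by simp [hx]) h

end DiagramSpace

section Relations

variable {L : Type u} [Lattice L] [BoundedOrder L] [IsGeometricLattice L]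

open ModularExtension

/-- Diagrams are invariant under embeddings of extensions of the same rank. -/
theorem cls_emb {X Y : ModularExtension L} {φ : X.E → Y.E} (h : X.IsMap Y φ) {l : List X.E}
    (hl : ∀ a ∈ l, IsAtom a) : cls Y (l.map φ) = cls X l := by
  lift l to List (Atoms X.E) using hl
  have e := cls_map_val Y (l.map fun a : Atoms X.E => ⟨φ a, h.embedding.map_atom a a.2⟩)
  rw [List.map_map] at e
  rw [cls_map_val, List.map_map]
  refine e.trans ?_
  symm
  rw [← sub_eq_zero, ← Submodule.Quotient.mk_sub, Submodule.Quotient.mk_eq_zero]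
  exact Submodule.subset_span (.inl (Relator.embedding ⟨X, l⟩ ⟨Y, _⟩ φ h.embedding h.rk_top
    h.map_ι rfl))

theorem join_eq_jn (Γ : ModularDiagram L) : Γ.join = jn (Γ.word.map Subtype.val) := by
  have : ∀ (E : Type u) (p : E → Prop) (w : List {a : E // p a}),
      (do let a ← w; pure (a : E)) = w.map Subtype.val := fun E p w => by
    induction w with
    | nil => rfl
    | cons a w ih => exact congrArg (List.cons (a : E)) ih
  rw [ModularDiagram.join, this]
  rfl

/-- Diagrams vanish unless `F` and the word span. -/
theorem cls_span {X : ModularExtension L} {l : List X.E} (hl : ∀ a ∈ l, IsAtom a)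
    (h : X.F ⊔ jn l ≠ ⊤) : cls X l = 0 := by
  lift l to List (Atoms X.E) using hl
  rw [cls_map_val, Submodule.Quotient.mk_eq_zero]
  refine Submodule.subset_span (.inl (Relator.not_spanning ⟨X, l⟩ (lt_top_iff_ne_top.2 ?_)))
  rwa [join_eq_jn]

theorem exists_map_eq {α β : Type*} {f : α → β} {l : List β} (h : ∀ b ∈ l, ∃ a, f a = b) :
    ∃ l' : List α, l'.map f = l := by
  induction l with
  | nil => exact ⟨[], rfl⟩
  | cons b l ih =>
    obtain ⟨a, ha⟩ := h b (by simp)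
    obtain ⟨l', hl'⟩ := ih fun b hb => h b (by simp [hb])
    exact ⟨a :: l', by simp [ha, hl']⟩

theorem rk_sup_of_split {E : Type u} [Lattice E] [BoundedOrder E] [IsGeometricLattice E]
    {w z x y : E} (h : w ⊔ z = ⊤) (hr : rk w + rk z = rk (⊤ : E)) (hx : x ≤ w) (hy : y ≤ z) :
    rk (x ⊔ y) = rk x + rk y := by
  have h1 := rk_inf_add_rk_sup_le (w ⊔ y) z
  have h2 : rk y ≤ rk ((w ⊔ y) ⊓ z) := rk_mono (le_inf le_sup_right hy)
  have h3 : (w ⊔ y) ⊔ z = ⊤ := top_le_iff.1 (h.ge.trans (sup_le_sup_right le_sup_left _))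
  have h4 := rk_inf_add_rk_sup_le w (x ⊔ y)
  have h5 : rk x ≤ rk (w ⊓ (x ⊔ y)) := rk_mono (le_inf hx le_sup_left)
  have h6 : w ⊔ (x ⊔ y) = w ⊔ y := by rw [← sup_assoc, sup_eq_left.2 hx]
  have h7 := rk_sup_le x y
  rw [h3] at h1
  rw [h6] at h4
  omega

/-- If the flats `w` and `z` are complementary of complementary ranks, then the sublattice generated
by the atoms below `w` or `z` is a product. -/
theorem isEmbedding_sup {E : Type u} [Lattice E] [BoundedOrder E] [IsGeometricLattice E]
    {w z : E} (h : w ⊔ z = ⊤) (hr : rk w + rk z = rk (⊤ : E)) :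
    IsEmbedding fun p : Set.Iic w × Set.Iic z => (p.1 : E) ⊔ p.2 := by
  have key : ∀ p : Set.Iic w × Set.Iic z, rk ((p.1 : E) ⊔ p.2) = rk (p.1 : E) + rk (p.2 : E) :=
    fun p => rk_sup_of_split h hr p.1.2 p.2.2
  have hsup : ∀ p q : Set.Iic w × Set.Iic z,
      ((p ⊔ q).1 : E) ⊔ (p ⊔ q).2 = ((p.1 : E) ⊔ p.2) ⊔ ((q.1 : E) ⊔ q.2) := fun p q => by
    rw [sup_sup_sup_comm]; rfl
  have hle : ∀ p q : Set.Iic w × Set.Iic z, (p.1 : E) ⊔ p.2 = (q.1 : E) ⊔ q.2 → q ≤ p := fun p q hpq => by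
    have h1 := key p
    have h2 := key (p ⊔ q)
    rw [hsup, ← hpq, sup_idem, h1] at h2
    have h3 : (p.1 : E) ≤ ((p ⊔ q).1 : E) := le_sup_left (a := p.1) (b := q.1)
    have h4 : (p.2 : E) ≤ ((p ⊔ q).2 : E) := le_sup_left (a := p.2) (b := q.2)
    have h5 := rk_mono h3
    have h6 := rk_mono h4
    have e1 := eq_of_le_of_rk_le h3 (by omega)
    have e2 := eq_of_le_of_rk_le h4 (by omega)
    refine ⟨?_, ?_⟩
    · exact sup_eq_left.1 (Subtype.ext e1.symm : p.1 ⊔ q.1 = p.1)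
    · exact sup_eq_left.1 (Subtype.ext e2.symm : p.2 ⊔ q.2 = p.2)
  refine ⟨fun p q hpq => le_antisymm (hle q p hpq.symm) (hle p q hpq), hsup, fun p hp => ?_⟩
  rw [isAtom_iff_rk] at hp ⊢
  rw [key, ← rk_Iic, ← rk_Iic, ← rk_prod, hp]

/-- The vanishing of product diagrams, without a product: it suffices that `F` is below `w`, that
`w` and `z` are complementary of complementary ranks and that each letter is below `w` or `z`. -/
theorem cls_split {X : ModularExtension L} {l : List X.E} {w z : X.E} (hl : ∀ a ∈ l, IsAtom a)
    (hF : X.F ≤ w) (h : w ⊔ z = ⊤) (hr : rk w + rk z = rk (⊤ : X.E)) (hz : z ≠ ⊥)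
    (hlw : ∀ a ∈ l, a ≤ w ∨ a ≤ z) : cls X l = 0 := by
  rcases subsingleton_or_nontrivial L with hL | hL
  · lift l to List (Atoms X.E) using hl
    rw [cls_map_val, Submodule.Quotient.mk_eq_zero]
    exact Submodule.subset_span (.inr ⟨⟨X, l⟩, hL, ⟨z, ⊥, hz⟩, rfl⟩)
  have hemb := isEmbedding_sup h hr
  have hι : ∀ a, X.ι a ≤ w := fun a => (X.ι_le_F a).trans hF
  -- The product `[⊥, w] × [⊥, z]` embeds into `X` and has the same rank, so that the diagram comes
  -- from a product diagram.
  let Y : ModularExtension L :=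
    { E := Set.Iic w × Set.Iic z
      ι := fun a => (⟨X.ι a, hι a⟩, ⊥)
      embedding := by
        refine ⟨fun a b hab => ?_, fun a b => ?_, fun a ha => ?_⟩
        · have := congrArg (fun p : Set.Iic w × Set.Iic z => (p.1 : X.E)) hab
          exact X.embedding.injective this
        · refine Prod.ext (Subtype.ext (X.embedding.map_sup a b)) ?_
          simp
        · exact isAtom_mk_bot (isAtom_coe_Iic.1 (X.embedding.map_atom a ha))
      range_eq := by
        ext ⟨x, y⟩
        constructor
        · rintro ⟨a, ha⟩
          rw [← ha]
          exact ⟨X.ι_le_F a, le_rfl⟩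
        · rintro ⟨h1, h2⟩
          refine ⟨X.trace x, Prod.ext (Subtype.ext (X.ι_trace_of_le h1)) (le_bot_iff.1 h2).symm⟩
      modular := by
        rintro ⟨x, y⟩
        have h1 := X.modular_F x
        have e1 : (((⟨X.ι ⊤, hι ⊤⟩, ⊥) : Set.Iic w × Set.Iic z) ⊓ (x, y)) =
          (⟨X.F ⊓ x, inf_le_right.trans x.2⟩, ⊥) := Prod.ext rfl (bot_inf_eq _)
        have e2 : (((⟨X.ι ⊤, hι ⊤⟩, ⊥) : Set.Iic w × Set.Iic z) ⊔ (x, y)) =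
          (⟨X.F ⊔ x, sup_le (hι ⊤) x.2⟩, y) := Prod.ext rfl (bot_sup_eq _)
        rw [e1, e2, rk_prod, rk_prod, rk_prod, rk_prod]
        simp only [rk_Iic, rk_bot] at h1 ⊢
        change _ = rk X.F + _ + _
        omega }
  let φ : Y.E → X.E := fun p => (p.1 : X.E) ⊔ p.2
  have hφ : Y.IsMap X φ := by
    refine ⟨hemb, ?_, fun a => ?_⟩
    · refine Eq.trans (rk_prod (⊤ : Set.Iic w × Set.Iic z)) ?_
      rw [rk_Iic, rk_Iic]
      exact hr
    · exact (sup_bot_eq _).symm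
  obtain ⟨l', rfl⟩ : ∃ l' : List Y.E, l'.map φ = l := by
    refine exists_map_eq fun a ha => ?_
    rcases hlw a ha with h | h
    · exact ⟨(⟨a, h⟩, ⊥), sup_bot_eq _⟩
    · exact ⟨(⊥, ⟨a, h⟩), bot_sup_eq _⟩
  have hl' : ∀ a ∈ l', IsAtom a := fun a ha => by
    rw [isAtom_iff_rk, ← hφ.rk, ← isAtom_iff_rk]
    exact hl _ (List.mem_map_of_mem ha)
  rw [cls_emb hφ hl']
  lift l' to List (Atoms Y.E) using hl'
  rw [cls_map_val, Submodule.Quotient.mk_eq_zero]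
  have : Nontrivial (Set.Iic w) := ⟨⟨X.ι ⊤, hι ⊤⟩, ⟨X.ι ⊥, hι ⊥⟩, fun h' =>
    top_ne_bot (X.embedding.injective (congrArg Subtype.val h'))⟩
  have : Nontrivial (Set.Iic z) := ⟨⊤, ⊥, fun h' => hz (congrArg Subtype.val h')⟩
  exact Submodule.subset_span (.inl (Relator.product ⟨Y, l'⟩ (Set.Iic w) (Set.Iic z)
    (OrderIso.refl _) rfl))

theorem ncard_get_eq_countP {α : Type*} (p : α → Prop) [DecidablePred p] (w : List α) :
    {i : Fin w.length | p (w.get i)}.ncard = w.countP (fun a => decide (p a)) := by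
  have h1 : {i : Fin w.length | p (w.get i)} =
      ((List.finRange w.length).filter fun i => decide (p (w.get i))).toFinset := by
    ext i; simp
  rw [h1, Set.ncard_coe_finset, List.toFinset_card_of_nodup ((List.nodup_finRange _).filter _),
    ← List.countP_eq_length_filter]
  conv_rhs => rw [← List.map_get_finRange w]
  rw [List.countP_map]
  rfl

/-- The vanishing of diagrams for which exactly two letters are not below a modular flat. -/
theorem cls_biv {X : ModularExtension L} {G e f : X.E} {l : List X.E} (hG : IsModularFlat G)
    (hF : X.F ≤ G) (he : IsAtom e) (hf : IsAtom f) (hl : ∀ a ∈ l, IsAtom a) (heG : ¬ e ≤ G)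
    (hfG : ¬ f ≤ G) (hlG : ∀ a ∈ l, a ≤ G) : cls X (e :: f :: l) = 0 := by
  classical
  lift l to List (Atoms X.E) using hl
  lift e to Atoms X.E using he
  lift f to Atoms X.E using hf
  have e1 := cls_map_val X (e :: f :: l)
  simp only [List.map_cons] at e1
  rw [e1, Submodule.Quotient.mk_eq_zero]
  refine Submodule.subset_span (.inl (Relator.bivalent ⟨X, e :: f :: l⟩ G hG hF ?_))
  refine (ncard_get_eq_countP (fun a : Atoms X.E => ¬ (a : X.E) ≤ G) _).trans ?_
  rw [List.countP_cons_of_pos (by simpa using heG), List.countP_cons_of_pos (by simpa using hfG),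
    List.countP_eq_zero.2]
  intro a ha
  simpa using hlG a (List.mem_map_of_mem ha)

/-- The universal family. -/
noncomputable def clsFun (L : Type u) [Lattice L] [BoundedOrder L] [IsGeometricLattice L] :
    DiagramFun L (D L) where
  toFun := cls
  alt := cls_alt
  bot _ _ := cls_bot
  emb _ _ _ h _ hl := cls_emb h hl
  span _ _ hl h := cls_span hl h
  split _ _ _ _ hl := cls_split hl
  biv _ _ _ _ _ h := cls_biv h

namespace DiagramFun

variable {V : Type v} [AddCommGroup V] [Module ℚ V] (f : DiagramFun L V)

/-- Words in elements of rank at most one are stable under contractions: a letter parallel to the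
contracted atom becomes `⊥`. The relations of a family are therefore extended to such words, on which
the family vanishes as soon as `⊥` occurs. -/
theorem atoms_or_bot {E : Type u} [Lattice E] [BoundedOrder E] [IsGeometricLattice E] {l : List E}
    (hl : ∀ a ∈ l, rk a ≤ 1) : (∀ a ∈ l, IsAtom a) ∨ ⊥ ∈ l := by
  by_cases h : ⊥ ∈ l
  · exact .inr h
  · refine .inl fun a ha => (isAtom_or_bot (hl a ha)).resolve_right ?_
    rintro rfl
    exact h ha

theorem emb' {X Y : ModularExtension L} {φ : X.E → Y.E} (h : X.IsMap Y φ) {l : List X.E}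
    (hl : ∀ a ∈ l, rk a ≤ 1) : f.toFun Y (l.map φ) = f.toFun X l := by
  rcases atoms_or_bot hl with h1 | h1
  · exact f.emb X Y φ h l h1
  · rw [f.bot X l h1, f.bot]
    exact List.mem_map.2 ⟨⊥, h1, h.map_bot⟩

theorem span' {X : ModularExtension L} {l : List X.E} (hl : ∀ a ∈ l, rk a ≤ 1)
    (h : X.F ⊔ jn l ≠ ⊤) : f.toFun X l = 0 := by
  rcases atoms_or_bot hl with h1 | h1
  · exact f.span X l h1 h
  · exact f.bot X l h1

theorem split' {X : ModularExtension L} {l : List X.E} {w z : X.E} (hl : ∀ a ∈ l, rk a ≤ 1)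
    (hF : X.F ≤ w) (h : w ⊔ z = ⊤) (hr : rk w + rk z = rk (⊤ : X.E)) (hz : z ≠ ⊥)
    (hlw : ∀ a ∈ l, a ≤ w ∨ a ≤ z) : f.toFun X l = 0 := by
  rcases atoms_or_bot hl with h1 | h1
  · exact f.split X l w z h1 hF h hr hz hlw
  · exact f.bot X l h1

theorem biv' {X : ModularExtension L} {G e g : X.E} {l : List X.E} (hG : IsModularFlat G)
    (hF : X.F ≤ G) (hl : ∀ a ∈ e :: g :: l, rk a ≤ 1) (heG : ¬ e ≤ G)
    (hgG : ¬ g ≤ G) (hlG : ∀ a ∈ l, a ≤ G) : f.toFun X (e :: g :: l) = 0 := by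
  rcases atoms_or_bot hl with h1 | h1
  · exact f.biv X G e g l hG hF (h1 e (by simp)) (h1 g (by simp)) (fun a ha => h1 a (by simp [ha]))
      heG hgG hlG
  · exact f.bot X _ h1

theorem iso {X Y : ModularExtension L} (e : X.E ≃o Y.E) (he : ∀ l, Y.ι l = e (X.ι l))
    {l : List X.E} (hl : ∀ a ∈ l, rk a ≤ 1) {m : List Y.E} (hm : m = l.map e) :
    f.toFun X l = f.toFun Y m := by
  rw [hm]; exact (f.emb' (IsMap.of_orderIso e he) hl).symm

theorem jn_Fjoin_ne {X : ModularExtension L} {w : List (Atoms X.E)}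
    (h : X.F ⊔ (⟨X, w⟩ : ModularDiagram L).join < ⊤) :
    X.F ⊔ jn (w.map Subtype.val) ≠ ⊤ := by
  rw [join_eq_jn] at h
  exact h.ne

theorem map_relator {x : ModularDiagram L →₀ ℚ} (hx : DRelator L x) :
    Finsupp.linearCombination ℚ (fun Γ : ModularDiagram L => f.toFun Γ.ext (Γ.word.map Subtype.val))
      x = 0 := by
  classical
  have hat : ∀ (E : Type u) [Lattice E] [BoundedOrder E] (w : List (Atoms E)),
      ∀ a ∈ w.map Subtype.val, IsAtom a := by
    intro E _ _ w a ha
    obtain ⟨b, _, rfl⟩ := List.mem_map.1 ha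
    exact b.2
  rcases hx with hx | ⟨Γ, hL, hE, rfl⟩
  · cases hx with
    | transposition X l₁ l₂ l₃ a b =>
      have := (f.alt X).transposition (l₁.map Subtype.val) (l₂.map Subtype.val)
        (l₃.map Subtype.val) a b
      simp only [map_add, Finsupp.linearCombination_single, one_smul, List.map_append,
        List.map_cons]
      rw [this, neg_add_cancel]
    | embedding Γ Γ' φ hφ hrk hι hword =>
      have := f.emb Γ.ext Γ'.ext φ ⟨hφ, hrk, hι⟩ (Γ.word.map Subtype.val) (hat _ _)
      rw [List.map_map] at this
      simp only [map_sub, Finsupp.linearCombination_single, one_smul, hword, List.map_map]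
      rw [sub_eq_zero, ← this]
      rfl
    | not_spanning Γ h =>
      simp only [Finsupp.linearCombination_single, one_smul]
      exact f.span _ _ (hat _ _) (jn_Fjoin_ne h)
    -- An isomorphism with a product gives the complementary flats `(⊤, ⊥)` and `(⊥, ⊤)`, and each
    -- atom of a product is below one of them.
    | product Γ E₁ E₂ e h =>
      simp only [Finsupp.linearCombination_single, one_smul]
      refine f.split _ _ (e.symm (⊤, ⊥)) (e.symm (⊥, ⊤)) (hat _ _) ?_ ?_ ?_ ?_ ?_
      · rw [e.le_symm_apply]
        exact ⟨le_top, h.le⟩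
      · rw [← e.symm.map_sup, ← e.symm.map_top]
        congr 1
        exact Prod.ext (sup_bot_eq _) (bot_sup_eq _)
      · rw [rk_orderIso, rk_orderIso, ← e.symm.map_top, rk_orderIso, rk_prod, rk_prod, rk_prod]
        simp [rk_bot]
      · intro h'
        rw [← e.symm.map_bot, e.symm.injective.eq_iff] at h'
        exact top_ne_bot (congrArg Prod.snd h')
      · intro a ha
        have h1 : IsAtom (e a) := (e.isAtom_iff a).2 (hat _ _ a ha)
        rw [e.le_symm_apply, e.le_symm_apply]
        rcases h1.le_iff.1 (show ((e a).1, ⊥) ≤ e a from ⟨le_rfl, bot_le⟩) with h2 | h2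
        · exact .inr ⟨(congrArg Prod.fst h2).le, le_top⟩
        · exact .inl ⟨le_top, (congrArg Prod.snd h2).ge⟩
    | bivalent Γ G hG hF h =>
      simp only [Finsupp.linearCombination_single, one_smul]
      rw [ncard_get_eq_countP (fun a : Atoms Γ.ext.E => ¬ (a : Γ.ext.E) ≤ G),
        List.countP_eq_length_filter] at h
      have hp := List.filter_append_perm (fun a : Atoms Γ.ext.E => decide ¬ (a : Γ.ext.E) ≤ G)
        Γ.word
      obtain ⟨e, g, heg⟩ := List.length_eq_two.1 h
      have he : e ∈ Γ.word.filter fun a : Atoms Γ.ext.E => decide ¬ (a : Γ.ext.E) ≤ G := by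
        rw [heg]; simp
      have hg : g ∈ Γ.word.filter fun a : Atoms Γ.ext.E => decide ¬ (a : Γ.ext.E) ≤ G := by
        rw [heg]; simp
      refine (f.alt _).eq_zero_of_perm (hp.symm.map Subtype.val) ?_
      rw [heg]
      refine f.biv _ G e g _ hG hF e.2 g.2 (hat _ _) (by simpa using (List.mem_filter.1 he).2)
        (by simpa using (List.mem_filter.1 hg).2) ?_
      intro a ha
      obtain ⟨b, hb, rfl⟩ := List.mem_map.1 ha
      simpa using (List.mem_filter.1 hb).2
  -- The additional relators, for trivial `L`, are splittings with `w = F = ⊥` and `z = ⊤`.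
  · simp only [Finsupp.linearCombination_single, one_smul]
    have hF : Γ.ext.F = ⊥ := by
      rw [← Γ.ext.ι_bot, ModularExtension.F, Subsingleton.elim (⊤ : L) ⊥]
    refine f.split _ _ ⊥ ⊤ (hat _ _) hF.le (by simp) (by simp [rk_bot]) top_ne_bot ?_
    exact fun a _ => .inr le_top

/-- The linear map defined by a family which respects the relations. -/
noncomputable def lift : D L →ₗ[ℚ] V :=
  Submodule.liftQ _ (Finsupp.linearCombination ℚ
    fun Γ : ModularDiagram L => f.toFun Γ.ext (Γ.word.map Subtype.val))
    (Submodule.span_le.2 fun _ hx => f.map_relator hx)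

theorem lift_cls {X : ModularExtension L} {l : List X.E} (hl : ∀ a ∈ l, rk a ≤ 1) :
    f.lift (cls X l) = f.toFun X l := by
  rcases atoms_or_bot hl with h1 | h1
  · lift l to List (Atoms X.E) using h1
    rw [cls_map_val, lift, Submodule.liftQ_apply]
    simp
  · rw [cls_bot h1, map_zero, f.bot X l h1]

end DiagramFun

end Relations

end ModDiag

namespace ModDiag

/-! ### Contractions and the differential -/

section Contraction

variable {L : Type u} [Lattice L] [BoundedOrder L] [IsGeometricLattice L]

open ModularExtension

/-- The exchange property of geometric lattices. -/
theorem exchange {x e f : L} (he : IsAtom e) (h : e ≤ x ⊔ f) (hx : ¬ e ≤ x) (hf : rk f ≤ 1) :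
    f ≤ x ⊔ e := by
  have h1 := rk_sup_atom he hx
  have h2 : rk (x ⊔ f) ≤ rk x + rk f := rk_sup_le x f
  rw [eq_of_le_of_rk_le (sup_le le_sup_left h : x ⊔ e ≤ x ⊔ f) (by omega)]
  exact le_sup_right

namespace ModularExtension

/-- The map `a ↦ b ∨ a` to the contraction at the atom `b`. -/
def cup (X : ModularExtension L) (b : Atoms X.E) (h : ¬ (b : X.E) ≤ X.F) (a : X.E) :
    (X.contract b h).E := up (b : X.E) a

section

variable {X Y : ModularExtension L} {b : Atoms X.E} {h : ¬ (b : X.E) ≤ X.F}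

theorem cup_le_cup {a c : X.E} : X.cup b h a ≤ X.cup b h c ↔ a ≤ (b : X.E) ⊔ c :=
  ⟨fun h' => le_sup_right.trans h', fun h' => sup_le le_sup_left h'⟩

theorem exists_cup (y : (X.contract b h).E) : ∃ x, (b : X.E) ≤ x ∧ X.cup b h x = y := by
  obtain ⟨x, hx⟩ := y
  exact ⟨x, hx, Subtype.ext (sup_eq_right.2 hx)⟩

theorem cup_inj {a c : X.E} : X.cup b h a = X.cup b h c ↔ (b : X.E) ⊔ a = (b : X.E) ⊔ c :=
  Subtype.ext_iff

theorem cup_sup (a c : X.E) : X.cup b h (a ⊔ c) = X.cup b h a ⊔ X.cup b h c := up_sup _ a c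

theorem cup_eq_bot {a : X.E} : X.cup b h a = ⊥ ↔ a ≤ b :=
  Subtype.ext_iff.trans sup_eq_left

theorem cup_eq_top {a : X.E} : X.cup b h a = ⊤ ↔ (b : X.E) ⊔ a = ⊤ := Subtype.ext_iff

theorem contract_ι (a : L) : (X.contract b h).ι a = X.cup b h (X.ι a) := rfl

theorem contract_F : (X.contract b h).F = X.cup b h X.F := rfl

theorem jn_map_cup (l : List X.E) : jn (l.map (X.cup b h)) = X.cup b h (jn l) :=
  jn_map _ (cup_eq_bot.2 bot_le) cup_sup l

theorem rk_cup (a : X.E) : rk (X.cup b h a) + 1 = rk ((b : X.E) ⊔ a) := by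
  rw [← rk_atom b.2]; exact rk_up (b : X.E) a

theorem rk_cup_le (a : X.E) : rk (X.cup b h a) ≤ rk a := rk_up_le _ a

theorem rk_contract_top : rk (⊤ : (X.contract b h).E) + 1 = rk (⊤ : X.E) := by
  rw [← cup_eq_top.2 (sup_top_eq (b : X.E)), rk_cup, sup_top_eq]

theorem modular_cup {G : X.E} (hG : IsModularFlat G) (hb : (b : X.E) ≤ G) :
    IsModularFlat (X.cup b h G) := by
  have := hG.up hb
  have e : X.cup b h G = (⟨G, hb⟩ : Set.Ici (b : X.E)) := Subtype.ext (sup_eq_right.2 hb)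
  rw [e]
  exact this

theorem isAtom_cup {a : X.E} (ha : IsAtom a) : IsAtom (X.cup b h a) ↔ a ≠ b := by
  constructor
  · rintro h1 rfl
    exact h1.1 (cup_eq_bot.2 le_rfl)
  · intro h1
    exact isAtom_up ha fun h2 => h1 (atom_eq_of_le ha b.2 h2)

theorem rk_le_one_map_cup {l : List X.E} (hl : ∀ a ∈ l, rk a ≤ 1) :
    ∀ a ∈ l.map (X.cup b h), rk a ≤ 1 := by
  intro a ha
  obtain ⟨c, hc, rfl⟩ := List.mem_map.1 ha
  exact (rk_cup_le c).trans (hl c hc)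

/-- An isomorphism from a contraction, given by maps defined on the whole lattice. -/
def contractIso (b : Atoms X.E) (h : ¬ (b : X.E) ≤ X.F) {K : Type u} [Lattice K]
    (f : X.E → K) (g : K → X.E) (hf : Monotone f) (hg : Monotone g)
    (hgb : ∀ y, (b : X.E) ≤ g y) (hfg : ∀ y, f (g y) = y)
    (hgf : ∀ x, (b : X.E) ≤ x → g (f x) = x) : (X.contract b h).E ≃o K where
  toFun x := f x.1
  invFun y := ⟨g y, hgb y⟩
  left_inv x := Subtype.ext (hgf x.1 x.2)
  right_inv y := hfg y
  map_rel_iff' := by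
    intro x y
    refine ⟨fun h => ?_, fun h => hf h⟩
    have := hg h
    change g (f x.1) ≤ g (f y.1) at this
    rw [hgf _ x.2, hgf _ y.2] at this
    exact this

theorem contractIso_cup {K : Type u} [Lattice K]
    {f : X.E → K} {g : K → X.E} {hf : Monotone f} {hg : Monotone g}
    {hgb : ∀ y, (b : X.E) ≤ g y} {hfg : ∀ y, f (g y) = y}
    {hgf : ∀ x, (b : X.E) ≤ x → g (f x) = x} (a : X.E) :
    contractIso b h f g hf hg hgb hfg hgf (X.cup b h a) = f (b ⊔ a) := rfl

/-- A map of extensions induces a map between the contractions at an atom and at its image. -/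
theorem IsMap.exists_contract {φ : X.E → Y.E} (hφ : X.IsMap Y φ) (b : Atoms X.E)
    (h : ¬ (b : X.E) ≤ X.F) (c : Atoms Y.E) (h' : ¬ (c : Y.E) ≤ Y.F) (hc : (c : Y.E) = φ b) :
    ∃ ψ : (X.contract b h).E → (Y.contract c h').E, IsMap _ _ ψ ∧
      ∀ a, ψ (X.cup b h a) = Y.cup c h' (φ a) := by
  obtain ⟨ψ, hψ⟩ : ∃ ψ : (X.contract b h).E → (Y.contract c h').E,
      ∀ a, ψ (X.cup b h a) = Y.cup c h' (φ a) := by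
    refine ⟨fun x => Y.cup c h' (φ x.1), fun a => ?_⟩
    rw [cup_inj]
    change (c : Y.E) ⊔ φ ((b : X.E) ⊔ a) = (c : Y.E) ⊔ φ a
    rw [hφ.map_sup, hc, ← sup_assoc, sup_idem]
  refine ⟨ψ, ?_, hψ⟩
  have hrk : ∀ x, ModDiag.rk (ψ x) = ModDiag.rk x := fun x => by
    obtain ⟨a, -, rfl⟩ := exists_cup x
    have h1 := rk_cup (h := h) a
    have h2 := rk_cup (h := h') (φ a)
    rw [hc, ← hφ.map_sup, hφ.rk] at h2
    rw [hψ]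
    omega
  refine ⟨⟨fun x y hxy => ?_, fun x y => ?_, fun x hx => ?_⟩, ?_, fun a => ?_⟩
  · obtain ⟨x, -, rfl⟩ := exists_cup x
    obtain ⟨y, -, rfl⟩ := exists_cup y
    rw [hψ, hψ, cup_inj, hc, ← hφ.map_sup, ← hφ.map_sup, hφ.embedding.injective.eq_iff] at hxy
    exact cup_inj.2 hxy
  · obtain ⟨x, -, rfl⟩ := exists_cup x
    obtain ⟨y, -, rfl⟩ := exists_cup y
    rw [← cup_sup, hψ, hψ, hψ, hφ.map_sup, cup_sup]
  · rwa [isAtom_iff_rk, hrk, ← isAtom_iff_rk]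
  · have h1 := rk_contract_top (h := h)
    have h2 := rk_contract_top (h := h')
    have h3 := hφ.rk_top
    omega
  · rw [contract_ι, contract_ι, hψ, hφ.map_ι]

end

end ModularExtension

open Classical in
/-- The class of the contraction of `(E, ι)` at the element `b`, with the letters of `l` replaced by
their joins with `b`; zero if `b` is not an atom or if `b ≤ F_ι`. -/
noncomputable def ctr (X : ModularExtension L) (b : X.E) (l : List X.E) : D L :=
  if h : IsAtom b ∧ ¬ b ≤ X.F then cls (X.contract ⟨b, h.1⟩ h.2) (l.map (X.cup ⟨b, h.1⟩ h.2)) else 0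

variable {X Y : ModularExtension L}

theorem ctr_of {b : X.E} (hb : IsAtom b) (h : ¬ b ≤ X.F) (l : List X.E) :
    ctr X b l = cls (X.contract ⟨b, hb⟩ h) (l.map (X.cup ⟨b, hb⟩ h)) := dif_pos ⟨hb, h⟩

theorem ctr_of_not {b : X.E} (h : ¬ (IsAtom b ∧ ¬ b ≤ X.F)) (l : List X.E) :
    ctr X b l = 0 := dif_neg h

theorem ctr_of_le {b : X.E} (h : b ≤ X.F) (l : List X.E) : ctr X b l = 0 :=
  ctr_of_not (fun h' => h'.2 h) l

theorem ctr_alt (X : ModularExtension L) (b : X.E) : IsAlt (ctr X b) := by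
  by_cases h : IsAtom b ∧ ¬ b ≤ X.F
  · rw [funext fun l => ctr_of h.1 h.2 l]
    exact (cls_alt _).map _
  · intro l₁ a c l₂
    rw [ctr_of_not h, ctr_of_not h, neg_zero]

/-- A letter parallel to the contracted one becomes `⊥`, so that the contraction vanishes. -/
theorem ctr_of_mem_le {b a : X.E} {l : List X.E} (ha : a ∈ l) (hab : a ≤ b) : ctr X b l = 0 := by
  by_cases h : IsAtom b ∧ ¬ b ≤ X.F
  · rw [ctr_of h.1 h.2]
    exact cls_bot (List.mem_map.2 ⟨a, ha, cup_eq_bot.2 hab⟩)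
  · exact ctr_of_not h l

theorem ctr_emb {φ : X.E → Y.E} (h : X.IsMap Y φ) {b : X.E} {l : List X.E}
    (hl : ∀ a ∈ l, rk a ≤ 1) : ctr Y (φ b) (l.map φ) = ctr X b l := by
  have hiff : IsAtom (φ b) ∧ ¬ φ b ≤ Y.F ↔ IsAtom b ∧ ¬ b ≤ X.F := by
    rw [isAtom_iff_rk, isAtom_iff_rk, h.rk, ← h.map_F, h.le_iff]
  by_cases hb : IsAtom b ∧ ¬ b ≤ X.F
  · rw [ctr_of hb.1 hb.2, ctr_of (hiff.2 hb).1 (hiff.2 hb).2]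
    obtain ⟨ψ, hψ, hψ'⟩ := h.exists_contract ⟨b, hb.1⟩ hb.2 ⟨φ b, (hiff.2 hb).1⟩ (hiff.2 hb).2 rfl
    have := (clsFun L).emb' hψ (rk_le_one_map_cup hl)
    rw [List.map_map] at this ⊢
    have e : List.map (ψ ∘ X.cup ⟨b, hb.1⟩ hb.2) l =
        List.map (Y.cup ⟨φ b, (hiff.2 hb).1⟩ (hiff.2 hb).2 ∘ φ) l :=
      List.map_congr_left fun a _ => hψ' a
    rw [e] at this
    exact this
  · rw [ctr_of_not hb, ctr_of_not (mt hiff.1 hb)]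

theorem ctr_span {b : X.E} {l : List X.E} (hl : ∀ a ∈ l, rk a ≤ 1)
    (h : X.F ⊔ (b ⊔ jn l) ≠ ⊤) : ctr X b l = 0 := by
  by_cases hb : IsAtom b ∧ ¬ b ≤ X.F
  · rw [ctr_of hb.1 hb.2]
    refine (clsFun L).span' (rk_le_one_map_cup hl) fun h' => h ?_
    rw [jn_map_cup, contract_F, ← cup_sup, cup_eq_top] at h'
    rw [← h', sup_left_comm]
  · exact ctr_of_not hb l

/-- Contracting an atom below the first factor of a splitting. -/
theorem ctr_split_left {b w z : X.E} {l : List X.E} (hl : ∀ a ∈ l, rk a ≤ 1)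
    (hF : X.F ≤ w) (h : w ⊔ z = ⊤) (hr : rk w + rk z = rk (⊤ : X.E)) (hz : z ≠ ⊥)
    (hlw : ∀ a ∈ l, a ≤ w ∨ a ≤ z) (hbw : b ≤ w) : ctr X b l = 0 := by
  by_cases hb : IsAtom b ∧ ¬ b ≤ X.F
  · rw [ctr_of hb.1 hb.2]
    have h2 := rk_sup_of_split h hr hbw (le_refl z)
    rw [rk_atom hb.1] at h2
    refine (clsFun L).split' (w := X.cup ⟨b, hb.1⟩ hb.2 w) (z := X.cup ⟨b, hb.1⟩ hb.2 z)
      (rk_le_one_map_cup hl) ?_ ?_ ?_ ?_ ?_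
    · exact cup_le_cup.2 (hF.trans le_sup_right)
    · rw [← cup_sup, cup_eq_top, h, sup_top_eq]
    · have h3 := rk_cup (b := ⟨b, hb.1⟩) (h := hb.2) w
      have h4 := rk_cup (b := ⟨b, hb.1⟩) (h := hb.2) z
      have h5 := rk_contract_top (b := ⟨b, hb.1⟩) (h := hb.2)
      simp only at h3 h4
      rw [sup_eq_right.2 hbw] at h3
      omega
    · intro h'
      have h6 := cup_eq_bot.1 h'
      simp only at h6
      rw [sup_eq_left.2 h6, rk_atom hb.1] at h2
      exact hz (rk_eq_zero.1 (by omega))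
    · intro a ha
      obtain ⟨c, hc, rfl⟩ := List.mem_map.1 ha
      rcases hlw c hc with h3 | h3
      · exact .inl (cup_le_cup.2 (h3.trans le_sup_right))
      · exact .inr (cup_le_cup.2 (h3.trans le_sup_right))
  · exact ctr_of_not hb l

/-- Contracting an atom strictly below the second factor of a splitting. -/
theorem ctr_split_right {b w z : X.E} {l : List X.E} (hl : ∀ a ∈ l, rk a ≤ 1)
    (hF : X.F ≤ w) (h : w ⊔ z = ⊤) (hr : rk w + rk z = rk (⊤ : X.E))
    (hlw : ∀ a ∈ l, a ≤ w ∨ a ≤ z) (hbz : b ≤ z) (hne : b ≠ z) : ctr X b l = 0 := by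
  by_cases hb : IsAtom b ∧ ¬ b ≤ X.F
  · rw [ctr_of hb.1 hb.2]
    have h2 := rk_sup_of_split h hr (le_refl w) hbz
    rw [rk_atom hb.1] at h2
    refine (clsFun L).split' (w := X.cup ⟨b, hb.1⟩ hb.2 w) (z := X.cup ⟨b, hb.1⟩ hb.2 z)
      (rk_le_one_map_cup hl) ?_ ?_ ?_ ?_ ?_
    · exact cup_le_cup.2 (hF.trans le_sup_right)
    · rw [← cup_sup, cup_eq_top, h, sup_top_eq]
    · have h3 := rk_cup (b := ⟨b, hb.1⟩) (h := hb.2) w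
      have h4 := rk_cup (b := ⟨b, hb.1⟩) (h := hb.2) z
      have h5 := rk_contract_top (b := ⟨b, hb.1⟩) (h := hb.2)
      simp only at h3 h4
      rw [sup_eq_right.2 hbz] at h4
      rw [sup_comm] at h3
      omega
    · intro h'
      exact hne (le_antisymm hbz (cup_eq_bot.1 h'))
    · intro a ha
      obtain ⟨c, hc, rfl⟩ := List.mem_map.1 ha
      rcases hlw c hc with h3 | h3
      · exact .inl (cup_le_cup.2 (h3.trans le_sup_right))
      · exact .inr (cup_le_cup.2 (h3.trans le_sup_right))
  · exact ctr_of_not hb l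

/-- Contracting an atom below the modular flat `G` preserves the two letters not below `G`. -/
theorem ctr_biv {b G e f : X.E} {l : List X.E} (hl : ∀ a ∈ e :: f :: l, rk a ≤ 1)
    (hG : IsModularFlat G) (hF : X.F ≤ G) (hbG : b ≤ G) (he : ¬ e ≤ G) (hf : ¬ f ≤ G)
    (hlG : ∀ a ∈ l, a ≤ G) : ctr X b (e :: f :: l) = 0 := by
  by_cases hb : IsAtom b ∧ ¬ b ≤ X.F
  · rw [ctr_of hb.1 hb.2]
    have key : ∀ a, X.cup ⟨b, hb.1⟩ hb.2 a ≤ X.cup ⟨b, hb.1⟩ hb.2 G ↔ a ≤ G := fun a => by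
      rw [cup_le_cup, sup_eq_right.2 hbG]
    refine (clsFun L).biv' (l := l.map (X.cup ⟨b, hb.1⟩ hb.2)) (modular_cup hG hbG)
      ((key _).2 hF) (rk_le_one_map_cup hl) (mt (key e).1 he) (mt (key f).1 hf) ?_
    intro a ha
    obtain ⟨c, hc, rfl⟩ := List.mem_map.1 ha
    exact (key c).2 (hlG c hc)
  · exact ctr_of_not hb _

/-- If `G` is a modular hyperplane not containing the atom `e`, then `[e, ⊤]` is isomorphic to
`[⊥, G]`. -/
def hyperplaneIso {G e : L} (hG : IsModularFlat G) (he : IsAtom e) (heG : ¬ e ≤ G)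
    (h : e ⊔ G = ⊤) : Set.Iic G ≃o Set.Ici e where
  toFun y := up e y
  invFun x := ⟨x ⊓ G, inf_le_right⟩
  left_inv y := by
    refine Subtype.ext ?_
    change (e ⊔ y) ⊓ G = y
    have h1 := hG.inf_sup (a := y) e y.2
    have h2 : G ⊓ e = ⊥ := (he.le_iff.1 inf_le_right).resolve_right fun h' => heG (inf_eq_right.1 h')
    rw [inf_comm, sup_comm, h1, h2, sup_bot_eq]
  right_inv x := by
    refine Subtype.ext ?_
    change e ⊔ (x ⊓ G) = x
    rw [← hG.inf_sup' x.2, h, inf_top_eq]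
  map_rel_iff' := by
    intro x y
    refine ⟨fun hxy => ?_, fun hxy => sup_le_sup_left (show (x : L) ≤ y from hxy) e⟩
    have h2 : G ⊓ e = ⊥ := (he.le_iff.1 inf_le_right).resolve_right fun h' => heG (inf_eq_right.1 h')
    have h3 : ∀ y : Set.Iic G, G ⊓ (e ⊔ y) = y := fun y => by
      rw [sup_comm, hG.inf_sup e y.2, h2, sup_bot_eq]
    have h4 : G ⊓ (e ⊔ x) ≤ G ⊓ (e ⊔ y) := inf_le_inf_left _ hxy
    rwa [h3, h3] at h4

/-- The contractions of the two letters which are not below a modular hyperplane agree. -/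
theorem ctr_hyperplane {G e f : X.E} {l : List X.E} (hl : ∀ a ∈ e :: f :: l, rk a ≤ 1)
    (hG : IsModularFlat G) (hF : X.F ≤ G) (he : IsAtom e) (hf : IsAtom f) (heG : ¬ e ≤ G)
    (hfG : ¬ f ≤ G) (hlG : ∀ a ∈ l, a ≤ G) (hGe : e ⊔ G = ⊤) (hGf : f ⊔ G = ⊤) :
    ctr X e (f :: l) = ctr X f (e :: l) := by
  have heF : ¬ e ≤ X.F := fun h => heG (h.trans hF)
  have hfF : ¬ f ≤ X.F := fun h => hfG (h.trans hF)
  rw [ctr_of he heF, ctr_of hf hfF]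
  let φ : (X.contract ⟨e, he⟩ heF).E ≃o (X.contract ⟨f, hf⟩ hfF).E :=
    (hyperplaneIso hG he heG hGe).symm.trans (hyperplaneIso hG hf hfG hGf)
  have hφ : ∀ a, a ≤ G → φ (X.cup ⟨e, he⟩ heF a) = X.cup ⟨f, hf⟩ hfF a := fun a ha => by
    have : X.cup ⟨e, he⟩ heF a = hyperplaneIso hG he heG hGe ⟨a, ha⟩ := rfl
    rw [this]
    change hyperplaneIso hG hf hfG hGf ((hyperplaneIso hG he heG hGe).symm _) = _
    rw [OrderIso.symm_apply_apply]
    rfl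
  have hφ' : φ (X.cup ⟨e, he⟩ heF f) = X.cup ⟨f, hf⟩ hfF e := Subtype.ext (by
    change f ⊔ ((e ⊔ f) ⊓ G) = f ⊔ e
    rw [← hG.inf_sup' le_sup_right, hGf, inf_top_eq, sup_comm])
  refine (clsFun L).iso φ (fun a => (hφ (X.ι a) ((X.ι_le_F a).trans hF)).symm)
    (rk_le_one_map_cup fun a ha => hl a (by simp at ha ⊢; tauto)) ?_
  rw [List.map_map, List.map_cons, List.map_cons]
  refine congrArg₂ List.cons hφ'.symm ?_
  exact List.map_congr_left fun a ha => (hφ a (hlG a ha)).symm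

theorem not_le_sup_F_symm {b c : X.E} (hb : IsAtom b) (hbF : ¬ b ≤ X.F) (hc : IsAtom c)
    (h : ¬ c ≤ b ⊔ X.F) : ¬ b ≤ c ⊔ X.F := fun h' =>
  h (by rw [sup_comm] at h' ⊢; exact exchange hb h' hbF (rk_atom hc).le)

/-- Contractions at two atoms commute. -/
theorem ctr_comm {b c : X.E} (hb : IsAtom b) (hbF : ¬ b ≤ X.F) (hc : IsAtom c) (hcF : ¬ c ≤ X.F)
    {l : List X.E} (hl : ∀ a ∈ l, rk a ≤ 1) :
    ctr (X.contract ⟨b, hb⟩ hbF) (X.cup ⟨b, hb⟩ hbF c) (l.map (X.cup ⟨b, hb⟩ hbF)) =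
      ctr (X.contract ⟨c, hc⟩ hcF) (X.cup ⟨c, hc⟩ hcF b) (l.map (X.cup ⟨c, hc⟩ hcF)) := by
  have key : ∀ {b c : X.E} (hb : IsAtom b) (hbF : ¬ b ≤ X.F) (_ : IsAtom c),
      IsAtom (X.cup ⟨b, hb⟩ hbF c) ∧ ¬ X.cup ⟨b, hb⟩ hbF c ≤ (X.contract ⟨b, hb⟩ hbF).F ↔
        ¬ c ≤ b ⊔ X.F := by
    intro b c hb hbF hc
    rw [contract_F, cup_le_cup, isAtom_cup hc]
    exact ⟨fun h => h.2, fun h => ⟨fun h' => h (h'.le.trans le_sup_left), h⟩⟩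
  have hiff : ¬ c ≤ b ⊔ X.F ↔ ¬ b ≤ c ⊔ X.F :=
    ⟨not_le_sup_F_symm hb hbF hc, not_le_sup_F_symm hc hcF hb⟩
  by_cases h : ¬ c ≤ b ⊔ X.F
  · have h1 := (key hb hbF hc).2 h
    have h2 := (key hc hcF hb).2 (hiff.1 h)
    rw [ctr_of h1.1 h1.2, ctr_of h2.1 h2.2]
    let φ : ((X.contract ⟨b, hb⟩ hbF).contract ⟨_, h1.1⟩ h1.2).E ≃o
        ((X.contract ⟨c, hc⟩ hcF).contract ⟨_, h2.1⟩ h2.2).E :=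
      { toFun := fun x => ⟨⟨x.1.1, le_sup_right.trans x.2⟩,
          show c ⊔ b ≤ x.1.1 from (sup_comm c b).le.trans x.2⟩
        invFun := fun x => ⟨⟨x.1.1, le_sup_right.trans x.2⟩,
          show b ⊔ c ≤ x.1.1 from (sup_comm b c).le.trans x.2⟩
        left_inv := fun _ => rfl
        right_inv := fun _ => rfl
        map_rel_iff' := Iff.rfl }
    have hφ : ∀ a, φ (cup _ _ _ (X.cup ⟨b, hb⟩ hbF a)) = cup _ _ _ (X.cup ⟨c, hc⟩ hcF a) :=
      fun a => Subtype.ext (Subtype.ext (show (b ⊔ c) ⊔ (b ⊔ a) = (c ⊔ b) ⊔ (c ⊔ a) by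
        have e : ∀ b c : X.E, (b ⊔ c) ⊔ (b ⊔ a) = b ⊔ c ⊔ a := fun b c => by
          rw [sup_sup_sup_comm, sup_idem, sup_assoc]
        rw [e, e, sup_comm b c]))
    refine (clsFun L).iso φ (fun a => (hφ (X.ι a)).symm)
      (rk_le_one_map_cup (rk_le_one_map_cup hl)) ?_
    simp only [List.map_map]
    exact List.map_congr_left fun a _ => (hφ a).symm
  · rw [ctr_of_not (mt (key hb hbF hc).1 h), ctr_of_not (mt (key hc hcF hb).1 (mt hiff.2 h))]

open Classical in
/-- The term of the letter `b` in the differential of the word `b :: l`: the contraction of `b`, or zero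
if `b` is a bridge or below `F`. -/
noncomputable def dTerm (X : ModularExtension L) (b : X.E) (l : List X.E) : D L :=
  if b ≤ X.F ⊔ jn l then ctr X b l else 0

theorem dTerm_alt (X : ModularExtension L) (b : X.E) : IsAlt (dTerm X b) := by
  classical
  have := (ctr_alt X b).ite (fun l => b ≤ X.F ⊔ jn l) fun l l' h => by rw [jn_perm h]
  exact this

theorem dTerm_eq_zero {b : X.E} {l : List X.E} (h : ctr X b l = 0) : dTerm X b l = 0 := by
  rw [dTerm, h, ite_self]

theorem dTerm_of_le {b : X.E} {l : List X.E} (h : b ≤ X.F ⊔ jn l) : dTerm X b l = ctr X b l :=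
  if_pos h

theorem dTerm_emb {φ : X.E → Y.E} (h : X.IsMap Y φ) {b : X.E} {l : List X.E}
    (hl : ∀ a ∈ l, rk a ≤ 1) : dTerm Y (φ b) (l.map φ) = dTerm X b l := by
  have e : φ b ≤ Y.F ⊔ jn (l.map φ) ↔ b ≤ X.F ⊔ jn l := by
    rw [h.jn, ← h.map_F, ← h.map_sup, h.le_iff]
  rw [dTerm, dTerm, ctr_emb h hl]
  by_cases h1 : b ≤ X.F ⊔ jn l
  · rw [if_pos h1, if_pos (e.2 h1)]
  · rw [if_neg h1, if_neg (mt e.1 h1)]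

/-- The differential, as a family which respects the relations. -/
noncomputable def dFun (L : Type u) [Lattice L] [BoundedOrder L] [IsGeometricLattice L] :
    DiagramFun L (D L) where
  toFun X l := dsum l (dTerm X)
  alt X := IsAlt.dsum (dTerm_alt X)
  bot X l hl := dsum_eq_zero fun b l' h => dTerm_eq_zero (by
    rcases List.mem_cons.1 (h.mem_iff.2 hl) with h1 | h1
    · exact ctr_of_not (fun h' => h'.1.1 h1.symm) _
    · exact ctr_of_mem_le h1 bot_le)
  emb X Y φ h l hl := by
    rw [dsum_map]
    exact dsum_congr fun b l' hb => dTerm_emb h fun a ha =>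
      (rk_atom (hl a (hb.mem_iff.1 (by simp [ha])))).le
  span X l hl h := dsum_eq_zero fun b l' hb => dTerm_eq_zero (ctr_span
    (fun a ha => (rk_atom (hl a (hb.mem_iff.1 (by simp [ha])))).le)
    (by rw [← jn_cons, jn_perm hb]; exact h))
  split X l w z hl hF h hr hz hlw := dsum_eq_zero fun b l' hb => by
    have hl' : ∀ a ∈ l', IsAtom a := fun a ha => hl a (hb.mem_iff.1 (by simp [ha]))
    have hlw' : ∀ a ∈ l', a ≤ w ∨ a ≤ z := fun a ha => hlw a (hb.mem_iff.1 (by simp [ha]))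
    have hrl : ∀ a ∈ l', rk a ≤ 1 := fun a ha => (rk_atom (hl' a ha)).le
    have hbl : b ∈ l := hb.mem_iff.1 (by simp)
    by_cases hbw : b ≤ w
    · exact dTerm_eq_zero (ctr_split_left hrl hF h hr hz hlw' hbw)
    have hbz := (hlw b hbl).resolve_left hbw
    -- If `z` is itself the letter `b`, then either another letter is parallel to `b`, or all the
    -- other letters are below `w` and `b` is a bridge.
    by_cases hne : b = z
    · by_cases h1 : ∃ a ∈ l', a ≤ b
      · obtain ⟨a, ha, hab⟩ := h1
        exact dTerm_eq_zero (ctr_of_mem_le ha hab)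
      · push Not at h1
        refine if_neg fun h2 => hbw (h2.trans (sup_le hF (jn_le_iff.2 fun a ha => ?_)))
        exact (hlw' a ha).resolve_right (by rw [← hne]; exact h1 a ha)
    · exact dTerm_eq_zero (ctr_split_right hrl hF h hr hlw' hbz hne)
  biv X G e f l hG hF he hf hl heG hfG hlG := by
    have hrl : ∀ a ∈ e :: f :: l, rk a ≤ 1 := by
      intro a ha
      simp only [List.mem_cons] at ha
      rcases ha with rfl | rfl | ha
      · exact (rk_atom he).le
      · exact (rk_atom hf).le
      · exact (rk_atom (hl a ha)).le
    -- Contracting a letter below `G` leaves exactly two letters outside of `G`; the contractions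
    -- of `e` and `f` agree and occur with opposite signs.
    have hrest : (dsum l fun b l' => dTerm X b (e :: f :: l')) = 0 :=
      dsum_eq_zero fun b l' hb => by
        have hl' : ∀ a ∈ l', a ∈ l := fun a ha => hb.mem_iff.1 (by simp [ha])
        refine dTerm_eq_zero (ctr_biv (fun a ha => hrl a ?_) hG hF
          (hlG b (hb.mem_iff.1 (by simp))) heG hfG fun a ha => hlG a (hl' a ha))
        simp only [List.mem_cons] at ha ⊢
        rcases ha with h | h | h
        · exact .inl h
        · exact .inr (.inl h)
        · exact .inr (.inr (hl' a h))
    have hx : X.F ⊔ jn l ≤ G := sup_le hF (jn_le_iff.2 hlG)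
    have hiff : e ≤ X.F ⊔ jn (f :: l) ↔ f ≤ X.F ⊔ jn (e :: l) := by
      have e1 : ∀ a, X.F ⊔ jn (a :: l) = (X.F ⊔ jn l) ⊔ a := fun a => by
        rw [jn_cons, sup_comm a, sup_assoc]
      rw [e1, e1]
      exact ⟨fun h => exchange he h (fun h' => heG (h'.trans hx)) (rk_atom hf).le,
        fun h => exchange hf h (fun h' => hfG (h'.trans hx)) (rk_atom he).le⟩
    change dTerm X e (f :: l) - (dTerm X f (e :: l) - dsum l fun b l' => dTerm X b (e :: f :: l')) = 0
    rw [hrest, sub_zero, sub_eq_zero]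
    by_cases hsp : X.F ⊔ (e ⊔ jn (f :: l)) = ⊤
    · by_cases h1 : e ≤ X.F ⊔ jn (f :: l)
      · rw [dTerm_of_le h1, dTerm_of_le (hiff.1 h1)]
        have hGf : f ⊔ G = ⊤ := top_le_iff.1 (by
          rw [← hsp, sup_left_comm, sup_eq_right.2 h1, jn_cons, sup_left_comm]
          exact sup_le_sup_left hx _)
        have hGe : e ⊔ G = ⊤ := by
          refine eq_top_of_rk ?_
          rw [← hGf, sup_comm f, sup_comm e, rk_sup_atom he heG, rk_sup_atom hf hfG]
        exact ctr_hyperplane hrl hG hF he hf heG hfG hlG hGe hGf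
      · rw [dTerm, if_neg h1, dTerm, if_neg (mt hiff.2 h1)]
    · rw [dTerm_eq_zero (ctr_span (fun a ha => hrl a (by simp at ha ⊢; tauto)) hsp),
        dTerm_eq_zero (ctr_span (fun a ha => hrl a (by simp at ha ⊢; tauto)) ?_)]
      rw [jn_cons] at hsp ⊢
      rwa [sup_left_comm f]

/-- The differential of the space of diagrams. -/
noncomputable def dMap (L : Type u) [Lattice L] [BoundedOrder L] [IsGeometricLattice L] :
    D L →ₗ[ℚ] D L := (dFun L).lift

theorem dMap_cls {l : List X.E} (hl : ∀ a ∈ l, rk a ≤ 1) :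
    dMap L (cls X l) = dsum l (dTerm X) := (dFun L).lift_cls hl

/-- The differential of a contraction, as a sum over the letters before contraction. -/
theorem dMap_ctr {b : X.E} (hb : IsAtom b) (hbF : ¬ b ≤ X.F) {l : List X.E}
    (hl : ∀ a ∈ l, rk a ≤ 1) :
    dMap L (ctr X b l) = dsum l fun c l' =>
      dTerm (X.contract ⟨b, hb⟩ hbF) (X.cup _ _ c) (l'.map (X.cup _ _)) := by
  rw [ctr_of hb hbF, dMap_cls (rk_le_one_map_cup hl), dsum_map]

theorem le_contract_iff {b : X.E} (hb : IsAtom b) (hbF : ¬ b ≤ X.F) {c : X.E} {l : List X.E} :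
    X.cup ⟨b, hb⟩ hbF c ≤ (X.contract ⟨b, hb⟩ hbF).F ⊔ jn (l.map (X.cup ⟨b, hb⟩ hbF)) ↔
      c ≤ X.F ⊔ jn (b :: l) := by
  rw [jn_map_cup, contract_F, ← cup_sup, cup_le_cup, jn_cons, sup_left_comm]

theorem dMap_dMap (x : D L) : dMap L (dMap L x) = 0 := by
  refine D.induction (p := fun x => dMap L (dMap L x) = 0) x (by simp)
    (fun x y hx hy => by simp [hx, hy]) (fun r x hx => by simp [hx]) fun X l hl => ?_
  have hrl : ∀ a ∈ l, rk a ≤ 1 := fun a ha => (rk_atom (hl a ha)).le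
  classical
  rw [dMap_cls hrl, map_dsum]
  -- `Φ b c` is the successive contraction of `b` and `c`, which is symmetric in `b` and `c`.
  let Φ : X.E → X.E → List X.E → D L := fun b c l'' =>
    if h : (IsAtom b ∧ ¬ b ≤ X.F) ∧ (b ≤ X.F ⊔ jn (c :: l'')) ∧ c ≤ X.F ⊔ jn (b :: l'') then
      ctr (X.contract ⟨b, h.1.1⟩ h.1.2) (X.cup _ _ c) (l''.map (X.cup _ _)) else 0
  have h1 : (dsum l fun b l' => dMap L (dTerm X b l')) = dsum l fun b l' => dsum l' (Φ b) := by
    refine dsum_congr fun b l' hb => ?_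
    have hbl : b ∈ l := hb.mem_iff.1 (by simp)
    have hrl' : ∀ a ∈ l', rk a ≤ 1 := fun a ha => hrl a (hb.mem_iff.1 (by simp [ha]))
    by_cases h2 : b ≤ X.F ⊔ jn l'
    · rw [dTerm_of_le h2]
      by_cases h3 : b ≤ X.F
      · rw [ctr_of_le h3, map_zero]
        exact (dsum_eq_zero fun c l'' _ => dif_neg fun h => h.1.2 h3).symm
      · rw [dMap_ctr (hl b hbl) h3 hrl']
        refine dsum_congr fun c l'' hc => ?_
        rw [← jn_perm hc] at h2
        simp only [Φ, dTerm]
        by_cases h4 : c ≤ X.F ⊔ jn (b :: l'')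
        · rw [if_pos ((le_contract_iff (hl b hbl) h3).2 h4), dif_pos ⟨⟨hl b hbl, h3⟩, h2, h4⟩]
        · rw [if_neg (mt (le_contract_iff (hl b hbl) h3).1 h4), dif_neg fun h => h4 h.2.2]
    · rw [dTerm, if_neg h2, map_zero]
      refine (dsum_eq_zero fun c l'' hc => dif_neg fun h => h2 ?_).symm
      rw [← jn_perm hc]
      exact h.2.1
  rw [h1]
  refine dsum_dsum_eq_zero_of_symm l Φ fun b c l'' hbc => ?_
  have hb : IsAtom b := hl b (hbc.mem_iff.1 (by simp))
  have hc : IsAtom c := hl c (hbc.mem_iff.1 (by simp))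
  have hrl' : ∀ a ∈ l'', rk a ≤ 1 := fun a ha => hrl a (hbc.mem_iff.1 (by simp [ha]))
  simp only [Φ]
  by_cases h3 : b ≤ X.F ⊔ jn (c :: l'') ∧ c ≤ X.F ⊔ jn (b :: l'')
  · by_cases hbF : b ≤ X.F
    · rw [dif_neg fun h => h.1.2 hbF]
      by_cases hcF : c ≤ X.F
      · rw [dif_neg fun h => h.1.2 hcF]
      · rw [dif_pos ⟨⟨hc, hcF⟩, h3.2, h3.1⟩]
        exact (ctr_of_le (cup_le_cup.2 (hbF.trans le_sup_right)) _).symm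
    · rw [dif_pos ⟨⟨hb, hbF⟩, h3⟩]
      by_cases hcF : c ≤ X.F
      · rw [dif_neg fun h => h.1.2 hcF]
        exact ctr_of_le (cup_le_cup.2 (hcF.trans le_sup_right)) _
      · rw [dif_pos ⟨⟨hc, hcF⟩, h3.2, h3.1⟩]
        exact ctr_comm hb hbF hc hcF hrl'
  · rw [dif_neg fun h => h3 h.2, dif_neg fun h => h3 h.2.symm]

end Contraction

end ModDiag

namespace ModDiag

/-! ### Gluing a fixed extension to a diagram -/

namespace ModularExtension

section Glue

variable {L K : Type u} [Lattice L] [BoundedOrder L] [IsGeometricLattice L]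
  [Lattice K] [BoundedOrder K] [IsGeometricLattice K]

theorem trace_eq_top {X : ModularExtension L} {G : X.E} (h : X.F ≤ G) : X.trace G = ⊤ :=
  top_le_iff.1 (X.ι_le_iff_le_trace.1 h)

/-- The pushout of two modular extensions `X` and `Y` of `L`, as a modular extension of `Y`. -/
noncomputable def pushR (X Y : ModularExtension L) : ModularExtension Y.E where
  E := Pushout X Y
  ι := Pushout.inr
  embedding := by
    refine ⟨fun a b h => congrArg (fun p : Pushout X Y => p.1.2) h, fun a b => ?_, fun a ha =>
      Pushout.isAtom_inr ha⟩
    refine eq_of_forall_ge_iff fun p => ?_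
    rw [Pushout.inr_le_iff, sup_le_iff, sup_le_iff, Pushout.inr_le_iff, Pushout.inr_le_iff]
  range_eq := by
    ext p
    constructor
    · rintro ⟨a, rfl⟩
      exact Pushout.inr_le_iff.2 le_top
    · intro h
      have h1 : p.1.1 ≤ X.F := h.1.trans (X.ι_le_F _)
      refine ⟨p.1.2, Subtype.ext (Prod.ext ?_ rfl)⟩
      change X.ι (Y.trace p.1.2) = p.1.1
      rw [← p.2, X.ι_trace_of_le h1]
  modular := by
    intro p
    have h1 := Pushout.rk_add_rk_trace (Pushout.inr ⊤ ⊓ p : Pushout X Y)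
    have h2 := Pushout.rk_add_rk_trace (Pushout.inr ⊤ ⊔ p : Pushout X Y)
    have h3 := Pushout.rk_add_rk_trace (Pushout.inr ⊤ : Pushout X Y)
    have h4 := Pushout.rk_add_rk_trace p
    have e1 : (Pushout.inr ⊤ : Pushout X Y).1 = (X.F, ⊤) := by
      change (X.ι (Y.trace ⊤), (⊤ : Y.E)) = _
      rw [Y.trace_top]; rfl
    have e2 : (Pushout.inr ⊤ ⊓ p : Pushout X Y).1 = (X.F ⊓ p.1.1, p.1.2) := by
      change ((Pushout.inr ⊤ : Pushout X Y).1.1 ⊓ p.1.1,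
        (Pushout.inr ⊤ : Pushout X Y).1.2 ⊓ p.1.2) = _
      rw [e1, top_inf_eq]
    -- The join of `Y` with a flat `p` is `(F ∨ p₁, ⊤)`. By the rank formula for pushouts, the
    -- modularity of `Y` reduces to that of `F` in `X`.
    have e3 : (Pushout.inr ⊤ ⊔ p : Pushout X Y).1 = (X.F ⊔ p.1.1, ⊤) := by
      have : (Pushout.inr ⊤ ⊔ p : Pushout X Y) = ⟨(X.F ⊔ p.1.1, ⊤), by
          rw [trace_eq_top le_sup_left, Y.trace_top]⟩ := by
        refine le_antisymm (sup_le (Pushout.inr_le_iff.2 le_rfl) ⟨le_sup_right, le_top⟩) ?_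
        have h5 : (Pushout.inr ⊤ : Pushout X Y).1 ≤ (Pushout.inr ⊤ ⊔ p : Pushout X Y).1 :=
          (le_sup_left : (Pushout.inr ⊤ : Pushout X Y) ≤ _)
        rw [e1] at h5
        exact ⟨sup_le h5.1 (le_sup_right : p ≤ Pushout.inr ⊤ ⊔ p).1, h5.2⟩
      rw [this]
    rw [e2] at h1
    rw [e3] at h2
    rw [e1] at h3
    simp only at h1 h2 h3
    rw [trace_inf, trace_eq_top le_rfl, top_inf_eq] at h1
    rw [trace_eq_top le_sup_left] at h2
    rw [trace_eq_top le_rfl] at h3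
    have h7 := X.modular_F p.1.1
    omega

/-- Let `Y` be a modular extension of `L` and let `β : K → Y` be a modular embedding. To a modular
extension `X` of `L` one can attach the pushout of `X` and `Y`, seen as a modular extension of `K`
through `β`. -/
noncomputable def glue (X Y : ModularExtension L) {β : K → Y.E} (hβ : IsModularEmbedding β) :
    ModularExtension K := (pushR X Y).comp hβ

variable {X X' Y : ModularExtension L} {β : K → Y.E} {hβ : IsModularEmbedding β}

/-- The first component of an element of a pushout. -/
def fst (p : (X.glue Y hβ).E) : X.E := Prod.fst (Subtype.val p)

/-- The second component of an element of a pushout. -/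
def snd (p : (X.glue Y hβ).E) : Y.E := Prod.snd (Subtype.val p)

/-- An element of a pushout, given by its components. -/
def pair (hβ : IsModularEmbedding β) (x : X.E) (y : Y.E) (h : X.trace x = Y.trace y) :
    (X.glue Y hβ).E := ⟨(x, y), h⟩

/-- The map from the first extension to a pushout. -/
noncomputable def gl (hβ : IsModularEmbedding β) (x : X.E) : (X.glue Y hβ).E :=
  Pushout.inl x

/-- The map from the second extension to a pushout. -/
noncomputable def gr (X : ModularExtension L) (hβ : IsModularEmbedding β) (y : Y.E) :
    (X.glue Y hβ).E := Pushout.inr y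

theorem fst_pair {x : X.E} {y : Y.E} {h} : fst (pair hβ x y h) = x := rfl
theorem snd_pair {x : X.E} {y : Y.E} {h} : snd (pair hβ x y h) = y := rfl

theorem glue_le_iff {p q : (X.glue Y hβ).E} : p ≤ q ↔ fst p ≤ fst q ∧ snd p ≤ snd q := Iff.rfl

theorem glue_ext {p q : (X.glue Y hβ).E} (h1 : fst p = fst q) (h2 : snd p = snd q) : p = q :=
  Subtype.ext (Prod.ext h1 h2)

theorem trace_fst (p : (X.glue Y hβ).E) : X.trace (fst p) = Y.trace (snd p) := p.2

theorem glue_ι (a : K) : (X.glue Y hβ).ι a = gr X hβ (β a) := rfl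

theorem glue_F : (X.glue Y hβ).F = gr X hβ (β ⊤) := rfl

theorem gl_le_iff {x : X.E} {p : (X.glue Y hβ).E} : gl hβ x ≤ p ↔ x ≤ fst p :=
  Pushout.inl_le_iff

theorem gr_le_iff {y : Y.E} {p : (X.glue Y hβ).E} : gr X hβ y ≤ p ↔ y ≤ snd p :=
  Pushout.inr_le_iff

theorem fst_gl (x : X.E) : fst (gl hβ x) = x := rfl
theorem snd_gl (x : X.E) : snd (gl hβ x) = Y.ι (X.trace x) := rfl
theorem fst_gr (y : Y.E) : fst (gr X hβ y) = X.ι (Y.trace y) := rfl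
theorem snd_gr (y : Y.E) : snd (gr X hβ y) = y := rfl

theorem fst_top : fst (⊤ : (X.glue Y hβ).E) = ⊤ := rfl
theorem snd_top : snd (⊤ : (X.glue Y hβ).E) = ⊤ := rfl

theorem fst_inf (p q : (X.glue Y hβ).E) : fst (p ⊓ q) = fst p ⊓ fst q := rfl
theorem snd_inf (p q : (X.glue Y hβ).E) : snd (p ⊓ q) = snd p ⊓ snd q := rfl

theorem fst_sup (p q : (X.glue Y hβ).E) : fst (p ⊔ q) =
    fst p ⊔ fst q ⊔ X.ι (X.trace (fst p ⊔ fst q) ⊔ Y.trace (snd p ⊔ snd q)) := rfl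
theorem snd_sup (p q : (X.glue Y hβ).E) : snd (p ⊔ q) =
    snd p ⊔ snd q ⊔ Y.ι (X.trace (fst p ⊔ fst q) ⊔ Y.trace (snd p ⊔ snd q)) := rfl

theorem rk_glue (p : (X.glue Y hβ).E) :
    rk p + rk (X.trace (fst p)) = rk (fst p) + rk (snd p) := Pushout.rk_add_rk_trace p

theorem gl_bot : gl (Y := Y) hβ (⊥ : X.E) = ⊥ := le_bot_iff.1 (gl_le_iff.2 bot_le)

theorem gr_bot : gr X hβ (⊥ : Y.E) = ⊥ := le_bot_iff.1 (gr_le_iff.2 bot_le)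

theorem gl_sup (x y : X.E) : gl (Y := Y) hβ (x ⊔ y) = gl hβ x ⊔ gl hβ y :=
  eq_of_forall_ge_iff fun p => by
    rw [gl_le_iff, sup_le_iff, sup_le_iff, gl_le_iff, gl_le_iff]

theorem gr_sup (x y : Y.E) : gr X hβ (x ⊔ y) = gr X hβ x ⊔ gr X hβ y :=
  eq_of_forall_ge_iff fun p => by
    rw [gr_le_iff, sup_le_iff, sup_le_iff, gr_le_iff, gr_le_iff]

theorem rk_gl (x : X.E) : rk (gl (Y := Y) hβ x) = rk x := by
  have := rk_glue (gl (Y := Y) hβ x)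
  rw [fst_gl, snd_gl, Y.rk_ι_eq] at this
  omega

theorem rk_gr (y : Y.E) : rk (gr X hβ y) = rk y := by
  have := rk_glue (gr X hβ y)
  rw [fst_gr, snd_gr, X.rk_ι_eq, X.trace_ι] at this
  omega

theorem isAtom_gl {x : X.E} : IsAtom (gl (Y := Y) hβ x) ↔ IsAtom x := by
  rw [isAtom_iff_rk, isAtom_iff_rk, rk_gl]

theorem isAtom_gr {y : Y.E} : IsAtom (gr X hβ y) ↔ IsAtom y := by
  rw [isAtom_iff_rk, isAtom_iff_rk, rk_gr]

theorem gl_ι (a : L) : gl hβ (X.ι a) = gr X hβ (Y.ι a) := by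
  refine glue_ext ?_ ?_
  · rw [fst_gl, fst_gr, Y.trace_ι]
  · rw [snd_gl, snd_gr, X.trace_ι]

/-- The element `(G, ⊤)` of a pushout, for `G ≥ F`. -/
def hat (hβ : IsModularEmbedding β) {G : X.E} (h : X.F ≤ G) : (X.glue Y hβ).E :=
  pair hβ G ⊤ (by rw [trace_eq_top h, Y.trace_top])

theorem gr_le_hat {G : X.E} {h : X.F ≤ G} (y : Y.E) : gr X hβ y ≤ hat hβ h :=
  gr_le_iff.2 le_top

theorem gl_le_hat {G x : X.E} {h : X.F ≤ G} : gl (Y := Y) hβ x ≤ hat hβ h ↔ x ≤ G := gl_le_iff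

theorem F_le_hat {G : X.E} {h : X.F ≤ G} : (X.glue Y hβ).F ≤ hat hβ h := gr_le_hat _

/-- The ranks of the flats above `Y`: up to a constant, those of the flats above `F` in `X`. -/
theorem rk_hat {G : X.E} {h : X.F ≤ G} :
    rk (hat hβ h) + rk (⊤ : L) = rk G + rk (⊤ : Y.E) := by
  have := rk_glue (hat hβ h)
  rwa [hat, fst_pair, snd_pair, trace_eq_top h] at this

theorem rk_glue_top : rk (⊤ : (X.glue Y hβ).E) + rk (⊤ : L) = rk (⊤ : X.E) + rk (⊤ : Y.E) := by
  have := rk_glue (⊤ : (X.glue Y hβ).E)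
  rwa [fst_top, snd_top, X.trace_top] at this

theorem hat_sup {G : X.E} (h : X.F ≤ G) (p : (X.glue Y hβ).E) :
    hat hβ h ⊔ p = hat hβ (h.trans le_sup_left : X.F ≤ G ⊔ fst p) := by
  refine le_antisymm (sup_le ⟨le_sup_left, le_rfl⟩ ⟨le_sup_right, le_top⟩) ⟨sup_le ?_ ?_, ?_⟩
  · exact (glue_le_iff.1 (le_sup_left : hat hβ h ≤ hat hβ h ⊔ p)).1
  · exact (glue_le_iff.1 (le_sup_right : p ≤ hat hβ h ⊔ p)).1
  · exact (glue_le_iff.1 (le_sup_left : hat hβ h ≤ hat hβ h ⊔ p)).2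

/-- A modular flat of `X` above `F` remains modular in the pushout once it is enlarged by `Y`. -/
theorem modular_hat {G : X.E} (hG : IsModularFlat G) (h : X.F ≤ G) :
    IsModularFlat (hat (Y := Y) hβ h) := by
  intro p
  rw [hat_sup]
  have h1 := rk_glue (hat hβ h ⊓ p)
  have h2 := rk_hat (hβ := hβ) (h := (h.trans le_sup_left : X.F ≤ G ⊔ fst p))
  have h3 := rk_hat (hβ := hβ) (h := h)
  have h4 := rk_glue p
  have h5 := hG (fst p)
  rw [fst_inf, snd_inf, hat, fst_pair, snd_pair, top_inf_eq, trace_inf, trace_eq_top h,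
    top_inf_eq] at h1
  rw [hat] at h3 ⊢
  omega

theorem jn_map_gl (l : List X.E) : jn (l.map (gl (Y := Y) hβ)) = gl hβ (jn l) :=
  jn_map _ gl_bot gl_sup l

theorem jn_map_gr (l : List Y.E) : jn (l.map (gr X hβ)) = gr X hβ (jn l) :=
  jn_map _ gr_bot gr_sup l

/-- Pushouts are functorial in the first extension. -/
theorem IsMap.glue {φ : X.E → X'.E} (h : X.IsMap X' φ) :
    ∃ ψ : (X.glue Y hβ).E → (X'.glue Y hβ).E, IsMap _ _ ψ ∧
      (∀ x, ψ (gl hβ x) = gl hβ (φ x)) ∧ ∀ y, ψ (gr X hβ y) = gr X' hβ y := by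
  let ψ : (X.glue Y hβ).E → (X'.glue Y hβ).E := fun p =>
    pair hβ (φ (fst p)) (snd p) (by rw [h.trace, trace_fst])
  have hr : ∀ p, ModDiag.rk (ψ p) = ModDiag.rk p := fun p => by
    have h1 := rk_glue p
    have h2 := rk_glue (ψ p)
    simp only [ψ, fst_pair, snd_pair, h.trace, h.rk] at h2
    change ModDiag.rk (ψ p) + _ = _ at h2
    omega
  have hgr : ∀ y, ψ (gr X hβ y) = gr X' hβ y := fun y =>
    glue_ext (by simp only [ψ, fst_pair, fst_gr, h.map_ι]) rfl
  refine ⟨ψ, ⟨⟨fun p q hpq => ?_, fun p q => ?_, fun p hp => ?_⟩, ?_, fun a => ?_⟩, fun x => ?_, hgr⟩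
  · exact glue_ext (h.embedding.injective (congrArg fst hpq))
      (show snd (ψ p) = snd (ψ q) from congrArg snd hpq)
  · refine glue_ext ?_ ?_
    · simp only [ψ, fst_pair, snd_pair, fst_sup, h.map_sup, ← h.map_ι, ← h.trace]
    · simp only [ψ, fst_pair, snd_pair, snd_sup, ← h.map_sup, h.trace]
  · rwa [isAtom_iff_rk, hr, ← isAtom_iff_rk]
  · have h1 := rk_glue_top (X := X) (hβ := hβ)
    have h2 := rk_glue_top (X := X') (hβ := hβ)
    have h3 := h.rk_top
    omega
  · exact (hgr _).symm
  · exact glue_ext rfl (by simp only [ψ, snd_pair, snd_gl, h.trace])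

/-- Contracting an atom of the first extension commutes with pushouts. -/
theorem exists_contract_glue {c : X.E} (hc : IsAtom c) (hcF : ¬ c ≤ X.F)
    (hc' : ¬ gl hβ c ≤ (X.glue Y hβ).F) :
    ∃ e : ((X.glue Y hβ).contract ⟨gl hβ c, isAtom_gl.2 hc⟩ hc').E ≃o
        ((X.contract ⟨c, hc⟩ hcF).glue Y hβ).E,
      (∀ x, e (cup _ _ _ (gl hβ x)) = gl hβ (X.cup ⟨c, hc⟩ hcF x)) ∧
      ∀ y, e (cup _ _ _ (gr X hβ y)) = gr _ hβ y := by
  let X₁ := X.contract ⟨c, hc⟩ hcF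
  let val : X₁.E → X.E := fun x => x.1
  have hval : ∀ x, c ≤ val x := fun x => x.2
  have hcup : ∀ x y, X.cup ⟨c, hc⟩ hcF x ≤ y ↔ x ≤ val y := fun x y =>
    ⟨fun h => le_sup_right.trans (show c ⊔ x ≤ val y from h),
      fun h => show c ⊔ x ≤ val y from sup_le y.2 h⟩
  have hcv : ∀ x, X.cup ⟨c, hc⟩ hcF (val x) = x := fun x => Subtype.ext (sup_eq_right.2 x.2)
  have hvc : ∀ x, c ≤ x → val (X.cup ⟨c, hc⟩ hcF x) = x := fun x hx => sup_eq_right.2 hx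
  have htr : ∀ x : X₁.E, X.trace (val x) = X₁.trace x := fun x =>
    eq_of_forall_le_iff fun a => by
      rw [← X.ι_le_iff_le_trace, ← X₁.ι_le_iff_le_trace, contract_ι, hcup]
  -- On pairs, `g` is the inclusion of the interval above `c` and `f` its left adjoint.
  let g : (X₁.glue Y hβ).E → (X.glue Y hβ).E := fun q => pair hβ (val (fst q)) (snd q) (by
    rw [htr, trace_fst])
  let f : (X.glue Y hβ).E → (X₁.glue Y hβ).E := fun p =>
    gl hβ (X.cup ⟨c, hc⟩ hcF (fst p)) ⊔ gr X₁ hβ (snd p)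
  have gc : GaloisConnection f g := fun p q => by
    rw [sup_le_iff, gl_le_iff, gr_le_iff, hcup, glue_le_iff, fst_pair, snd_pair]
  have hfg : ∀ y, f (g y) = y := fun q => eq_of_forall_ge_iff fun r => by
    rw [sup_le_iff, gl_le_iff, gr_le_iff, fst_pair, snd_pair, hcv, glue_le_iff]
  have hgb : ∀ y, gl hβ c ≤ g y := fun y => gl_le_iff.2 (hval _)
  have hgf : ∀ x, gl hβ c ≤ x → g (f x) = x := fun x hx => by
    have h1 : c ≤ fst x := gl_le_iff.1 hx
    have h2 : X₁.trace (X.cup ⟨c, hc⟩ hcF (fst x)) = Y.trace (snd x) := by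
      rw [← htr, hvc _ h1, trace_fst]
    have h3 : f x = pair hβ (X.cup ⟨c, hc⟩ hcF (fst x)) (snd x) h2 :=
      eq_of_forall_ge_iff fun r => by
        rw [sup_le_iff, gl_le_iff, gr_le_iff, glue_le_iff, fst_pair, snd_pair]
    rw [h3]
    exact glue_ext (hvc _ h1) rfl
  refine ⟨contractIso (X := X.glue Y hβ) ⟨gl hβ c, isAtom_gl.2 hc⟩ hc' f g gc.monotone_l
    gc.monotone_u hgb hfg hgf, fun x => ?_, fun y => ?_⟩
  · rw [contractIso_cup]
    refine eq_of_forall_ge_iff fun q => ?_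
    rw [gc, sup_le_iff, gl_le_iff, gl_le_iff, fst_pair, gl_le_iff, hcup]
    exact and_iff_right (hval _)
  · rw [contractIso_cup]
    refine eq_of_forall_ge_iff fun q => ?_
    rw [gc, sup_le_iff, gl_le_iff, gr_le_iff, fst_pair, snd_pair, gr_le_iff]
    exact and_iff_right (hval _)

end Glue

end ModularExtension

section GlueFun

open ModularExtension

variable {L K : Type u} [Lattice L] [BoundedOrder L] [IsGeometricLattice L]
  [Lattice K] [BoundedOrder K] [IsGeometricLattice K]

/-- The word of a glued diagram. -/
noncomputable def glueWord (X : ModularExtension L) {Y : ModularExtension L} {β : K → Y.E}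
    (hβ : IsModularEmbedding β) (W : List Y.E) (l : List X.E) : List (X.glue Y hβ).E :=
  W.map (gr X hβ) ++ l.map (gl hβ)

variable {X Y : ModularExtension L} {β : K → Y.E} {hβ : IsModularEmbedding β}

theorem map_glueWord {γ : Type*} {ψ : (X.glue Y hβ).E → γ} {f : Y.E → γ} {g : X.E → γ}
    (h1 : ∀ y, ψ (gr X hβ y) = f y) (h2 : ∀ x, ψ (gl hβ x) = g x) (W : List Y.E) (l : List X.E) :
    (glueWord X hβ W l).map ψ = W.map f ++ l.map g := by
  rw [glueWord, List.map_append, List.map_map, List.map_map]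
  exact congrArg₂ _ (List.map_congr_left fun y _ => h1 y) (List.map_congr_left fun x _ => h2 x)

theorem rk_le_one_glueWord {W : List Y.E} {l : List X.E} (hW : ∀ a ∈ W, rk a ≤ 1)
    (hl : ∀ a ∈ l, rk a ≤ 1) : ∀ a ∈ glueWord X hβ W l, rk a ≤ 1 := by
  intro a ha
  rcases List.mem_append.1 ha with h | h
  · obtain ⟨b, hb, rfl⟩ := List.mem_map.1 h
    rw [rk_gr]; exact hW b hb
  · obtain ⟨b, hb, rfl⟩ := List.mem_map.1 h
    rw [rk_gl]; exact hl b hb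

theorem glueWord_le_hat {W : List Y.E} {l : List X.E} {G : X.E} {h : X.F ≤ G}
    (hl : ∀ a ∈ l, a ≤ G) : ∀ a ∈ glueWord X hβ W l, a ≤ hat hβ h := by
  intro a ha
  rcases List.mem_append.1 ha with h | h
  · obtain ⟨b, hb, rfl⟩ := List.mem_map.1 h
    exact gr_le_hat _
  · obtain ⟨b, hb, rfl⟩ := List.mem_map.1 h
    exact gl_le_hat.2 (hl b hb)

/-- Gluing a fixed extension `Y`, decorated with a word `W`. -/
noncomputable def glueFun (Y : ModularExtension L) {β : K → Y.E} (hβ : IsModularEmbedding β)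
    (W : List Y.E) (hW : ∀ a ∈ W, rk a ≤ 1) : DiagramFun L (D K) where
  toFun X l := cls (X.glue Y hβ) (glueWord X hβ W l)
  alt X := ((cls_alt _).append_left _).map _
  bot X l hl := cls_bot (List.mem_append_right _ (List.mem_map.2 ⟨⊥, hl, gl_bot⟩))
  emb X X' φ h l hl := by
    obtain ⟨ψ, hψ, h1, h2⟩ := h.glue (Y := Y) (hβ := hβ)
    have := (clsFun K).emb' hψ
      (rk_le_one_glueWord (hβ := hβ) hW fun a ha => (rk_atom (hl a ha)).le)
    rw [map_glueWord (g := fun x => gl hβ (φ x)) h2 h1] at this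
    refine Eq.trans ?_ this
    rw [glueWord, List.map_map]
    rfl
  span X l hl h := by
    refine (clsFun K).span' (rk_le_one_glueWord hW fun a ha => (rk_atom (hl a ha)).le)
      fun h' => h ?_
    have h1 : (⊤ : (X.glue Y hβ).E) ≤ hat hβ (le_sup_left : X.F ≤ X.F ⊔ jn l) := by
      rw [← h']
      exact sup_le F_le_hat (jn_le_iff.2 (glueWord_le_hat fun a ha =>
        (le_jn ha).trans le_sup_right))
    exact top_le_iff.1 (show (⊤ : X.E) ≤ X.F ⊔ jn l from (glue_le_iff.1 h1).1)
  split X l w z hl hF h hr hz hlw := by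
    -- A splitting `(w, z)` of `X` gives the splitting `(w ∪ Y, z)` of the pushout.
    refine (clsFun K).split' (w := hat hβ hF) (z := gl hβ z)
      (rk_le_one_glueWord hW fun a ha => (rk_atom (hl a ha)).le) F_le_hat ?_ ?_ ?_ ?_
    · rw [hat_sup, fst_gl]
      exact glue_ext (show w ⊔ z = ⊤ from h) rfl
    · have h1 := rk_hat (hβ := hβ) (h := hF)
      have h2 := rk_glue_top (X := X) (hβ := hβ)
      rw [rk_gl]
      omega
    · intro h'
      have := rk_gl (hβ := hβ) z
      rw [h', rk_bot] at this
      exact hz (rk_eq_zero.1 this.symm)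
    · intro a ha
      rcases List.mem_append.1 ha with h | h
      · obtain ⟨b, hb, rfl⟩ := List.mem_map.1 h
        exact .inl (gr_le_hat _)
      · obtain ⟨b, hb, rfl⟩ := List.mem_map.1 h
        rcases hlw b hb with h | h
        · exact .inl (gl_le_hat.2 h)
        · refine .inr (gl_le_iff.2 ?_)
          rwa [fst_gl]
  biv X G e f l hG hF he hf hl heG hfG hlG := by
    have hp : (glueWord X hβ W (e :: f :: l)).Perm
        (gl hβ e :: gl hβ f :: glueWord X hβ W l) := by
      rw [glueWord, List.map_cons, List.map_cons]
      exact (List.perm_middle).trans (List.Perm.cons _ List.perm_middle)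
    refine (cls_alt _).eq_zero_of_perm hp ?_
    refine (clsFun K).biv' (modular_hat (hβ := hβ) hG hF) F_le_hat ?_ (mt gl_le_hat.1 heG)
      (mt gl_le_hat.1 hfG) (glueWord_le_hat hlG)
    intro a ha
    refine rk_le_one_glueWord (l := e :: f :: l) hW ?_ a (hp.mem_iff.2 ha)
    intro a ha
    simp only [List.mem_cons] at ha
    rcases ha with rfl | rfl | ha
    · exact (rk_atom he).le
    · exact (rk_atom hf).le
    · exact (rk_atom (hl a ha)).le

theorem gl_not_le_F {c : X.E} (hcF : ¬ c ≤ X.F) : ¬ gl hβ c ≤ (X.glue Y hβ).F := fun h =>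
  hcF ((gl_le_iff.1 h).trans (X.ι_le_F _))

/-- Gluing commutes with contracting a letter of the glued diagram which is not below `F`. -/
theorem ctr_glue {c : X.E} (hc : IsAtom c) (hcF : ¬ c ≤ X.F) {W : List Y.E} {l : List X.E}
    (hW : ∀ a ∈ W, rk a ≤ 1) (hl : ∀ a ∈ l, rk a ≤ 1) :
    ctr (X.glue Y hβ) (gl hβ c) (glueWord X hβ W l) = (glueFun Y hβ W hW).lift (ctr X c l) := by
  rw [ctr_of hc hcF, DiagramFun.lift_cls _ (rk_le_one_map_cup hl),
    ctr_of (isAtom_gl.2 hc) (gl_not_le_F hcF)]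
  obtain ⟨e, he1, he2⟩ := exists_contract_glue (Y := Y) (hβ := hβ) hc hcF (gl_not_le_F hcF)
  refine (clsFun K).iso e (fun a => ?_) (rk_le_one_map_cup (rk_le_one_glueWord hW hl)) ?_
  · rw [contract_ι, glue_ι, glue_ι, he2]
  · rw [List.map_map]
    refine Eq.trans ?_ (map_glueWord (f := gr _ hβ)
      (g := fun x => gl hβ (X.cup ⟨c, hc⟩ hcF x)) he2 he1 W l).symm
    rw [glueWord, List.map_map]
    rfl

end GlueFun

end ModDiag

namespace ModDiag

/-! ### The product and the grading -/

section Product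

open ModularExtension

variable {L K : Type u} [Lattice L] [BoundedOrder L] [IsGeometricLattice L]
  [Lattice K] [BoundedOrder K] [IsGeometricLattice K]

variable {X Y Z : ModularExtension L}

/-- The linear map `D L → D K` gluing a fixed extension `Y` decorated with a word `W`. -/
noncomputable def glueMap (Y : ModularExtension L) {β : K → Y.E} (hβ : IsModularEmbedding β)
    (W : List Y.E) (hW : ∀ a ∈ W, rk a ≤ 1) : D L →ₗ[ℚ] D K := (glueFun Y hβ W hW).lift

theorem glueMap_cls {β : K → Y.E} {hβ : IsModularEmbedding β} {W : List Y.E}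
    (hW : ∀ a ∈ W, rk a ≤ 1) {l : List X.E} (hl : ∀ a ∈ l, rk a ≤ 1) :
    glueMap Y hβ W hW (cls X l) = cls (X.glue Y hβ) (glueWord X hβ W l) :=
  (glueFun Y hβ W hW).lift_cls hl

/-- Gluing commutes with the contraction of a letter of the first diagram, as soon as the flat
`F` of the glued diagram and the letters of `W` span the flat `F` of `Y`. -/
theorem dTerm_glue {β : K → Y.E} {hβ : IsModularEmbedding β} {W : List Y.E}
    (hW : ∀ a ∈ W, rk a ≤ 1) (hsp : Y.F ≤ β ⊤ ⊔ jn W) {c : X.E} (hc : IsAtom c)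
    (h0 : c ≤ X.F → gl hβ c ≤ (X.glue Y hβ).F) {l : List X.E} (hl : ∀ a ∈ l, rk a ≤ 1) :
    dTerm (X.glue Y hβ) (gl hβ c) (glueWord X hβ W l) = glueMap Y hβ W hW (dTerm X c l) := by
  by_cases hcF : c ≤ X.F
  · rw [dTerm_eq_zero (ctr_of_le hcF l), map_zero, dTerm_eq_zero (ctr_of_le (h0 hcF) _)]
  · have h1 : gl hβ c ≤ (X.glue Y hβ).F ⊔ jn (glueWord X hβ W l) ↔ c ≤ X.F ⊔ jn l := by
      rw [glueWord, jn_append, jn_map_gr, jn_map_gl, glue_F]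
      constructor
      · intro h
        refine gl_le_hat (hβ := hβ) (h := (le_sup_left : X.F ≤ X.F ⊔ jn l)) |>.1 (h.trans ?_)
        exact sup_le (gr_le_hat _) (sup_le (gr_le_hat _) (gl_le_hat.2 le_sup_right))
      · intro h
        have h2 : gl hβ X.F ≤ gr X hβ (β ⊤) ⊔ gr X hβ (jn W) := by
          rw [← gr_sup, F, gl_ι]
          exact gr_le_iff.2 hsp
        refine (gl_le_iff.2 h : gl hβ c ≤ gl hβ (X.F ⊔ jn l)).trans ?_
        rw [gl_sup, ← sup_assoc]
        exact sup_le_sup_right h2 _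
    by_cases h : c ≤ X.F ⊔ jn l
    · rw [dTerm_of_le h, dTerm_of_le (h1.2 h), ctr_glue hc hcF hW hl]
      rfl
    · rw [dTerm, if_neg (mt h1.1 h), dTerm, if_neg h, map_zero]

/-- The symmetry of pushouts. -/
def swapIso (X Y : ModularExtension L) :
    (X.glue Y Y.isModularEmbedding).E ≃o (Y.glue X X.isModularEmbedding).E :=
  Pushout.swap X Y

theorem swapIso_gr (y : Y.E) : swapIso X Y (gr _ _ y) = gl _ y := rfl

theorem swapIso_ι (a : L) : (Y.glue X X.isModularEmbedding).ι a =
    swapIso X Y ((X.glue Y Y.isModularEmbedding).ι a) := by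
  rw [glue_ι, glue_ι, swapIso_gr, gl_ι]

open Classical in
/-- The product with a fixed diagram `(X, l)` as left factor; zero if a letter of `l` has rank
greater than one. -/
noncomputable def mulAux (X : ModularExtension L) (l : List X.E) : D L →ₗ[ℚ] D L :=
  if h : ∀ a ∈ l, rk a ≤ 1 then glueMap X X.isModularEmbedding l h else 0

theorem mulAux_cls {l : List X.E} {m : List Y.E} (hm : ∀ a ∈ m, rk a ≤ 1) :
    mulAux X l (cls Y m) = cls (Y.glue X _) (glueWord Y X.isModularEmbedding l m) := by
  by_cases h : ∀ a ∈ l, rk a ≤ 1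
  · rw [mulAux, dif_pos h, glueMap_cls h hm]
  · rw [mulAux, dif_neg h]
    push Not at h
    obtain ⟨a, ha, h⟩ := h
    refine (cls_of_not_atom (a := gr Y _ a) ?_ fun h' => ?_).symm
    · exact List.mem_append_left _ (List.mem_map_of_mem ha)
    · rw [isAtom_gr, isAtom_iff_rk] at h'
      omega

theorem cls_swap {l : List X.E} {m : List Y.E} (hl : ∀ a ∈ l, rk a ≤ 1)
    (hm : ∀ a ∈ m, rk a ≤ 1) :
    cls (Y.glue X X.isModularEmbedding) (l.map (gr Y _) ++ m.map (gl _)) =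
      cls (X.glue Y Y.isModularEmbedding) (l.map (gl _) ++ m.map (gr X _)) := by
  refine (clsFun L).iso (swapIso Y X) swapIso_ι (rk_le_one_glueWord hl hm) ?_
  exact (map_glueWord (f := gl _) (g := gr X _) (fun _ => rfl) (fun _ => rfl) l m).symm

/-- By the symmetry of pushouts, the relations in the left factor of a product follow from those
satisfied by gluing. -/
theorem mulAux_cls_swap {l : List X.E} {m : List Y.E} (hl : ∀ a ∈ l, rk a ≤ 1)
    (hm : ∀ a ∈ m, rk a ≤ 1) : mulAux X l (cls Y m) = (-1 : ℚ) ^ (l.length * m.length) •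
      (glueFun Y Y.isModularEmbedding m hm).toFun X l := by
  rw [mulAux_cls hm, glueWord, cls_swap hl hm, (cls_alt _).append_comm, List.length_map,
    List.length_map]
  rfl

/-- The product, as a family of endomorphisms which respects the relations. -/
noncomputable def mulFun (L : Type u) [Lattice L] [BoundedOrder L] [IsGeometricLattice L] :
    DiagramFun L (D L →ₗ[ℚ] D L) where
  toFun := mulAux
  alt X l₁ a b l₂ := D.hom_ext fun Y m hm => by
    have hm' : ∀ a ∈ m, rk a ≤ 1 := fun a ha => (rk_atom (hm a ha)).le
    rw [LinearMap.neg_apply, mulAux_cls hm', mulAux_cls hm']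
    exact (((cls_alt _).append_right _).map _) l₁ a b l₂
  bot X l hl := D.hom_ext fun Y m hm => by
    have hm' : ∀ a ∈ m, rk a ≤ 1 := fun a ha => (rk_atom (hm a ha)).le
    rw [mulAux_cls hm']
    exact cls_bot (List.mem_append_left _ (List.mem_map.2 ⟨⊥, hl, gr_bot⟩))
  emb X X' φ h l hl := D.hom_ext fun Y m hm => by
    have hm' : ∀ a ∈ m, rk a ≤ 1 := fun a ha => (rk_atom (hm a ha)).le
    have hl' : ∀ a ∈ l, rk a ≤ 1 := fun a ha => (rk_atom (hl a ha)).le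
    have hl'' : ∀ a ∈ l.map φ, rk a ≤ 1 := by
      intro a ha
      obtain ⟨b, hb, rfl⟩ := List.mem_map.1 ha
      rw [h.rk]; exact hl' b hb
    rw [mulAux_cls_swap hl'' hm', mulAux_cls_swap hl' hm', (glueFun Y _ m hm').emb X X' φ h l hl,
      List.length_map]
  span X l hl h := D.hom_ext fun Y m hm => by
    rw [mulAux_cls_swap (fun a ha => (rk_atom (hl a ha)).le)
      (fun a ha => (rk_atom (hm a ha)).le), (glueFun Y _ m _).span X l hl h, smul_zero]
    rfl
  split X l w z hl hF h hr hz hlw := D.hom_ext fun Y m hm => by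
    rw [mulAux_cls_swap (fun a ha => (rk_atom (hl a ha)).le)
      (fun a ha => (rk_atom (hm a ha)).le), (glueFun Y _ m _).split X l w z hl hF h hr hz hlw,
      smul_zero]
    rfl
  biv X G e f l hG hF he hf hl heG hfG hlG := D.hom_ext fun Y m hm => by
    rw [mulAux_cls_swap (l := e :: f :: l) ?_
      (fun a ha => (rk_atom (hm a ha)).le),
      (glueFun Y _ m _).biv X G e f l hG hF he hf hl heG hfG hlG, smul_zero]
    · rfl
    · intro a ha
      simp only [List.mem_cons] at ha
      rcases ha with rfl | rfl | ha
      · exact (rk_atom he).le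
      · exact (rk_atom hf).le
      · exact (rk_atom (hl a ha)).le

/-- The product of the space of diagrams. -/
noncomputable def mulMap (L : Type u) [Lattice L] [BoundedOrder L] [IsGeometricLattice L] :
    D L →ₗ[ℚ] D L →ₗ[ℚ] D L := (mulFun L).lift

theorem mulMap_cls {l : List X.E} {m : List Y.E} (hl : ∀ a ∈ l, rk a ≤ 1)
    (hm : ∀ a ∈ m, rk a ≤ 1) : mulMap L (cls X l) (cls Y m) =
      cls (X.glue Y Y.isModularEmbedding) (l.map (gl _) ++ m.map (gr X _)) := by
  rw [mulMap, DiagramFun.lift_cls _ hl, ← cls_swap hl hm]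
  exact mulAux_cls hm

/-- Multiplying on the right by a diagram is gluing this diagram, up to moving its word to the front. -/
theorem mulMap_cls_right {l : List X.E} {m : List Y.E} (hl : ∀ a ∈ l, rk a ≤ 1)
    (hm : ∀ a ∈ m, rk a ≤ 1) : mulMap L (cls X l) (cls Y m) =
      (-1 : ℚ) ^ (l.length * m.length) • glueMap Y Y.isModularEmbedding m hm (cls X l) := by
  rw [mulMap, DiagramFun.lift_cls _ hl, glueMap, DiagramFun.lift_cls _ hl]
  exact mulAux_cls_swap hl hm

theorem mulMap_comm_cls {l : List X.E} {m : List Y.E} (hl : ∀ a ∈ l, rk a ≤ 1)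
    (hm : ∀ a ∈ m, rk a ≤ 1) : mulMap L (cls X l) (cls Y m) =
      (-1 : ℚ) ^ (l.length * m.length) • mulMap L (cls Y m) (cls X l) := by
  rw [mulMap_cls hl hm, mulMap_cls hm hl, ← cls_swap hl hm, (cls_alt _).append_comm,
    List.length_map, List.length_map]

variable (L) in
/-- The unit of the space of diagrams. -/
noncomputable def oneD : D L := cls (ModularExtension.refl L) []

theorem isEmbedding_gl {β : K → Y.E} {hβ : IsModularEmbedding β} :
    IsEmbedding (gl (X := X) (Y := Y) hβ) :=
  ⟨fun _ _ h => congrArg fst h, gl_sup, fun _ h => isAtom_gl.2 h⟩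

theorem isEmbedding_gr {β : K → Y.E} {hβ : IsModularEmbedding β} :
    IsEmbedding (gr X (Y := Y) hβ) :=
  ⟨fun _ _ h => congrArg snd h, gr_sup, fun _ h => isAtom_gr.2 h⟩

theorem one_mulMap (x : D L) : mulMap L (oneD L) x = x := by
  have : mulMap L (oneD L) = LinearMap.id := D.hom_ext fun Y m hm => by
    rw [oneD, mulMap_cls (by simp) fun a ha => (rk_atom (hm a ha)).le]
    refine cls_emb (φ := gr _ _) ⟨isEmbedding_gr, ?_, fun _ => rfl⟩ hm
    have := rk_glue_top (X := ModularExtension.refl L) (Y := Y) (hβ := Y.isModularEmbedding)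
    change _ = rk (⊤ : L) + _ at this
    omega
  rw [this]; rfl

theorem mulMap_one (x : D L) : mulMap L x (oneD L) = x := by
  have : (mulMap L).flip (oneD L) = LinearMap.id := D.hom_ext fun Y m hm => by
    rw [LinearMap.flip_apply, oneD, mulMap_cls (fun a ha => (rk_atom (hm a ha)).le) (by simp)]
    rw [List.map_nil, List.append_nil]
    refine cls_emb (φ := gl _) ⟨isEmbedding_gl, ?_, fun a => (gl_ι a).symm⟩ hm
    have := rk_glue_top (X := Y) (Y := ModularExtension.refl L)
      (hβ := (ModularExtension.refl L).isModularEmbedding)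
    change _ = _ + rk (⊤ : L) at this
    omega
  exact LinearMap.congr_fun this x

theorem trace_glue (p : (X.glue Y Y.isModularEmbedding).E) :
    (X.glue Y Y.isModularEmbedding).trace p = Y.trace (snd p) :=
  eq_of_forall_le_iff fun a => by
    rw [← ι_le_iff_le_trace, ← ι_le_iff_le_trace, glue_ι, gr_le_iff]

/-- The associativity of pushouts. -/
noncomputable def assocIso (X Y Z : ModularExtension L) :
    ((X.glue Y Y.isModularEmbedding).glue Z Z.isModularEmbedding).E ≃o
      (X.glue (Y.glue Z Z.isModularEmbedding)
        (Y.glue Z Z.isModularEmbedding).isModularEmbedding).E where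
  toFun q := pair _ (fst (fst q)) (pair _ (snd (fst q)) (snd q) (by
    rw [← trace_glue, trace_fst])) (by
    rw [trace_glue, snd_pair, trace_fst, ← trace_glue, trace_fst])
  invFun q := pair _ (pair _ (fst q) (fst (snd q)) (by
    rw [trace_fst, trace_glue, trace_fst])) (snd (snd q)) (by
    rw [trace_glue, snd_pair, trace_fst])
  left_inv _ := rfl
  right_inv _ := rfl
  map_rel_iff' := by
    intro p q
    exact and_assoc.symm

theorem mulMap_assoc (x y z : D L) :
    mulMap L (mulMap L x y) z = mulMap L x (mulMap L y z) := by
  refine D.induction (p := fun x => ∀ y z, mulMap L (mulMap L x y) z = mulMap L x (mulMap L y z)) x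
    (by simp) (fun x y hx hy => by simp [hx, hy]) (fun r x hx => by simp [hx])
    (fun X l hl y z => ?_) y z
  refine D.induction (p := fun y => ∀ z, mulMap L (mulMap L (cls X l) y) z =
      mulMap L (cls X l) (mulMap L y z)) y
    (by simp) (fun x y hx hy => by simp [hx, hy]) (fun r x hx => by simp [hx])
    (fun Y m hm z => ?_) z
  refine D.induction (p := fun z => mulMap L (mulMap L (cls X l) (cls Y m)) z =
      mulMap L (cls X l) (mulMap L (cls Y m) z)) z
    (by simp) (fun x y hx hy => by simp [hx, hy]) (fun r x hx => by simp [hx])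
    fun Z n hn => ?_
  have hl' : ∀ a ∈ l, rk a ≤ 1 := fun a ha => (rk_atom (hl a ha)).le
  have hm' : ∀ a ∈ m, rk a ≤ 1 := fun a ha => (rk_atom (hm a ha)).le
  have hn' : ∀ a ∈ n, rk a ≤ 1 := fun a ha => (rk_atom (hn a ha)).le
  have key : ∀ {X Y : ModularExtension L} {l : List X.E} {m : List Y.E}, (∀ a ∈ l, rk a ≤ 1) →
      (∀ a ∈ m, rk a ≤ 1) →
      ∀ a ∈ l.map (gl Y.isModularEmbedding) ++ m.map (gr X Y.isModularEmbedding), rk a ≤ 1 := by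
    intro X Y l m hl hm a ha
    exact rk_le_one_glueWord hm hl a (List.mem_append.2 (List.mem_append.1 ha).symm)
  rw [mulMap_cls hl' hm', mulMap_cls hm' hn', mulMap_cls (key hl' hm') hn',
    mulMap_cls hl' (key hm' hn')]
  refine (clsFun L).iso (assocIso X Y Z) (fun a => ?_) (key (key hl' hm') hn') ?_
  · refine eq_of_forall_ge_iff fun q => ?_
    rw [glue_ι, gr_le_iff, glue_ι, gr_le_iff, ← OrderIso.le_symm_apply, glue_ι, gr_le_iff]
    rfl
  · simp only [List.map_append, List.map_map, List.append_assoc]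
    refine congrArg₂ _ (List.map_congr_left fun x _ => ?_) (congrArg₂ _
      (List.map_congr_left fun x _ => ?_) (List.map_congr_left fun x _ => ?_))
    · refine eq_of_forall_ge_iff fun q => ?_
      rw [Function.comp_apply, Function.comp_apply, gl_le_iff, ← OrderIso.le_symm_apply,
        gl_le_iff, gl_le_iff]
      rfl
    · refine eq_of_forall_ge_iff fun q => ?_
      rw [Function.comp_apply, Function.comp_apply, Function.comp_apply, gr_le_iff,
        ← OrderIso.le_symm_apply, gl_le_iff, gl_le_iff, gr_le_iff]
      rfl
    · refine eq_of_forall_ge_iff fun q => ?_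
      rw [Function.comp_apply, Function.comp_apply, gr_le_iff, ← OrderIso.le_symm_apply,
        gr_le_iff, gr_le_iff]
      rfl

theorem dTerm_eq_cls (X : ModularExtension L) (b : X.E) (l : List X.E) :
    dTerm X b l = 0 ∨ ∃ (hb : IsAtom b) (h : ¬ b ≤ X.F),
      dTerm X b l = cls (X.contract ⟨b, hb⟩ h) (l.map (X.cup ⟨b, hb⟩ h)) := by
  by_cases h : IsAtom b ∧ ¬ b ≤ X.F
  · by_cases h' : b ≤ X.F ⊔ jn l
    · exact .inr ⟨h.1, h.2, by rw [dTerm_of_le h', ctr_of h.1 h.2]⟩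
    · exact .inl (if_neg h')
  · exact .inl (dTerm_eq_zero (ctr_of_not h _))

/-- The contraction of a letter of the first factor of a product. -/
theorem dTerm_mul {b : X.E} (hb : IsAtom b) {l : List X.E} {m : List Y.E}
    (hl : ∀ a ∈ l, rk a ≤ 1) (hm : ∀ a ∈ m, rk a ≤ 1) :
    dTerm (X.glue Y Y.isModularEmbedding) (gl _ b) (l.map (gl _) ++ m.map (gr X _)) =
      mulMap L (dTerm X b l) (cls Y m) := by
  have h1 : dTerm (X.glue Y Y.isModularEmbedding) (gl _ b) (l.map (gl _) ++ m.map (gr X _)) =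
      (-1 : ℚ) ^ (l.length * m.length) • glueMap Y Y.isModularEmbedding m hm (dTerm X b l) := by
    rw [← dTerm_glue hm le_sup_left hb (fun h => ?_) hl, (dTerm_alt _ _).append_comm, List.length_map,
      List.length_map]
    · rfl
    · rw [glue_F]
      exact (gl_le_iff.2 h).trans (gl_ι ⊤).le
  rw [h1]
  rcases dTerm_eq_cls X b l with h | ⟨hb', h, h2⟩
  · simp [h]
  · rw [h2, mulMap_cls_right (rk_le_one_map_cup hl) hm, List.length_map]

theorem dMap_mulMap_cls {l : List X.E} {m : List Y.E} (hl : ∀ a ∈ l, IsAtom a)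
    (hm : ∀ a ∈ m, IsAtom a) : dMap L (mulMap L (cls X l) (cls Y m)) =
      mulMap L (dMap L (cls X l)) (cls Y m) +
        (-1 : ℚ) ^ l.length • mulMap L (cls X l) (dMap L (cls Y m)) := by
  have hl' : ∀ a ∈ l, rk a ≤ 1 := fun a ha => (rk_atom (hl a ha)).le
  have hm' : ∀ a ∈ m, rk a ≤ 1 := fun a ha => (rk_atom (hm a ha)).le
  rw [mulMap_cls hl' hm', dMap_cls fun a ha =>
    rk_le_one_glueWord hm' hl' a (List.mem_append.2 (List.mem_append.1 ha).symm),
    dMap_cls hl', dMap_cls hm', dsum_append, dsum_map, dsum_map, List.length_map]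
  congr 1
  · refine Eq.trans (dsum_congr fun b l' hb => ?_)
      (map_dsum ((mulMap L).flip (cls Y m)) l (dTerm X)).symm
    exact dTerm_mul (hl b (hb.mem_iff.1 (by simp)))
      (fun a ha => hl' a (hb.mem_iff.1 (by simp [ha]))) hm'
  · congr 1
    -- A letter of the second factor becomes a letter of the first one after exchanging the factors.
    refine Eq.trans (dsum_congr fun c m' hc => ?_) (map_dsum (mulMap L (cls X l)) m (dTerm Y)).symm
    have hca : IsAtom c := hm c (hc.mem_iff.1 (by simp))
    have hm'' : ∀ a ∈ m', rk a ≤ 1 := fun a ha => hm' a (hc.mem_iff.1 (by simp [ha]))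
    have h1 := dTerm_emb (IsMap.of_orderIso (X := X.glue Y Y.isModularEmbedding)
      (Y := Y.glue X X.isModularEmbedding) (swapIso X Y) swapIso_ι)
      (b := gr X _ c) (l := l.map (gl _) ++ m'.map (gr X _)) fun a ha =>
        rk_le_one_glueWord hm'' hl' a (List.mem_append.2 (List.mem_append.1 ha).symm)
    rw [← h1, List.map_append, List.map_map, List.map_map]
    change dTerm (Y.glue X X.isModularEmbedding) (gl _ c) (l.map (gr Y _) ++ m'.map (gl _)) = _
    rw [(dTerm_alt _ _).append_comm, dTerm_mul hca hm'' hl', List.length_map, List.length_map]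
    rcases dTerm_eq_cls Y c m' with h | ⟨hc', h, h2⟩
    · simp [h]
    · rw [h2, mulMap_comm_cls hl' (rk_le_one_map_cup hm''), List.length_map]

/-! #### The grading -/

/-- The degree of a non-vanishing diagram with `n` letters. As the word and `F` span and `F` is
modular, only the corank of `F` and the number of letters matter. -/
noncomputable def deg (X : ModularExtension L) (n : ℕ) : ℤ :=
  n - 2 * ((rk (⊤ : X.E) : ℤ) - rk (⊤ : L))

variable (L) in
/-- The homogeneous elements of degree `k`. -/
noncomputable def grD (k : ℤ) : Submodule ℚ (D L) :=
  Submodule.span ℚ {x | ∃ (X : ModularExtension L) (l : List X.E), (∀ a ∈ l, IsAtom a) ∧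
    deg X l.length = k ∧ cls X l = x}

theorem cls_mem_grD {k : ℤ} {l : List X.E} (h : deg X l.length = k) : cls X l ∈ grD L k := by
  by_cases hl : ∀ a ∈ l, IsAtom a
  · exact Submodule.subset_span ⟨X, l, hl, h, rfl⟩
  · rw [cls, dif_neg hl]; exact Submodule.zero_mem _

open Classical in
/-- The projection onto the homogeneous elements of degree `k`, as a family which respects the
relations. -/
noncomputable def projFun (L : Type u) [Lattice L] [BoundedOrder L] [IsGeometricLattice L] (k : ℤ) :
    DiagramFun L (D L) where
  toFun X l := if deg X l.length = k then cls X l else 0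
  alt X := (cls_alt X).ite _ fun l l' h => by rw [h.length_eq]
  bot X l h := by rw [cls_bot h, ite_self]
  emb X Y φ h l hl := by
    rw [cls_emb h hl, List.length_map, deg, deg, h.rk_top]
  span X l hl h := by rw [cls_span hl h, ite_self]
  split X l w z hl hF h hr hz hlw := by rw [cls_split hl hF h hr hz hlw, ite_self]
  biv X G e f l hG hF he hf hl heG hfG hlG := by
    rw [cls_biv hG hF he hf hl heG hfG hlG, ite_self]

/-- The projections separate the homogeneous parts, which makes the grading a direct sum. -/
theorem proj_of_mem {k : ℤ} {x : D L} (hx : x ∈ grD L k) (j : ℤ) :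
    (projFun L j).lift x = if k = j then x else 0 := by
  induction hx using Submodule.span_induction with
  | mem x hx =>
    obtain ⟨X, l, hl, rfl, rfl⟩ := hx
    rw [DiagramFun.lift_cls _ fun a ha => (rk_atom (hl a ha)).le]
    rfl
  | zero => simp
  | add x y _ _ hx hy => rw [map_add, hx, hy]; split_ifs <;> simp
  | smul r x _ hx => rw [map_smul, hx]; split_ifs <;> simp

theorem proj_mem (k : ℤ) (x : D L) : (projFun L k).lift x ∈ grD L k := by
  refine D.induction (p := fun x => (projFun L k).lift x ∈ grD L k) x (by simp)
    (fun x y hx hy => by rw [map_add]; exact Submodule.add_mem _ hx hy)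
    (fun r x hx => by rw [map_smul]; exact Submodule.smul_mem _ _ hx) fun X l hl => ?_
  rw [DiagramFun.lift_cls _ fun a ha => (rk_atom (hl a ha)).le]
  change (if deg X l.length = k then cls X l else 0) ∈ _
  split_ifs with h
  · exact cls_mem_grD h
  · exact Submodule.zero_mem _

theorem isInternal_grD : DirectSum.IsInternal (grD L) := by
  rw [DirectSum.isInternal_submodule_iff_iSupIndep_and_iSup_eq_top]
  constructor
  · rw [iSupIndep_def]
    intro k
    rw [Submodule.disjoint_def]
    intro x hx hx'
    have h1 : ⨆ j, ⨆ (_ : j ≠ k), grD L j ≤ LinearMap.ker (projFun L k).lift :=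
      iSup₂_le fun j hj y hy => LinearMap.mem_ker.2 (by rw [proj_of_mem hy, if_neg hj])
    have h2 := LinearMap.mem_ker.1 (h1 hx')
    rwa [proj_of_mem hx, if_pos rfl] at h2
  · refine eq_top_iff.2 fun x _ => ?_
    refine D.induction (p := fun x => x ∈ ⨆ k, grD L k) x (Submodule.zero_mem _)
      (fun x y => Submodule.add_mem _) (fun r x => Submodule.smul_mem _ r) fun X l _ => ?_
    exact Submodule.mem_iSup_of_mem _ (cls_mem_grD rfl)

theorem dsum_mem {α V : Type*} [AddCommGroup V] [Module ℚ V] {S : Submodule ℚ V} {l : List α}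
    {f : α → List α → V} (h : ∀ b l', (b :: l').Perm l → f b l' ∈ S) : dsum l f ∈ S := by
  rw [← Submodule.Quotient.mk_eq_zero, ← Submodule.mkQ_apply, map_dsum]
  exact dsum_eq_zero fun b l' hb => (Submodule.Quotient.mk_eq_zero S).2 (h b l' hb)

theorem dTerm_mem {b : X.E} {l : List X.E} {k : ℤ} (h : deg X (l.length + 1) = k) :
    dTerm X b l ∈ grD L (k + 1) := by
  rcases dTerm_eq_cls X b l with h1 | ⟨hb, hF, h1⟩
  · rw [h1]; exact Submodule.zero_mem _
  · rw [h1]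
    refine cls_mem_grD ?_
    have h2 := rk_contract_top (b := ⟨b, hb⟩) (h := hF)
    rw [deg] at h ⊢
    rw [List.length_map]
    push_cast at h
    omega

theorem dMap_mem {k : ℤ} {x : D L} (hx : x ∈ grD L k) : dMap L x ∈ grD L (k + 1) := by
  induction hx using Submodule.span_induction with
  | mem x hx =>
    obtain ⟨X, l, hl, hk, rfl⟩ := hx
    rw [dMap_cls fun a ha => (rk_atom (hl a ha)).le]
    exact dsum_mem fun b l' hb => dTerm_mem (by rw [← hk, ← hb.length_eq]; rfl)
  | zero => simp
  | add x y _ _ hx hy => rw [map_add]; exact Submodule.add_mem _ hx hy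
  | smul r x _ hx => rw [map_smul]; exact Submodule.smul_mem _ _ hx

theorem mulMap_mem {k j : ℤ} {x y : D L} (hx : x ∈ grD L k) (hy : y ∈ grD L j) :
    mulMap L x y ∈ grD L (k + j) := by
  induction hx using Submodule.span_induction with
  | mem x hx =>
    obtain ⟨X, l, hl, hk, rfl⟩ := hx
    induction hy using Submodule.span_induction with
    | mem y hy =>
      obtain ⟨Y, m, hm, hj, rfl⟩ := hy
      rw [mulMap_cls (fun a ha => (rk_atom (hl a ha)).le) fun a ha => (rk_atom (hm a ha)).le]
      refine cls_mem_grD ?_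
      have := rk_glue_top (X := X) (hβ := Y.isModularEmbedding)
      rw [deg] at hk hj ⊢
      rw [List.length_append, List.length_map, List.length_map]
      push_cast
      omega
    | zero => simp
    | add x y _ _ hx hy => rw [map_add]; exact Submodule.add_mem _ hx hy
    | smul r x _ hx => rw [map_smul]; exact Submodule.smul_mem _ _ hx
  | zero => simp
  | add x y _ _ hx hy => rw [map_add, LinearMap.add_apply]; exact Submodule.add_mem _ hx hy
  | smul r x _ hx => rw [map_smul, LinearMap.smul_apply]; exact Submodule.smul_mem _ _ hx

theorem neg_one_zpow_eq {a b c : ℤ} (h : a = b + 2 * c) : (-1 : ℚ) ^ a = (-1 : ℚ) ^ b := by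
  rw [h, zpow_add₀ (by norm_num), zpow_mul]
  norm_num

theorem mulMap_comm {k j : ℤ} {x y : D L} (hx : x ∈ grD L k) (hy : y ∈ grD L j) :
    mulMap L x y = (-1 : ℚ) ^ (k * j) • mulMap L y x := by
  induction hx using Submodule.span_induction with
  | mem x hx =>
    obtain ⟨X, l, hl, hk, rfl⟩ := hx
    induction hy using Submodule.span_induction with
    | mem y hy =>
      obtain ⟨Y, m, hm, hj, rfl⟩ := hy
      rw [mulMap_comm_cls (fun a ha => (rk_atom (hl a ha)).le) fun a ha => (rk_atom (hm a ha)).le]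
      congr 1
      rw [← zpow_natCast]
      refine (neg_one_zpow_eq (c := -(l.length * ((rk (⊤ : Y.E) : ℤ) - rk (⊤ : L)) +
        ((rk (⊤ : X.E) : ℤ) - rk (⊤ : L)) * m.length -
        2 * ((rk (⊤ : X.E) : ℤ) - rk (⊤ : L)) * ((rk (⊤ : Y.E) : ℤ) - rk (⊤ : L)))) ?_).symm
      rw [← hk, ← hj, deg, deg]
      push_cast
      ring
    | zero => simp
    | add x y _ _ hx hy => rw [map_add, map_add, LinearMap.add_apply, hx, hy, smul_add]
    | smul r x _ hx => rw [map_smul, map_smul, LinearMap.smul_apply, hx, smul_comm]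
  | zero => simp
  | add x y _ _ hx hy => rw [map_add, map_add, LinearMap.add_apply, hx, hy, smul_add]
  | smul r x _ hx => rw [map_smul, map_smul, LinearMap.smul_apply, hx, smul_comm]

theorem dMap_mulMap {k : ℤ} {x : D L} (hx : x ∈ grD L k) (y : D L) :
    dMap L (mulMap L x y) = mulMap L (dMap L x) y + (-1 : ℚ) ^ k • mulMap L x (dMap L y) := by
  induction hx using Submodule.span_induction with
  | mem x hx =>
    obtain ⟨X, l, hl, hk, rfl⟩ := hx
    have hs : (-1 : ℚ) ^ k = (-1 : ℚ) ^ l.length := by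
      rw [← zpow_natCast]
      exact neg_one_zpow_eq (c := -((rk (⊤ : X.E) : ℤ) - rk (⊤ : L))) (by rw [← hk, deg]; ring)
    rw [hs]
    refine D.induction (p := fun y => dMap L (mulMap L (cls X l) y) =
      mulMap L (dMap L (cls X l)) y + (-1 : ℚ) ^ l.length • mulMap L (cls X l) (dMap L y)) y
      (by simp) (fun x y hx hy => ?_) (fun r x hx => ?_) fun Y m hm => dMap_mulMap_cls hl hm
    · simp only [map_add, hx, hy, smul_add]; abel
    · simp only [map_smul, hx, smul_add, smul_comm r]
  | zero => simp
  | add x y _ _ hx hy => simp only [map_add, LinearMap.add_apply, hx, hy, smul_add]; abel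
  | smul r x _ hx => simp only [map_smul, LinearMap.smul_apply, hx, smul_add, smul_comm r]

end Product

end ModDiag

namespace ModDiag

/-! ### Orlik–Solomon algebras -/

section OrlikSolomon

variable {L : Type u} [Lattice L] [BoundedOrder L] [IsGeometricLattice L]

open Classical in
/-- The generator of the Orlik–Solomon algebra attached to an element of the lattice: it is zero for
elements which are not atoms. -/
noncomputable def gen (a : L) : OS L := if h : IsAtom a then OS.gen ⟨a, h⟩ else 0

/-- The product of the generators attached to the letters of a word. -/
noncomputable def genProd (l : List L) : OS L := (l.map gen).prod

@[simp] theorem genProd_nil : genProd ([] : List L) = 1 := rfl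

@[simp] theorem genProd_cons (a : L) (l : List L) : genProd (a :: l) = gen a * genProd l := by
  simp [genProd]

theorem genProd_append (l m : List L) : genProd (l ++ m) = genProd l * genProd m := by
  simp [genProd]

theorem gen_coe (a : Atoms L) : gen (a : L) = OS.gen a := dif_pos a.2

theorem gen_of_not {a : L} (h : ¬ IsAtom a) : gen a = 0 := dif_neg h

theorem gen_bot : gen (⊥ : L) = 0 := gen_of_not fun h => h.1 rfl

theorem genProd_eq_zero {l : List L} {a : L} (ha : a ∈ l) (h : gen a = 0) : genProd l = 0 :=
  List.prod_eq_zero (List.mem_map.2 ⟨a, ha, h⟩)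

theorem extGen_add_mul_swap (a b : Atoms L) : extGen a * extGen b + extGen b * extGen a = 0 :=
  ExteriorAlgebra.ι_add_mul_swap _ _

theorem gen_mul_gen (a b : L) : gen a * gen b = -(gen b * gen a) := by
  by_cases ha : IsAtom a
  · by_cases hb : IsAtom b
    · lift a to Atoms L using ha
      lift b to Atoms L using hb
      rw [gen_coe, gen_coe, OS.gen, OS.gen, ← map_mul, ← map_mul, ← map_neg]
      rw [eq_neg_of_add_eq_zero_left (extGen_add_mul_swap a b)]
    · simp [gen_of_not hb]
  · simp [gen_of_not ha]

theorem gen_mul_self (a : L) : gen a * gen a = 0 := by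
  have h := gen_mul_gen a a
  rw [eq_neg_iff_add_eq_zero, ← two_smul ℚ] at h
  exact (smul_eq_zero.1 h).resolve_left two_ne_zero

theorem prod_isAlt {α A : Type*} [Ring A] [Algebra ℚ A] {g : α → A}
    (h : ∀ a b, g a * g b = -(g b * g a)) : IsAlt fun l : List α => (l.map g).prod := by
  intro l₁ a b l₂
  simp only [List.map_append, List.map_cons, List.prod_append, List.prod_cons]
  rw [← mul_assoc (g a), h, neg_mul, mul_neg, mul_assoc]

theorem genProd_alt : IsAlt (genProd (L := L)) := prod_isAlt gen_mul_gen

/-- The sum `δ` over a word in the generators. -/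
theorem extδ_prod (l : List (Atoms L)) :
    extδ (l.map extGen).prod = dsum l fun _ l' => (l'.map extGen).prod := by
  induction l with
  | nil => simp [extδ, CliffordAlgebra.contractLeft_one]
  | cons a l ih =>
    rw [dsum_cons, List.map_cons, List.prod_cons, extδ, extGen, ExteriorAlgebra.ι,
      CliffordAlgebra.contractLeft_ι_mul, Finsupp.linearCombination_single, one_smul, one_smul]
    congr 1
    change extGen a * extδ _ = _
    rw [ih]
    refine (map_dsum (LinearMap.mulLeft ℚ (extGen a)) l _).trans (dsum_congr fun b l' _ => ?_)
    simp

theorem sup_toFinset_eq_jn [DecidableEq (Atoms L)] (l : List (Atoms L)) :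
    l.toFinset.sup Subtype.val = jn (l.map Subtype.val) := by
  induction l with
  | nil => simp
  | cons a l ih => rw [List.toFinset_cons, Finset.sup_insert, ih]; rfl

open Classical in
/-- A word in distinct atoms is a circuit if it is dependent but becomes independent after removing
any of its letters. -/
theorem isCircuit_toFinset {l : List (Atoms L)} (hl : l.Nodup) :
    IsCircuit l.toFinset ↔ rk (jn (l.map Subtype.val)) + 1 = l.length ∧
      ∀ c l', (c :: l').Perm l → rk (jn (l'.map Subtype.val)) + 1 = l.length := by
  rw [IsCircuit, sup_toFinset_eq_jn, List.toFinset_card_of_nodup hl]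
  refine and_congr_right fun _ => ⟨fun h c l' hc => ?_, fun h c hc => ?_⟩
  · have hn : (c :: l').Nodup := hc.nodup_iff.2 hl
    have := h c (List.mem_toFinset.2 (hc.mem_iff.1 (by simp)))
    rwa [← List.toFinset_eq_of_perm _ _ hc, List.toFinset_cons, Finset.erase_insert (by
      simpa using (List.nodup_cons.1 hn).1), sup_toFinset_eq_jn] at this
  · have hp := List.perm_cons_erase (List.mem_toFinset.1 hc)
    have hn : (c :: l.erase c).Nodup := hp.nodup_iff.1 hl
    have := h c (l.erase c) hp.symm
    rwa [List.toFinset_eq_of_perm _ _ hp, List.toFinset_cons, Finset.erase_insert (by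
      simpa using (List.nodup_cons.1 hn).1), sup_toFinset_eq_jn]

/-- The defining relations of the Orlik–Solomon algebra, as alternating sums over the letters of a
circuit. -/
theorem delta_gen_eq_zero {l : List (Atoms L)} (hl : l.Nodup)
    (h : rk (jn (l.map Subtype.val)) + 1 = l.length ∧
      ∀ c l', (c :: l').Perm l → rk (jn (l'.map Subtype.val)) + 1 = l.length) :
    (dsum l fun _ l' => (l'.map OS.gen).prod) = 0 := by
  classical
  have h1 := OSRel.circuit l.toFinset ((isCircuit_toFinset hl).2 h) l
    (congrArg Finset.val (List.toFinset_eq hl) : _)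
  have h2 := RingQuot.mkAlgHom_rel ℚ h1
  rw [extδ_prod, map_zero] at h2
  have h3 := map_dsum (RingQuot.mkAlgHom ℚ (OSRel (L := L))).toLinearMap l
    fun _ l' => (l'.map extGen).prod
  refine Eq.trans (dsum_congr fun b l' _ => ?_) (h3.symm.trans h2)
  rw [AlgHom.toLinearMap_apply, map_list_prod, List.map_map]
  rfl

theorem dsum_genProd_cons (a : L) (l : List L) :
    (dsum (a :: l) fun _ l' => genProd l') =
      genProd l - gen a * dsum l fun _ l' => genProd l' := by
  rw [dsum_cons]
  congr 1
  refine Eq.trans (dsum_congr fun b l' _ => ?_)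
    (map_dsum (LinearMap.mulLeft ℚ (gen a)) l fun _ l' => genProd l').symm
  simp

theorem dsum_genProd_alt : IsAlt fun l : List L => dsum l fun _ l' => genProd l' :=
  IsAlt.dsum fun _ => genProd_alt

/-- The relations of the Orlik–Solomon algebra hold for all dependent words, not only for the
circuits. -/
theorem dependent_relations {l : List L} (hl : ∀ a ∈ l, IsAtom a) (h : rk (jn l) < l.length) :
    genProd l = 0 ∧ (dsum l fun _ l' => genProd l') = 0 := by
  induction hn : l.length generalizing l with
  | zero => omega
  | succ n ih =>
    by_cases hd : l.Nodup
    swap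
    · exact ⟨genProd_alt.eq_zero_of_not_nodup hd, dsum_genProd_alt.eq_zero_of_not_nodup hd⟩
    -- Either a smaller dependent word is obtained by removing a letter `c`, and the relations for `l`
    -- follow from those for the smaller word, or the word is a circuit.
    by_cases hc : ∃ c l', (c :: l').Perm l ∧ rk (jn l') < l'.length
    · obtain ⟨c, l', hp, hr⟩ := hc
      have := ih (fun a ha => hl a (hp.mem_iff.1 (by simp [ha]))) hr (by
        have := hp.length_eq
        simp only [List.length_cons] at this
        omega)
      exact ⟨genProd_alt.eq_zero_of_perm hp.symm (by rw [genProd_cons, this.1, mul_zero]),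
        dsum_genProd_alt.eq_zero_of_perm hp.symm (by
          rw [dsum_genProd_cons, this.1, this.2, mul_zero, sub_zero])⟩
    · push Not at hc
      have hδ : (dsum l fun _ l' => genProd l') = 0 := by
        lift l to List (Atoms L) using hl
        rw [List.length_map] at h
        have hd' : l.Nodup := hd.of_map _
        have hl0 : l ≠ [] := by rintro rfl; simp at h
        have hcirc : ∀ c l', (c :: l').Perm l → rk (jn (l'.map Subtype.val)) + 1 = l.length := by
          intro c l' hp
          have h1 := hc c (l'.map Subtype.val) (hp.map Subtype.val)
          have h2 := hp.length_eq
          have h3 := rk_mono (show jn (l'.map Subtype.val) ≤ jn (l.map Subtype.val) from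
            jn_le_iff.2 fun a ha => le_jn (by
              obtain ⟨b, hb, rfl⟩ := List.mem_map.1 ha
              exact List.mem_map_of_mem (hp.mem_iff.1 (by simp [hb]))))
          simp only [List.length_cons, List.length_map] at h1 h2
          omega
        have hr : rk (jn (l.map Subtype.val)) + 1 = l.length := by
          obtain ⟨c, l', rfl⟩ := List.exists_cons_of_ne_nil hl0
          have h1 := hcirc c l' (List.Perm.refl _)
          have h3 := rk_mono (show jn (l'.map Subtype.val) ≤ jn ((c :: l').map Subtype.val) from
            le_sup_right)
          omega
        rw [dsum_map]
        refine Eq.trans (dsum_congr fun b l' _ => ?_) (delta_gen_eq_zero hd' ⟨hr, hcirc⟩)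
        rw [genProd, List.map_map]
        exact congrArg List.prod (List.map_congr_left fun a _ => gen_coe a)
      -- Multiplying `δ(e_C) = 0` by a letter `c` of `C` gives `e_C = 0`.
      refine ⟨?_, hδ⟩
      cases l with
      | nil => simp at hn
      | cons c l =>
        rw [dsum_genProd_cons, sub_eq_zero] at hδ
        rw [genProd_cons, hδ, ← mul_assoc, gen_mul_self, zero_mul]

theorem genProd_eq_zero_of_rk {l : List L} (hl : ∀ a ∈ l, rk a ≤ 1) (h : rk (jn l) < l.length) :
    genProd l = 0 := by
  rcases DiagramFun.atoms_or_bot hl with h1 | h1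
  · exact (dependent_relations h1 h).1
  · exact genProd_eq_zero h1 gen_bot

/-- A variant of the relations of the Orlik–Solomon algebra where some letters may be `⊥`. -/
theorem dsum_genProd_eq_zero {l : List L} (hl : ∀ a ∈ l, rk a ≤ 1)
    (h : rk (jn l) + 1 < l.length ∨ ⊥ ∉ l ∧ rk (jn l) < l.length) :
    (dsum l fun _ l' => genProd l') = 0 := by
  classical
  by_cases h1 : ⊥ ∈ l
  · have hp := List.perm_cons_erase h1
    refine dsum_genProd_alt.eq_zero_of_perm hp ?_
    have h2 : rk (jn l) + 1 < l.length := h.resolve_right fun h' => h'.1 h1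
    rw [jn_perm hp, jn_cons, bot_sup_eq, hp.length_eq, List.length_cons] at h2
    rw [dsum_genProd_cons, gen_bot, zero_mul, sub_zero]
    exact genProd_eq_zero_of_rk (fun a ha => hl a (hp.mem_iff.2 (by simp [ha]))) (by omega)
  · exact (dependent_relations (fun a ha => (isAtom_or_bot (hl a ha)).resolve_right fun h' =>
      h1 (h' ▸ ha)) (by omega)).2

/-- The words in distinct atoms which are circuits. -/
structure IsCircuitWord (l : List L) : Prop where
  atoms : ∀ a ∈ l, IsAtom a
  nodup : l.Nodup
  rk_jn : rk (jn l) + 1 = l.length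
  rk_cons : ∀ c l', (c :: l').Perm l → rk (jn l') + 1 = l.length

theorem isCircuitWord_map {l : List (Atoms L)} {C : Finset (Atoms L)} (hC : IsCircuit C)
    (hl : (l : Multiset (Atoms L)) = C.val) : IsCircuitWord (l.map Subtype.val) := by
  classical
  have hn : l.Nodup := by
    rw [← Multiset.coe_nodup, hl]; exact C.nodup
  have hC' : C = l.toFinset := Finset.val_injective (by rw [← hl, ← List.toFinset_eq hn])
  rw [hC', isCircuit_toFinset hn] at hC
  refine ⟨?_, hn.map Subtype.val_injective, by rw [hC.1, List.length_map], fun c l' hp => ?_⟩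
  · intro a ha
    obtain ⟨b, _, rfl⟩ := List.mem_map.1 ha
    exact b.2
  · have hat : ∀ a ∈ c :: l', IsAtom a := fun a ha => by
      obtain ⟨b, _, rfl⟩ := List.mem_map.1 (hp.mem_iff.1 ha)
      exact b.2
    have h2 : ∀ a ∈ l', IsAtom a := fun a ha => hat a (by simp [ha])
    have h1 : IsAtom c := hat c (by simp)
    lift l' to List (Atoms L) using h2
    lift c to Atoms L using h1
    rw [← List.map_cons, List.map_perm_map_iff Subtype.val_injective] at hp
    rw [hC.2 c l' hp, List.length_map]

theorem linearCombination_mul_self {A : Type v} [Ring A] [Algebra ℚ A] {α : Type w} {g : α → A}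
    (h : ∀ a b, g a * g b = -(g b * g a)) (x : α →₀ ℚ) :
    Finsupp.linearCombination ℚ g x * Finsupp.linearCombination ℚ g x = 0 := by
  have key : ∀ x y : α →₀ ℚ, Finsupp.linearCombination ℚ g x * Finsupp.linearCombination ℚ g y +
      Finsupp.linearCombination ℚ g y * Finsupp.linearCombination ℚ g x = 0 := by
    intro x y
    induction x using Finsupp.induction_linear with
    | zero => simp
    | add x x' hx hx' =>
      rw [map_add, add_mul, mul_add, add_add_add_comm, hx, hx', add_zero]
    | single a r =>
      induction y using Finsupp.induction_linear with
      | zero => simp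
      | add x x' hx hx' =>
        rw [map_add, add_mul, mul_add, add_add_add_comm, hx, hx', add_zero]
      | single b s =>
        rw [Finsupp.linearCombination_single, Finsupp.linearCombination_single, smul_mul_smul_comm,
          smul_mul_smul_comm, h a b, mul_comm s r, smul_neg, neg_add_cancel]
  have h1 := key x x
  rw [← two_smul ℚ] at h1
  exact (smul_eq_zero.1 h1).resolve_left two_ne_zero

/-- The universal property of the Orlik–Solomon algebra: anticommuting elements satisfying the circuit
relations define a morphism of algebras. -/
theorem exists_osHom {A : Type v} [Ring A] [Algebra ℚ A] (g : L → A)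
    (h : ∀ a b, g a * g b = -(g b * g a))
    (h' : ∀ l, IsCircuitWord l → (dsum l fun _ l' => (l'.map g).prod) = 0) :
    ∃ φ : OS L →ₐ[ℚ] A, ∀ l, (∀ a ∈ l, IsAtom a) → φ (genProd l) = (l.map g).prod := by
  let f : ExteriorAlgebra ℚ (Atoms L →₀ ℚ) →ₐ[ℚ] A := ExteriorAlgebra.lift ℚ
    ⟨Finsupp.linearCombination ℚ fun a : Atoms L => g a,
      linearCombination_mul_self fun a b => h a b⟩
  have hf : ∀ a, f (extGen a) = g a := fun a => by
    rw [extGen, ExteriorAlgebra.lift_ι_apply, Finsupp.linearCombination_single, one_smul]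
  have hf' : ∀ l : List (Atoms L), f (l.map extGen).prod = ((l.map Subtype.val).map g).prod := by
    intro l
    rw [map_list_prod, List.map_map, List.map_map]
    exact congrArg List.prod (List.map_congr_left fun a _ => hf a)
  have hrel : ∀ ⦃x y⦄, OSRel (L := L) x y → f x = f y := by
    rintro _ _ ⟨C, hC, l, hl⟩
    have h1 := h' _ (isCircuitWord_map hC hl)
    rw [dsum_map] at h1
    rw [map_zero, extδ_prod, ← h1]
    refine (map_dsum f.toLinearMap l _).trans (dsum_congr fun b l' _ => hf' l')
  refine ⟨RingQuot.liftAlgHom ℚ ⟨f, hrel⟩, fun l hl => ?_⟩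
  lift l to List (Atoms L) using hl
  rw [genProd, map_list_prod, List.map_map, List.map_map, List.map_map]
  refine congrArg List.prod (List.map_congr_left fun a _ => ?_)
  simp only [Function.comp_apply]
  rw [gen_coe, OS.gen, RingQuot.liftAlgHom_mkAlgHom_apply, hf]

end OrlikSolomon

/-! ### The morphism to the Orlik–Solomon algebra -/

section Integration

open ModularExtension

variable {L : Type u} [Lattice L] [BoundedOrder L] [IsGeometricLattice L]

open Classical in
/-- The morphism to the Orlik–Solomon algebra, as a family which respects the relations. -/
noncomputable def osFun (L : Type u) [Lattice L] [BoundedOrder L] [IsGeometricLattice L] :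
    DiagramFun L (OS L) where
  toFun X l := if X.F = ⊤ then genProd (l.map X.trace) else 0
  alt X := (genProd_alt.map _).ite (fun _ => X.F = ⊤) fun _ _ _ => Iff.rfl
  bot X l hl := by
    split_ifs
    · exact genProd_eq_zero (List.mem_map.2 ⟨⊥, hl, X.trace_bot⟩) gen_bot
    · rfl
  emb X Y φ h l hl := by
    have h1 : Y.F = ⊤ ↔ X.F = ⊤ := by rw [← h.map_F, h.eq_top]
    have h2 : (l.map φ).map Y.trace = l.map X.trace := by
      rw [List.map_map]
      exact List.map_congr_left fun a _ => h.trace a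
    simp only [h1, h2]
  span X l hl h := if_neg fun h' => h (by rw [h', top_sup_eq])
  split X l w z hl hF h hr hz hlw := if_neg fun h' => hz (by
    rw [h', top_le_iff] at hF
    rw [hF] at hr
    exact rk_eq_zero.1 (by omega))
  biv X G e f l hG hF he hf hl heG hfG hlG := if_neg fun h' => heG (by
    rw [h', top_le_iff] at hF
    rw [hF]
    exact le_top)

/-- The morphism to the Orlik–Solomon algebra. -/
noncomputable def osMap (L : Type u) [Lattice L] [BoundedOrder L] [IsGeometricLattice L] :
    D L →ₗ[ℚ] OS L := (osFun L).lift

variable {X Y : ModularExtension L}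

open Classical in
theorem osMap_cls {l : List X.E} (hl : ∀ a ∈ l, rk a ≤ 1) :
    osMap L (cls X l) = if X.F = ⊤ then genProd (l.map X.trace) else 0 := (osFun L).lift_cls hl

theorem osMap_one : osMap L (oneD L) = 1 := by
  rw [oneD, osMap_cls (by simp), if_pos]
  · rfl
  · rfl

theorem osMap_mul (x y : D L) : osMap L (mulMap L x y) = osMap L x * osMap L y := by
  refine D.induction (p := fun x => osMap L (mulMap L x y) = osMap L x * osMap L y) x
    (by simp) (fun x y hx hy => by simp [hx, hy, add_mul]) (fun r x hx => by simp [hx])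
    fun X l hl => ?_
  refine D.induction (p := fun y => osMap L (mulMap L (cls X l) y) = osMap L (cls X l) * osMap L y)
    y (by simp) (fun x y hx hy => by simp [hx, hy, mul_add]) (fun r x hx => by simp [hx])
    fun Y m hm => ?_
  have hl' : ∀ a ∈ l, rk a ≤ 1 := fun a ha => (rk_atom (hl a ha)).le
  have hm' : ∀ a ∈ m, rk a ≤ 1 := fun a ha => (rk_atom (hm a ha)).le
  rw [mulMap_cls hl' hm', osMap_cls fun a ha => rk_le_one_glueWord hm' hl' a
    (List.mem_append.2 (List.mem_append.1 ha).symm), osMap_cls hl', osMap_cls hm']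
  have hF : (X.glue Y Y.isModularEmbedding).F = ⊤ ↔ X.F = ⊤ ∧ Y.F = ⊤ := by
    have e : (X.glue Y Y.isModularEmbedding).F = pair _ X.F Y.F (by
        rw [trace_eq_top le_rfl, trace_eq_top le_rfl]) := by
      refine glue_ext ?_ rfl
      rw [glue_F, fst_gr, Y.trace_ι]
      rfl
    rw [e]
    exact ⟨fun h => ⟨congrArg fst h, congrArg snd h⟩, fun h => glue_ext h.1 h.2⟩
  by_cases h1 : X.F = ⊤
  · by_cases h2 : Y.F = ⊤
    · rw [if_pos h1, if_pos h2, if_pos (hF.2 ⟨h1, h2⟩), List.map_append, genProd_append,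
        List.map_map, List.map_map]
      refine congrArg₂ _ (congrArg genProd (List.map_congr_left fun a _ => ?_))
        (congrArg genProd (List.map_congr_left fun a _ => ?_))
      · rw [Function.comp_apply, trace_glue, ← trace_fst, fst_gl]
      · rw [Function.comp_apply, trace_glue, snd_gr]
    · rw [if_neg h2, if_neg fun h => h2 (hF.1 h).2, mul_zero]
  · rw [if_neg h1, if_neg fun h => h1 (hF.1 h).1, zero_mul]

/-- The trace of a letter after the contraction of `b` is the trace of the line through `b` and this
letter. -/
theorem trace_contract {b : Atoms X.E} {h : ¬ (b : X.E) ≤ X.F} (a : X.E) :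
    (X.contract b h).trace (X.cup b h a) = X.trace ((b : X.E) ⊔ a) :=
  eq_of_forall_le_iff fun c => by
    rw [← ι_le_iff_le_trace, ← ι_le_iff_le_trace, contract_ι, cup_le_cup]

theorem trace_atom_sup {b a : X.E} (hb : IsAtom b) (hbF : ¬ b ≤ X.F) (h : a ≤ X.F) :
    X.trace (b ⊔ a) = X.trace a := by
  apply X.embedding.injective
  have h1 := X.modular_F.inf_sup b h
  rw [X.inf_F_eq_bot hb hbF, sup_bot_eq] at h1
  rw [ι_trace, ι_trace, inf_comm, sup_comm, h1, inf_eq_left.2 h]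

section Coatom

variable (htop : rk (⊤ : X.E) = rk X.F + 1)
include htop

theorem rk_trace_of_not_le {x : X.E} (h : ¬ x ≤ X.F) : rk (X.trace x) + 1 = rk x := by
  have h1 := X.rk_trace x
  have h2 : rk X.F < rk (X.F ⊔ x) := rk_strictMono (left_lt_sup.2 h)
  have h3 : rk (X.F ⊔ x) ≤ rk (⊤ : X.E) := rk_mono le_top
  have h4 := X.rk_F
  omega

theorem sup_eq_top_of_not_le {x : X.E} (h : ¬ x ≤ X.F) : X.F ⊔ x = ⊤ := by
  have h2 : rk X.F < rk (X.F ⊔ x) := rk_strictMono (left_lt_sup.2 h)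
  exact eq_top_of_rk (by omega)

/-- The relation satisfied by the traces of the three lines through three points. -/
theorem gen_trace_relation {a b c : X.E} (ha : IsAtom a) (hb : IsAtom b) (hc : IsAtom c)
    (haF : ¬ a ≤ X.F) (hbF : ¬ b ≤ X.F) (hcF : ¬ c ≤ X.F) :
    gen (X.trace (b ⊔ a)) * gen (X.trace (b ⊔ c)) =
      gen (X.trace (b ⊔ a)) * gen (X.trace (a ⊔ c)) -
        gen (X.trace (b ⊔ c)) * gen (X.trace (c ⊔ a)) := by
  have hself : ∀ {a : X.E}, IsAtom a → ¬ a ≤ X.F → gen (X.trace (a ⊔ a)) = 0 := fun {a} ha h => by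
    have h1 := rk_trace_of_not_le htop h
    rw [rk_atom ha] at h1
    have h2 : X.trace a = ⊥ := rk_eq_zero.1 (by omega)
    rw [sup_idem, h2, gen_bot]
  by_cases hab : a = b
  · subst hab
    rw [hself ha haF, zero_mul, sup_comm c, gen_mul_self, sub_zero]
  by_cases hac : a = c
  · subst hac
    rw [hself ha haF, mul_zero, gen_mul_self, sub_zero]
  by_cases hbc : b = c
  · subst hbc
    rw [hself hb hbF, mul_zero, zero_mul, sub_zero, sup_comm a b, gen_mul_self]
  have hline : ∀ {a b : X.E}, IsAtom a → IsAtom b → ¬ a ≤ X.F → a ≠ b → IsAtom (X.trace (a ⊔ b)) := by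
    intro a b ha hb h hab
    have h1 := rk_sup_atom ha fun h' => hab (atom_eq_of_le ha hb h')
    have h2 := rk_trace_of_not_le htop (x := a ⊔ b) fun h' => h (le_sup_left.trans h')
    rw [rk_atom hb, sup_comm] at h1
    rw [isAtom_iff_rk]
    omega
  have h1 : rk (a ⊔ b ⊔ c) ≤ 3 := by
    have h2 := rk_sup_le (a ⊔ b) c
    have h3 := rk_sup_le a b
    rw [rk_atom hc] at h2
    rw [rk_atom ha, rk_atom hb] at h3
    omega
  have h4 := rk_trace_of_not_le htop (x := a ⊔ b ⊔ c) fun h' =>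
    haF ((le_sup_left.trans le_sup_left).trans h')
  -- The three traces lie in the trace of a plane, which has rank at most two: they are dependent.
  have h5 : jn [X.trace (b ⊔ a), X.trace (b ⊔ c), X.trace (a ⊔ c)] ≤ X.trace (a ⊔ b ⊔ c) := by
    refine jn_le_iff.2 fun x hx => ?_
    simp only [List.mem_cons, List.not_mem_nil, or_false] at hx
    rcases hx with rfl | rfl | rfl
    · exact X.trace_mono (by rw [sup_comm b]; exact le_sup_left)
    · exact X.trace_mono (sup_le (le_sup_right.trans le_sup_left) le_sup_right)
    · exact X.trace_mono (sup_le (le_sup_left.trans le_sup_left) le_sup_right)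
  have h6 := (dependent_relations (l := [X.trace (b ⊔ a), X.trace (b ⊔ c), X.trace (a ⊔ c)])
    (fun x hx => by
      simp only [List.mem_cons, List.not_mem_nil, or_false] at hx
      rcases hx with rfl | rfl | rfl
      · exact hline hb ha hbF (Ne.symm hab)
      · exact hline hb hc hbF hbc
      · exact hline ha hc haF hac) (by
      have := rk_mono h5
      simp only [List.length_cons, List.length_nil]
      omega)).2
  simp only [dsum_cons, dsum_nil, genProd_cons, genProd_nil, mul_one, sub_zero] at h6
  rw [sup_comm c a, ← sub_eq_zero, ← h6]
  abel

end Coatom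

/-- The product of the traces of the lines joining `b` to the letters of a word. -/
noncomputable def traceProd (X : ModularExtension L) (b : X.E) (l : List X.E) : OS L :=
  genProd (l.map fun a => X.trace (b ⊔ a))

theorem traceProd_alt (b : X.E) : IsAlt (traceProd X b) := genProd_alt.map _

theorem traceProd_cons (b a : X.E) (l : List X.E) :
    traceProd X b (a :: l) = gen (X.trace (b ⊔ a)) * traceProd X b l := by
  rw [traceProd, List.map_cons, genProd_cons]; rfl

open Classical in
/-- The product of the traces of the letters of a word; zero if some letter is not below `F`. -/
noncomputable def insideProd (X : ModularExtension L) (l : List X.E) : OS L :=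
  if ∀ a ∈ l, a ≤ X.F then genProd (l.map X.trace) else 0

open Classical in
theorem insideProd_cons (a : X.E) (l : List X.E) :
    insideProd X (a :: l) = if a ≤ X.F then gen (X.trace a) * insideProd X l else 0 := by
  simp only [insideProd, List.forall_mem_cons]
  by_cases h1 : a ≤ X.F
  · by_cases h2 : ∀ a ∈ l, a ≤ X.F
    · rw [if_pos ⟨h1, h2⟩, if_pos h1, if_pos h2, List.map_cons, genProd_cons]
    · rw [if_neg fun h => h2 h.2, if_pos h1, if_neg h2, mul_zero]
  · rw [if_neg fun h => h1 h.1, if_neg h1]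

open Classical in
/-- Expansion of the product of the traces of the lines through a point `b` outside of the
hyperplane `F`, along the letters outside of `F`. -/
theorem traceProd_eq (htop : rk (⊤ : X.E) = rk X.F + 1) {b : X.E} (hb : IsAtom b)
    (hbF : ¬ b ≤ X.F) {l : List X.E} (hl : ∀ a ∈ l, IsAtom a) :
    traceProd X b l = insideProd X l + dsum l fun c l' =>
      if c ≤ X.F then 0 else gen (X.trace (b ⊔ c)) * traceProd X c l' := by
  induction l generalizing b with
  | nil => simp [traceProd, insideProd]
  | cons a l ih =>
    have hl' : ∀ a ∈ l, IsAtom a := fun a ha => hl a (by simp [ha])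
    have ha : IsAtom a := hl a (by simp)
    rw [dsum_cons, insideProd_cons, traceProd_cons, ih hb hbF hl', mul_add]
    by_cases haF : a ≤ X.F
    · rw [if_pos haF, if_pos haF, trace_atom_sup hb hbF haF, zero_sub, ← dsum_neg]
      congr 1
      refine (map_dsum (LinearMap.mulLeft ℚ (gen (X.trace a))) l _).trans
        (dsum_congr fun c l' hc => ?_)
      rw [LinearMap.mulLeft_apply]
      split_ifs with hcF
      · simp
      · rw [traceProd_cons, trace_atom_sup (hl' c (hc.mem_iff.1 (by simp))) hcF haF, ← mul_assoc,
          ← mul_assoc, gen_mul_gen, neg_mul]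
    -- The letter `a` is outside of `F`: the induction hypothesis is used for the lines through `b` and
    -- for the lines through `a`, and the terms match by the relation for the points `a`, `b`, `c`.
    · rw [if_neg haF, if_neg haF, zero_add, ih ha haF hl', mul_add, add_sub_assoc]
      congr 1
      have e1 := map_dsum (LinearMap.mulLeft ℚ (gen (X.trace (b ⊔ a)))) l fun c l' =>
        if c ≤ X.F then 0 else gen (X.trace (b ⊔ c)) * traceProd X c l'
      have e2 := map_dsum (LinearMap.mulLeft ℚ (gen (X.trace (b ⊔ a)))) l fun c l' =>
        if c ≤ X.F then 0 else gen (X.trace (a ⊔ c)) * traceProd X c l'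
      rw [LinearMap.mulLeft_apply] at e1 e2
      rw [e1, e2, ← dsum_sub]
      refine dsum_congr fun c l' hc => ?_
      rw [LinearMap.mulLeft_apply, LinearMap.mulLeft_apply]
      split_ifs with hcF
      · simp
      · have hcA := hl' c (hc.mem_iff.1 (by simp))
        rw [traceProd_cons, ← mul_assoc, ← mul_assoc, ← mul_assoc, ← sub_mul,
          gen_trace_relation htop ha hb hcA haF hbF hcF]

open Classical in
/-- If at least two letters of a word are outside of the hyperplane `F`, then the expansion of the
term of the first of them cancels the terms of all the others. -/
theorem dsum_traceProd_eq_zero (htop : rk (⊤ : X.E) = rk X.F + 1) {l : List X.E}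
    (hl : ∀ a ∈ l, IsAtom a) {b c : X.E} {l' : List X.E} (hp : l.Perm (b :: l')) (hbF : ¬ b ≤ X.F)
    (hc : c ∈ l') (hcF : ¬ c ≤ X.F) :
    (dsum l fun b l' => if b ≤ X.F then 0 else traceProd X b l') = 0 := by
  have hb : IsAtom b := hl b (hp.mem_iff.2 (by simp))
  have halt : ∀ b, IsAlt fun l' => if b ≤ X.F then 0 else traceProd X b l' := fun b => by
    by_cases h : b ≤ X.F
    · simp only [if_pos h]
      intro _ _ _ _
      simp
    · simp only [if_neg h]
      exact traceProd_alt b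
  refine (IsAlt.dsum halt).eq_zero_of_perm hp ?_
  have h1 := traceProd_eq htop hb hbF (l := l') fun a ha => hl a (hp.mem_iff.2 (by simp [ha]))
  rw [insideProd, if_neg fun h => hcF (h c hc), zero_add] at h1
  rw [dsum_cons, if_neg hbF, h1, ← dsum_sub]
  refine dsum_eq_zero fun c l'' _ => ?_
  split_ifs
  · exact sub_self _
  · rw [traceProd_cons, sup_comm, sub_self]

/-- The morphism kills the coboundaries: the flat `F` becomes the top element after a contraction
only if it is a hyperplane, and then the terms of the differential cancel by the expansion of
`traceProd`. -/
theorem osMap_dMap (x : D L) : osMap L (dMap L x) = 0 := by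
  classical
  refine D.induction (p := fun x => osMap L (dMap L x) = 0) x (by simp)
    (fun x y hx hy => by simp [hx, hy]) (fun r x hx => by simp [hx]) fun X l hl => ?_
  have hl1 : ∀ a ∈ l, rk a ≤ 1 := fun a ha => (rk_atom (hl a ha)).le
  rw [dMap_cls hl1, map_dsum]
  have hterm : ∀ b l', (b :: l').Perm l → osMap L (dTerm X b l') =
      if b ≤ X.F then 0 else if b ≤ X.F ⊔ jn l' ∧ b ⊔ X.F = ⊤ then traceProd X b l' else 0 := by
    intro b l' hp
    by_cases hbF : b ≤ X.F
    · rw [if_pos hbF, dTerm_eq_zero (ctr_of_le hbF _), map_zero]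
    · rw [if_neg hbF]
      by_cases h : b ≤ X.F ⊔ jn l'
      · rw [dTerm_of_le h, ctr_of (hl b (hp.mem_iff.1 (by simp))) hbF,
          osMap_cls (rk_le_one_map_cup fun a ha => hl1 a (hp.mem_iff.1 (by simp [ha]))),
          contract_F]
        refine if_congr (cup_eq_top.trans (and_iff_right h).symm) ?_ rfl
        rw [List.map_map, traceProd]
        exact congrArg genProd (List.map_congr_left fun a _ => trace_contract a)
      · rw [dTerm, if_neg h, map_zero, if_neg fun h' => h h'.1]
  rw [dsum_congr hterm]
  by_cases h1 : ∃ b l', (b :: l').Perm l ∧ ¬ b ≤ X.F ∧ b ≤ X.F ⊔ jn l' ∧ b ⊔ X.F = ⊤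
  · obtain ⟨b, l', hp, hbF, hb1, hb2⟩ := h1
    have htop : rk (⊤ : X.E) = rk X.F + 1 := by
      rw [← hb2, sup_comm, rk_sup_atom (hl b (hp.mem_iff.1 (by simp))) hbF]
    obtain ⟨c, hc, hcF⟩ : ∃ c ∈ l', ¬ c ≤ X.F := by
      by_contra! h
      exact hbF (hb1.trans (sup_le le_rfl (jn_le_iff.2 h)))
    refine Eq.trans (dsum_congr fun e l'' he => ?_)
      (dsum_traceProd_eq_zero htop hl hp.symm hbF hc hcF)
    by_cases heF : e ≤ X.F
    · rw [if_pos heF, if_pos heF]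
    · rw [if_neg heF, if_neg heF, if_pos]
      -- As `b` and `c` are outside of `F`, every letter outside of `F` is contractible.
      have h2 : ∃ a ∈ l'', ¬ a ≤ X.F := by
        by_contra! h
        have h3 : (b :: l').countP (fun a => decide ¬ a ≤ X.F) =
            (e :: l'').countP (fun a => decide ¬ a ≤ X.F) := (hp.trans he.symm).countP_eq _
        rw [List.countP_cons_of_pos (by simpa using hbF), List.countP_cons_of_pos
          (by simpa using heF)] at h3
        have h5 : l''.countP (fun a => decide ¬ a ≤ X.F) = 0 :=
          List.countP_eq_zero.2 (by simpa using h)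
        have h4 : 0 < l'.countP (fun a => decide ¬ a ≤ X.F) :=
          List.countP_pos_iff.2 ⟨c, hc, by simpa using hcF⟩
        omega
      obtain ⟨a, ha, haF⟩ := h2
      refine ⟨?_, by rw [sup_comm, sup_eq_top_of_not_le htop heF]⟩
      rw [sup_eq_top_of_not_le htop fun h => haF ((le_jn ha).trans h)]
      exact le_top
  · push Not at h1
    refine dsum_eq_zero fun b l' hp => ?_
    split_ifs with h2 h3
    · rfl
    · exact absurd h3.2 (h1 b l' hp h2 h3.1)
    · rfl

theorem osMap_mem {k : ℤ} {x : D L} (hx : x ∈ grD L k) : osMap L x ∈ (OS.cdga L).gr k := by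
  classical
  induction hx using Submodule.span_induction with
  | mem x hx =>
    obtain ⟨X, l, hl, hk, rfl⟩ := hx
    rw [osMap_cls fun a ha => (rk_atom (hl a ha)).le]
    split_ifs with hF
    · refine Submodule.subset_span ⟨l.pmap (fun a ha => ⟨X.trace a, X.isAtom_trace ha
        (hF ▸ le_top)⟩) hl, ?_, ?_⟩
      · rw [List.length_pmap, ← hk, deg, ← hF, X.rk_F]
        ring
      · rw [List.map_pmap, genProd, List.map_map]
        refine congrArg List.prod ?_
        rw [← List.pmap_eq_map (p := fun a => IsAtom a) (H := hl)]
        exact List.pmap_congr_left _ fun a _ ha _ => (gen_coe ⟨X.trace a, _⟩).symm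
    · exact Submodule.zero_mem _
  | zero => simp
  | add x y _ _ hx hy => rw [map_add]; exact Submodule.add_mem _ hx hy
  | smul r x _ hx => rw [map_smul]; exact Submodule.smul_mem _ _ hx

theorem osMap_refl {l : List L} (hl : ∀ a ∈ l, rk a ≤ 1) :
    osMap L (cls (ModularExtension.refl L) l) = genProd l := by
  classical
  refine (osMap_cls (X := ModularExtension.refl L) hl).trans
    ((if_pos rfl).trans (congrArg genProd ?_))
  exact (List.map_congr_left fun a _ => (ModularExtension.refl L).trace_ι a).trans (List.map_id l)

/-- The Orlik–Solomon algebra is spanned by the products of generators, which are the images of the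
diagrams on the trivial extension. -/
theorem exists_osMap_eq {k : ℤ} {y : OS L} (hy : y ∈ (OS.cdga L).gr k) :
    ∃ x ∈ grD L k, dMap L x = 0 ∧ osMap L x = y := by
  classical
  induction hy using Submodule.span_induction with
  | mem y hy =>
    obtain ⟨l, hk, rfl⟩ := hy
    have hl : ∀ a ∈ l.map Subtype.val, rk (a : L) ≤ 1 := by
      intro a ha
      obtain ⟨b, _, rfl⟩ := List.mem_map.1 ha
      exact (rk_atom b.2).le
    refine ⟨cls (ModularExtension.refl L) (l.map Subtype.val), cls_mem_grD ?_, ?_, ?_⟩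
    · change ((l.map Subtype.val).length : ℤ) - 2 * ((rk (⊤ : L) : ℤ) - rk (⊤ : L)) = k
      rw [List.length_map, hk]
      ring
    · rw [dMap_cls hl]
      exact dsum_eq_zero fun b l' _ => dTerm_eq_zero (ctr_of_le (le_top : b ≤ (⊤ : L)) _)
    · refine (osMap_refl hl).trans ?_
      rw [genProd, List.map_map]
      exact congrArg List.prod (List.map_congr_left fun a _ => gen_coe a)
  | zero => exact ⟨0, Submodule.zero_mem _, by simp, by simp⟩
  | add x y _ _ hx hy =>
    obtain ⟨x', h1, h2, rfl⟩ := hx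
    obtain ⟨y', h3, h4, rfl⟩ := hy
    exact ⟨x' + y', Submodule.add_mem _ h1 h3, by rw [map_add, h2, h4, add_zero], map_add _ _ _⟩
  | smul r x _ hx =>
    obtain ⟨x', h1, h2, rfl⟩ := hx
    exact ⟨r • x', Submodule.smul_mem _ _ h1, by rw [map_smul, h2, smul_zero], map_smul _ _ _⟩

end Integration

end ModDiag

namespace ModDiag

/-! ### Residues of Orlik–Solomon algebras along a modular hyperplane -/

section Residues

variable {L : Type u} [Lattice L] [BoundedOrder L] [IsGeometricLattice L]

/-- The trace of a flat on the interval `[⊥, M]`. -/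
def tr (M x : L) : Set.Iic M := ⟨x ⊓ M, inf_le_right⟩

theorem tr_mono (M : L) : Monotone (tr M) := fun _ _ h => inf_le_inf_right M h

theorem coe_tr (M x : L) : (tr M x : L) = x ⊓ M := rfl

theorem rk_tr_of_le {M x : L} (h : x ≤ M) : rk (tr M x) = rk x := by
  rw [rk_Iic, coe_tr, inf_eq_left.2 h]

theorem coe_jn_Iic {M : L} (l : List (Set.Iic M)) : Subtype.val (jn l) = jn (l.map Subtype.val) :=
  (jn_map (fun x : Set.Iic M => (x : L)) rfl (fun _ _ => rfl) l).symm

theorem rk_jn_map_tr {M : L} {l : List L} (h : ∀ a ∈ l, a ≤ M) :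
    rk (jn (l.map (tr M))) = rk (jn l) := by
  rw [rk_Iic, coe_jn_Iic, List.map_map]
  congr 2
  exact (List.map_congr_left fun a ha => inf_eq_left.2 (h a ha)).trans (List.map_id l)

theorem dsum_prod_cons {A α : Type*} [Ring A] [Algebra ℚ A] (g : α → A) (a : α) (l : List α) :
    (dsum (a :: l) fun _ l' => (l'.map g).prod) =
      (l.map g).prod - g a * dsum l fun _ l' => (l'.map g).prod := by
  rw [dsum_cons]
  congr 1
  refine Eq.trans (dsum_congr fun b l' _ => ?_)
    (map_dsum (LinearMap.mulLeft ℚ (g a)) l fun _ l' => (l'.map g).prod).symm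
  simp

/-- Each letter of a circuit is below the join of the other ones. -/
theorem IsCircuitWord.jn_eq {l l' : List L} {c : L} (h : IsCircuitWord l)
    (hp : (c :: l').Perm l) : jn l' = jn l := by
  have h1 := h.rk_jn
  have h2 := h.rk_cons c l' hp
  rw [← jn_perm hp] at h1 ⊢
  exact eq_of_le_of_rk_le le_sup_right (by omega)

open Classical in
/-- The projection of Orlik–Solomon algebras which kills the generators not below `M`. -/
theorem exists_osProj (M : L) : ∃ φ : OS L →ₗ[ℚ] OS (Set.Iic M), ∀ l : List L,
    (∀ a ∈ l, IsAtom a) → φ (genProd l) =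
      if ∀ a ∈ l, a ≤ M then genProd (l.map (tr M)) else 0 := by
  let g : L → OS (Set.Iic M) := fun a => if a ≤ M then gen (tr M a) else 0
  have hpos : ∀ l : List L, (∀ a ∈ l, a ≤ M) → (l.map g).prod = genProd (l.map (tr M)) := by
    intro l h
    rw [genProd, List.map_map]
    exact congrArg List.prod (List.map_congr_left fun a ha => if_pos (h a ha))
  have hneg : ∀ l : List L, ∀ a ∈ l, ¬ a ≤ M → (l.map g).prod = 0 := fun l a ha h =>
    List.prod_eq_zero (List.mem_map.2 ⟨a, ha, if_neg h⟩)
  obtain ⟨φ, hφ⟩ := exists_osHom g (fun a b => by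
    by_cases ha : a ≤ M
    · by_cases hb : b ≤ M
      · simp only [g, if_pos ha, if_pos hb]
        exact gen_mul_gen _ _
      · simp only [g, if_neg hb, mul_zero, zero_mul, neg_zero]
    · simp only [g, if_neg ha, mul_zero, zero_mul, neg_zero]) (fun l hl => by
    by_cases h : ∀ a ∈ l, a ≤ M
    · have h1 := (dependent_relations (l := l.map (tr M)) (fun x hx => by
        obtain ⟨a, ha, rfl⟩ := List.mem_map.1 hx
        rw [isAtom_iff_rk, rk_tr_of_le (h a ha), rk_atom (hl.atoms a ha)]) (by
        rw [rk_jn_map_tr h, List.length_map]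
        have := hl.rk_jn
        omega)).2
      rw [dsum_map] at h1
      rw [← h1]
      exact dsum_congr fun b l' hp => hpos l' fun a ha => h a (hp.mem_iff.1 (by simp [ha]))
    · push Not at h
      obtain ⟨c, hc, hcM⟩ := h
      have hp := List.perm_cons_erase hc
      have halt : IsAlt fun l : List L => dsum l fun _ l' => (l'.map g).prod :=
        IsAlt.dsum fun _ => prod_isAlt fun a b => by
          by_cases ha : a ≤ M
          · by_cases hb : b ≤ M
            · simp only [g, if_pos ha, if_pos hb]
              exact gen_mul_gen _ _
            · simp only [g, if_neg hb, mul_zero, zero_mul, neg_zero]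
          · simp only [g, if_neg ha, mul_zero, zero_mul, neg_zero]
      refine halt.eq_zero_of_perm hp ?_
      rw [dsum_prod_cons]
      have h1 : g c = 0 := if_neg hcM
      -- A circuit with a letter `c` not below `M` has another such letter.
      obtain ⟨e, he, heM⟩ : ∃ e ∈ l.erase c, ¬ e ≤ M := by
        by_contra! h
        refine hcM (le_trans ?_ (jn_le_iff.2 h))
        rw [hl.jn_eq hp.symm]
        exact le_jn hc
      rw [h1, zero_mul, hneg _ e he heM, sub_zero])
  refine ⟨φ.toLinearMap, fun l hl => ?_⟩
  rw [AlgHom.toLinearMap_apply, hφ l hl]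
  split_ifs with h
  · exact hpos l h
  · push Not at h
    obtain ⟨c, hc, hcM⟩ := h
    exact hneg l c hc hcM

section Coatom

variable {M : L} (hM : IsModularFlat M) (htop : rk (⊤ : L) = rk M + 1)
include hM htop

theorem rk_tr_of_not_le {x : L} (h : ¬ x ≤ M) : rk (tr M x) + 1 = rk x := by
  have h1 := hM x
  have h2 : rk M < rk (M ⊔ x) := rk_strictMono (left_lt_sup.2 h)
  have h3 : rk (M ⊔ x) ≤ rk (⊤ : L) := rk_mono le_top
  rw [rk_Iic, coe_tr, inf_comm]
  omega

theorem rk_tr_le {a b : L} (ha : IsAtom a) (haM : ¬ a ≤ M) (hb : rk b ≤ 1) :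
    rk (tr M (a ⊔ b)) ≤ 1 := by
  have h1 := rk_tr_of_not_le hM htop (x := a ⊔ b) fun h => haM (le_sup_left.trans h)
  have h2 := rk_sup_le a b
  rw [rk_atom ha] at h2
  omega

open Classical in
/-- The residue of the Orlik–Solomon algebra at an atom `a` which is not below the modular
hyperplane `M`. It is the lower left entry of a representation of the Orlik–Solomon algebra by
triangular `2 × 2` matrices. -/
theorem exists_osRes {a : L} (ha : IsAtom a) (haM : ¬ a ≤ M) :
    ∃ φ : OS L →ₗ[ℚ] OS (Set.Iic M), ∀ l : List L, (∀ a ∈ l, IsAtom a) → φ (genProd l) =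
      dsum l fun c l' => if c = a then genProd (l'.map fun b => tr M (a ⊔ b)) else 0 := by
  let t : L → Set.Iic M := fun b => tr M (a ⊔ b)
  let γ : L → OS (Set.Iic M) := fun b => gen (t b)
  let δ : L → OS (Set.Iic M) := fun b => if b = a then 1 else 0
  let g : L → Matrix (Fin 2) (Fin 2) (OS (Set.Iic M)) := fun b => !![γ b, 0; δ b, -γ b]
  have hγ : ∀ l : List L, (l.map γ).prod = genProd (l.map t) := fun l => by
    rw [genProd, List.map_map]; rfl
  -- The products of the matrices, whose lower left entry is the residue.
  have hprod : ∀ l : List L, (l.map g).prod = !![genProd (l.map t), 0;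
      dsum l fun c l' => if c = a then genProd (l'.map t) else 0,
      (-1 : ℚ) ^ l.length • genProd (l.map t)] := by
    intro l
    induction l with
    | nil => simp [Matrix.one_fin_two]
    | cons b l ih =>
      rw [List.map_cons, List.prod_cons, ih, Matrix.mul_fin_two]
      have e1 : (dsum l fun c l' => if c = a then genProd ((b :: l').map t) else 0) =
          γ b * dsum l fun c l' => if c = a then genProd (l'.map t) else 0 := by
        refine Eq.trans (dsum_congr fun c l' _ => ?_)
          (map_dsum (LinearMap.mulLeft ℚ (γ b)) l _).symm
        rw [LinearMap.mulLeft_apply]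
        split_ifs
        · rw [List.map_cons, genProd_cons]
        · rw [mul_zero]
      rw [dsum_cons, e1, List.map_cons, genProd_cons, List.length_cons, pow_succ]
      congr 1
      ext i j
      fin_cases i <;> fin_cases j
      · simp [γ]
      · simp
      · simp only [δ]
        split_ifs <;> simp [sub_eq_add_neg]
      · simp [γ]
  have hanti : ∀ b c, g b * g c = -(g c * g b) := by
    intro b c
    have h1 : γ b * γ c = -(γ c * γ b) := gen_mul_gen _ _
    have h2 : ∀ b x, δ b * x = x * δ b := fun b x => by
      simp only [δ]; split_ifs <;> simp
    rw [Matrix.mul_fin_two, Matrix.mul_fin_two]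
    ext i j
    fin_cases i <;> fin_cases j
    · simpa using h1
    · simp
    · simp [h2 b, h2 c]
    · simpa using h1
  have hrk : ∀ l : List L, rk (jn (l.map t)) + 1 ≤ rk (a ⊔ jn l) := by
    intro l
    rw [← rk_tr_of_not_le hM htop (x := a ⊔ jn l) fun h => haM (le_sup_left.trans h)]
    refine Nat.add_le_add_right (rk_mono (jn_le_iff.2 fun x hx => ?_)) 1
    obtain ⟨b, hb, rfl⟩ := List.mem_map.1 hx
    exact tr_mono M (sup_le_sup_left (le_jn hb) a)
  have hle : ∀ l : List L, (∀ b ∈ l, IsAtom b) → ∀ x ∈ l.map t, rk x ≤ 1 := by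
    intro l hl x hx
    obtain ⟨b, hb, rfl⟩ := List.mem_map.1 hx
    exact rk_tr_le hM htop ha haM (rk_atom (hl b hb)).le
  -- A letter different from `a` gives an atom of `[⊥, M]`; the letter `a` gives `⊥`.
  have hbot : ∀ l : List L, (∀ b ∈ l, IsAtom b) → a ∉ l → ⊥ ∉ l.map t := by
    intro l hl hal hx
    obtain ⟨b, hb, hb0⟩ := List.mem_map.1 hx
    have h1 := rk_tr_of_not_le hM htop (x := a ⊔ b) fun h => haM (le_sup_left.trans h)
    have h2 : rk (tr M (a ⊔ b)) = 0 := rk_eq_zero.2 hb0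
    have h3 := rk_sup_atom (a := b) ha fun h => hal (atom_eq_of_le ha (hl b hb) h ▸ hb)
    rw [rk_atom (hl b hb), sup_comm] at h3
    omega
  -- The relation for the upper left entry: the image of a circuit is dependent, and strongly so if it
  -- contains `a`.
  have h00 : ∀ l, IsCircuitWord l → (dsum l fun _ l' => genProd (l'.map t)) = 0 := by
    intro l hl
    rw [← dsum_map t l fun _ l' => genProd l']
    refine dsum_genProd_eq_zero (hle l hl.atoms) ?_
    have h1 := hrk l
    have h2 := hl.rk_jn
    rw [List.length_map]
    by_cases hal : a ∈ l
    · rw [sup_eq_right.2 (le_jn hal)] at h1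
      exact .inl (by omega)
    · have h3 := rk_sup_le a (jn l)
      rw [rk_atom ha] at h3
      exact .inr ⟨hbot l hl.atoms hal, by omega⟩
  obtain ⟨φ, hφ⟩ := exists_osHom g hanti (fun l hl => by
    ext i j
    have e := map_dsum (Matrix.entryLinearMap ℚ (OS (Set.Iic M)) i j) l fun _ l' => (l'.map g).prod
    rw [Matrix.entryLinearMap_apply] at e
    rw [e, Matrix.zero_apply]
    simp only [hprod, Matrix.entryLinearMap_apply]
    fin_cases i <;> fin_cases j
    · exact h00 l hl
    · exact dsum_zero l
    -- For the lower left entry, the residue is taken first: removing `a` from the circuit leaves an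
    -- independent word, whose image in `[⊥, M]` is dependent.
    · have h1 := dsum_comm l fun _ c l'' => if c = a then genProd (l''.map t) else 0
      refine (eq_neg_of_add_eq_zero_left h1).trans (neg_eq_zero.2 (dsum_eq_zero fun c l' hp => ?_))
      by_cases hca : c = a
      · simp only [if_pos hca]
        rw [← dsum_map t l' fun _ l' => genProd l']
        have hat : ∀ b ∈ l', IsAtom b := fun b hb => hl.atoms b (hp.mem_iff.1 (by simp [hb]))
        refine dsum_genProd_eq_zero (hle l' hat) (.inr ⟨hbot l' hat ?_, ?_⟩)
        · rw [← hca]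
          exact (List.nodup_cons.1 (hp.nodup_iff.2 hl.nodup)).1
        · have h2 := hrk l'
          have h3 := hl.rk_jn
          have h4 := hp.length_eq
          rw [← hca, ← jn_cons, jn_perm hp] at h2
          rw [List.length_cons] at h4
          rw [List.length_map]
          omega
      · simp only [if_neg hca]
        exact dsum_zero l'
    -- The sign of the lower right entry depends only on the length of the word.
    · refine Eq.trans (dsum_congr (f' := fun _ l' => (-1 : ℚ) ^ (l.length - 1) •
        genProd (l'.map t)) fun b l' hp => ?_) ?_
      · have h4 := hp.length_eq
        rw [List.length_cons] at h4
        rw [← h4, Nat.add_sub_cancel]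
        rfl
      · rw [dsum_smul, h00 l hl, smul_zero])
  refine ⟨(Matrix.entryLinearMap ℚ (OS (Set.Iic M)) 1 0).comp φ.toLinearMap, fun l hl => ?_⟩
  rw [LinearMap.comp_apply, AlgHom.toLinearMap_apply, hφ l hl, hprod]
  rfl

end Coatom

end Residues

end ModDiag

namespace ModDiag

/-! ### Doubling a lattice along a modular hyperplane -/

section HatLattice

variable {L : Type u} [Lattice L] [BoundedOrder L] [IsGeometricLattice L]

/-- The lattice of flats of the configuration consisting of two copies of the atoms of `L` glued
along the atoms below `M`, together with an additional atom `p` such that, for every atom `a` not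
below `M`, the atom `p` and the two copies of `a` are collinear. A flat is determined by the flats
`y` and `x` of `L` formed by its atoms in the two copies, and by whether it contains `p`. -/
def Hat (M : L) : Type u :=
  {q : L × L × Prop // q.1 ⊓ M = q.2.1 ⊓ M ∧ ∀ a, IsAtom a → ¬ a ≤ M →
    (a ≤ q.1 → a ≤ q.2.1 → q.2.2) ∧ (a ≤ q.1 → q.2.2 → a ≤ q.2.1) ∧
      (a ≤ q.2.1 → q.2.2 → a ≤ q.1)}

namespace Hat

variable {M : L}

/-- The atoms of the first copy contained in a flat. -/
def y (q : Hat M) : L := q.1.1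

/-- The atoms of the second copy contained in a flat. -/
def x (q : Hat M) : L := q.1.2.1

/-- Whether a flat contains the additional atom. -/
def b (q : Hat M) : Prop := q.1.2.2

instance : PartialOrder (Hat M) := Subtype.partialOrder _

instance : Finite (Hat M) := Subtype.finite

theorem le_iff {p q : Hat M} : p ≤ q ↔ p.y ≤ q.y ∧ p.x ≤ q.x ∧ (p.b → q.b) := Iff.rfl

theorem ext {p q : Hat M} (h1 : p.y = q.y) (h2 : p.x = q.x) (h3 : p.b ↔ q.b) : p = q :=
  le_antisymm (le_iff.2 ⟨h1.le, h2.le, h3.1⟩) (le_iff.2 ⟨h1.ge, h2.ge, h3.2⟩)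

theorem inf_eq (q : Hat M) : q.y ⊓ M = q.x ⊓ M := q.2.1

theorem le_x_of_le_y {q : Hat M} {a : L} (h : a ≤ M) (h' : a ≤ q.y) : a ≤ q.x :=
  (le_inf h' h).trans (q.inf_eq.le.trans inf_le_left)

theorem le_y_of_le_x {q : Hat M} {a : L} (h : a ≤ M) (h' : a ≤ q.x) : a ≤ q.y :=
  (le_inf h' h).trans (q.inf_eq.ge.trans inf_le_left)

theorem b_of {q : Hat M} {a : L} (ha : IsAtom a) (haM : ¬ a ≤ M) (h : a ≤ q.y) (h' : a ≤ q.x) :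
    q.b := (q.2.2 a ha haM).1 h h'

theorem eq_of_b {q : Hat M} (h : q.b) : q.y = q.x := by
  refine le_antisymm ?_ ?_
  · by_contra hc
    obtain ⟨c, hcA, h1, h2⟩ := exists_atom_not_le hc
    by_cases hcM : c ≤ M
    · exact h2 (le_x_of_le_y hcM h1)
    · exact h2 ((q.2.2 c hcA hcM).2.1 h1 h)
  · by_contra hc
    obtain ⟨c, hcA, h1, h2⟩ := exists_atom_not_le hc
    by_cases hcM : c ≤ M
    · exact h2 (le_y_of_le_x hcM h1)
    · exact h2 ((q.2.2 c hcA hcM).2.2 h1 h)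

instance : SemilatticeInf (Hat M) where
  inf p q := ⟨(p.y ⊓ q.y, p.x ⊓ q.x, p.b ∧ q.b), by
    refine ⟨?_, fun a ha haM => ⟨fun h h' => ⟨?_, ?_⟩, fun h h' => ?_, fun h h' => ?_⟩⟩
    · change (p.y ⊓ q.y) ⊓ M = (p.x ⊓ q.x) ⊓ M
      rw [inf_inf_distrib_right, p.inf_eq, q.inf_eq, ← inf_inf_distrib_right]
    · exact b_of ha haM (h.trans inf_le_left) (h'.trans inf_le_left)
    · exact b_of ha haM (h.trans inf_le_right) (h'.trans inf_le_right)
    · exact le_inf ((h.trans inf_le_left).trans (eq_of_b h'.1).le)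
        ((h.trans inf_le_right).trans (eq_of_b h'.2).le)
    · exact le_inf ((h.trans inf_le_left).trans (eq_of_b h'.1).ge)
        ((h.trans inf_le_right).trans (eq_of_b h'.2).ge)⟩
  inf_le_left _ _ := ⟨inf_le_left, inf_le_left, fun h => h.1⟩
  inf_le_right _ _ := ⟨inf_le_right, inf_le_right, fun h => h.2⟩
  le_inf _ _ _ h h' := ⟨le_inf h.1 h'.1, le_inf h.2.1 h'.2.1, fun hb => ⟨h.2.2 hb, h'.2.2 hb⟩⟩

instance : BoundedOrder (Hat M) where
  top := ⟨(⊤, ⊤, True), rfl, fun _ _ _ => ⟨fun _ _ => trivial, fun h _ => h, fun h _ => h⟩⟩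
  le_top _ := ⟨le_top, le_top, fun _ => trivial⟩
  bot := ⟨(⊥, ⊥, False), rfl, fun _ _ haM => ⟨fun h _ => haM (h.trans bot_le),
    fun h _ => h, fun h _ => h⟩⟩
  bot_le _ := ⟨bot_le, bot_le, fun h => h.elim⟩

theorem exists_sup (p q : Hat M) : ∃ s : Hat M, ∀ r, s ≤ r ↔ p ≤ r ∧ q ≤ r := by
  classical
  have : Fintype (Hat M) := Fintype.ofFinite _
  refine ⟨(Finset.univ.filter fun r => p ≤ r ∧ q ≤ r).inf id, fun r => ⟨fun h => ⟨?_, ?_⟩,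
    fun h => Finset.inf_le (f := id) (Finset.mem_filter.2 ⟨Finset.mem_univ _, h⟩)⟩⟩
  · exact (Finset.le_inf fun r hr => (Finset.mem_filter.1 hr).2.1).trans h
  · exact (Finset.le_inf fun r hr => (Finset.mem_filter.1 hr).2.2).trans h

noncomputable instance : Lattice (Hat M) where
  sup p q := (exists_sup p q).choose
  le_sup_left p q := (((exists_sup p q).choose_spec _).1 le_rfl).1
  le_sup_right p q := (((exists_sup p q).choose_spec _).1 le_rfl).2
  sup_le p q r h h' := ((exists_sup p q).choose_spec r).2 ⟨h, h'⟩
  inf p q := p ⊓ q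
  inf_le_left _ _ := inf_le_left
  inf_le_right _ _ := inf_le_right
  le_inf _ _ _ := le_inf

/-- The flat consisting of a flat of the first copy and its trace on the second one. -/
def inV (M a : L) : Hat M := ⟨(a, a ⊓ M, False), by
  refine ⟨?_, fun _ _ hcM => ⟨fun _ h => hcM (h.trans inf_le_right), fun _ h => h.elim,
    fun _ h => h.elim⟩⟩
  change a ⊓ M = (a ⊓ M) ⊓ M
  rw [inf_assoc, inf_idem]⟩

/-- The symmetry exchanging the two copies. -/
def swap (q : Hat M) : Hat M := ⟨(q.x, q.y, q.b), q.inf_eq.symm, fun _ ha haM =>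
  ⟨fun h h' => b_of ha haM h' h, fun h h' => h.trans (eq_of_b h').ge,
    fun h h' => h.trans (eq_of_b h').le⟩⟩

/-- The flat consisting of a flat of the second copy and its trace on the first one. -/
def inB (M a : L) : Hat M := swap (inV M a)

/-- The additional atom. -/
def pt (M : L) : Hat M := ⟨(⊥, ⊥, True), rfl, fun _ _ haM => ⟨fun _ _ => trivial,
  fun h _ => (haM (h.trans bot_le)).elim, fun h _ => (haM (h.trans bot_le)).elim⟩⟩

/-- The flats containing the additional atom. -/
def diag (M a : L) : Hat M := ⟨(a, a, True), rfl, fun _ _ _ =>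
  ⟨fun _ _ => trivial, fun h _ => h, fun h _ => h⟩⟩

theorem inV_le_iff {a : L} {q : Hat M} : inV M a ≤ q ↔ a ≤ q.y :=
  ⟨fun h => h.1, fun h => ⟨h, (le_inf (inf_le_left.trans h) inf_le_right).trans
    (q.inf_eq.le.trans inf_le_left), fun h => h.elim⟩⟩

theorem inB_le_iff {a : L} {q : Hat M} : inB M a ≤ q ↔ a ≤ q.x :=
  ⟨fun h => h.2.1, fun h => ⟨(le_inf (inf_le_left.trans h) inf_le_right).trans
    (q.inf_eq.ge.trans inf_le_left), h, fun h => h.elim⟩⟩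

theorem pt_le_iff {q : Hat M} : pt M ≤ q ↔ q.b :=
  ⟨fun h => h.2.2 trivial, fun h => ⟨bot_le, bot_le, fun _ => h⟩⟩

theorem le_diag_iff {a : L} {q : Hat M} : q ≤ diag M a ↔ q.y ≤ a ∧ q.x ≤ a :=
  ⟨fun h => ⟨h.1, h.2.1⟩, fun h => ⟨h.1, h.2, fun _ => trivial⟩⟩

section Geometric

variable (hM : IsModularFlat M) (htop : rk (⊤ : L) = rk M + 1)
include hM htop

theorem rk_inf_of_not_le {a : L} (h : ¬ a ≤ M) : rk (a ⊓ M) + 1 = rk a := by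
  have := rk_tr_of_not_le hM htop h
  rwa [rk_Iic, coe_tr] at this

theorem eq_inf_sup {a c : L} (hc : IsAtom c) (hcM : ¬ c ≤ M) (h : c ≤ a) : a = (a ⊓ M) ⊔ c := by
  symm
  refine eq_of_le_of_rk_le (sup_le inf_le_left h) ?_
  rw [rk_sup_atom hc fun h' => hcM (h'.trans inf_le_right),
    rk_inf_of_not_le hM htop fun h' => hcM (h.trans h')]

/-- Flats with the same trace on `M` and with a common atom outside of `M` are equal. -/
theorem eq_of_common {a a' c : L} (h : a ⊓ M = a' ⊓ M) (hc : IsAtom c) (hcM : ¬ c ≤ M)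
    (h1 : c ≤ a) (h2 : c ≤ a') : a = a' := by
  rw [eq_inf_sup hM htop hc hcM h1, eq_inf_sup hM htop hc hcM h2, h]

/-- The smallest flat with given intersections with the two copies of `L`. It contains the additional
atom if these intersections share an atom outside of `M`. -/
def ofPair (a a' : L) (h : a ⊓ M = a' ⊓ M) : Hat M :=
  ⟨(a, a', ∃ c, IsAtom c ∧ ¬ c ≤ M ∧ c ≤ a ∧ c ≤ a'), h, fun e he heM =>
    ⟨fun h1 h2 => ⟨e, he, heM, h1, h2⟩, fun h1 ⟨_, hc, hcM, h2, h3⟩ =>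
      h1.trans (eq_of_common hM htop h hc hcM h2 h3).le, fun h1 ⟨_, hc, hcM, h2, h3⟩ =>
      h1.trans (eq_of_common hM htop h hc hcM h2 h3).ge⟩⟩

omit hM htop in
open Classical in
/-- The rank function: the rank of the part `y` in the first copy, plus one for the flats which are not
contained in the first copy. -/
noncomputable def rho (q : Hat M) : ℕ := rk q.y + if q.x ≤ M ∧ ¬ q.b then 0 else 1

omit hM htop in
theorem rho_of_b {q : Hat M} (h : q.b) : rho q = rk q.y + 1 := by
  rw [rho, if_neg fun h' => h'.2 h]

omit hM htop in
theorem rho_of_not_le {q : Hat M} (h : ¬ q.x ≤ M) : rho q = rk q.y + 1 := by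
  rw [rho, if_neg fun h' => h h'.1]

omit hM htop in
theorem rho_of_le {q : Hat M} (h : q.x ≤ M) (h' : ¬ q.b) : rho q = rk q.y := by
  rw [rho, if_pos ⟨h, h'⟩, add_zero]

/-- Although its definition distinguishes the first copy, the rank function is symmetric. -/
theorem rho_swap (q : Hat M) : rho (swap q) = rho q := by
  by_cases hb : q.b
  · rw [rho_of_b hb, rho_of_b (show (swap q).b from hb)]
    change rk q.x + 1 = _
    rw [eq_of_b hb]
  have hb' : ¬ (swap q).b := hb
  have h0 := q.inf_eq
  by_cases hx : q.x ≤ M <;> by_cases hy : q.y ≤ M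
  · rw [rho_of_le hx hb, rho_of_le hy hb']
    rw [inf_eq_left.2 hx, inf_eq_left.2 hy] at h0
    rw [h0]; rfl
  · have h1 := rk_inf_of_not_le hM htop hy
    rw [rho_of_le hx hb, rho_of_not_le (q := swap q) hy, ← h1, h0, inf_eq_left.2 hx]
    rfl
  · have h1 := rk_inf_of_not_le hM htop hx
    rw [rho_of_not_le hx, rho_of_le (q := swap q) hy hb']
    change rk q.x = _
    rw [← h1, ← h0, inf_eq_left.2 hy]
  · have h1 := rk_inf_of_not_le hM htop hx
    have h2 := rk_inf_of_not_le hM htop hy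
    rw [rho_of_not_le hx, rho_of_not_le (q := swap q) hy]
    change rk q.x + 1 = _
    rw [← h1, ← h2, h0]

theorem rho_strictMono : StrictMono (rho (M := M)) := by
  intro p q hpq
  have h1 : rk p.y ≤ rk q.y := rk_mono hpq.le.1
  classical
  have h2 : (if p.x ≤ M ∧ ¬ p.b then 0 else 1) ≤ if q.x ≤ M ∧ ¬ q.b then 0 else 1 := by
    by_cases h : q.x ≤ M ∧ ¬ q.b
    · rw [if_pos h, if_pos ⟨hpq.le.2.1.trans h.1, fun h' => h.2 (hpq.le.2.2 h')⟩]
    · rw [if_neg h]; split_ifs <;> simp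
  by_contra hc
  rw [rho, rho] at hc
  have h3 : p.y = q.y := eq_of_le_of_rk_le hpq.le.1 (by omega)
  have h4 : q.x ≤ M ∧ ¬ q.b ↔ p.x ≤ M ∧ ¬ p.b := by
    by_cases h : q.x ≤ M ∧ ¬ q.b <;> by_cases h' : p.x ≤ M ∧ ¬ p.b
    · tauto
    · rw [if_pos h, if_neg h'] at h2; omega
    · rw [if_neg h, if_pos h', h3] at hc; omega
    · tauto
  have h5 : p.x ⊓ M = q.x ⊓ M := by rw [← p.inf_eq, ← q.inf_eq, h3]
  refine hpq.ne (ext h3 ?_ ?_)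
  · by_cases h : q.x ≤ M ∧ ¬ q.b
    · rw [← inf_eq_left.2 h.1, ← inf_eq_left.2 (h4.1 h).1, h5]
    · by_cases hb : p.b
      · rw [← eq_of_b hb, h3, eq_of_b (hpq.le.2.2 hb)]
      · have h6 : ¬ p.x ≤ M := fun h' => h (h4.2 ⟨h', hb⟩)
        have h7 : ¬ q.x ≤ M := fun h' => h6 (hpq.le.2.1.trans h')
        have h8 := rk_inf_of_not_le hM htop h6
        have h9 := rk_inf_of_not_le hM htop h7
        rw [h5] at h8
        exact eq_of_le_of_rk_le hpq.le.2.1 (by omega)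
  · refine ⟨hpq.le.2.2, fun hb => ?_⟩
    by_contra hb'
    have h6 : ¬ p.x ≤ M := fun h' => (h4.2 ⟨h', hb'⟩).2 hb
    obtain ⟨c, hc, h7, h8⟩ := exists_atom_not_le h6
    exact hb' (b_of hc h8 (h3 ▸ (eq_of_b hb).ge.trans' (h7.trans hpq.le.2.1)) h7)

/-- Two flats with the same trace on `M` which do not meet outside of `M`. -/
theorem rk_sup_of_not_b {q : Hat M} (hb : ¬ q.b) (hx : ¬ q.x ≤ M) :
    rk (q.y ⊔ q.x) = rk q.y + 1 := by
  have h0 := q.inf_eq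
  have h1 := rk_inf_of_not_le hM htop hx
  by_cases hy : q.y ≤ M
  · rw [inf_eq_left.2 hy] at h0
    rw [sup_eq_right.2 (h0.le.trans inf_le_left), h0, ← h1]
  · have h2 := rk_inf_of_not_le hM htop hy
    have h3 := rk_inf_add_rk_sup_le q.y q.x
    have h4 : rk (q.y ⊓ M) ≤ rk (q.y ⊓ q.x) := rk_mono (le_inf inf_le_left
      (h0.le.trans inf_le_left))
    rw [← h0] at h1
    have h5 : rk q.y < rk (q.y ⊔ q.x) := by
      refine rk_strictMono (left_lt_sup.2 fun h => ?_)
      obtain ⟨c, hc, h7, h8⟩ := exists_atom_not_le hx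
      exact hb (b_of hc h8 (h7.trans h) h7)
    omega

/-- Adding the additional atom to a flat increases the rank by one. -/
theorem step_p {q : Hat M} (h : ¬ q.b) : ∃ r, q ≤ r ∧ r.b ∧ rho r = rho q + 1 := by
  refine ⟨diag M (q.y ⊔ q.x), le_diag_iff.2 ⟨le_sup_left, le_sup_right⟩, trivial, ?_⟩
  rw [rho_of_b (q := diag M _) trivial]
  change rk (q.y ⊔ q.x) + 1 = _
  by_cases hx : q.x ≤ M
  · have h0 := q.inf_eq
    rw [inf_eq_left.2 hx] at h0
    rw [rho_of_le hx h, sup_eq_left.2 (h0.ge.trans inf_le_left)]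
  · rw [rho_of_not_le hx, rk_sup_of_not_b hM htop h hx]

/-- Adding an atom below `M` to a flat increases the rank by one. -/
theorem step_m {q : Hat M} {a : L} (ha : IsAtom a) (haM : a ≤ M) (h : ¬ a ≤ q.y) :
    ∃ r, q ≤ r ∧ a ≤ r.y ∧ a ≤ r.x ∧ rho r = rho q + 1 := by
  have h1 := rk_sup_atom ha h
  by_cases hb : q.b
  · refine ⟨diag M (q.y ⊔ a), le_diag_iff.2 ⟨le_sup_left, (eq_of_b hb).ge.trans le_sup_left⟩,
      le_sup_right, le_sup_right, ?_⟩
    rw [rho_of_b (q := diag M _) trivial, rho_of_b hb, ← h1]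
    rfl
  · have e : ∀ z, (z ⊔ a) ⊓ M = (z ⊓ M) ⊔ a := fun z => by
      rw [inf_comm, sup_comm z, hM.inf_sup z haM, sup_comm, inf_comm]
    refine ⟨ofPair hM htop (q.y ⊔ a) (q.x ⊔ a) (by rw [e, e, q.inf_eq]),
      ⟨le_sup_left, le_sup_left, fun h => (hb h).elim⟩, le_sup_right, le_sup_right, ?_⟩
    by_cases hx : q.x ≤ M
    · rw [rho_of_le hx hb, rho_of_le (show q.x ⊔ a ≤ M from sup_le hx haM)]
      · exact h1
      · rintro ⟨c, -, hcM, -, hc⟩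
        exact hcM (hc.trans (sup_le hx haM))
    · rw [rho_of_not_le hx, rho_of_not_le (show ¬ q.x ⊔ a ≤ M from fun h => hx
        (le_sup_left.trans h)), ← h1]
      rfl

/-- Adding an atom of the first copy, not below `M`, to a flat increases the rank by one. -/
theorem step_v {q : Hat M} {a : L} (ha : IsAtom a) (haM : ¬ a ≤ M) (h : ¬ a ≤ q.y) :
    ∃ r, q ≤ r ∧ a ≤ r.y ∧ rho r = rho q + 1 := by
  have h1 := rk_sup_atom ha h
  have h0 := q.inf_eq
  by_cases hb : q.b
  · refine ⟨diag M (q.y ⊔ a), le_diag_iff.2 ⟨le_sup_left, (eq_of_b hb).ge.trans le_sup_left⟩,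
      le_sup_right, ?_⟩
    rw [rho_of_b (q := diag M _) trivial, rho_of_b hb, ← h1]
    rfl
  -- If the second copy of `a` belongs to the flat, then so will the additional atom.
  by_cases hax : a ≤ q.x
  · refine ⟨diag M (q.y ⊔ a), le_diag_iff.2 ⟨le_sup_left, ?_⟩, le_sup_right, ?_⟩
    · rw [eq_inf_sup hM htop ha haM hax, ← h0]
      exact sup_le_sup_right inf_le_left a
    · rw [rho_of_b (q := diag M _) trivial, rho_of_not_le fun h => haM (hax.trans h), ← h1]
      rfl
  -- Otherwise the new trace `z` on `M` has to be added to the flat of the second copy.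
  · set z := (q.y ⊔ a) ⊓ M with hz
    have h2 : q.y ⊓ M ≤ z := inf_le_inf_right M le_sup_left
    have h3 : (q.y ⊔ a) ⊓ M = (q.x ⊔ z) ⊓ M := by
      rw [inf_comm (q.x ⊔ z), sup_comm q.x, hM.inf_sup q.x (inf_le_right : z ≤ M), inf_comm M,
        ← h0, sup_eq_left.2 h2]
    refine ⟨ofPair hM htop (q.y ⊔ a) (q.x ⊔ z) h3, ⟨le_sup_left, le_sup_left,
      fun h => (hb h).elim⟩, le_sup_right, ?_⟩
    by_cases hx : q.x ≤ M
    · rw [rho_of_le hx hb, rho_of_le (show q.x ⊔ z ≤ M from sup_le hx inf_le_right)]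
      · exact h1
      · rintro ⟨c, -, hcM, -, hc⟩
        exact hcM (hc.trans (sup_le hx inf_le_right))
    · rw [rho_of_not_le hx, rho_of_not_le (show ¬ q.x ⊔ z ≤ M from fun h => hx
        (le_sup_left.trans h)), ← h1]
      rfl

omit hM htop in
theorem rho_bot : rho (⊥ : Hat M) = 0 := by
  rw [rho_of_le (q := (⊥ : Hat M)) (show (⊥ : L) ≤ M from bot_le) (fun h : False => h)]
  exact rk_bot

theorem isAtom_of_rho {e : Hat M} (h : rho e = 1) : IsAtom e := by
  refine ⟨fun h0 => ?_, fun q hq => ?_⟩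
  · rw [h0, rho_bot] at h; omega
  · by_contra h0
    have h1 := rho_strictMono hM htop (bot_lt_iff_ne_bot.2 h0)
    have h2 := rho_strictMono hM htop hq
    omega

/-- A flat which does not contain `p` can be enlarged by an atom below `p`, with the rank growing by
one. Together with the strict monotonicity of `rho`, this shows that `Hat M` is geometric with rank
function `rho`. -/
theorem exists_step {p q : Hat M} (h : ¬ p ≤ q) :
    ∃ e r, IsAtom e ∧ e ≤ p ∧ ¬ e ≤ q ∧ e ≤ r ∧ q ≤ r ∧ rho r = rho q + 1 := by
  have hrv : ∀ a, IsAtom a → rho (inV M a) = 1 := fun a ha => by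
    rw [rho_of_le (q := inV M a) (show a ⊓ M ≤ M from inf_le_right) (fun h : False => h)]
    exact rk_atom ha
  by_cases hy : p.y ≤ q.y
  · by_cases hx : p.x ≤ q.x
    · have hb : ¬ (p.b → q.b) := fun hb => h ⟨hy, hx, hb⟩
      push Not at hb
      obtain ⟨r, h1, h2, h3⟩ := step_p hM htop hb.2
      refine ⟨pt M, r, isAtom_of_rho hM htop ?_, pt_le_iff.2 hb.1, fun h => hb.2 (pt_le_iff.1 h),
        pt_le_iff.2 h2, h1, h3⟩
      rw [rho_of_b (q := pt M) trivial]
      change rk (⊥ : L) + 1 = 1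
      rw [rk_bot]
    · obtain ⟨a, ha, h1, h2⟩ := exists_atom_not_le hx
      have haM : ¬ a ≤ M := fun haM => h2 (le_x_of_le_y haM ((le_y_of_le_x haM h1).trans hy))
      obtain ⟨r, h3, h4, h5⟩ := step_v hM htop (q := swap q) ha haM h2
      refine ⟨inB M a, swap r, isAtom_of_rho hM htop ?_, inB_le_iff.2 h1,
        fun h => h2 (inB_le_iff.1 h), inB_le_iff.2 h4, ⟨h3.2.1, h3.1, h3.2.2⟩, ?_⟩
      · rw [inB, rho_swap hM htop, hrv a ha]
      · rw [rho_swap hM htop, h5, rho_swap hM htop]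
  · obtain ⟨a, ha, h1, h2⟩ := exists_atom_not_le hy
    have hat := isAtom_of_rho hM htop (hrv a ha)
    by_cases haM : a ≤ M
    · obtain ⟨r, h3, h4, -, h5⟩ := step_m hM htop ha haM h2
      exact ⟨inV M a, r, hat, inV_le_iff.2 h1, fun h => h2 (inV_le_iff.1 h), inV_le_iff.2 h4, h3, h5⟩
    · obtain ⟨r, h3, h4, h5⟩ := step_v hM htop ha haM h2
      exact ⟨inV M a, r, hat, inV_le_iff.2 h1, fun h => h2 (inV_le_iff.1 h), inV_le_iff.2 h4, h3, h5⟩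

theorem isGeometricLattice : IsGeometricLattice (Hat M) where
  finite := inferInstance
  isLUB_atoms p := by
    refine ⟨{a | IsAtom a ∧ a ≤ p}, ⟨fun x hx => hx.2, fun q hq => ?_⟩, fun x hx => hx.1⟩
    by_contra hpq
    obtain ⟨e, r, h1, h2, h3, -⟩ := exists_step hM htop hpq
    exact h3 (hq ⟨h1, h2⟩)
  toIsUpperModularLattice := by
    have : IsAtomistic (Hat M) := ⟨fun p => by
      refine ⟨{a | IsAtom a ∧ a ≤ p}, ⟨fun x hx => hx.2, fun q hq => ?_⟩, fun x hx => hx.1⟩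
      by_contra hpq
      obtain ⟨e, r, h1, h2, h3, -⟩ := exists_step hM htop hpq
      exact h3 (hq ⟨h1, h2⟩)⟩
    refine isUpperModularLattice_of_atoms fun q e he heq => ⟨left_lt_sup.2 heq, fun s h1 h2 => ?_⟩
    obtain ⟨e', r, h3, h4, -, h5, h6, h7⟩ := exists_step hM htop heq
    have h5 : e ≤ r := (he.le_iff.1 h4).resolve_left h3.1 ▸ h5
    have h8 : rho q < rho s := rho_strictMono hM htop h1
    have h9 : q ⊔ e ≤ r := sup_le h6 h5
    have h10 : rho s < rho r := rho_strictMono hM htop (lt_of_lt_of_le h2 h9)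
    omega

theorem rk_eq_rho (q : Hat M) : rk q = rho q := by
  have := isGeometricLattice hM htop
  have h0 : rho (⊥ : Hat M) = 0 := rho_bot
  refine rk_eq_of_covBy (rho (M := M)) h0 (fun a b hab => ?_) q
  obtain ⟨e, r, h1, h2, h3, h4, h5, h6⟩ := exists_step hM htop hab.lt.not_ge
  have h7 := (hab.eq_or_eq (le_sup_left : a ≤ a ⊔ e) (sup_le hab.le h2)).resolve_left
    fun h => h3 (sup_eq_left.1 h)
  have h8 := rho_strictMono hM htop hab.lt
  have h9 := (rho_strictMono hM htop).monotone (h7.ge.trans (sup_le h5 h4))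
  omega

theorem rk_inV (a : L) : rk (inV M a) = rk a := by
  rw [rk_eq_rho hM htop, rho_of_le (q := inV M a) (show a ⊓ M ≤ M from inf_le_right) (fun h : False => h)]
  rfl

theorem rk_inB (a : L) : rk (inB M a) = rk a := by
  rw [rk_eq_rho hM htop, inB, rho_swap hM htop, ← rk_eq_rho hM htop, rk_inV hM htop]

theorem rk_pt : rk (pt M) = 1 := by
  rw [rk_eq_rho hM htop, rho_of_b (q := pt M) trivial]
  change rk (⊥ : L) + 1 = 1
  rw [rk_bot]

theorem rk_top : rk (⊤ : Hat M) = rk (⊤ : L) + 1 := by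
  rw [rk_eq_rho hM htop, rho_of_b (q := (⊤ : Hat M)) trivial]
  rfl

open Classical in
/-- A modularity criterion for the hyperplanes of `Hat M`, applied to the two copies of the top element
of `L`. -/
theorem modular_of_le {F : Hat M} (hF : rk F = rk (⊤ : L))
    (h : ∀ q, rk (F ⊓ q) + (if q ≤ F then 0 else 1) = rk q) : IsModularFlat F := by
  have := isGeometricLattice hM htop
  intro q
  have h1 := h q
  by_cases hq : q ≤ F
  · rw [if_pos hq] at h1
    rw [sup_eq_left.2 hq]
    omega
  · rw [if_neg hq] at h1
    have h2 : rk F < rk (F ⊔ q) := rk_strictMono (left_lt_sup.2 hq)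
    have h3 : rk (F ⊔ q) ≤ rk (⊤ : Hat M) := rk_mono le_top
    rw [rk_top hM htop] at h3
    omega

theorem isModularEmbedding_inV : IsModularEmbedding (inV M : L → Hat M) where
  embedding := by
    have := isGeometricLattice hM htop
    refine ⟨fun a a' h => congrArg y h, fun a a' => ?_, fun a ha => ?_⟩
    · exact eq_of_forall_ge_iff fun q => by
        rw [sup_le_iff, inV_le_iff, inV_le_iff, inV_le_iff, sup_le_iff]
    · rw [isAtom_iff_rk, rk_inV hM htop, rk_atom ha]
  range_eq := by
    ext q
    constructor
    · rintro ⟨a, rfl⟩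
      exact inV_le_iff.2 le_top
    · intro h
      have hx : q.x ≤ M := h.2.1.trans inf_le_right
      exact ⟨q.y, ext rfl (q.inf_eq.trans (inf_eq_left.2 hx)) ⟨fun h => h.elim, h.2.2⟩⟩
  modular := by
    refine modular_of_le hM htop (rk_inV hM htop _) fun q => ?_
    have e : inV M ⊤ ⊓ q = inV M q.y := by
      refine ext (top_inf_eq _) ?_ (by
        change False ∧ q.b ↔ False
        tauto)
      change (⊤ ⊓ M) ⊓ q.x = q.y ⊓ M
      rw [top_inf_eq, q.inf_eq, inf_comm]
    rw [e, rk_inV hM htop, rk_eq_rho hM htop, rho]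
    congr 1
    have h1 : q ≤ inV M ⊤ ↔ q.x ≤ M ∧ ¬ q.b :=
      ⟨fun h => ⟨h.2.1.trans inf_le_right, fun h' => h.2.2 h'⟩,
        fun h => le_iff.2 ⟨le_top, le_inf le_top h.1, fun h' => h.2 h'⟩⟩
    split_ifs <;> tauto

theorem isModularEmbedding_inB : IsModularEmbedding (inB M : L → Hat M) where
  embedding := by
    have := isGeometricLattice hM htop
    refine ⟨fun a a' h => congrArg x h, fun a a' => ?_, fun a ha => ?_⟩
    · exact eq_of_forall_ge_iff fun q => by
        rw [sup_le_iff, inB_le_iff, inB_le_iff, inB_le_iff, sup_le_iff]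
    · rw [isAtom_iff_rk, rk_inB hM htop, rk_atom ha]
  range_eq := by
    ext q
    constructor
    · rintro ⟨a, rfl⟩
      exact inB_le_iff.2 le_top
    · intro h
      have hy : q.y ≤ M := h.1.trans inf_le_right
      exact ⟨q.x, ext (q.inf_eq.symm.trans (inf_eq_left.2 hy)) rfl ⟨fun h => h.elim, h.2.2⟩⟩
  modular := by
    refine modular_of_le hM htop (rk_inB hM htop _) fun q => ?_
    have e : inB M ⊤ ⊓ q = inB M q.x := by
      refine ext ?_ (top_inf_eq _) (by
        change False ∧ q.b ↔ False
        tauto)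
      change (⊤ ⊓ M) ⊓ q.y = q.x ⊓ M
      rw [top_inf_eq, ← q.inf_eq, inf_comm]
    rw [e, rk_inB hM htop, rk_eq_rho hM htop, ← rho_swap hM htop, rho]
    congr 1
    have h1 : q ≤ inB M ⊤ ↔ q.y ≤ M ∧ ¬ q.b :=
      ⟨fun h => ⟨h.1.trans inf_le_right, fun h' => h.2.2 h'⟩,
        fun h => le_iff.2 ⟨le_inf le_top h.1, le_top, fun h' => h.2 h'⟩⟩
    split_ifs <;> tauto

/-- The doubled lattice, as a modular extension of `L` through the first copy. -/
@[reducible] noncomputable def ext' : ModularExtension L where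
  E := Hat M
  geometric := isGeometricLattice hM htop
  ι := inV M
  embedding := (isModularEmbedding_inV hM htop).embedding
  range_eq := (isModularEmbedding_inV hM htop).range_eq
  modular := (isModularEmbedding_inV hM htop).modular

end Geometric

end Hat

end HatLattice

end ModDiag

namespace ModDiag

/-! ### Restriction to a modular hyperplane -/

section Restriction

open ModularExtension

variable {L : Type u} [Lattice L] [BoundedOrder L] [IsGeometricLattice L] {M : L}
  (hM : IsModularFlat M)

namespace ModularExtension

/-- An extension of `L`, seen as an extension of the interval `[⊥, M]`. -/
@[reducible] def restr (X : ModularExtension L) : ModularExtension (Set.Iic M) :=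
  X.comp (isModularEmbedding_coe hM)

end ModularExtension

variable {X Y : ModularExtension L}

theorem IsMap.restr {φ : X.E → Y.E} (h : X.IsMap Y φ) :
    IsMap (X.restr hM) (Y.restr hM) φ := ⟨h.embedding, h.rk_top, fun a => h.map_ι a⟩

theorem not_le_restr_F {a : L} (haM : ¬ a ≤ M) : ¬ X.ι a ≤ (X.restr hM).F :=
  fun h => haM (X.ι_le_iff.1 h)

variable (htop : rk (⊤ : L) = rk M + 1)
include htop

theorem sup_eq_top_of_hyperplane {a : L} (ha : IsAtom a) (haM : ¬ a ≤ M) : M ⊔ a = ⊤ :=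
  eq_top_of_rk (by rw [rk_sup_atom ha haM, htop])

theorem ι_sup_eq_F {a : L} (ha : IsAtom a) (haM : ¬ a ≤ M) : X.ι M ⊔ X.ι a = X.F := by
  rw [← X.embedding.map_sup, sup_eq_top_of_hyperplane htop ha haM]; rfl

omit htop in
/-- If `b`, `c` and `a ≠ c` are collinear, then `b` is on the line through `c` and `a`. -/
theorem le_sup_of_line {a b c : L} (hb : IsAtom b) (hc : IsAtom c) (ha : IsAtom a) (hca : c ≠ a)
    (h : b ⊔ c = b ⊔ a) : b ≤ c ⊔ a := by
  have h1 : a ≤ b ⊔ c := h ▸ le_sup_right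
  rw [sup_comm] at h1
  exact exchange ha h1 (fun h' => hca (atom_eq_of_le ha hc h').symm) (rk_atom hb).le

/-- The contraction, in the restricted extension, of an atom `a` of `L` not below `M`. As `M ∨ a = ⊤`,
the result is an extension of `[⊥, M] ≅ [a, ⊤]` with the same flat `F` as the original one. -/
noncomputable def resFun {a : L} (ha : IsAtom a) (haM : ¬ a ≤ M) :
    DiagramFun L (D (Set.Iic M)) where
  toFun X l := ctr (X.restr hM) (X.ι a) l
  alt X := ctr_alt (X.restr hM) (X.ι a)
  bot X l hl := ctr_of_mem_le hl bot_le
  emb X Y φ h l hl := by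
    rw [h.map_ι]
    exact ctr_emb (IsMap.restr hM h) fun b hb => (rk_atom (hl b hb)).le
  span X l hl h := by
    refine ctr_span (fun b hb => (rk_atom (hl b hb)).le) fun h' => h ?_
    rw [← h', ← ι_sup_eq_F htop ha haM, sup_assoc]
    rfl
  split X l w z hl hF h hr hz hlw := by
    refine ctr_split_left (X := X.restr hM) (fun b hb => (rk_atom (hl b hb)).le)
      ((X.ι_le_F _).trans hF) h hr hz hlw ((X.ι_le_F _).trans hF)
  biv X G e f l hG hF he hf hl heG hfG hlG := by
    refine ctr_biv (X := X.restr hM) (fun b hb => ?_) hG ((X.ι_le_F _).trans hF)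
      ((X.ι_le_F _).trans hF) heG hfG hlG
    simp only [List.mem_cons] at hb
    rcases hb with rfl | rfl | hb
    · exact (rk_atom he).le
    · exact (rk_atom hf).le
    · exact (rk_atom (hl b hb)).le

open Classical in
/-- The part of the restriction to `M` which comes from the diagrams whose letters and `M` do not
span, that is, whose letters lie in a hyperplane together with `M`. The resulting map does not
depend on the chosen atom `a`. -/
noncomputable def epsFun {a : L} (ha : IsAtom a) (haM : ¬ a ≤ M) :
    DiagramFun L (D (Set.Iic M)) where
  toFun X l := if X.ι M ⊔ jn l ≠ ⊤ then (resFun hM htop ha haM).toFun X l else 0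
  alt X := ((resFun hM htop ha haM).alt X).ite (fun l => X.ι M ⊔ jn l ≠ ⊤)
    fun l l' h => by rw [jn_perm h]
  bot X l hl := by rw [(resFun hM htop ha haM).bot X l hl, ite_self]
  emb X Y φ h l hl := by
    rw [(resFun hM htop ha haM).emb X Y φ h l hl]
    exact if_congr (by rw [h.jn, h.map_ι, ← h.map_sup, ne_eq, h.eq_top]) rfl rfl
  span X l hl h := by rw [(resFun hM htop ha haM).span X l hl h, ite_self]
  split X l w z hl hF h hr hz hlw := by
    rw [(resFun hM htop ha haM).split X l w z hl hF h hr hz hlw, ite_self]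
  biv X G e f l hG hF he hf hl heG hfG hlG := by
    rw [(resFun hM htop ha haM).biv X G e f l hG hF he hf hl heG hfG hlG, ite_self]

open Classical in
/-- The residue at the atom `a`: the letters equal to `a` are removed and `a` is contracted in the
restricted extension. -/
noncomputable def resAtFun {a : L} (ha : IsAtom a) (haM : ¬ a ≤ M) :
    DiagramFun L (D (Set.Iic M)) where
  toFun X l := dsum l fun c l' => if c = X.ι a then (resFun hM htop ha haM).toFun X l' else 0
  alt X := IsAlt.dsum fun c => ((resFun hM htop ha haM).alt X).ite (fun _ => c = X.ι a)
    fun _ _ _ => Iff.rfl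
  bot X l hl := dsum_eq_zero fun c l' h => by
    split_ifs with hc
    · refine (resFun hM htop ha haM).bot X _ ((List.mem_cons.1 (h.mem_iff.2 hl)).resolve_left ?_)
      rw [hc]
      exact fun h' => ha.1 (X.ι_eq_bot.1 h'.symm)
    · rfl
  emb X Y φ h l hl := by
    rw [dsum_map]
    refine dsum_congr fun c l' hc => ?_
    rw [(resFun hM htop ha haM).emb X Y φ h l' fun b hb => hl b (hc.mem_iff.1 (by simp [hb])),
      h.map_ι, h.embedding.injective.eq_iff]
  span X l hl h := dsum_eq_zero fun c l' hc => by
    split_ifs with hca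
    · refine (resFun hM htop ha haM).span X _ (fun b hb => hl b (hc.mem_iff.1 (by simp [hb])))
        fun h' => h ?_
      rw [← jn_perm hc, jn_cons, hca, ← sup_assoc, sup_eq_left.2 (X.ι_le_F a), h']
    · rfl
  split X l w z hl hF h hr hz hlw := dsum_eq_zero fun c l' hc => by
    rw [(resFun hM htop ha haM).split X _ w z (fun b hb => hl b (hc.mem_iff.1 (by simp [hb])))
      hF h hr hz (fun b hb => hlw b (hc.mem_iff.1 (by simp [hb]))), ite_self]
  biv X G e f l hG hF he hf hl heG hfG hlG := by
    have hF' := (X.ι_le_F a).trans hF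
    rw [dsum_cons, dsum_cons, if_neg (show e ≠ X.ι a from fun h => heG (h ▸ hF')),
      if_neg (show f ≠ X.ι a from fun h => hfG (h ▸ hF')),
      dsum_eq_zero, sub_zero, sub_zero]
    intro c l' hc
    rw [(resFun hM htop ha haM).biv X G e f l' hG hF he hf
      (fun b hb => hl b (hc.mem_iff.1 (by simp [hb]))) heG hfG
      (fun b hb => hlG b (hc.mem_iff.1 (by simp [hb]))), ite_self]

variable {a : L} (ha : IsAtom a) (haM : ¬ a ≤ M)

/-- In the restricted extension, the contractions at `a` and at `b` commute. -/
theorem resFun_contract {b : X.E} (hb : IsAtom b) (hbF : ¬ b ≤ X.F) {l : List X.E}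
    (hl : ∀ c ∈ l, rk c ≤ 1) :
    (resFun hM htop ha haM).toFun (X.contract ⟨b, hb⟩ hbF) (l.map (X.cup _ _)) =
      ctr ((X.restr hM).contract ⟨X.ι a, X.isAtom_ι.2 ha⟩ (not_le_restr_F hM haM))
        (cup _ _ _ b) (l.map (cup _ _ _)) :=
  ctr_comm (X := X.restr hM) hb (fun h => hbF (h.trans (X.ι_le_F M))) (X.isAtom_ι.2 ha)
    (not_le_restr_F hM haM) hl

include ha haM

theorem cup_restr_le_F {b : X.E} (hbF : b ≤ X.F) :
    cup (X.restr hM) ⟨X.ι a, X.isAtom_ι.2 ha⟩ (not_le_restr_F hM haM) b ≤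
      ((X.restr hM).contract ⟨X.ι a, X.isAtom_ι.2 ha⟩ (not_le_restr_F hM haM)).F := by
  rw [contract_F, cup_le_cup]
  refine hbF.trans (le_of_eq ?_)
  rw [sup_comm]
  exact (ι_sup_eq_F htop ha haM).symm

theorem restr_F_sup_jn (l : List X.E) :
    (X.restr hM).F ⊔ jn (X.ι a :: l) = X.F ⊔ jn l := by
  rw [jn_cons, ← sup_assoc]
  exact congrArg (· ⊔ jn l) (ι_sup_eq_F htop ha haM)

/-- A letter is contractible after the contraction of `a` if and only if it is contractible in `X`. -/
theorem dTerm_restr {b : X.E} {l : List X.E} :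
    dTerm ((X.restr hM).contract ⟨X.ι a, X.isAtom_ι.2 ha⟩ (not_le_restr_F hM haM))
      (cup _ _ _ b) (l.map (cup _ _ _)) =
    open Classical in if ¬ b ≤ X.F ∧ b ≤ X.F ⊔ jn l then
      ctr ((X.restr hM).contract ⟨X.ι a, X.isAtom_ι.2 ha⟩ (not_le_restr_F hM haM))
        (cup _ _ _ b) (l.map (cup _ _ _)) else 0 := by
  have h := le_contract_iff (X := X.restr hM) (X.isAtom_ι.2 ha) (not_le_restr_F hM haM) (c := b) (l := l)
  rw [restr_F_sup_jn hM htop ha haM] at h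
  by_cases h1 : b ≤ X.F
  · rw [if_neg fun h' => h'.1 h1]
    exact dTerm_eq_zero (ctr_of_le (cup_restr_le_F hM htop ha haM h1) _)
  · by_cases h2 : b ≤ X.F ⊔ jn l
    · rw [if_pos ⟨h1, h2⟩, dTerm_of_le (h.2 h2)]
    · rw [if_neg fun h' => h2 h'.2, dTerm, if_neg (mt h.1 h2)]

/-- The restriction map `ε` to the diagrams of `[⊥, M]`, see `epsFun`. -/
noncomputable def epsMap : D L →ₗ[ℚ] D (Set.Iic M) := (epsFun hM htop ha haM).lift

/-- The residue map at the atom `a`, see `resAtFun`. -/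
noncomputable def resAtMap : D L →ₗ[ℚ] D (Set.Iic M) := (resAtFun hM htop ha haM).lift

open Classical in
theorem epsMap_cls {l : List X.E} (hl : ∀ c ∈ l, rk c ≤ 1) : epsMap hM htop ha haM (cls X l) =
    if X.ι M ⊔ jn l ≠ ⊤ then (resFun hM htop ha haM).toFun X l else 0 :=
  (epsFun hM htop ha haM).lift_cls hl

open Classical in
theorem resAtMap_cls {l : List X.E} (hl : ∀ c ∈ l, rk c ≤ 1) : resAtMap hM htop ha haM (cls X l) =
    dsum l fun c l' => if c = X.ι a then (resFun hM htop ha haM).toFun X l' else 0 :=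
  (resAtFun hM htop ha haM).lift_cls hl

/-- The differential of a residue, as a sum over the letters before contraction. -/
theorem resFun_dMap {l : List X.E} (hl : ∀ c ∈ l, rk c ≤ 1) :
    dMap _ ((resFun hM htop ha haM).toFun X l) = dsum l fun b l' =>
      dTerm ((X.restr hM).contract ⟨X.ι a, X.isAtom_ι.2 ha⟩ (not_le_restr_F hM haM))
        (cup _ _ _ b) (l'.map (cup _ _ _)) :=
  dMap_ctr (X := X.restr hM) (X.isAtom_ι.2 ha) (not_le_restr_F hM haM) hl

/-- Contracting a letter changes neither whether `M` and the word span, nor, by commutation of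
contractions, the contraction at `a`. -/
theorem epsMap_dMap (x : D L) :
    epsMap hM htop ha haM (dMap L x) = dMap _ (epsMap hM htop ha haM x) := by
  classical
  refine LinearMap.congr_fun (f := epsMap hM htop ha haM ∘ₗ dMap L)
    (g := dMap _ ∘ₗ epsMap hM htop ha haM) (D.hom_ext fun X l hl => ?_) x
  have hrl : ∀ a ∈ l, rk a ≤ 1 := fun a ha => (rk_atom (hl a ha)).le
  rw [LinearMap.comp_apply, LinearMap.comp_apply, dMap_cls hrl, map_dsum,
    epsMap_cls hM htop ha haM hrl]
  have key : ∀ b l', (b :: l').Perm l → epsMap hM htop ha haM (dTerm X b l') =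
      if X.ι M ⊔ jn l ≠ ⊤ then
        dTerm ((X.restr hM).contract ⟨X.ι a, X.isAtom_ι.2 ha⟩ (not_le_restr_F hM haM))
        (cup _ _ _ b) (l'.map (cup _ _ _)) else 0 := by
    intro b l' hb
    have hrl' : ∀ a ∈ l', rk a ≤ 1 := fun a ha => hrl a (hb.mem_iff.1 (by simp [ha]))
    have hbA : IsAtom b := hl b (hb.mem_iff.1 (by simp))
    rw [dTerm_restr hM htop ha haM]
    by_cases hbF : b ≤ X.F
    · rw [if_neg (fun h' => h'.1 hbF : ¬ (¬ b ≤ X.F ∧ b ≤ X.F ⊔ jn l')), ite_self,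
        dTerm_eq_zero (ctr_of_le hbF _), map_zero]
    by_cases h2 : b ≤ X.F ⊔ jn l'
    · rw [dTerm_of_le h2, if_pos (⟨hbF, h2⟩ : ¬ b ≤ X.F ∧ b ≤ X.F ⊔ jn l'), ctr_of hbA hbF,
        epsMap_cls hM htop ha haM (rk_le_one_map_cup hrl'), resFun_contract hM htop ha haM hbA hbF
        hrl']
      refine if_congr ?_ rfl rfl
      rw [jn_map_cup, contract_ι, ← cup_sup, ne_eq, cup_eq_top, ← jn_perm hb, jn_cons,
        sup_left_comm]
    · rw [if_neg (fun h' => h2 h'.2 : ¬ (¬ b ≤ X.F ∧ b ≤ X.F ⊔ jn l')), ite_self, dTerm,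
        if_neg h2, map_zero]
  rw [dsum_congr key]
  by_cases h4 : X.ι M ⊔ jn l ≠ ⊤
  · simp only [if_pos h4]
    exact (resFun_dMap hM htop ha haM hrl).symm
  · simp only [if_neg h4, dsum_zero, map_zero]

/-- Residues anticommute with the differential. In the residue of `d x`, the letters equal to `a` give
the differential of the residue, and the letters which become equal to `a` after the contraction of
a letter `b` cancel in pairs. -/
theorem resAtMap_dMap (x : D L) :
    resAtMap hM htop ha haM (dMap L x) = - dMap _ (resAtMap hM htop ha haM x) := by
  classical
  refine LinearMap.congr_fun (f := resAtMap hM htop ha haM ∘ₗ dMap L)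
    (g := - (dMap _ ∘ₗ resAtMap hM htop ha haM)) (D.hom_ext fun X l hl => ?_) x
  have hrl : ∀ a ∈ l, rk a ≤ 1 := fun a ha => (rk_atom (hl a ha)).le
  rw [LinearMap.neg_apply, LinearMap.comp_apply, LinearMap.comp_apply, dMap_cls hrl, map_dsum,
    resAtMap_cls hM htop ha haM hrl, map_dsum]
  set C : X.E → List X.E → D (Set.Iic M) := fun b l'' =>
    ctr ((X.restr hM).contract ⟨X.ι a, X.isAtom_ι.2 ha⟩ (not_le_restr_F hM haM))
        (cup _ _ _ b) (l''.map (cup _ _ _)) with hC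
  -- contributions of the letters which become equal to `a` after contraction
  let Φ : X.E → X.E → List X.E → D (Set.Iic M) := fun b c l'' =>
    if (c ≠ X.ι a ∧ ¬ b ≤ X.F) ∧ b ⊔ c = b ⊔ X.ι a then C b l'' else 0
  -- contributions of the letters equal to `a`
  let Θ : X.E → X.E → List X.E → D (Set.Iic M) := fun c b l'' =>
    if c = X.ι a ∧ (¬ b ≤ X.F ∧ b ≤ X.F ⊔ jn l'') then C b l'' else 0
  have hΦ0 : ∀ b c l'', ¬ ((c ≠ X.ι a ∧ ¬ b ≤ X.F) ∧ b ⊔ c = b ⊔ X.ι a) → Φ b c l'' = 0 :=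
    fun _ _ _ h => if_neg h
  have hΘ0 : ∀ c b l'', ¬ (c = X.ι a ∧ (¬ b ≤ X.F ∧ b ≤ X.F ⊔ jn l'')) → Θ c b l'' = 0 :=
    fun _ _ _ h => if_neg h
  have h1 : (dsum l fun c l' => dMap _ (if c = X.ι a then (resFun hM htop ha haM).toFun X l'
      else 0)) = dsum l fun c l' => dsum l' (Θ c) := by
    refine dsum_congr fun c l' hc => ?_
    have hrl' : ∀ a ∈ l', rk a ≤ 1 := fun a ha => hrl a (hc.mem_iff.1 (by simp [ha]))
    by_cases h : c = X.ι a
    · rw [if_pos h, resFun_dMap hM htop ha haM hrl']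
      refine dsum_congr fun b l'' hb => ?_
      rw [dTerm_restr hM htop ha haM]
      simp only [Θ, h, true_and, hC]
    · rw [if_neg h, map_zero]
      exact (dsum_eq_zero fun b l'' _ => if_neg fun h' => h h'.1).symm
  have h2 : (dsum l fun b l' => resAtMap hM htop ha haM (dTerm X b l')) =
      dsum l fun b l' => dsum l' fun c l'' => Φ b c l'' + Θ c b l'' := by
    refine dsum_congr fun b l' hb => ?_
    have hrl' : ∀ a ∈ l', rk a ≤ 1 := fun a ha => hrl a (hb.mem_iff.1 (by simp [ha]))
    have hbA : IsAtom b := hl b (hb.mem_iff.1 (by simp))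
    by_cases hbF : b ≤ X.F
    · rw [dTerm_eq_zero (ctr_of_le hbF _), map_zero]
      refine (dsum_eq_zero fun c l'' _ => ?_).symm
      rw [hΦ0 _ _ _ fun h => h.1.2 hbF, hΘ0 _ _ _ fun h => h.2.1 hbF, add_zero]
    have hval : ∀ c l'', (c :: l'').Perm l' → b ≤ X.F ⊔ jn l' →
        (if X.cup ⟨b, hbA⟩ hbF c = (X.contract ⟨b, hbA⟩ hbF).ι a then
          (resFun hM htop ha haM).toFun (X.contract ⟨b, hbA⟩ hbF) (l''.map (X.cup _ _)) else 0) =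
        Φ b c l'' + Θ c b l'' := by
      intro c l'' hc hb1
      have hrl'' : ∀ a ∈ l'', rk a ≤ 1 := fun a ha => hrl' a (hc.mem_iff.1 (by simp [ha]))
      rw [resFun_contract hM htop ha haM hbA hbF hrl'', contract_ι, cup_inj]
      by_cases hca : c = X.ι a
      · have hb2 : b ≤ X.F ⊔ jn l'' := by
          rwa [← jn_perm hc, jn_cons, hca, ← sup_assoc, sup_eq_left.2 (X.ι_le_F a)] at hb1
        rw [hΦ0 _ _ _ fun h => h.1.1 hca, zero_add, if_pos (by rw [hca])]
        exact (if_pos ⟨hca, hbF, hb2⟩).symm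
      · rw [hΘ0 _ _ _ fun h => hca h.1, add_zero]
        exact if_congr (and_iff_right ⟨hca, hbF⟩).symm rfl rfl
    by_cases hb1 : b ≤ X.F ⊔ jn l'
    · rw [dTerm_of_le hb1, ctr_of hbA hbF, resAtMap_cls hM htop ha haM (rk_le_one_map_cup hrl'),
        dsum_map]
      exact dsum_congr fun c l'' hc => hval c l'' hc hb1
    · rw [dTerm, if_neg hb1, map_zero]
      refine (dsum_eq_zero fun c l'' hc => ?_).symm
      rw [hΦ0, hΘ0, add_zero]
      · refine fun h => hb1 (h.2.2.trans (sup_le_sup_left ?_ _))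
        rw [← jn_perm hc, jn_cons]
        exact le_sup_right
      · rintro ⟨⟨hca, -⟩, hbc⟩
        refine hb1 ?_
        have hcA : IsAtom c := hl c (hb.mem_iff.1 (by
          rw [List.mem_cons, ← hc.mem_iff]; simp))
        have h5 : b ≤ X.ι a ⊔ c := by
          rw [sup_comm]
          exact le_sup_of_line hbA hcA (X.isAtom_ι.2 ha) hca hbc
        refine h5.trans (sup_le_sup (X.ι_le_F a) ?_)
        rw [← jn_perm hc, jn_cons]
        exact le_sup_left
  rw [h1, h2]
  simp only [dsum_add]
  rw [eq_neg_iff_add_eq_zero, add_assoc, add_comm (dsum l fun b l' => dsum l' fun c l'' => Θ c b l''),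
    dsum_comm, add_zero]
  -- If `c` becomes equal to `a` after the contraction of `b`, then `a`, `b`, `c` are collinear, so
  -- that `b` becomes equal to `a` after the contraction of `c`, with the same result.
  refine dsum_dsum_eq_zero_of_symm l Φ fun b c l'' hbc => ?_
  have hbA : IsAtom b := hl b (hbc.mem_iff.1 (by simp))
  have hcA : IsAtom c := hl c (hbc.mem_iff.1 (by simp))
  have haA := X.isAtom_ι.2 ha
  have key : ∀ {b c : X.E}, IsAtom b → IsAtom c → (c ≠ X.ι a ∧ ¬ b ≤ X.F) ∧ b ⊔ c = b ⊔ X.ι a →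
      (b ≠ X.ι a ∧ ¬ c ≤ X.F) ∧ c ⊔ b = c ⊔ X.ι a := by
    rintro b c hb hc ⟨⟨h1, h2⟩, h3⟩
    have h4 := le_sup_of_line hb hc haA h1 h3
    refine ⟨⟨?_, fun h => h2 (h4.trans (sup_le h (X.ι_le_F a)))⟩, le_antisymm ?_ ?_⟩
    · rintro rfl
      exact h2 (X.ι_le_F a)
    · exact sup_le le_sup_left h4
    · refine sup_le le_sup_left (le_sup_right.trans (h3.ge.trans (sup_comm b c).le))
  simp only [Φ]
  by_cases h : (c ≠ X.ι a ∧ ¬ b ≤ X.F) ∧ b ⊔ c = b ⊔ X.ι a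
  · rw [if_pos h, if_pos (key hbA hcA h), hC]
    simp only
    congr 1
    rw [cup_inj]
    have h' := key hbA hcA h
    simp only
    rw [sup_comm, ← h.2, sup_comm, h'.2, sup_comm]
  · rw [if_neg h, if_neg fun h' => h (key hcA hbA h')]

end Restriction

end ModDiag

namespace ModDiag

/-! ### Compatibility of restrictions with Orlik–Solomon algebras -/

section OSCompat

open ModularExtension

variable {L : Type u} [Lattice L] [BoundedOrder L] [IsGeometricLattice L] {M : L}
  (hM : IsModularFlat M) (htop : rk (⊤ : L) = rk M + 1)
  {a : L} (ha : IsAtom a) (haM : ¬ a ≤ M) {X : ModularExtension L}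
include hM htop ha haM

open Classical in
/-- On Orlik–Solomon algebras, the contraction at `a` is given by the traces on `M` of the lines
through `a`. -/
theorem osMap_resFun {l : List X.E} (hl : ∀ c ∈ l, rk c ≤ 1) :
    osMap _ ((resFun hM htop ha haM).toFun X l) =
      if X.F = ⊤ then genProd ((l.map X.trace).map fun b => tr M (a ⊔ b)) else 0 := by
  have h1 : (resFun hM htop ha haM).toFun X l =
    cls ((X.restr hM).contract ⟨X.ι a, X.isAtom_ι.2 ha⟩ (not_le_restr_F hM haM))
      (l.map (cup _ _ _)) := ctr_of (X := X.restr hM) (X.isAtom_ι.2 ha) (not_le_restr_F hM haM) l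
  have h2 : ((X.restr hM).contract ⟨X.ι a, X.isAtom_ι.2 ha⟩ (not_le_restr_F hM haM)).F = ⊤ ↔
      X.F = ⊤ := by
    rw [contract_F, cup_eq_top, ← ι_sup_eq_F htop ha haM, sup_comm]
    exact Iff.rfl
  rw [h1]
  refine (osMap_cls (rk_le_one_map_cup (X := X.restr hM) (b := ⟨X.ι a, X.isAtom_ι.2 ha⟩)
    (h := not_le_restr_F hM haM) hl)).trans ?_
  by_cases hF : X.F = ⊤
  · rw [if_pos hF, if_pos (h2.2 hF), List.map_map, List.map_map]
    refine congrArg genProd (List.map_congr_left fun b _ => ?_)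
    rw [Function.comp_apply, Function.comp_apply, trace_contract]
    refine eq_of_forall_le_iff fun m => ?_
    rw [← ι_le_iff_le_trace]
    have h3 : X.ι a ⊔ b = X.ι (a ⊔ X.trace b) := by
      rw [X.embedding.map_sup, X.ι_trace_of_le (hF ▸ le_top)]
    change X.ι m.1 ≤ X.ι a ⊔ b ↔ m.1 ≤ (a ⊔ X.trace b) ⊓ M
    rw [h3, X.ι_le_iff, le_inf_iff]
    exact (and_iff_left m.2).symm
  · rw [if_neg hF, if_neg (mt h2.1 hF)]

/-- The map `epsMap` induces the projection of Orlik–Solomon algebras. -/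
theorem exists_osMap_epsMap : ∃ φ : OS L →ₗ[ℚ] OS (Set.Iic M), ∀ x,
    osMap _ (epsMap hM htop ha haM x) = φ (osMap L x) := by
  classical
  obtain ⟨φ, hφ⟩ := exists_osProj M
  refine ⟨φ, LinearMap.congr_fun (f := osMap _ ∘ₗ epsMap hM htop ha haM) (g := φ ∘ₗ osMap L)
    (D.hom_ext fun X l hl => ?_)⟩
  have hrl : ∀ a ∈ l, rk a ≤ 1 := fun a ha => (rk_atom (hl a ha)).le
  rw [LinearMap.comp_apply, LinearMap.comp_apply, epsMap_cls hM htop ha haM hrl, osMap_cls hrl,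
    apply_ite (osMap _), map_zero, osMap_resFun hM htop ha haM hrl]
  by_cases hF : X.F = ⊤
  · have hle : ∀ b, b ≤ X.F := fun b => hF ▸ le_top
    have h1 : ∀ b ∈ l.map X.trace, IsAtom b := by
      intro b hb
      obtain ⟨c, hc, rfl⟩ := List.mem_map.1 hb
      exact X.isAtom_trace (hl c hc) (hle c)
    rw [if_pos hF, if_pos hF, hφ _ h1]
    by_cases h2 : ∀ b ∈ l.map X.trace, b ≤ M
    · have h3 : X.ι M ⊔ jn l ≠ ⊤ := by
        rw [sup_eq_left.2 (jn_le_iff.2 fun c hc => ?_), ← hF]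
        · exact fun h => haM (le_top.trans (X.ι_le_iff.1 h.ge))
        · rw [← X.ι_trace_of_le (hle c)]
          exact X.ι_le_ι (h2 _ (List.mem_map_of_mem hc))
      rw [if_pos h2, if_pos h3]
      refine congrArg genProd (List.map_congr_left fun b hb => Subtype.ext ?_)
      change (a ⊔ b) ⊓ M = b ⊓ M
      have h4 := hM.inf_sup a (h2 b hb)
      have h5 : M ⊓ a = ⊥ := (ha.le_iff.1 inf_le_right).resolve_right
        fun h' => haM (inf_eq_right.1 h')
      rw [inf_comm, sup_comm, h4, h5, sup_bot_eq, inf_eq_left.2 (h2 b hb)]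
    · rw [if_neg h2]
      push Not at h2
      obtain ⟨b, hb, hbM⟩ := h2
      obtain ⟨c, hc, rfl⟩ := List.mem_map.1 hb
      rw [if_neg]
      rw [not_not, ← top_le_iff, ← hF, ← ι_sup_eq_F htop (h1 _ hb) hbM]
      exact sup_le_sup_left ((X.ι_trace_of_le (hle c)).le.trans (le_jn hc)) _
  · rw [if_neg hF, if_neg hF, ite_self, map_zero]

/-- The residue maps induce the residues of Orlik–Solomon algebras. -/
theorem exists_osMap_resAtMap : ∃ φ : OS L →ₗ[ℚ] OS (Set.Iic M), ∀ x,
    osMap _ (resAtMap hM htop ha haM x) = φ (osMap L x) := by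
  classical
  obtain ⟨φ, hφ⟩ := exists_osRes hM htop ha haM
  refine ⟨φ, LinearMap.congr_fun (f := osMap _ ∘ₗ resAtMap hM htop ha haM) (g := φ ∘ₗ osMap L)
    (D.hom_ext fun X l hl => ?_)⟩
  have hrl : ∀ a ∈ l, rk a ≤ 1 := fun a ha => (rk_atom (hl a ha)).le
  rw [LinearMap.comp_apply, LinearMap.comp_apply, resAtMap_cls hM htop ha haM hrl, osMap_cls hrl,
    map_dsum]
  by_cases hF : X.F = ⊤
  · have hle : ∀ b, b ≤ X.F := fun b => hF ▸ le_top
    have h1 : ∀ b ∈ l.map X.trace, IsAtom b := by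
      intro b hb
      obtain ⟨c, hc, rfl⟩ := List.mem_map.1 hb
      exact X.isAtom_trace (hl c hc) (hle c)
    rw [if_pos hF, hφ _ h1, dsum_map]
    refine dsum_congr fun c l' hc => ?_
    rw [apply_ite (osMap _), map_zero, osMap_resFun hM htop ha haM
      fun b hb => hrl b (hc.mem_iff.1 (by simp [hb])), if_pos hF]
    refine if_congr ?_ rfl rfl
    rw [trace_eq_iff, inf_eq_left.2 (hle c)]
  · rw [if_neg hF, map_zero]
    refine dsum_eq_zero fun c l' hc => ?_
    rw [apply_ite (osMap _), map_zero, osMap_resFun hM htop ha haM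
      fun b hb => hrl b (hc.mem_iff.1 (by simp [hb])), if_neg hF, ite_self]

end OSCompat

/-! ### Extension from a modular hyperplane -/

section Induction

open ModularExtension

variable {L : Type u} [Lattice L] [BoundedOrder L] [IsGeometricLattice L] {M : L}
  (hM : IsModularFlat M)

/-- The lattice `L`, as a modular extension of `[⊥, M]`. -/
@[reducible] def ambient : ModularExtension (Set.Iic M) := .of (isModularEmbedding_coe hM)

/-- The identity, as a map from `L` to the extension `L` of `[⊥, M]`. -/
@[reducible] def toAmbient (x : L) : (ambient hM).E := x

theorem isModularEmbedding_toAmbient : IsModularEmbedding (toAmbient hM) :=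
  isModularEmbedding_id (L := L)

theorem ambient_ι_le_iff {m : Set.Iic M} {x : L} : m ≤ (ambient hM).trace x ↔ (m : L) ≤ x :=
  (ambient hM).ι_le_iff_le_trace.symm

/-- Extending diagrams from `[⊥, M]` to `L`, by gluing the lattice `L` along `[⊥, M]` and adding the
letters `W`. -/
noncomputable def indMap (W : List L) (hW : ∀ b ∈ W, rk b ≤ 1) : D (Set.Iic M) →ₗ[ℚ] D L :=
  glueMap (ambient hM) (isModularEmbedding_toAmbient hM) W hW

theorem indMap_cls {X : ModularExtension (Set.Iic M)} {W : List L} (hW : ∀ b ∈ W, rk b ≤ 1)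
    {l : List X.E} (hl : ∀ b ∈ l, rk b ≤ 1) : indMap hM W hW (cls X l) =
      cls (X.glue (ambient hM) (isModularEmbedding_toAmbient hM))
        (glueWord X (isModularEmbedding_toAmbient hM) W l) := glueMap_cls hW hl

/-- The letters of `W` are below the flat `F = L` of an induced diagram, hence are never contracted;
the other letters are moved past them. -/
theorem dMap_indMap {W : List L} (hW : ∀ b ∈ W, rk b ≤ 1) (x : D (Set.Iic M)) :
    dMap L (indMap hM W hW x) = (-1 : ℚ) ^ W.length • indMap hM W hW (dMap _ x) := by
  refine LinearMap.congr_fun (f := dMap L ∘ₗ indMap hM W hW)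
    (g := (-1 : ℚ) ^ W.length • (indMap hM W hW ∘ₗ dMap _)) (D.hom_ext fun X l hl => ?_) x
  have hrl : ∀ a ∈ l, rk a ≤ 1 := fun a ha => (rk_atom (hl a ha)).le
  have hF : ∀ y : (ambient hM).E, gr X (isModularEmbedding_toAmbient hM) y ≤
      (X.glue (ambient hM) (isModularEmbedding_toAmbient hM)).F := fun y =>
    gr_le_iff.2 (show y ≤ (⊤ : L) from le_top)
  rw [LinearMap.smul_apply, LinearMap.comp_apply, LinearMap.comp_apply, indMap_cls hM hW hrl,
    dMap_cls (rk_le_one_glueWord hW hrl), glueWord, dsum_append, dMap_cls hrl, map_dsum,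
    List.length_map, dsum_eq_zero, zero_add, dsum_map]
  · congr 1
    refine dsum_congr fun c l' hc => ?_
    have hle : (ambient hM).F ≤ toAmbient hM ⊤ ⊔ jn W := le_sup_of_le_left (le_top (α := L))
    refine dTerm_glue hW hle (hl c (hc.mem_iff.1 (by simp))) (fun h => ?_)
      fun b hb => hrl b (hc.mem_iff.1 (by simp [hb]))
    rw [← X.ι_trace_of_le h, gl_ι]
    exact hF _
  · intro c W' hc
    obtain ⟨b, hb, rfl⟩ := List.mem_map.1 (hc.mem_iff.1 (by simp : c ∈ c :: W'))
    exact dTerm_eq_zero (ctr_of_le (hF b) _)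

/-- A map of lattices which preserves joins and ranks is an embedding. -/
theorem isEmbedding_of_rk {E E' : Type u} [Lattice E] [BoundedOrder E] [IsGeometricLattice E]
    [Lattice E'] [BoundedOrder E'] [IsGeometricLattice E'] {φ : E → E'}
    (hsup : ∀ x y, φ (x ⊔ y) = φ x ⊔ φ y) (hrk : ∀ x, rk (φ x) = rk x) : IsEmbedding φ := by
  have key : ∀ x y, φ x = φ y → y ≤ x := fun x y h => by
    have h1 := hsup x y
    rw [← h, sup_idem] at h1
    have h2 := hrk (x ⊔ y)
    rw [h1, hrk] at h2
    exact sup_eq_left.1 (eq_of_le_of_rk_le le_sup_left h2.ge).symm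
  refine ⟨fun x y h => le_antisymm (key y x h.symm) (key x y h), hsup, fun x hx => ?_⟩
  rw [isAtom_iff_rk, hrk, rk_atom hx]

variable (htop : rk (⊤ : L) = rk M + 1) {X : ModularExtension L}

/-- The interval `[⊥, G]` of an extension of `L`, as a modular extension of `[⊥, M]`. -/
def below (X : ModularExtension L) {G : X.E} (hMG : X.ι M ≤ G) : ModularExtension (Set.Iic M) where
  E := Set.Iic G
  ι m := ⟨X.ι m, (X.ι_le_ι m.2).trans hMG⟩
  embedding := ⟨fun _ _ h => Subtype.ext (X.embedding.injective (congrArg Subtype.val h)),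
    fun m m' => Subtype.ext (X.embedding.map_sup m m'),
    fun m hm => isAtom_coe_Iic.1 (X.embedding.map_atom m (isAtom_coe_Iic.2 hm))⟩
  range_eq := by
    ext ⟨x, hx⟩
    constructor
    · rintro ⟨m, hm⟩
      rw [← hm]
      exact X.ι_le_ι m.2
    · intro h
      have h1 : x ≤ X.ι M := h
      have h2 : X.ι (X.trace x) = x := X.ι_trace_of_le (h1.trans (X.ι_le_F M))
      exact ⟨⟨X.trace x, X.ι_le_iff.1 (h2.le.trans h1)⟩, Subtype.ext h2⟩
  modular := by
    rintro ⟨x, hx⟩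
    have := X.modular_ι hM x
    rw [rk_Iic, rk_Iic, rk_Iic, rk_Iic]
    exact this

include hM in
/-- The interval `[⊥, G]`, its inclusion `val` into the extension and the adjoint `mk` of `val`. -/
theorem exists_below (X : ModularExtension L) {G : X.E} (hMG : X.ι M ≤ G) :
    ∃ (P : ModularExtension (Set.Iic M)) (val : P.E → X.E) (mk : X.E → P.E),
      (∀ g e, val g ≤ e ↔ g ≤ mk e) ∧ (∀ x, x ≤ G → val (mk x) = x) ∧ (∀ g, val g ≤ G) ∧
      (∀ g, rk (val g) = rk g) ∧ (∀ m, val (P.ι m) = X.ι m) ∧ val ⊤ = G := by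
  refine ⟨below hM X hMG, Subtype.val, fun e => ⟨e ⊓ G, inf_le_right⟩, fun g e => ?_,
    fun x hx => inf_eq_left.2 hx, fun g => g.2, fun g => (rk_Iic (M := G) g).symm, fun m => rfl,
    rfl⟩
  exact ⟨fun h => le_inf h g.2, fun h => le_trans h inf_le_left⟩

include htop

/-- A proper flat above `M` which spans together with `F` is a hyperplane. -/
theorem rk_of_hyperplane {G : X.E} (hMG : X.ι M ≤ G) (h : X.F ⊔ G = ⊤) (hG : G ≠ ⊤) :
    rk G + 1 = rk (⊤ : X.E) := by
  have h1 := X.modular_F G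
  have h2 : rk (X.ι M) ≤ rk (X.F ⊓ G) := rk_mono (le_inf (X.ι_le_F M) hMG)
  have h3 : rk G < rk (⊤ : X.E) := rk_strictMono (lt_top_iff_ne_top.2 hG)
  rw [h, X.rk_F] at h1
  rw [X.rk_ι_eq] at h2
  omega

/-- If the letters of a diagram lie in a hyperplane `G` above `M`, then the diagram is induced from
`[⊥, M]`. -/
theorem indMap_epsMap_cls {a : L} (ha : IsAtom a) (haM : ¬ a ≤ M) {l : List X.E}
    (hl : ∀ c ∈ l, IsAtom c) (hsp : X.ι M ⊔ jn l ≠ ⊤) :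
    indMap hM [] (by simp) ((resFun hM htop ha haM).toFun X l) = cls X l := by
  have hrl : ∀ a ∈ l, rk a ≤ 1 := fun a ha => (rk_atom (hl a ha)).le
  by_cases hF : X.F ⊔ jn l = ⊤
  swap
  · rw [cls_span hl hF, (resFun hM htop ha haM).span X l hl hF, map_zero]
  -- Outside of the vanishing cases, `G` is a hyperplane, and an atom of `L` below `G` is below `M`.
  set G := X.ι M ⊔ jn l with hG
  have hMG : X.ι M ≤ G := le_sup_left
  have hFG : X.F ⊔ G = ⊤ := top_le_iff.1 (hF ▸ sup_le_sup_left le_sup_right _)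
  have hrG := rk_of_hyperplane htop hMG hFG hsp
  have htr : ∀ x, IsAtom x → ¬ x ≤ M → ¬ X.ι x ≤ G := fun x hx hxM h => hsp (by
    rw [← hFG, ← ι_sup_eq_F htop hx hxM, eq_comm, sup_eq_right]
    exact sup_le hMG h)
  have haG := htr a ha haM
  have haX : IsAtom (X.ι a) := X.isAtom_ι.2 ha
  obtain ⟨P, val, mk, gcP, val_mk, val_le, rk_val, val_ι, val_top⟩ := exists_below hM X hMG
  have val_sup : ∀ g g', val (g ⊔ g') = val g ⊔ val g' := fun g g' =>
    GaloisConnection.l_sup (u := mk) gcP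
  obtain ⟨lP, hlP⟩ : ∃ lP : List P.E, lP.map val = l := exists_map_eq fun b hb =>
    ⟨mk b, val_mk b ((le_jn hb).trans le_sup_right)⟩
  have hlP1 : ∀ b ∈ lP, rk b ≤ 1 := fun b hb => by
    rw [← rk_val]
    exact hrl _ (hlP ▸ List.mem_map_of_mem hb)
  -- the atom `a` is in general position with respect to the hyperplane `G`
  have e1 : (resFun hM htop ha haM).toFun X l = cls P lP := by
    have hrk : ∀ g, rk (cup (X.restr hM) ⟨X.ι a, haX⟩ (not_le_restr_F hM haM) (val g)) = rk g :=
      fun g => by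
        have h1 := rk_cup (X := X.restr hM) (b := ⟨X.ι a, haX⟩) (h := not_le_restr_F hM haM) (val g)
        have h2 := rk_sup_atom haX (fun h => haG (h.trans (val_le g)))
        rw [sup_comm, rk_val] at h2
        simp only [h2] at h1
        omega
    have h₁ : IsMap P ((X.restr hM).contract ⟨X.ι a, haX⟩ (not_le_restr_F hM haM))
        fun g => cup _ _ _ (val g) := by
      refine ⟨isEmbedding_of_rk (fun g g' => ?_) hrk, ?_, fun m => ?_⟩
      · rw [val_sup, cup_sup]
      · have h1 := rk_contract_top (X := X.restr hM) (b := ⟨X.ι a, haX⟩)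
          (h := not_le_restr_F hM haM)
        have h2 := rk_val ⊤
        rw [val_top] at h2
        simp only [← hrG, h2] at h1
        omega
      · rw [val_ι]
        rfl
    refine (ctr_of (X := X.restr hM) haX (not_le_restr_F hM haM) l).trans ?_
    refine Eq.trans ?_ ((clsFun _).emb' h₁ hlP1)
    rw [← hlP, List.map_map]
    rfl
  rw [e1, indMap_cls hM _ hlP1, glueWord, List.map_nil, List.nil_append]
  let hβ := isModularEmbedding_toAmbient hM
  -- The join map from the pushout of `[⊥, G]` and `L` to `X` is an embedding of full rank.
  let φ₂ : (P.glue (ambient hM) hβ).E → X.E := fun p => val (fst p) ⊔ X.ι (snd p)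
  have hcond : ∀ e : X.E, P.trace (mk e) = (ambient hM).trace (X.trace e) :=
    fun e => eq_of_forall_le_iff fun m => by
      rw [ambient_ι_le_iff, ← P.ι_le_iff_le_trace, ← X.ι_le_iff_le_trace, ← gcP, val_ι]
  have gc : GaloisConnection φ₂ fun e => pair hβ (mk e) (X.trace e) (hcond e) := fun p e => by
    rw [glue_le_iff, sup_le_iff, X.ι_le_iff_le_trace, gcP]
    exact Iff.rfl
  have hrk : ∀ p, rk (φ₂ p) = rk p := fun p => by
    have h1 := rk_glue p
    have h2 := rk_val (fst p)
    have hp : ∀ m : L, m ≤ M → (X.ι m ≤ val (fst p) ↔ m ≤ snd p) := fun m hm => by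
      have h3 := P.ι_le_iff_le_trace (a := ⟨m, hm⟩) (x := fst p)
      rw [trace_fst, ambient_ι_le_iff] at h3
      rw [← h3, ← val_ι ⟨m, hm⟩]
      refine ⟨fun h => ?_, fun h => (GaloisConnection.monotone_l (u := mk) gcP) h⟩
      have h4 := val_sup (P.ι ⟨m, hm⟩) (fst p)
      rw [sup_eq_right.2 h] at h4
      have h5 := rk_val (P.ι ⟨m, hm⟩ ⊔ fst p)
      rw [h4, rk_val] at h5
      exact sup_eq_right.1 (eq_of_le_of_rk_le le_sup_right h5.ge).symm
    have h4 : (P.trace (fst p) : L) = snd p ⊓ M := by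
      refine eq_of_forall_le_iff fun m => ?_
      rw [trace_fst]
      constructor
      · intro hm
        have hmM : m ≤ M := hm.trans ((ambient hM).trace (snd p)).2
        exact le_inf ((ambient_ι_le_iff hM (m := ⟨m, hmM⟩)).1 hm) hmM
      · intro hm
        exact (ambient_ι_le_iff hM (m := ⟨m, hm.trans inf_le_right⟩)).2 (hm.trans inf_le_left)
    have h5 : rk (P.trace (fst p)) = rk (snd p ⊓ M : L) := by rw [rk_Iic, h4]
    -- Either `φ₂ p` is below `G`, or it is the join of its part below `G` with one further atom.
    by_cases hx : (snd p : L) ≤ M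
    · have h6 : φ₂ p = val (fst p) := sup_eq_left.2 ((hp _ hx).2 le_rfl)
      rw [inf_eq_left.2 hx] at h5
      rw [h6]
      omega
    · obtain ⟨c, hc, hcx, hcM⟩ := exists_atom_not_le hx
      have h6 : φ₂ p = val (fst p) ⊔ X.ι c := by
        refine le_antisymm (sup_le le_sup_left ?_) (sup_le_sup_left (X.ι_le_ι hcx) _)
        rw [Hat.eq_inf_sup hM htop hc hcM hcx, X.embedding.map_sup]
        exact sup_le_sup_right ((hp _ inf_le_right).2 inf_le_left) _
      have h8 := Hat.rk_inf_of_not_le hM htop hx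
      have h9 := rk_sup_atom (X.isAtom_ι.2 hc) (fun h => htr c hc hcM (h.trans (val_le (fst p))))
      rw [h6, h9]
      omega
  have h₂ : IsMap (P.glue (ambient hM) hβ) X φ₂ := by
    refine ⟨isEmbedding_of_rk (fun p q => gc.l_sup) hrk, ?_, fun x => ?_⟩
    · have h1 : φ₂ ⊤ = ⊤ := by
        rw [← hFG, sup_comm]
        change val ⊤ ⊔ X.ι ⊤ = _
        rw [val_top]
        rfl
      rw [← hrk, h1]
    · refine eq_of_forall_ge_iff fun e => ?_
      rw [gc, glue_ι, gr_le_iff, X.ι_le_iff_le_trace, snd_pair]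
  refine ((clsFun L).emb' h₂ (l := lP.map (gl hβ)) fun b hb => ?_).symm.trans ?_
  · obtain ⟨c, hc, rfl⟩ := List.mem_map.1 hb
    rw [rk_gl]
    exact hlP1 c hc
  refine congrArg (cls X) ?_
  rw [List.map_map]
  refine Eq.trans (List.map_congr_left fun b _ => ?_) hlP
  refine eq_of_forall_ge_iff fun e => ?_
  rw [Function.comp_apply, gc, gl_le_iff, fst_pair, gcP]

end Induction

end ModDiag

namespace ModDiag

/-! ### The homotopy -/

section Homotopy

open ModularExtension Hat

variable {L : Type u} [Lattice L] [BoundedOrder L] [IsGeometricLattice L] {M : L}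
  (hM : IsModularFlat M) (htop : rk (⊤ : L) = rk M + 1)

theorem trace_hat (q : Hat M) : (Hat.ext' hM htop).trace q = q.y :=
  eq_of_forall_le_iff fun a => by
    rw [← ι_le_iff_le_trace]
    exact inV_le_iff

/-- The embedding of `L` as the second copy. -/
theorem isModularEmbedding_second :
    @IsModularEmbedding L (Hat.ext' hM htop).E _ _ _ _ (inB M) :=
  Hat.isModularEmbedding_inB hM htop

/-- The extension of `L` obtained by gluing an extension `X` to the first copy of `L` in the doubled
lattice. -/
noncomputable abbrev double (X : ModularExtension L) : ModularExtension L :=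
  X.glue (Hat.ext' hM htop) (isModularEmbedding_second hM htop)

/-- The map from `X` to the doubled extension. -/
noncomputable abbrev dl {X : ModularExtension L} (x : X.E) : (double hM htop X).E :=
  gl (isModularEmbedding_second hM htop) x

/-- The map from the doubled lattice to the doubled extension. -/
noncomputable abbrev dr (X : ModularExtension L) (q : Hat M) : (double hM htop X).E :=
  gr X (isModularEmbedding_second hM htop) q

variable {X : ModularExtension L}

theorem isAtom_pt : IsAtom (dr hM htop X (pt M)) :=
  isAtom_gr.2 ((@isAtom_iff_rk _ _ _ (Hat.isGeometricLattice hM htop) _).2 (Hat.rk_pt hM htop))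

theorem pt_not_le_F : ¬ dr hM htop X (pt M) ≤ (double hM htop X).F := fun h =>
  pt_le_iff.1 (gr_le_iff.1 h : pt M ≤ inB M ⊤)

/-- Contracting the additional atom identifies the two copies. -/
theorem exists_contract_pt :
    ∃ e : ((double hM htop X).contract ⟨dr hM htop X (pt M), isAtom_pt hM htop⟩
      (pt_not_le_F hM htop)).E ≃o X.E,
      (∀ a, e (cup _ _ _ (dr hM htop X (inB M a))) = X.ι a) ∧
      ∀ x, e (cup _ _ _ (dl hM htop x)) = x := by
  -- `g x` is the flat formed by `x`, both copies of its trace on `L` and the additional atom; `f` is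
  -- the left adjoint of `g`.
  let g : X.E → (double hM htop X).E := fun x =>
    pair _ x (diag M (X.trace x)) (trace_hat hM htop (diag M (X.trace x))).symm
  let f : (double hM htop X).E → X.E := fun z => fst z ⊔ X.ι (snd z : Hat M).x
  have hy : ∀ z : (double hM htop X).E, (snd z : Hat M).y = X.trace (fst z) := fun z => by
    rw [trace_fst]
    exact (trace_hat hM htop _).symm
  have gc : GaloisConnection f g := fun z x => by
    rw [sup_le_iff, X.ι_le_iff_le_trace, glue_le_iff]
    refine and_congr_right fun h => ?_
    refine Iff.trans ?_ le_diag_iff.symm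
    rw [hy]
    exact (and_iff_right (X.trace_mono h)).symm
  have hfg : ∀ x, f (g x) = x := fun x => sup_eq_left.2 (X.ι_le_iff_le_trace.2 le_rfl)
  have hgb : ∀ x, dr hM htop X (pt M) ≤ g x := fun x => gr_le_iff.2 (pt_le_iff.2 trivial)
  have hgf : ∀ z, dr hM htop X (pt M) ≤ z → g (f z) = z := fun z hz => by
    have hb : (snd z : Hat M).b := pt_le_iff.1 (gr_le_iff.1 hz)
    have h1 : f z = fst z := sup_eq_left.2 (by
      rw [X.ι_le_iff_le_trace, ← hy]
      exact (eq_of_b hb).ge)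
    refine glue_ext h1 (Hat.ext ?_ ?_ ⟨fun _ => hb, fun _ => trivial⟩)
    · change X.trace (f z) = _
      rw [h1, hy]
    · change X.trace (f z) = _
      rw [h1, ← hy, eq_of_b hb]
  refine ⟨contractIso ⟨dr hM htop X (pt M), isAtom_pt hM htop⟩ (pt_not_le_F hM htop) f g
    gc.monotone_l gc.monotone_u hgb hfg hgf, fun a => ?_, fun x => ?_⟩
  · rw [contractIso_cup]
    refine eq_of_forall_ge_iff fun x => ?_
    rw [gc, sup_le_iff, X.ι_le_iff_le_trace]
    exact (and_iff_right (hgb x)).trans (gr_le_iff.trans (inB_le_iff (q := diag M (X.trace x))))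
  · rw [contractIso_cup]
    refine eq_of_forall_ge_iff fun x' => ?_
    rw [gc, sup_le_iff, gl_le_iff]
    exact and_iff_right (hgb x')

/-- The contraction of the additional atom returns the original diagram. -/
theorem ctr_pt {l : List X.E} (hl : ∀ c ∈ l, rk c ≤ 1) :
    ctr (double hM htop X) (dr hM htop X (pt M)) (l.map (dl hM htop)) = cls X l := by
  rw [ctr_of (isAtom_pt hM htop) (pt_not_le_F hM htop)]
  obtain ⟨e, he1, he2⟩ := exists_contract_pt hM htop (X := X)
  refine (clsFun L).iso e (fun a => (he1 a).symm) (rk_le_one_map_cup fun b hb => ?_) ?_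
  · obtain ⟨c, hc, rfl⟩ := List.mem_map.1 hb
    exact (rk_gl (x := c)).le.trans (hl c hc)
  · rw [List.map_map, List.map_map]
    exact (List.map_id l).symm.trans (List.map_congr_left fun x _ => (he2 x).symm)

variable {a : L} (ha : IsAtom a) (haM : ¬ a ≤ M)
include haM

theorem inV_not_le_F : ¬ dr hM htop X (inV M a) ≤ (double hM htop X).F := fun h =>
  haM ((gr_le_iff.1 h : inV M a ≤ inB M ⊤).1.trans inf_le_right)

include ha

theorem isAtom_dr_inV : IsAtom (dr hM htop X (inV M a)) :=
  isAtom_gr.2 ((Hat.isModularEmbedding_inV hM htop).embedding.map_atom a ha)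

/-- Contracting an atom `a` of the first copy: the additional atom becomes the atom `a` of the
second copy, and the rest of the first copy collapses onto `M`. -/
theorem exists_contract_inV :
    ∃ e : ((double hM htop X).contract ⟨dr hM htop X (inV M a), isAtom_dr_inV hM htop ha haM⟩
      (inV_not_le_F hM htop haM)).E ≃o
      (((X.restr hM).contract ⟨X.ι a, X.isAtom_ι.2 ha⟩ (not_le_restr_F hM haM)).glue (ambient hM)
        (isModularEmbedding_toAmbient hM)).E,
      (∀ m, e (cup _ _ _ (dr hM htop X (inB M m))) = gr _ _ m) ∧
      e (cup _ _ _ (dr hM htop X (pt M))) = gr _ _ a ∧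
      ∀ x : X.E, e (cup _ _ _ (dl hM htop x)) = gl _ (cup (X.restr hM) _ _ x) := by
  classical
  let X₁ := (X.restr hM).contract ⟨X.ι a, X.isAtom_ι.2 ha⟩ (not_le_restr_F hM haM)
  let hβ := isModularEmbedding_toAmbient hM
  let c : X.E → X₁.E := cup (X.restr hM) ⟨X.ι a, X.isAtom_ι.2 ha⟩ (not_le_restr_F hM haM)
  let val : X₁.E → X.E := fun x => x.1
  have hval : ∀ x, X.ι a ≤ val x := fun x => x.2
  have hcup : ∀ x y, c x ≤ y ↔ x ≤ val y := fun x y =>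
    ⟨fun h => le_sup_right.trans (show X.ι a ⊔ x ≤ val y from h),
      fun h => show X.ι a ⊔ x ≤ val y from sup_le y.2 h⟩
  have hvmono : ∀ x y, x ≤ y ↔ val x ≤ val y := fun x y => Iff.rfl
  have hvc : ∀ x, X.ι a ≤ x → val (c x) = x := fun x hx => sup_eq_right.2 hx
  have htr : ∀ (x : X₁.E) (m : L) (hm : m ≤ M), ⟨m, hm⟩ ≤ X₁.trace x ↔ m ≤ X.trace (val x) :=
    fun x m hm => by
      rw [← X.ι_le_iff_le_trace, ← X₁.ι_le_iff_le_trace]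
      exact hcup _ _
  have htr' : ∀ t : (X₁.glue (ambient hM) hβ).E, X.trace (val (fst t)) ⊓ M = snd t ⊓ M :=
    fun t => eq_of_forall_le_iff fun m => by
      have h1 : ∀ hm : m ≤ M, m ≤ X.trace (val (fst t)) ↔ m ≤ snd t := fun hm => by
        rw [← htr _ m hm, trace_fst, ambient_ι_le_iff]
      rw [le_inf_iff, le_inf_iff]
      exact and_congr_left h1
  -- A flat above `a` is determined by its part in `X` and its part in the second copy of `L`, which
  -- have the same trace on `M`; `f` is the left adjoint of `g`.
  let g : (X₁.glue (ambient hM) hβ).E → (double hM htop X).E := fun t =>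
    pair _ (val (fst t)) (ofPair hM htop (X.trace (val (fst t))) (snd t) (htr' t))
      (trace_hat hM htop (ofPair hM htop _ _ (htr' t))).symm
  -- Such a flat contains the additional atom if and only if its part in the second copy contains `a`.
  have hgb' : ∀ t, (ofPair hM htop (X.trace (val (fst t))) (snd t) (htr' t)).b ↔ a ≤ snd t := by
    intro t
    have h1 : a ≤ X.trace (val (fst t)) := X.ι_le_iff_le_trace.1 (hval _)
    constructor
    · rintro ⟨c, hc, hcM, h2, h3⟩
      exact h1.trans (eq_of_common hM htop (htr' t) hc hcM h2 h3).le
    · exact fun h => ⟨a, ha, haM, h1, h⟩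
  let f : (double hM htop X).E → (X₁.glue (ambient hM) hβ).E := fun z =>
    gl hβ (c (fst z)) ⊔ gr X₁ hβ ((snd z : Hat M).x ⊔ if (snd z : Hat M).b then a else ⊥)
  have hy : ∀ z : (double hM htop X).E, (snd z : Hat M).y = X.trace (fst z) := fun z => by
    rw [trace_fst]
    exact (trace_hat hM htop _).symm
  have hf : ∀ z t, f z ≤ t ↔ fst z ≤ val (fst t) ∧ (snd z : Hat M).x ≤ snd t ∧
      ((snd z : Hat M).b → a ≤ snd t) := fun z t => by
    rw [sup_le_iff, gl_le_iff, gr_le_iff, hcup, sup_le_iff]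
    refine and_congr_right fun _ => and_congr_right fun _ => ?_
    by_cases hb : (snd z : Hat M).b
    · rw [if_pos hb]
      exact ⟨fun h _ => h, fun h => h hb⟩
    · rw [if_neg hb]
      exact ⟨fun _ h => (hb h).elim, fun _ => bot_le⟩
  have gc : GaloisConnection f g := fun z t => by
    rw [hf, glue_le_iff]
    refine and_congr_right fun h => ?_
    refine Iff.trans ?_ Hat.le_iff.symm
    rw [← hgb' t, hy]
    exact (and_iff_right (X.trace_mono h)).symm
  have hfg : ∀ t, f (g t) = t := fun t => eq_of_forall_ge_iff fun r => by
    rw [hf, glue_le_iff, hvmono]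
    refine and_congr_right fun _ => ⟨fun h => h.1, fun h => ⟨h, fun h' => ?_⟩⟩
    exact ((hgb' t).1 h').trans h
  have hgb : ∀ t, dr hM htop X (inV M a) ≤ g t := fun t =>
    gr_le_iff.2 (inV_le_iff.2 (X.ι_le_iff_le_trace.1 (hval _)))
  have hgf : ∀ z, dr hM htop X (inV M a) ≤ z → g (f z) = z := fun z hz => by
    have h1 : a ≤ (snd z : Hat M).y := inV_le_iff.1 (gr_le_iff.1 hz)
    have h2 : X.ι a ≤ fst z := by rw [X.ι_le_iff_le_trace, ← hy]; exact h1
    have h3 : (snd z : Hat M).b ↔ a ≤ (snd z : Hat M).x :=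
      ⟨fun h => h1.trans (eq_of_b h).le, fun h => b_of ha haM h1 h⟩
    have h4 : X₁.trace (c (fst z)) = (ambient hM).trace (snd z : Hat M).x :=
      eq_of_forall_le_iff fun m => by
        rw [ambient_ι_le_iff]
        refine (htr _ m.1 m.2).trans ?_
        rw [hvc _ h2, ← hy]
        exact ⟨le_x_of_le_y m.2, le_y_of_le_x m.2⟩
    have h5 : f z = pair hβ (c (fst z)) (snd z : Hat M).x h4 := eq_of_forall_ge_iff fun r => by
      rw [hf, glue_le_iff, fst_pair, snd_pair, hcup]
      exact and_congr_right fun _ => and_iff_left_of_imp fun h h' => (h3.1 h').trans h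
    have h6 : val (fst (f z)) = fst z := by rw [h5]; exact hvc _ h2
    have h7 : snd (f z) = (snd z : Hat M).x := by rw [h5, snd_pair]
    refine glue_ext h6 (Hat.ext ?_ h7 ?_)
    · change X.trace (val (fst (f z))) = _
      rw [h6, hy]
    · refine (hgb' (f z)).trans ?_
      rw [h7, h3]
  refine ⟨contractIso ⟨dr hM htop X (inV M a), isAtom_dr_inV hM htop ha haM⟩
    (inV_not_le_F hM htop haM) f g gc.monotone_l gc.monotone_u hgb hfg hgf,
    fun m => ?_, ?_, fun x => ?_⟩
  · rw [contractIso_cup]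
    refine eq_of_forall_ge_iff fun t => ?_
    rw [gc, sup_le_iff]
    exact (and_iff_right (hgb t)).trans (gr_le_iff.trans
      ((inB_le_iff (q := ofPair hM htop _ _ (htr' t))).trans (gr_le_iff (X := X₁) (Y := ambient hM) (hβ := hβ)).symm))
  · rw [contractIso_cup]
    refine eq_of_forall_ge_iff fun t => ?_
    rw [gc, sup_le_iff]
    exact (and_iff_right (hgb t)).trans (gr_le_iff.trans
      ((pt_le_iff (q := ofPair hM htop _ _ (htr' t))).trans ((hgb' t).trans (gr_le_iff (X := X₁) (Y := ambient hM) (hβ := hβ)).symm)))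
  · rw [contractIso_cup]
    refine eq_of_forall_ge_iff fun t => ?_
    rw [gc, sup_le_iff, gl_le_iff, gl_le_iff]
    exact (and_iff_right (hgb t)).trans (hcup _ _).symm

/-- The contraction of an atom `a` of the first copy is induced from the residue at `a`. -/
theorem ctr_inV {l : List X.E} (hl : ∀ c ∈ l, rk c ≤ 1) :
    ctr (double hM htop X) (dr hM htop X (inV M a)) (dr hM htop X (pt M) :: l.map (dl hM htop)) =
      indMap hM [a] (by simp [rk_atom ha]) ((resFun hM htop ha haM).toFun X l) := by
  have e1 : (resFun hM htop ha haM).toFun X l =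
    cls ((X.restr hM).contract ⟨X.ι a, X.isAtom_ι.2 ha⟩ (not_le_restr_F hM haM))
      (l.map (cup _ _ _)) := ctr_of (X := X.restr hM) (X.isAtom_ι.2 ha) (not_le_restr_F hM haM) l
  rw [ctr_of (isAtom_dr_inV hM htop ha haM) (inV_not_le_F hM htop haM), e1,
    indMap_cls hM _ (rk_le_one_map_cup (X := X.restr hM) hl)]
  obtain ⟨e, he1, he2, he3⟩ := exists_contract_inV hM htop ha haM (X := X)
  refine (clsFun L).iso e (fun m => (he1 m).symm) (rk_le_one_map_cup fun b hb => ?_) ?_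
  · rcases List.mem_cons.1 hb with rfl | hb
    · exact (rk_atom (isAtom_pt hM htop)).le
    · obtain ⟨c, hc, rfl⟩ := List.mem_map.1 hb
      exact (rk_gl (x := c)).le.trans (hl c hc)
  · rw [List.map_map, List.map_cons, glueWord, List.map_cons, List.map_nil, List.map_map,
      List.map_map]
    refine congrArg₂ List.cons he2.symm ?_
    exact List.map_congr_left fun x _ => (he3 x).symm

end Homotopy

end ModDiag

namespace ModDiag

/-! #### The homotopy formula -/

section HomotopyFormula

open ModularExtension Hat

variable {L : Type u} [Lattice L] [BoundedOrder L] [IsGeometricLattice L] {M : L}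
  (hM : IsModularFlat M) (htop : rk (⊤ : L) = rk M + 1)

theorem rk_word_pt : ∀ q ∈ [pt M], @rk (Hat.ext' hM htop).E _ q ≤ 1 := fun q hq => by
  rw [List.mem_singleton.1 hq]
  exact (Hat.rk_pt hM htop).le

/-- Gluing the doubled lattice along its first copy, and adding the additional atom to the word. -/
noncomputable def hatMap : D L →ₗ[ℚ] D L :=
  glueMap (Hat.ext' hM htop) (isModularEmbedding_second hM htop) [pt M] (rk_word_pt hM htop)

variable {X : ModularExtension L}

theorem hatMap_cls {l : List X.E} (hl : ∀ c ∈ l, rk c ≤ 1) : hatMap hM htop (cls X l) =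
    cls (double hM htop X) (dr hM htop X (pt M) :: l.map (dl hM htop)) := glueMap_cls _ hl

theorem snd_y (z : (double hM htop X).E) : (snd z : Hat M).y = X.trace (fst z) := by
  rw [trace_fst]
  exact (trace_hat hM htop _).symm

/-- The additional atom is a contractible letter exactly when `M` and the word span `X`. -/
theorem dTerm_pt {a : L} (ha : IsAtom a) (haM : ¬ a ≤ M) {l : List X.E} (hl : ∀ c ∈ l, IsAtom c) :
    dTerm (double hM htop X) (dr hM htop X (pt M)) (l.map (dl hM htop)) =
      cls X l - indMap hM [] (by simp) (epsMap hM htop ha haM (cls X l)) := by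
  have hrl : ∀ a ∈ l, rk a ≤ 1 := fun a ha => (rk_atom (hl a ha)).le
  have hz : (double hM htop X).F ⊔ jn (l.map (dl hM htop)) =
      dr hM htop X (inB M ⊤) ⊔ dl hM htop (jn l) := by
    rw [jn_map_gl]
    rfl
  by_cases hG : X.ι M ⊔ jn l = ⊤
  · rw [epsMap_cls hM htop ha haM hrl, if_neg (not_not.2 hG), map_zero, sub_zero, dTerm_of_le,
      ctr_pt hM htop hrl]
    rw [hz]
    -- The second copy of `L` is below `z`. If `M` and the word span `X`, then so is the first copy, and
    -- hence also the additional atom.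
    set z : (double hM htop X).E := dr hM htop X (inB M ⊤) ⊔ dl hM htop (jn l) with hzd
    have h1 : ⊤ ≤ (snd z : Hat M).x :=
      inB_le_iff.1 (gr_le_iff.1 (le_sup_left : dr hM htop X (inB M ⊤) ≤ z))
    have h2 : jn l ≤ fst z := gl_le_iff.1 (le_sup_right : dl hM htop (jn l) ≤ z)
    have h3 : M ≤ (snd z : Hat M).y := le_y_of_le_x le_rfl (le_top.trans h1)
    have h4 : fst z = ⊤ := top_le_iff.1 (hG.ge.trans (sup_le
      (X.ι_le_iff_le_trace.2 (h3.trans (snd_y hM htop z).le)) h2))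
    have h5 : (snd z : Hat M).y = ⊤ := by rw [snd_y, h4, X.trace_top]
    exact gr_le_iff.2 (pt_le_iff.2 (b_of ha haM (le_top.trans h5.ge) (le_top.trans h1)))
  -- If `M` and the word do not span, the additional atom is a bridge, and the diagram is induced.
  · by_cases hF : X.F ⊔ jn l = ⊤
    · rw [epsMap_cls hM htop ha haM hrl, if_pos hG, indMap_epsMap_cls hM htop ha haM hl hG, sub_self,
        dTerm, if_neg]
      rw [hz]
      have h1 : X.trace (X.ι M ⊔ jn l) = M := by
        have h2 : M ≤ X.trace (X.ι M ⊔ jn l) := X.ι_le_iff_le_trace.1 le_sup_left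
        by_contra h3
        have h4 := rk_strictMono (lt_of_le_of_ne h2 (Ne.symm h3))
        have h5 : X.trace (X.ι M ⊔ jn l) = ⊤ := eq_of_le_of_rk_le le_top (by omega)
        have h6 : X.F ≤ X.ι M ⊔ jn l := X.ι_le_iff_le_trace.2 h5.ge
        exact hG (top_le_iff.1 (hF.ge.trans (sup_le h6 le_sup_right)))
      have h2 : X.trace (X.ι M ⊔ jn l) = (Hat.ext' hM htop).trace (inB M ⊤) := by
        rw [h1]
        exact (top_inf_eq M).symm.trans (trace_hat hM htop (inB M ⊤)).symm
      intro h
      have h3 : dr hM htop X (pt M) ≤ pair (isModularEmbedding_second hM htop) (X.ι M ⊔ jn l)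
          (inB M ⊤) h2 := h.trans (sup_le (gr_le_iff.2 (le_refl (α := (Hat.ext' hM htop).E) _))
            (gl_le_iff.2 (le_sup_right.trans (fst_pair ..).ge)))
      exact pt_le_iff.1 ((gr_le_iff.1 h3 : pt M ≤ inB M ⊤))
    · rw [cls_span hl hF, map_zero, map_zero, sub_zero]
      exact dTerm_eq_zero ((ctr_pt hM htop hrl).trans (cls_span hl hF))

/-- The atoms which are not below `M`. -/
abbrev OutAtoms {L : Type u} [Lattice L] [BoundedOrder L] (M : L) : Type u :=
  {a : L // IsAtom a ∧ ¬ a ≤ M}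

/-- The second copy of `L` and the additional atom span the first copy. -/
theorem F_le_inB_sup_pt : (Hat.ext' hM htop).F ≤
    (show (Hat.ext' hM htop).E from inB M ⊤) ⊔ jn (L := (Hat.ext' hM htop).E) [pt M] := by
  set q : Hat M := (show (Hat.ext' hM htop).E from inB M ⊤) ⊔
    jn (L := (Hat.ext' hM htop).E) [pt M] with hq
  have h1 : inB M ⊤ ≤ q := le_sup_left (α := (Hat.ext' hM htop).E)
  have h2 : pt M ≤ q := (le_jn (L := (Hat.ext' hM htop).E) (List.mem_singleton_self (pt M))).trans
    (le_sup_right (α := (Hat.ext' hM htop).E))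
  have h3 : inV M ⊤ ≤ q := inV_le_iff.2 ((inB_le_iff.1 h1).trans (eq_of_b (pt_le_iff.1 h2)).ge)
  exact h3

open Classical in
/-- A letter of `X` is contracted in the doubled extension as in `X`, except if it is an atom `a` of
`L` not below `M`: this atom is not contractible in `X`, but becomes contractible in the doubled
extension, and its contraction is induced from `[⊥, M]`. -/
theorem dTerm_double [Fintype (OutAtoms M)] {c : X.E} (hc : IsAtom c) {l : List X.E}
    (hl : ∀ a ∈ l, rk a ≤ 1) :
    dTerm (double hM htop X) (dl hM htop c) (dr hM htop X (pt M) :: l.map (dl hM htop)) =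
      hatMap hM htop (dTerm X c l) + ∑ a : OutAtoms M, if c = X.ι a then
        indMap hM [a.1] (by simp [rk_atom a.2.1])
          ((resFun hM htop a.2.1 a.2.2).toFun X l) else 0 := by
  by_cases h : ∃ a : OutAtoms M, c = X.ι a
  · obtain ⟨a, rfl⟩ := h
    rw [dTerm_eq_zero (ctr_of_le (X.ι_le_F a) l), map_zero, zero_add, Finset.sum_eq_single a,
      if_pos rfl]
    · rw [← ctr_inV hM htop a.2.1 a.2.2 hl]
      have h1 : dl hM htop (X.ι a) = dr hM htop X (inV M a) := gl_ι ..
      rw [h1]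
      refine dTerm_of_le ?_
      have h2 : dr hM htop X (inV M a) ≤ (double hM htop X).F ⊔ dr hM htop X (pt M) := by
        have h3 := F_le_inB_sup_pt hM htop
        have h4 := (gr_le_iff (X := X) (hβ := isModularEmbedding_second hM htop)).2
          ((((Hat.ext' hM htop).ι_le_F a).trans h3).trans (snd_gr _).ge)
        rw [gr_sup] at h4
        refine h4.trans (sup_le_sup_left ?_ _)
        rw [jn_cons, jn_nil, sup_bot_eq]
      exact h2.trans (sup_le_sup_left (le_jn List.mem_cons_self) _)
    · exact fun b _ hb => if_neg fun h => hb (Subtype.ext (X.embedding.injective h)).symm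
    · exact fun h => (h (Finset.mem_univ _)).elim
  · rw [Finset.sum_eq_zero fun a _ => if_neg fun h' => h ⟨a, h'⟩, add_zero]
    refine dTerm_glue (rk_word_pt hM htop) (F_le_inB_sup_pt hM htop) hc (fun hcF => ?_) hl
    have h1 : X.ι (X.trace c) = c := by rw [X.ι_trace, inf_eq_left.2 hcF]
    have h2 : X.trace c ≤ M := by
      by_contra h3
      exact h ⟨⟨X.trace c, X.isAtom_trace hc hcF, h3⟩, h1.symm⟩
    rw [← h1, gl_ι]
    exact gr_le_iff.2 (inV_le_iff.2 (le_inf le_top h2) : inV M (X.trace c) ≤ inB M ⊤)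

/-- The homotopy formula: up to homotopy, every element is in the span of the images of the
algebra of `[⊥, M]` under the maps adding at most one atom of `L` which is not below `M`. -/
theorem dMap_hatMap [Fintype (OutAtoms M)] {a₀ : L} (ha₀ : IsAtom a₀) (haM₀ : ¬ a₀ ≤ M) (x : D L) :
    dMap L (hatMap hM htop x) + hatMap hM htop (dMap L x) =
      x - indMap hM [] (by simp) (epsMap hM htop ha₀ haM₀ x) -
        ∑ a : OutAtoms M, indMap hM [a.1] (by simp [rk_atom a.2.1])
          (resAtMap hM htop a.2.1 a.2.2 x) := by
  classical
  have key : dMap L ∘ₗ hatMap hM htop + hatMap hM htop ∘ₗ dMap L =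
      LinearMap.id - indMap hM [] (by simp) ∘ₗ epsMap hM htop ha₀ haM₀ -
        ∑ a : OutAtoms M, indMap hM [a.1] (by simp [rk_atom a.2.1]) ∘ₗ
          resAtMap hM htop a.2.1 a.2.2 := by
    refine D.hom_ext fun X l hl => ?_
    have hrl : ∀ a ∈ l, rk a ≤ 1 := fun a ha => (rk_atom (hl a ha)).le
    simp only [LinearMap.add_apply, LinearMap.sub_apply, LinearMap.comp_apply, LinearMap.sum_apply,
      LinearMap.id_apply]
    rw [hatMap_cls hM htop hrl, ← dTerm_pt hM htop ha₀ haM₀ hl, dMap_cls, dMap_cls hrl, dsum_cons,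
      dsum_map, map_dsum, sub_add, sub_right_inj]
    · have h1 : ∀ a : OutAtoms M, indMap hM [a.1] (by simp [rk_atom a.2.1])
          (resAtMap hM htop a.2.1 a.2.2 (cls X l)) = dsum l fun c l' => if c = X.ι a then
            indMap hM [a.1] (by simp [rk_atom a.2.1])
              ((resFun hM htop a.2.1 a.2.2).toFun X l') else 0 := fun a => by
        rw [resAtMap_cls hM htop a.2.1 a.2.2 hrl, map_dsum]
        refine dsum_congr fun c l' _ => ?_
        rw [apply_ite (indMap hM [a.1] _), map_zero]
      rw [Finset.sum_congr rfl fun a _ => h1 a, ← dsum_sum, ← dsum_sub]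
      refine dsum_congr fun c l' hp => ?_
      rw [dTerm_double hM htop (hl c (hp.mem_iff.1 List.mem_cons_self))
        fun a ha => hrl a (hp.mem_iff.1 (List.mem_cons_of_mem _ ha)), add_sub_cancel_left]
    · intro b hb
      rcases List.mem_cons.1 hb with rfl | hb
      · exact (rk_atom (isAtom_pt hM htop)).le
      · obtain ⟨c, hc, rfl⟩ := List.mem_map.1 hb
        exact (rk_gl (x := c)).le.trans (hrl c hc)
  simpa only [LinearMap.add_apply, LinearMap.sub_apply, LinearMap.comp_apply, LinearMap.sum_apply,
    LinearMap.id_apply] using LinearMap.congr_fun key x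

end HomotopyFormula

end ModDiag

namespace ModDiag

/-! ### Supersolvable lattices -/

section Supersolvable

variable {L : Type u} [Lattice L] [BoundedOrder L] [IsGeometricLattice L]

theorem mem_of_isMaxChain {c : Set L} (hc : IsMaxChain (· ≤ ·) c) {x : L}
    (h : ∀ y ∈ c, x ≤ y ∨ y ≤ x) : x ∈ c := by
  have h1 : IsChain (· ≤ ·) (insert x c) := hc.1.insert fun y hy _ => h y hy
  rw [hc.2 h1 (Set.subset_insert x c)]
  exact Set.mem_insert x c

theorem isModularFlat_Iic {M : L} {x : Set.Iic M} (h : IsModularFlat (x : L)) :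
    IsModularFlat x := fun y => by
  have := h y
  rw [rk_Iic, rk_Iic, rk_Iic, rk_Iic]
  exact this

/-- A nontrivial supersolvable lattice has a modular coatom `M` such that `[⊥, M]` is
supersolvable. -/
theorem IsSupersolvable.exists_coatom [Nontrivial L] (h : IsSupersolvable L) :
    ∃ M : L, IsModularFlat M ∧ rk (⊤ : L) = rk M + 1 ∧ IsSupersolvable (Set.Iic M) := by
  obtain ⟨c, hc, hmod⟩ := h
  obtain ⟨M, ⟨hMc, hMt⟩, hmax⟩ := (Set.toFinite (c \ {⊤})).exists_maximalFor rk _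
    ⟨⊥, hc.bot_mem, bot_ne_top⟩
  have hle : ∀ y ∈ c, y ≠ ⊤ → y ≤ M := fun y hy hyt => by
    rcases hc.1.total hy hMc with h | h
    · exact h
    · exact (eq_of_le_of_rk_le h (hmax ⟨hy, hyt⟩ (rk_mono h))).ge
  have hcov : M ⋖ ⊤ := ⟨lt_top_iff_ne_top.2 hMt, fun z h1 h2 => by
    have h3 : z ∈ c := mem_of_isMaxChain hc fun y hy => by
      by_cases hyt : y = ⊤
      · exact .inl (hyt ▸ le_top)
      · exact .inr ((hle y hy hyt).trans h1.le)
    exact (hle z h3 h2.ne).not_gt h1⟩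
  refine ⟨M, hmod M hMc, rk_of_covBy hcov, {x : Set.Iic M | (x : L) ∈ c}, ⟨fun x hx y hy hxy =>
    hc.1 hx hy fun h => hxy (Subtype.ext h), fun d hd hcd => ?_⟩, fun x hx =>
    isModularFlat_Iic (hmod x hx)⟩
  refine Set.Subset.antisymm hcd fun x hx => mem_of_isMaxChain hc fun y hy => ?_
  by_cases hyt : y = ⊤
  · exact .inl (hyt ▸ le_top)
  · exact hd.total hx (hcd (show (⟨y, hle y hy hyt⟩ : Set.Iic M) ∈ {x : Set.Iic M | (x : L) ∈ c} from hy))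

end Supersolvable

/-! ### Injectivity in cohomology -/

section Injectivity

open ModularExtension

/-- The Orlik–Solomon algebra of the trivial lattice is not zero: it maps to `ℚ`. -/
theorem osMap_oneD_ne_zero_of_subsingleton {L : Type u} [Lattice L] [BoundedOrder L]
    [IsGeometricLattice L] [Subsingleton L] : osMap L (oneD L) ≠ 0 := by
  obtain ⟨φ, -⟩ := exists_osHom (L := L) (A := ℚ) (fun _ => 0) (by simp) (fun l hl => by
    refine dsum_eq_zero fun b l' hp => ?_
    exact ((hl.1 b (hp.mem_iff.1 List.mem_cons_self)).1 (Subsingleton.elim _ _)).elim)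
  intro h
  have := congrArg φ h
  rw [osMap_one, map_one, map_zero] at this
  exact one_ne_zero this

/-- The space of diagrams of the trivial lattice is spanned by the unit. -/
theorem exists_smul_oneD {L : Type u} [Lattice L] [BoundedOrder L] [IsGeometricLattice L]
    [Subsingleton L] (x : D L) : ∃ r : ℚ, x = r • oneD L := by
  refine D.induction (p := fun x => ∃ r : ℚ, x = r • oneD L) x ⟨0, by simp⟩ ?_ ?_ fun X l hl => ?_
  · rintro _ _ ⟨r, rfl⟩ ⟨s, rfl⟩
    exact ⟨r + s, (add_smul ..).symm⟩
  · rintro s _ ⟨r, rfl⟩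
    exact ⟨s * r, (mul_smul ..).symm⟩
  · have hF : X.F = ⊥ := by
      rw [F, Subsingleton.elim (⊤ : L) ⊥, X.ι_bot]
    by_cases hE : (⊤ : X.E) = ⊥
    · have hs : Subsingleton X.E := subsingleton_of_bot_eq_top hE.symm
      have hl' : l = [] := List.eq_nil_iff_forall_not_mem.2 fun a ha =>
        (hl a ha).1 (Subsingleton.elim _ _)
      subst hl'
      refine ⟨1, ?_⟩
      rw [one_smul]
      have hm : (ModularExtension.refl L).IsMap X X.ι :=
        ⟨X.embedding, (congrArg rk (Subsingleton.elim (⊤ : L) ⊥)).trans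
          (rk_bot.trans (rk_bot.symm.trans (congrArg rk hE.symm))), fun _ => rfl⟩
      exact cls_emb hm (l := []) (by simp)
    · refine ⟨0, ?_⟩
      rw [zero_smul]
      exact cls_split (w := ⊥) (z := ⊤) hl hF.le (bot_sup_eq _) (by rw [rk_bot, zero_add]) hE
        fun _ _ => .inr le_top

/-- The inductive step: if the cohomology of the algebra of `[⊥, M]` is detected by its
Orlik–Solomon algebra, then so is the cohomology of the algebra of `L`. -/
theorem exists_dMap_eq_step {L : Type u} [Lattice L] [BoundedOrder L] [IsGeometricLattice L]
    {M : L} (hM : IsModularFlat M) (htop : rk (⊤ : L) = rk M + 1)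
    (ih : ∀ x : D (Set.Iic M), dMap _ x = 0 → osMap _ x = 0 → ∃ y, dMap _ y = x)
    {x : D L} (hx : dMap L x = 0) (hx' : osMap L x = 0) : ∃ y, dMap L y = x := by
  have := Fintype.ofFinite (OutAtoms M)
  have hnot : ¬ (⊤ : L) ≤ M := fun h => by
    have := rk_mono h
    omega
  obtain ⟨a₀, ha₀, -, haM₀⟩ := exists_atom_not_le hnot
  obtain ⟨y₀, hy₀⟩ := ih (epsMap hM htop ha₀ haM₀ x) (by rw [← epsMap_dMap, hx, map_zero]) (by
    obtain ⟨φ, hφ⟩ := exists_osMap_epsMap hM htop ha₀ haM₀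
    rw [hφ, hx', map_zero])
  have h1 : ∀ a : OutAtoms M, ∃ y, dMap _ y = resAtMap hM htop a.2.1 a.2.2 x := fun a => by
    refine ih _ ?_ ?_
    · rw [← neg_eq_zero, ← resAtMap_dMap, hx, map_zero]
    · obtain ⟨φ, hφ⟩ := exists_osMap_resAtMap hM htop a.2.1 a.2.2
      rw [hφ, hx', map_zero]
  choose y hy using h1
  -- By the homotopy formula, `x` is cohomologous to a sum of induced coboundaries.
  have h2 := dMap_hatMap hM htop ha₀ haM₀ x
  rw [hx, map_zero, add_zero, sub_sub, eq_sub_iff_add_eq] at h2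
  refine ⟨hatMap hM htop x + (indMap hM [] (by simp) y₀ -
    ∑ a : OutAtoms M, indMap hM [a.1] (by simp [rk_atom a.2.1]) (y a)), ?_⟩
  refine Eq.trans ?_ h2
  rw [map_add, map_sub, map_sum, dMap_indMap, hy₀, List.length_nil, pow_zero, one_smul]
  congr 1
  rw [sub_eq_add_neg, ← Finset.sum_neg_distrib]
  refine congrArg _ (Finset.sum_congr rfl fun a _ => ?_)
  rw [dMap_indMap, hy, List.length_singleton, pow_one, neg_one_smul, neg_neg]

/-- A cocycle whose image in the Orlik–Solomon algebra vanishes is a coboundary. -/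
theorem exists_dMap_eq {L : Type u} [Lattice L] [BoundedOrder L] [IsGeometricLattice L]
    (hL : IsSupersolvable L) {x : D L} (hx : dMap L x = 0) (hx' : osMap L x = 0) :
    ∃ y, dMap L y = x := by
  obtain ⟨n, hn⟩ : ∃ n, rk (⊤ : L) = n := ⟨_, rfl⟩
  induction n generalizing L with
  | zero =>
    have h1 : (⊥ : L) = ⊤ := eq_of_le_of_rk_le bot_le (by omega)
    have := subsingleton_of_bot_eq_top h1
    obtain ⟨r, rfl⟩ := exists_smul_oneD x
    refine ⟨0, ?_⟩
    rw [map_smul, smul_eq_zero] at hx'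
    rw [map_zero, hx'.resolve_right osMap_oneD_ne_zero_of_subsingleton, zero_smul]
  | succ n ih =>
    have : Nontrivial L := ⟨⊤, ⊥, fun h => by rw [h, rk_bot] at hn; omega⟩
    obtain ⟨M, hM, htop, hs⟩ := hL.exists_coatom
    refine exists_dMap_eq_step hM htop (fun x h1 h2 => ih hs h1 h2 ?_) hx hx'
    rw [rk_Iic]
    change rk M = n
    omega

/-- A homogeneous cocycle whose image in the Orlik–Solomon algebra vanishes is the differential of
a homogeneous element. -/
theorem exists_mem_dMap_eq {L : Type u} [Lattice L] [BoundedOrder L] [IsGeometricLattice L]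
    (hL : IsSupersolvable L) {k : ℤ} {x : D L} (hk : x ∈ grD L k) (hx : dMap L x = 0)
    (hx' : osMap L x = 0) : ∃ y ∈ grD L (k - 1), dMap L y = x := by
  obtain ⟨y, rfl⟩ := exists_dMap_eq hL hx hx'
  refine ⟨(projFun L (k - 1)).lift y, proj_mem _ y, ?_⟩
  have h1 : ∀ y, dMap L ((projFun L (k - 1)).lift y) = (projFun L k).lift (dMap L y) := by
    refine LinearMap.congr_fun (f := dMap L ∘ₗ (projFun L (k - 1)).lift)
      (g := (projFun L k).lift ∘ₗ dMap L) (D.hom_ext fun X l hl => ?_)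
    have h2 : cls X l ∈ grD L (deg X l.length) := cls_mem_grD rfl
    rw [LinearMap.comp_apply, LinearMap.comp_apply, proj_of_mem h2, proj_of_mem (dMap_mem h2),
      apply_ite (dMap L), map_zero]
    exact if_congr (by omega) rfl rfl
  rw [h1, proj_of_mem hk, if_pos rfl]

end Injectivity

end ModDiag

namespace ModDiag

/-! ### Transport of cdga structures and quasi-isomorphisms -/

namespace CDGAData

variable {V : Type v} [AddCommGroup V] [Module ℚ V] {W : Type w} [AddCommGroup W] [Module ℚ W]

/-- Transport of cdga data along a linear isomorphism. -/
noncomputable def transport (A : CDGAData V) (e : V ≃ₗ[ℚ] W) : CDGAData W where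
  gr k := (A.gr k).map (e : V →ₗ[ℚ] W)
  one := e A.one
  mul := (A.mul.compl₁₂ (e.symm : W →ₗ[ℚ] V) (e.symm : W →ₗ[ℚ] V)).compr₂ (e : V →ₗ[ℚ] W)
  d := (e : V →ₗ[ℚ] W) ∘ₗ A.d ∘ₗ (e.symm : W →ₗ[ℚ] V)

variable {A : CDGAData V} {e : V ≃ₗ[ℚ] W}

theorem transport_mul (x y : V) : (A.transport e).mul (e x) (e y) = e (A.mul x y) := by
  simp [transport]

theorem transport_d (x : V) : (A.transport e).d (e x) = e (A.d x) := by
  simp [transport]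

theorem mem_transport_gr {k : ℤ} {x : V} : e x ∈ (A.transport e).gr k ↔ x ∈ A.gr k := by
  simp [transport]

theorem IsCDGA.transport (h : A.IsCDGA) (e : V ≃ₗ[ℚ] W) : (A.transport e).IsCDGA where
  isInternal := by
    have h1 := h.isInternal
    rw [DirectSum.isInternal_submodule_iff_iSupIndep_and_iSup_eq_top] at h1 ⊢
    refine ⟨h1.1.map_orderIso (Submodule.orderIsoMapComap e), ?_⟩
    change ⨆ k, (A.gr k).map (e : V →ₗ[ℚ] W) = ⊤
    rw [← Submodule.map_iSup, h1.2, Submodule.map_top]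
    exact e.range
  one_mem := mem_transport_gr.2 h.one_mem
  mul_mem k l x hx y hy := by
    obtain ⟨x, rfl⟩ := e.surjective x
    obtain ⟨y, rfl⟩ := e.surjective y
    rw [mem_transport_gr] at hx hy
    rw [transport_mul, mem_transport_gr]
    exact h.mul_mem k l x hx y hy
  one_mul x := by
    obtain ⟨x, rfl⟩ := e.surjective x
    exact (transport_mul _ _).trans (congrArg e (h.one_mul x))
  mul_one x := by
    obtain ⟨x, rfl⟩ := e.surjective x
    exact (transport_mul _ _).trans (congrArg e (h.mul_one x))
  mul_assoc x y z := by
    obtain ⟨x, rfl⟩ := e.surjective x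
    obtain ⟨y, rfl⟩ := e.surjective y
    obtain ⟨z, rfl⟩ := e.surjective z
    simp only [transport_mul, h.mul_assoc]
  mul_comm k l x hx y hy := by
    obtain ⟨x, rfl⟩ := e.surjective x
    obtain ⟨y, rfl⟩ := e.surjective y
    rw [mem_transport_gr] at hx hy
    rw [transport_mul, transport_mul, h.mul_comm k l x hx y hy, map_smul]
  d_mem k x hx := by
    obtain ⟨x, rfl⟩ := e.surjective x
    rw [mem_transport_gr] at hx
    rw [transport_d, mem_transport_gr]
    exact h.d_mem k x hx
  d_d x := by
    obtain ⟨x, rfl⟩ := e.surjective x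
    rw [transport_d, transport_d, h.d_d, map_zero]
  leibniz k x hx y := by
    obtain ⟨x, rfl⟩ := e.surjective x
    obtain ⟨y, rfl⟩ := e.surjective y
    rw [mem_transport_gr] at hx
    simp only [transport_mul, transport_d, h.leibniz k x hx y, map_add, map_smul]

/-- A morphism to a cdga with zero differential is a quasi-isomorphism as soon as it is injective
on cocycles up to coboundaries, and surjective on cocycles. -/
theorem IsHom.isQuasiIso_of {B : CDGAData W} {f : V →ₗ[ℚ] W} (hf : IsHom A B f) (hB : B.d = 0)
    (hinj : ∀ k, ∀ x ∈ A.gr k, A.d x = 0 → f x = 0 → ∃ y ∈ A.gr (k - 1), A.d y = x)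
    (hsurj : ∀ k, ∀ y ∈ B.gr k, ∃ x ∈ A.gr k, A.d x = 0 ∧ f x = y) : hf.IsQuasiIso := by
  intro k
  constructor
  · refine (injective_iff_map_eq_zero _).2 fun z hz => ?_
    obtain ⟨⟨x, hx⟩, rfl⟩ := Submodule.Quotient.mk_surjective _ z
    rw [cohomologyMap, Submodule.mapQ_apply, Submodule.Quotient.mk_eq_zero] at hz
    obtain ⟨w, -, hw⟩ := hz
    rw [hB] at hw
    obtain ⟨y, hy, hyx⟩ := hinj k x hx.1 hx.2 hw.symm
    exact (Submodule.Quotient.mk_eq_zero _).2 ⟨y, hy, hyx⟩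
  · intro z
    obtain ⟨⟨y, hy⟩, rfl⟩ := Submodule.Quotient.mk_surjective _ z
    obtain ⟨x, hx, hdx, hxy⟩ := hsurj k y hy.1
    refine ⟨Submodule.Quotient.mk ⟨x, hx, hdx⟩, ?_⟩
    rw [cohomologyMap, Submodule.mapQ_apply]
    exact congrArg _ (Subtype.ext hxy)

end CDGAData

/-! ### The space of modular diagrams -/

section Main

open ModularExtension

variable {L : Type u} [Lattice L] [BoundedOrder L] [IsGeometricLattice L]

variable (L) in
/-- The cdga structure on the space `D L`. -/
noncomputable def dgaData : CDGAData (D L) where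
  gr := grD L
  one := oneD L
  mul := mulMap L
  d := dMap L

theorem isCDGA_dgaData : (dgaData L).IsCDGA where
  isInternal := isInternal_grD
  one_mem := cls_mem_grD (X := ModularExtension.refl L) (l := []) (by
    change ((0 : ℕ) : ℤ) - 2 * ((rk (⊤ : L) : ℤ) - rk (⊤ : L)) = 0
    simp)
  mul_mem _ _ _ hx _ hy := mulMap_mem hx hy
  one_mul := one_mulMap
  mul_one := mulMap_one
  mul_assoc := mulMap_assoc
  mul_comm _ _ _ hx _ hy := mulMap_comm hx hy
  d_mem _ _ hx := dMap_mem hx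
  d_d := dMap_dMap
  leibniz _ _ hx := dMap_mulMap hx

/-- A diagram with spanning word has the degree of its class. -/
theorem degree_eq_deg (Γ : ModularDiagram L) (h : Γ.ext.F ⊔ Γ.join = ⊤) :
    Γ.degree = deg Γ.ext Γ.word.length := by
  have h1 := Γ.ext.modular_F Γ.join
  rw [h, inf_comm] at h1
  have h2 := Γ.ext.rk_F
  rw [ModularDiagram.degree, deg]
  omega

variable [Nontrivial L]

variable (L) in
/-- For nontrivial `L`, the space `D L` is the space of modular diagrams. -/
noncomputable def dEquiv : D L ≃ₗ[ℚ] MD L :=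
  Submodule.quotEquivOfEq _ _ (congrArg (Submodule.span ℚ) (Set.ext fun _ =>
    ⟨fun h => h.resolve_right fun ⟨_, hs, _⟩ => not_subsingleton L hs, Or.inl⟩))

theorem dEquiv_cls (Γ : ModularDiagram L) :
    dEquiv L (cls Γ.ext (Γ.word.map Subtype.val)) = MD.mk Γ := by
  rw [cls_map_val]
  rfl

/-- The product of diagrams is the gluing used to define `mulMap`. -/
theorem cls_prod (Γ₁ Γ₂ : ModularDiagram L) :
    cls (Γ₁.prod Γ₂).ext ((Γ₁.prod Γ₂).word.map Subtype.val) =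
      mulMap L (cls Γ₁.ext (Γ₁.word.map Subtype.val)) (cls Γ₂.ext (Γ₂.word.map Subtype.val)) := by
  have h : ∀ Γ : ModularDiagram L, ∀ a ∈ Γ.word.map Subtype.val, IsAtom (a : Γ.ext.E) := fun Γ a ha => by
    obtain ⟨b, _, rfl⟩ := List.mem_map.1 ha
    exact b.2
  have h' : ∀ Γ : ModularDiagram L, ∀ a ∈ Γ.word.map Subtype.val, rk (a : Γ.ext.E) ≤ 1 :=
    fun Γ a ha => (rk_atom (h Γ a ha)).le
  rw [mulMap_cls (h' Γ₁) (h' Γ₂)]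
  refine (clsFun L).iso (X := (Γ₁.prod Γ₂).ext)
    (Y := Γ₁.ext.glue Γ₂.ext Γ₂.ext.isModularEmbedding)
    (OrderIso.refl (Pushout Γ₁.ext Γ₂.ext)) (fun a => ?_) (h' (Γ₁.prod Γ₂)) ?_
  · refine Subtype.ext (Prod.ext ?_ rfl)
    change Γ₁.ext.ι (Γ₂.ext.trace (Γ₂.ext.ι a)) = Γ₁.ext.ι a
    rw [trace_ι]
  · have e : (Γ₁.prod Γ₂).word.map Subtype.val =
        (Γ₁.word.map fun a => (Pushout.inl a.1 : Pushout Γ₁.ext Γ₂.ext)) ++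
          Γ₂.word.map fun a => (Pushout.inr a.1 : Pushout Γ₁.ext Γ₂.ext) :=
      List.map_append.trans (congrArg₂ (· ++ ·) List.map_map List.map_map)
    refine Eq.trans ?_ (e.symm.trans (List.map_id _).symm)
    exact congrArg₂ (· ++ ·) List.map_map List.map_map

/-- The smallest flat above `F` which can show that a letter is a bridge is the join of `F` with the
other letters. -/
theorem isContractible_iff (Γ : ModularDiagram L) (i : Fin Γ.word.length) :
    Γ.IsContractible i ↔ (Γ.word.get i : Γ.ext.E) ≤
      Γ.ext.F ⊔ jn ((Γ.word.eraseIdx i).map Subtype.val) ∧ ¬ (Γ.word.get i : Γ.ext.E) ≤ Γ.ext.F := by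
  refine and_congr_left fun _ => ?_
  rw [← not_iff_not, not_not]
  constructor
  · rintro ⟨G, hFG, hG⟩ hle
    refine (hG i).2 rfl (hle.trans (sup_le hFG (jn_le_iff.2 fun a ha => ?_)))
    obtain ⟨b, hb, rfl⟩ := List.mem_map.1 ha
    obtain ⟨j, hj, hji, rfl⟩ := List.mem_eraseIdx_iff_getElem.1 hb
    by_contra hcon
    exact hji (congrArg Fin.val ((hG ⟨j, hj⟩).1 hcon))
  · refine fun h => ⟨Γ.ext.F ⊔ jn ((Γ.word.eraseIdx i).map Subtype.val), le_sup_left, fun j => ⟨fun hj => ?_, fun hj => hj ▸ h⟩⟩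
    by_contra hji
    refine hj (le_trans (le_jn (List.mem_map_of_mem ?_)) le_sup_right)
    exact List.mem_eraseIdx_iff_getElem.2 ⟨j, j.2, fun h' => hji (Fin.ext h'), rfl⟩

theorem map_val_pmap {α β : Type*} {p : β → Prop} {q : α → Prop} {l : List α}
    {f : ∀ a, q a → {b // p b}} {g : α → β} {H : ∀ a ∈ l, q a}
    (h : ∀ a ha, g a = (f a ha).1) : l.map g = (l.pmap f H).map Subtype.val := by
  induction l with
  | nil => rfl
  | cons a l ih => exact congrArg₂ List.cons (h a _) ih

open Classical in
/-- The terms of the differential of `D L` are those of the differential of modular diagrams. -/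
theorem dTerm_get (Γ : ModularDiagram L) (hΓ : Γ.word.Nodup) (i : Fin Γ.word.length) :
    dEquiv L (dTerm Γ.ext (Γ.word.get i) ((Γ.word.eraseIdx i).map Subtype.val)) =
      if hi : Γ.IsContractible i then MD.mk (Γ.contract hΓ i hi) else 0 := by
  by_cases hi : Γ.IsContractible i
  · rw [dif_pos hi, ← dEquiv_cls, dTerm_of_le ((isContractible_iff Γ i).1 hi).1,
      ctr_of (Γ.word.get i).2 hi.2]
    congr 2
    exact List.map_map.trans (map_val_pmap fun _ _ => rfl)
  · rw [dif_neg hi]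
    rw [isContractible_iff, not_and_not_right] at hi
    by_cases h : (Γ.word.get i : Γ.ext.E) ≤ Γ.ext.F ⊔ jn ((Γ.word.eraseIdx i).map Subtype.val)
    · rw [dTerm_eq_zero (ctr_of_le (hi h) _), map_zero]
    · rw [dTerm, if_neg h, map_zero]

theorem isMDData : IsMDData ((dgaData L).transport (dEquiv L)) where
  gr_eq k := by
    change (grD L k).map (dEquiv L : D L →ₗ[ℚ] MD L) = _
    rw [grD, Submodule.map_span]
    refine le_antisymm (Submodule.span_le.2 ?_) (Submodule.span_le.2 ?_)
    · rintro _ ⟨_, ⟨X, l, hl, hk, rfl⟩, rfl⟩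
      by_cases h : X.F ⊔ jn l = ⊤
      · lift l to List (Atoms X.E) using hl
        refine Submodule.subset_span ⟨⟨X, l⟩, ?_, (dEquiv_cls ⟨X, l⟩).symm⟩
        rw [degree_eq_deg _ (by rw [join_eq_jn]; exact h), ← hk, List.length_map]
      · rw [cls_span hl h, LinearEquiv.coe_coe, map_zero]
        exact Submodule.zero_mem _
    · rintro _ ⟨Γ, hk, rfl⟩
      have hat : ∀ a ∈ Γ.word.map Subtype.val, IsAtom (a : Γ.ext.E) := fun a ha => by
        obtain ⟨b, _, rfl⟩ := List.mem_map.1 ha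
        exact b.2
      rw [← dEquiv_cls]
      by_cases h : Γ.ext.F ⊔ Γ.join = ⊤
      · refine Submodule.subset_span ⟨_, ⟨Γ.ext, _, hat, ?_, rfl⟩, rfl⟩
        rw [List.length_map, ← degree_eq_deg Γ h, hk]
      · rw [join_eq_jn] at h
        rw [cls_span hat h, map_zero]
        exact Submodule.zero_mem _
  one_eq := dEquiv_cls (ModularDiagram.empty L)
  mul_mk Γ₁ Γ₂ := by
    rw [← dEquiv_cls, ← dEquiv_cls, ← dEquiv_cls, CDGAData.transport_mul, cls_prod]
    rfl
  d_mk Γ hΓ := by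
    rw [← dEquiv_cls, CDGAData.transport_d]
    have h1 : (dgaData L).d (cls Γ.ext (Γ.word.map Subtype.val)) =
        dsum (Γ.word.map Subtype.val) (dTerm Γ.ext) := dMap_cls fun a ha => by
      obtain ⟨b, _, rfl⟩ := List.mem_map.1 ha
      exact (rk_atom b.2).le
    rw [h1, dsum_map, dsum_eq_sum, map_sum]
    refine Finset.sum_congr rfl fun i _ => ?_
    rw [map_smul, dTerm_get Γ hΓ]
    split_ifs
    · rfl
    · exact smul_zero _

theorem osMap_symm_mk (Γ : ModularDiagram L) :
    osMap L ((dEquiv L).symm (MD.mk Γ)) = Γ.osValue := by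
  rw [← dEquiv_cls, LinearEquiv.symm_apply_apply, osMap_cls fun a ha => by
    obtain ⟨b, _, rfl⟩ := List.mem_map.1 ha
    exact (rk_atom b.2).le]
  rw [ModularDiagram.osValue]
  split_ifs with h
  · rw [genProd, List.map_map, List.map_map]
    refine congrArg List.prod (List.map_congr_left fun a _ => ?_)
    exact dif_pos (Γ.ext.isAtom_trace a.2 (h ▸ le_top))
  · rfl

theorem isHom_osMap : CDGAData.IsHom ((dgaData L).transport (dEquiv L)) (OS.cdga L)
    (osMap L ∘ₗ ((dEquiv L).symm : MD L →ₗ[ℚ] D L)) where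
  map_gr k x hx := by
    obtain ⟨x, hx, rfl⟩ := hx
    simpa using osMap_mem hx
  map_one := by
    change osMap L ((dEquiv L).symm (dEquiv L (oneD L))) = 1
    rw [LinearEquiv.symm_apply_apply, osMap_one]
  map_mul x y := by
    obtain ⟨x, rfl⟩ := (dEquiv L).surjective x
    obtain ⟨y, rfl⟩ := (dEquiv L).surjective y
    rw [CDGAData.transport_mul]
    simp only [LinearMap.comp_apply, LinearEquiv.coe_coe, LinearEquiv.symm_apply_apply]
    exact osMap_mul x y
  map_d x := by
    obtain ⟨x, rfl⟩ := (dEquiv L).surjective x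
    rw [CDGAData.transport_d]
    simp only [LinearMap.comp_apply, LinearEquiv.coe_coe, LinearEquiv.symm_apply_apply]
    exact osMap_dMap x

theorem isQuasiIso_osMap (hL : IsSupersolvable L) : (isHom_osMap (L := L)).IsQuasiIso := by
  refine CDGAData.IsHom.isQuasiIso_of _ rfl (fun k x hx hdx hfx => ?_) fun k y hy => ?_
  · obtain ⟨x, rfl⟩ := (dEquiv L).surjective x
    rw [CDGAData.mem_transport_gr] at hx
    rw [CDGAData.transport_d, LinearEquiv.map_eq_zero_iff] at hdx
    obtain ⟨y, hy, rfl⟩ := exists_mem_dMap_eq hL hx hdx (by simpa using hfx)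
    exact ⟨dEquiv L y, CDGAData.mem_transport_gr.2 hy, CDGAData.transport_d y⟩
  · obtain ⟨x, hx, hdx, hxy⟩ := exists_osMap_eq hy
    refine ⟨dEquiv L x, CDGAData.mem_transport_gr.2 hx, ?_, by simpa using hxy⟩
    exact (CDGAData.transport_d x).trans ((congrArg (dEquiv L) hdx).trans (map_zero _))

end Main

end ModDiag

open ModDiag

theorem mainTheorem1 (L : Type u) [Lattice L] [BoundedOrder L] [IsGeometricLattice L]
    [Nontrivial L] (hL : IsSupersolvable L) :
    ∃ (A : CDGAData (MD L)) (I : MD L →ₗ[ℚ] OS L),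
      IsMDData A ∧ A.IsCDGA ∧
      (∀ Γ : ModularDiagram L, I (MD.mk Γ) = Γ.osValue) ∧
      ∃ hI : CDGAData.IsHom A (OS.cdga L) I, hI.IsQuasiIso :=
  ⟨_, _, isMDData, isCDGA_dgaData.transport _, osMap_symm_mk, isHom_osMap, isQuasiIso_osMap hL⟩
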